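/- There is an algorithm that, given a connected simple graph $G$ with $n$ vertices and $m$ edges and an integer $k\ge 0$, computes in time $2^{O(k)}\cdot n^4$ a cut of $G$ of size at least $\frac m2+\frac{n-1}4+k$, or decides that $G$ has no such cut. More precisely: a cut of $G$ is given by a set $S\subseteq V(G)$, and its size is the number of edges of $G$ with exactly one end in $S$. An algorithm is a fixed program for a random access machine which adds, subtracts, compares and copies non-negative integers held in registers and memory cells, with indirect memory access. Each instruction takes time $1$ plus the number of bits of the integers (operands and memory addresses) it handles. The input is $n$, $k$ and the adjacency matrix of $G$. Then there are one such program and one constant $C$ such that for every connected graph $G$ on the vertex set $\{0,\dots,n-1\}$ and every integer $k\ge 0$ the program halts within time $C\cdot 2^{Ck}\cdot n^4$ and either outputs the characteristic vector of a set $S\subseteq V(G)$ whose cut has size at least $\frac m2+\frac{n-1}4+k$, or answers that no such set exists, and this answer is then correct. -/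

import Mathlib

/-! ## Random access machines with logarithmic cost -/

namespace RAM

/-- Instructions of a random access machine. `r`, `s`, `t` are numbers of registers, `c` is a
constant and `l` is the number of an instruction. -/
inductive Instr where
  /-- `reg r := c` -/
  | const (r c : ℕ)
  /-- `reg r := reg s` -/
  | move (r s : ℕ)
  /-- `reg r := reg s + reg t` -/
  | add (r s t : ℕ)
  /-- `reg r := reg s - reg t`, or `0` if that is negative -/
  | sub (r s t : ℕ)
  /-- `reg r := mem (reg s)` -/
  | load (r s : ℕ)
  /-- `mem (reg s) := reg r` -/
  | store (r s : ℕ)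
  /-- continue with instruction `l` -/
  | jump (l : ℕ)
  /-- continue with instruction `l` if `reg r ≤ reg s` -/
  | jumpLE (r s l : ℕ)

/-- A program is a finite list of instructions; since register numbers occur only as constants
in it, it uses finitely many registers. -/
abbrev Program := List Instr

/-- A configuration: number of the current instruction, contents of the registers, and contents
of the memory cells. -/
structure Config where
  pc : ℕ
  reg : ℕ → ℕ
  mem : ℕ → ℕ

/-- The effect of one instruction. -/
def Instr.exec : Instr → Config → Config
  | .const r c, σ => ⟨σ.pc + 1, Function.update σ.reg r c, σ.mem⟩
  | .move r s, σ => ⟨σ.pc + 1, Function.update σ.reg r (σ.reg s), σ.mem⟩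
  | .add r s t, σ => ⟨σ.pc + 1, Function.update σ.reg r (σ.reg s + σ.reg t), σ.mem⟩
  | .sub r s t, σ => ⟨σ.pc + 1, Function.update σ.reg r (σ.reg s - σ.reg t), σ.mem⟩
  | .load r s, σ => ⟨σ.pc + 1, Function.update σ.reg r (σ.mem (σ.reg s)), σ.mem⟩
  | .store r s, σ => ⟨σ.pc + 1, σ.reg, Function.update σ.mem (σ.reg s) (σ.reg r)⟩
  | .jump l, σ => ⟨l, σ.reg, σ.mem⟩
  | .jumpLE r s l, σ => ⟨if σ.reg r ≤ σ.reg s then l else σ.pc + 1, σ.reg, σ.mem⟩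

/-- The time an instruction takes: one plus the number of bits of all the integers that it adds,
subtracts, compares, copies or uses as a memory address. -/
def Instr.cost : Instr → Config → ℕ
  | .const _ c, _ => 1 + c.size
  | .move _ s, σ => 1 + (σ.reg s).size
  | .add _ s t, σ => 1 + (σ.reg s).size + (σ.reg t).size
  | .sub _ s t, σ => 1 + (σ.reg s).size + (σ.reg t).size
  | .load _ s, σ => 1 + (σ.reg s).size + (σ.mem (σ.reg s)).size
  | .store r s, σ => 1 + (σ.reg s).size + (σ.reg r).size
  | .jump _, _ => 1
  | .jumpLE r s _, σ => 1 + (σ.reg r).size + (σ.reg s).size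

/-- `Runs p σ t τ`: the program `p` leads from `σ` to `τ` in finitely many steps that take
time `t` altogether. -/
inductive Runs (p : Program) : Config → ℕ → Config → Prop
  | refl (σ : Config) : Runs p σ 0 σ
  | step {σ τ : Config} {t : ℕ} (i : Instr) (hi : p[σ.pc]? = some i)
      (h : Runs p (i.exec σ) t τ) : Runs p σ (i.cost σ + t) τ

/-- A program halts when there is no instruction with the current number. -/
def Halted (p : Program) (σ : Config) : Prop := p.length ≤ σ.pc

/-- Started in `σ`, the program `p` halts in configuration `τ` after time `t`. -/
def HaltsIn (p : Program) (σ : Config) (t : ℕ) (τ : Config) : Prop :=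
  Runs p σ t τ ∧ Halted p τ

end RAM

/-! ## Cuts above the Edwards–Erdős bound -/

namespace MaxCut

/-- The size `|E(S, V ∖ S)|` of the cut of `G` given by a set `S` of vertices. -/
def cutSize {n : ℕ} (G : SimpleGraph (Fin n)) [DecidableRel G.Adj] (S : Finset (Fin n)) : ℕ :=
  (G.interedges S Sᶜ).card

/-- The cut given by `S` has size at least `m / 2 + (n - 1) / 4 + k`. -/
def IsLargeCut {n : ℕ} (G : SimpleGraph (Fin n)) [DecidableRel G.Adj] (k : ℕ)
    (S : Finset (Fin n)) : Prop :=
  (G.edgeFinset.card : ℚ) / 2 + ((n : ℚ) - 1) / 4 + (k : ℚ) ≤ (cutSize G S : ℚ)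

/-- The initial memory: the adjacency matrix of `G`, row by row, in the first `n * n` cells, and
zeros elsewhere. -/
def inputMem {n : ℕ} (G : SimpleGraph (Fin n)) [DecidableRel G.Adj] (a : ℕ) : ℕ :=
  if ∃ u v : Fin n, a = u * n + v ∧ G.Adj u v then 1 else 0

/-- The initial configuration on input `(G, k)`: register `0` holds `n`, register `1` holds `k`,
all other registers hold `0`, and the memory holds the adjacency matrix of `G`. -/
def input {n : ℕ} (G : SimpleGraph (Fin n)) [DecidableRel G.Adj] (k : ℕ) : RAM.Config where
  pc := 0
  reg r := if r = 0 then n else if r = 1 then k else 0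
  mem := inputMem G

/-- The final configuration `τ` outputs the set `S` of vertices: register `0` holds `1`, and the
first `n` memory cells hold the characteristic vector of `S`. -/
def Outputs {n : ℕ} (τ : RAM.Config) (S : Finset (Fin n)) : Prop :=
  τ.reg 0 = 1 ∧ ∀ v : Fin n, τ.mem v = if v ∈ S then 1 else 0

/-- The final configuration `τ` gives the answer "no such cut": register `0` holds `0`. -/
def Rejects (τ : RAM.Config) : Prop := τ.reg 0 = 0

end MaxCut

set_option linter.constructorNameAsVariable false
set_option linter.unusedSimpArgs false

/-! ## A language of counted loops and its compiler -/

namespace LoopLang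

/-- Scalar variables. -/
inductive Var where
  | i | x | y | t | j | u | w | v | r | sz | cw | cp | cnt | bad | top | px | py | fd
  | c0 | c1 | p | tot | thr | a | b0 | b1 | bn | nw | cd | fl | z | q
  deriving DecidableEq

/-- Arrays. -/
inductive Arr where
  | ord | vis | mn | comp | pc | mark | side | att | size | cnt | col | w0 | w1 | tab | out
  deriving DecidableEq

theorem Var.idx_inj {x y : Var} (h : x.ctorIdx = y.ctorIdx) : x = y := by
  cases x <;> cases y <;> first | rfl | (exfalso; revert h; decide)

theorem Arr.idx_inj {x y : Arr} (h : x.ctorIdx = y.ctorIdx) : x = y := by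
  cases x <;> cases y <;> first | rfl | (exfalso; revert h; decide)

theorem Arr.idx_lt (x : Arr) : x.ctorIdx < 31 := by cases x <;> decide

/-- The data that stay fixed during a run: numbers `n` and `k` and a binary relation. -/
structure Env where
  n : ℕ
  k : ℕ
  A : ℕ → ℕ → Bool

/-- Additions saturate at this number. -/
def Env.cap (E : Env) : ℕ := 4 * (E.n * E.n + E.n + E.k + 1)

/-- The number of iterations of the exponentially long loops. -/
def Env.P (E : Env) : ℕ := 4096 ^ E.k

/-- The values of the variables and of the array entries. -/
structure St where
  v : Var → ℕ
  a : Arr → ℕ → ℕ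

def St.setV (s : St) (x : Var) (m : ℕ) : St := ⟨fun y => if y = x then m else s.v y, s.a⟩

def St.setA (s : St) (b : Arr) (i m : ℕ) : St :=
  ⟨s.v, fun c j => if c = b ∧ j = i then m else s.a c j⟩

@[simp] theorem St.setV_v (s : St) (x y : Var) (m : ℕ) :
    (s.setV x m).v y = if y = x then m else s.v y := rfl
@[simp] theorem St.setV_a (s : St) (x : Var) (m : ℕ) : (s.setV x m).a = s.a := rfl
@[simp] theorem St.setA_v (s : St) (b : Arr) (i m : ℕ) : (s.setA b i m).v = s.v := rfl
@[simp] theorem St.setA_a (s : St) (b c : Arr) (i m j : ℕ) :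
    (s.setA b i m).a c j = if c = b ∧ j = i then m else s.a c j := rfl
theorem St.setA_ne (s : St) {b c : Arr} (i m : ℕ) (h : c ≠ b) :
    (s.setA b i m).a c = s.a c := by
  funext j; simp [h]

inductive Exp where
  | var (x : Var)
  | lit (c : ℕ)
  | nn
  | kk
  | get (a : Arr) (e : Exp)
  | inc (e : Exp)
  | add (e f : Exp)
  | sub (e f : Exp)

inductive BExp where
  | le (e f : Exp)
  | not (b : BExp)
  | and (b c : BExp)
  | adj (e f : Exp)

inductive Cmd where
  | skip
  | set (x : Var) (e : Exp)
  | put (a : Arr) (e f : Exp)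
  | seq (c d : Cmd)
  | ite (b : BExp) (c d : Cmd)
  | rep (q : Bool) (x : Var) (c : Cmd)

section Semantics

variable (E : Env)

def eval : Exp → St → ℕ
  | .var x, s => s.v x
  | .lit c, _ => c
  | .nn, _ => E.n
  | .kk, _ => E.k
  | .get a e, s => s.a a (eval e s)
  | .inc e, s => eval e s + 1
  | .add e f, s => min (eval e s + eval f s) E.cap
  | .sub e f, s => eval e s - eval f s

/-- The relation of the environment after composition with `o`, with arguments cut off below
`n`. -/
def Env.rel (o : ℕ → ℕ) (i j : ℕ) : Bool := E.A (min (o i) (E.n - 1)) (min (o j) (E.n - 1))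

def evalB : BExp → St → Bool
  | .le e f, s => decide (eval E e s ≤ eval E f s)
  | .not b, s => !evalB b s
  | .and b c, s => evalB b s && evalB c s
  | .adj e f, s => E.rel id (eval E e s) (eval E f s)

/-- The number of iterations of a loop. -/
def Env.bound (q : Bool) : ℕ := if q then E.P else E.n

def iter (f : ℕ → St → St) : ℕ → St → St
  | 0, s => s
  | m + 1, s => f m (iter f m s)

def run : Cmd → St → St
  | .skip, s => s
  | .set x e, s => s.setV x (eval E e s)
  | .put a e f, s => s.setA a (eval E e s) (eval E f s)
  | .seq c d, s => run d (run c s)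
  | .ite b c d, s => if evalB E b s then run c s else run d s
  | .rep q x c, s => iter (fun j s => run c (s.setV x j)) (E.bound q) s

def ew : Exp → ℕ
  | .var _ => 1
  | .lit c => c + 1
  | .nn => 1
  | .kk => 1
  | .get _ e => ew e + 9
  | .inc e => ew e + 2
  | .add e f => ew e + ew f + 3
  | .sub e f => ew e + ew f + 1

def bw : BExp → ℕ
  | .le e f => ew e + ew f + 3
  | .not b => bw b + 2
  | .and b c => bw b + bw c + 3
  | .adj e f => ew e + ew f + 15

/-- A bound for the number of machine steps. -/
def cost : Cmd → St → ℕ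
  | .skip, _ => 0
  | .set _ e, _ => ew e + 1
  | .put _ e f, _ => ew e + ew f + 10
  | .seq c d, s => cost c s + cost d (run E c s)
  | .ite b c d, s => bw b + 4 + if evalB E b s then cost c s else cost d s
  | .rep q x c, s => 2 + ∑ j ∈ Finset.range (E.bound q),
      (cost c ((iter (fun j s => run E c (s.setV x j)) j s).setV x j) + 5)

end Semantics

/-! ### Compilation -/

open RAM

def rV (x : Var) : ℕ := 5 + 3 * x.ctorIdx
def rT (d : ℕ) : ℕ := 6 + 3 * d
def rC (d : ℕ) : ℕ := 7 + 3 * d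

def times32 (r : ℕ) : List Instr := [.add r r r, .add r r r, .add r r r, .add r r r, .add r r r]

def ce : Exp → ℕ → List Instr
  | .var x, d => [.move (rT d) (rV x)]
  | .lit c, d => [.const (rT d) c]
  | .nn, d => [.move (rT d) 0]
  | .kk, d => [.move (rT d) 1]
  | .get a e, d => ce e d ++ (times32 (rT d) ++
      [.const (rT (d + 1)) (a.ctorIdx + 1), .add (rT d) (rT d) (rT (d + 1)),
       .add (rT d) (rT d) 2, .load (rT d) (rT d)])
  | .inc e, d => ce e d ++ [.const (rT (d + 1)) 1, .add (rT d) (rT d) (rT (d + 1))]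
  | .add e f, d => ce e d ++ (ce f (d + 1) ++
      [.add (rT d) (rT d) (rT (d + 1)), .sub (rT (d + 1)) (rT d) 3,
       .sub (rT d) (rT d) (rT (d + 1))])
  | .sub e f, d => ce e d ++ (ce f (d + 1) ++ [.sub (rT d) (rT d) (rT (d + 1))])

def cb : BExp → ℕ → List Instr
  | .le e f, d => ce e d ++ (ce f (d + 1) ++
      [.sub (rT d) (rT d) (rT (d + 1)), .const (rT (d + 1)) 1,
       .sub (rT d) (rT (d + 1)) (rT d)])
  | .not b, d => cb b d ++ [.const (rT (d + 1)) 1, .sub (rT d) (rT (d + 1)) (rT d)]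
  | .and b c, d => cb b d ++ (cb c (d + 1) ++
      [.const (rT (d + 2)) 1, .sub (rT (d + 1)) (rT (d + 2)) (rT (d + 1)),
       .sub (rT d) (rT d) (rT (d + 1))])
  | .adj e f, d => ce e d ++ (ce f (d + 1) ++
      ([.const (rT (d + 2)) 1, .sub (rT (d + 2)) 0 (rT (d + 2)),
        .sub (rT (d + 3)) (rT d) (rT (d + 2)), .sub (rT d) (rT d) (rT (d + 3)),
        .sub (rT (d + 3)) (rT (d + 1)) (rT (d + 2)),
        .sub (rT (d + 1)) (rT (d + 1)) (rT (d + 3))] ++ (times32 (rT d) ++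
       [.add (rT d) (rT d) 2, .load (rT d) (rT d), .add (rT d) (rT d) (rT (d + 1)),
        .load (rT d) (rT d)])))

def rQ (q : Bool) : ℕ := if q then 4 else 0

/-- The code of a command, to be put at position `o`; counters of loops start at `rC d`. -/
def cc : Cmd → ℕ → ℕ → List Instr
  | .skip, _, _ => []
  | .set x e, _, _ => ce e 0 ++ [.move (rV x) (rT 0)]
  | .put a e f, _, _ => ce e 0 ++ (ce f 1 ++ (times32 (rT 0) ++
      [.const (rT 2) (a.ctorIdx + 1), .add (rT 0) (rT 0) (rT 2), .add (rT 0) (rT 0) 2,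
       .store (rT 1) (rT 0)]))
  | .seq c c', d, o => cc c d o ++ cc c' d (o + (cc c d o).length)
  | .ite b c c', d, o =>
      let m := o + (cb b 0).length
      let C' := cc c' d (m + 2)
      let C := cc c d (m + 3 + C'.length)
      cb b 0 ++ ([.const (rT 1) 1, .jumpLE (rT 1) (rT 0) (m + 3 + C'.length)] ++
        (C' ++ ([.jump (m + 3 + C'.length + C.length)] ++ C)))
  | .rep q x c, d, o =>
      let B := cc c (d + 1) (o + 3)
      [.const (rC d) 0, .jumpLE (rQ q) (rC d) (o + 6 + B.length), .move (rV x) (rC d)] ++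
        (B ++ [.const (rT 0) 1, .add (rC d) (rC d) (rT 0), .jump (o + 1)])

/-! ### Correctness of compilation -/

/-- The program `p` contains the code `l` at position `o`. -/
def CodeAt (p : Program) : ℕ → List Instr → Prop
  | _, [] => True
  | o, i :: l => p[o]? = some i ∧ CodeAt p (o + 1) l

theorem codeAt_append {p : Program} {l l' : List Instr} : ∀ {o : ℕ},
    CodeAt p o (l ++ l') ↔ CodeAt p o l ∧ CodeAt p (o + l.length) l' := by
  induction l with
  | nil => intro o; simp [CodeAt]
  | cons i l ih =>
    intro o
    simp only [List.cons_append, CodeAt, ih, List.length_cons, and_assoc]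
    rw [show o + 1 + l.length = o + (l.length + 1) by ring]

theorem codeAt_self (l₁ l l₂ : List Instr) : CodeAt (l₁ ++ (l ++ l₂)) l₁.length l := by
  induction l generalizing l₁ with
  | nil => trivial
  | cons i l ih =>
    refine ⟨by simp, ?_⟩
    have := ih (l₁ ++ [i])
    simpa using this

/-- `p` leads from `σ` to `τ`, in time at most `m` times the cost of an instruction with two
operands of at most `W` bits. -/
def Reach (p : Program) (W m : ℕ) (σ τ : Config) : Prop :=
  ∃ t, Runs p σ t τ ∧ t ≤ m * (2 * W + 1)

theorem Reach.refl {p : Program} {W : ℕ} (σ : Config) : Reach p W 0 σ σ :=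
  ⟨0, .refl σ, by simp⟩

theorem runs_trans {p : Program} {σ τ ρ : Config} {t t' : ℕ} (h : Runs p σ t τ)
    (h' : Runs p τ t' ρ) : Runs p σ (t + t') ρ := by
  induction h with
  | refl σ => simpa using h'
  | step i hi _ ih => rw [add_assoc]; exact .step i hi (ih h')

theorem Reach.trans {p : Program} {W m m' : ℕ} {σ τ ρ : Config} (h : Reach p W m σ τ)
    (h' : Reach p W m' τ ρ) : Reach p W (m + m') σ ρ := by
  obtain ⟨t, h, ht⟩ := h
  obtain ⟨t', h', ht'⟩ := h'
  exact ⟨t + t', runs_trans h h', by rw [add_mul]; omega⟩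

theorem Reach.mono {p : Program} {W m m' : ℕ} {σ τ : Config} (h : Reach p W m σ τ)
    (hm : m ≤ m') : Reach p W m' σ τ := by
  obtain ⟨t, h, ht⟩ := h
  exact ⟨t, h, ht.trans (Nat.mul_le_mul_right _ hm)⟩

theorem Reach.head {p : Program} {W m : ℕ} {σ τ : Config} {i : Instr} (hi : p[σ.pc]? = some i)
    (hc : i.cost σ ≤ 2 * W + 1) (h : Reach p W m (i.exec σ) τ) : Reach p W (m + 1) σ τ := by
  obtain ⟨t, h, ht⟩ := h
  exact ⟨_, .step i hi h, by rw [add_mul]; omega⟩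

theorem reach_done {p : Program} {W o o' : ℕ} {R M : ℕ → ℕ} (h : o = o') :
    Reach p W 0 ⟨o, R, M⟩ ⟨o', R, M⟩ := h ▸ Reach.refl _

section
variable {p : Program} {W m : ℕ} {τ : Config} {o r s t l c : ℕ} {R : ℕ → ℕ} {M : ℕ → ℕ}

theorem reach_const (hi : p[o]? = some (.const r c)) (h1 : c < 2 ^ W)
    (h : Reach p W m ⟨o + 1, Function.update R r c, M⟩ τ) : Reach p W (m + 1) ⟨o, R, M⟩ τ :=
  Reach.head hi (by have := Nat.size_le.2 h1; simp only [Instr.cost]; omega) h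

theorem reach_move (hi : p[o]? = some (.move r s)) (h1 : R s < 2 ^ W)
    (h : Reach p W m ⟨o + 1, Function.update R r (R s), M⟩ τ) : Reach p W (m + 1) ⟨o, R, M⟩ τ :=
  Reach.head hi (by have := Nat.size_le.2 h1; simp only [Instr.cost]; omega) h

theorem reach_add (hi : p[o]? = some (.add r s t)) (h1 : R s < 2 ^ W) (h2 : R t < 2 ^ W)
    (h : Reach p W m ⟨o + 1, Function.update R r (R s + R t), M⟩ τ) :
    Reach p W (m + 1) ⟨o, R, M⟩ τ :=
  Reach.head hi (by
    have := Nat.size_le.2 h1; have := Nat.size_le.2 h2; simp only [Instr.cost]; omega) h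

theorem reach_sub (hi : p[o]? = some (.sub r s t)) (h1 : R s < 2 ^ W) (h2 : R t < 2 ^ W)
    (h : Reach p W m ⟨o + 1, Function.update R r (R s - R t), M⟩ τ) :
    Reach p W (m + 1) ⟨o, R, M⟩ τ :=
  Reach.head hi (by
    have := Nat.size_le.2 h1; have := Nat.size_le.2 h2; simp only [Instr.cost]; omega) h

theorem reach_load (hi : p[o]? = some (.load r s)) (h1 : R s < 2 ^ W) (h2 : M (R s) < 2 ^ W)
    (h : Reach p W m ⟨o + 1, Function.update R r (M (R s)), M⟩ τ) :
    Reach p W (m + 1) ⟨o, R, M⟩ τ :=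
  Reach.head hi (by
    have := Nat.size_le.2 h1; have := Nat.size_le.2 h2; simp only [Instr.cost]; omega) h

theorem reach_store (hi : p[o]? = some (.store r s)) (h1 : R s < 2 ^ W) (h2 : R r < 2 ^ W)
    (h : Reach p W m ⟨o + 1, R, Function.update M (R s) (R r)⟩ τ) :
    Reach p W (m + 1) ⟨o, R, M⟩ τ :=
  Reach.head hi (by
    have := Nat.size_le.2 h1; have := Nat.size_le.2 h2; simp only [Instr.cost]; omega) h

theorem reach_jump (hi : p[o]? = some (.jump l)) (h : Reach p W m ⟨l, R, M⟩ τ) :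
    Reach p W (m + 1) ⟨o, R, M⟩ τ :=
  Reach.head hi (by simp only [Instr.cost]; omega) h

theorem reach_jumpLE (hi : p[o]? = some (.jumpLE r s l)) (h1 : R r < 2 ^ W) (h2 : R s < 2 ^ W)
    (h : Reach p W m ⟨if R r ≤ R s then l else o + 1, R, M⟩ τ) :
    Reach p W (m + 1) ⟨o, R, M⟩ τ :=
  Reach.head hi (by
    have := Nat.size_le.2 h1; have := Nat.size_le.2 h2; simp only [Instr.cost]; omega) h

/-- Multiplication of a register by `32`. -/
theorem reach_times32 (hp : CodeAt p o (times32 r)) (h1 : 32 * R r < 2 ^ W)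
    (h : Reach p W m ⟨o + 5, Function.update R r (32 * R r), M⟩ τ) :
    Reach p W (m + 5) ⟨o, R, M⟩ τ := by
  obtain ⟨g1, g2, g3, g4, g5, -⟩ := hp
  refine reach_add g1 (by omega) (by omega) ?_
  refine reach_add g2 (by simp; omega) (by simp; omega) ?_
  refine reach_add g3 (by simp; omega) (by simp; omega) ?_
  refine reach_add g4 (by simp; omega) (by simp; omega) ?_
  refine reach_add g5 (by simp; omega) (by simp; omega) ?_
  simp only [Function.update_self, Function.update_idem]
  convert h using 3
  ring

end

/-- The machine state that represents a state of the loop language. -/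
structure Sim (E : Env) (s : St) (R M : ℕ → ℕ) : Prop where
  h0 : R 0 = E.n
  h1 : R 1 = E.k
  h2 : R 2 = E.n * E.n
  h3 : R 3 = E.cap
  h4 : R 4 = E.P
  hv : ∀ x, R (rV x) = s.v x
  hin : ∀ i < E.n, ∀ j < E.n, M (i * E.n + j) = if E.A i j then 1 else 0
  hrow : ∀ i < E.n, M (E.n * E.n + 32 * i) = i * E.n
  ha : ∀ b i, M (E.n * E.n + 32 * i + (b.ctorIdx + 1)) = s.a b i

/-- All numbers in the state are at most `B`. -/
structure Bnd (E : Env) (s : St) (B : ℕ) : Prop where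
  hn : E.n ≤ B
  hk : E.k ≤ B
  hnn : E.n * E.n ≤ B
  hcap : E.cap ≤ B
  hP : E.P ≤ B
  hv : ∀ x, s.v x ≤ B
  ha : ∀ b i, s.a b i ≤ B

theorem Bnd.mono {E : Env} {s : St} {B B' : ℕ} (h : Bnd E s B) (hB : B ≤ B') : Bnd E s B' :=
  ⟨h.hn.trans hB, h.hk.trans hB, h.hnn.trans hB, h.hcap.trans hB, h.hP.trans hB,
    fun x => (h.hv x).trans hB, fun b i => (h.ha b i).trans hB⟩

theorem eval_le {E : Env} {s : St} {B : ℕ} (h : Bnd E s B) (e : Exp) :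
    eval E e s ≤ B + ew e := by
  induction e with
  | var x => have := h.hv x; simp only [eval, ew]; omega
  | lit c => simp only [eval, ew]; omega
  | nn => have := h.hn; simp only [eval, ew]; omega
  | kk => have := h.hk; simp only [eval, ew]; omega
  | get a e _ => have := h.ha a (eval E e s); simp only [eval, ew]; omega
  | inc e ih => simp only [eval, ew]; omega
  | add e f _ _ => have := h.hcap; simp only [eval, ew]; omega
  | sub e f _ _ => simp only [eval, ew]; omega

theorem ce_length (e : Exp) : ∀ d, (ce e d).length ≤ ew e := by
  induction e with
  | add e f he hf => intro d; have := he d; have := hf (d + 1); simp [ce, ew]; omega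
  | sub e f he hf => intro d; have := he d; have := hf (d + 1); simp [ce, ew]; omega
  | get a e he => intro d; have := he d; simp [ce, ew, times32]; omega
  | inc e he => intro d; have := he d; simp [ce, ew]; omega
  | _ => intro d; simp [ce, ew]

theorem cb_length (b : BExp) : ∀ d, (cb b d).length ≤ bw b := by
  induction b with
  | le e f =>
    intro d; have := ce_length e d; have := ce_length f (d + 1); simp [cb, bw]; omega
  | adj e f =>
    intro d; have := ce_length e d; have := ce_length f (d + 1); simp [cb, bw, times32]; omega
  | not b hb => intro d; have := hb d; simp [cb, bw]; omega
  | and b c hb hc => intro d; have := hb d; have := hc (d + 1); simp [cb, bw]; omega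

/-- Registers other than the temporary ones from number `d` on agree. -/
def Keep (d : ℕ) (R R' : ℕ → ℕ) : Prop := ∀ r, (∀ d', d ≤ d' → r ≠ rT d') → R' r = R r

theorem Keep.trans {d d' : ℕ} {R R' R'' : ℕ → ℕ} (h : Keep d R R') (h' : Keep d' R' R'')
    (hd : d ≤ d') : Keep d R R'' := fun r hr =>
  (h' r fun e he => hr e (hd.trans he)).trans (h r hr)

theorem Keep.update {d d' x : ℕ} {R R' : ℕ → ℕ} (h : Keep d R R') (hd : d ≤ d') :
    Keep d R (Function.update R' (rT d') x) := fun r hr => by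
  rw [Function.update_of_ne (hr d' hd)]; exact h r hr

theorem Keep.refl (d : ℕ) (R : ℕ → ℕ) : Keep d R R := fun _ _ => rfl

theorem Keep.sim {E : Env} {s : St} {d : ℕ} {R R' M : ℕ → ℕ} (h : Keep d R R')
    (hs : Sim E s R M) : Sim E s R' M := by
  obtain ⟨h0, h1, h2, h3, h4, hv, hin, hrow, ha⟩ := hs
  refine ⟨?_, ?_, ?_, ?_, ?_, fun x => ?_, hin, hrow, ha⟩
  any_goals rw [h _ (fun d' _ => by simp only [rT, rV]; omega)]
  all_goals first | assumption | exact hv _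

theorem Keep.low {d d' : ℕ} {R R' : ℕ → ℕ} (h : Keep d R R') (hd : d' < d) :
    R' (rT d') = R (rT d') := h _ fun e he => by simp only [rT]; omega

theorem rT_ne {d d' : ℕ} (h : d ≠ d') : rT d ≠ rT d' := by simp only [rT]; omega

theorem times32_length (r : ℕ) : (times32 r).length = 5 := rfl

theorem ce_spec {E : Env} {p : Program} {W B : ℕ} {s : St} {M : ℕ → ℕ} (hB : Bnd E s B)
    (e : Exp) : ∀ (d o : ℕ) (R : ℕ → ℕ), CodeAt p o (ce e d) → Sim E s R M →
      64 * (B + ew e + 1) ≤ 2 ^ W →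
      ∃ R', Reach p W (ce e d).length ⟨o, R, M⟩ ⟨o + (ce e d).length, R', M⟩ ∧
        R' (rT d) = eval E e s ∧ Keep d R R' := by
  induction e with
  | var x =>
    intro d o R hp hs hW
    have hW0 : W ≠ 0 := by rintro rfl; omega
    have := hB.hv x
    simp only [ew] at hW
    exact ⟨_, reach_move hp.1 (by rw [hs.hv]; omega) (reach_done (by simp [ce])), by simp [eval, hs.hv],
      (Keep.refl d R).update le_rfl⟩
  | lit c =>
    intro d o R hp hs hW
    have hW0 : W ≠ 0 := by rintro rfl; omega
    simp only [ew] at hW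
    exact ⟨_, reach_const hp.1 (by omega) (reach_done (by simp [ce])), by simp [eval],
      (Keep.refl d R).update le_rfl⟩
  | nn =>
    intro d o R hp hs hW
    have hW0 : W ≠ 0 := by rintro rfl; omega
    have := hB.hn
    simp only [ew] at hW
    exact ⟨_, reach_move hp.1 (by rw [hs.h0]; omega) (reach_done (by simp [ce])), by simp [eval, hs.h0],
      (Keep.refl d R).update le_rfl⟩
  | kk =>
    intro d o R hp hs hW
    have hW0 : W ≠ 0 := by rintro rfl; omega
    have := hB.hk
    simp only [ew] at hW
    exact ⟨_, reach_move hp.1 (by rw [hs.h1]; omega) (reach_done (by simp [ce])), by simp [eval, hs.h1],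
      (Keep.refl d R).update le_rfl⟩
  | get a e ih =>
    intro d o R hp hs hW
    have hW0 : W ≠ 0 := by rintro rfl; omega
    simp only [ew] at hW
    simp only [ce, codeAt_append, times32_length] at hp
    obtain ⟨hp1, hp2, g1, g2, g3, g4, -⟩ := hp
    obtain ⟨R1, hr, hval, hk⟩ := ih d o R hp1 hs (by omega)
    have hs' := hk.sim hs
    have hev := eval_le hB e
    have ha := a.idx_lt
    have hnn := hB.hnn
    have hav := hB.ha a (eval E e s)
    have n1 : rT (d + 1) ≠ rT d := rT_ne (by omega)
    have n2 : (2 : ℕ) ≠ rT d := by simp only [rT]; omega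
    have n2' : (2 : ℕ) ≠ rT (d + 1) := by simp only [rT]; omega
    have hm := hs'.ha a (eval E e s)
    constructor
    refine ⟨?_, ?_, ?_⟩
    · simp only [ce, List.length_append, times32_length]
      refine hr.trans ?_
      rw [add_comm 5]
      refine reach_times32 hp2 (by rw [hval]; omega) ?_
      refine reach_const g1 (by omega) ?_
      refine reach_add g2 (by simp [n1.symm, hval]; omega) (by simp; omega) ?_
      refine reach_add g3 (by simp [n1.symm, hval]; omega) (by simp [n2, n2', hs'.h2]; omega) ?_
      refine reach_load g4 ?_ ?_ (reach_done (by simp; try omega))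
      · simp [n1.symm, n2, n2', hs'.h2, hval]; omega
      · simp only [Function.update_self, Function.update_of_ne n1.symm, Function.update_of_ne n2,
          Function.update_of_ne n2', hs'.h2, hval]
        rw [show 32 * eval E e s + (a.ctorIdx + 1) + E.n * E.n
          = E.n * E.n + 32 * eval E e s + (a.ctorIdx + 1) by ring, hm]
        omega
    · simp only [Function.update_self, Function.update_of_ne n1.symm, Function.update_of_ne n2,
          Function.update_of_ne n2', hs'.h2, hval]
      rw [show 32 * eval E e s + (a.ctorIdx + 1) + E.n * E.n
          = E.n * E.n + 32 * eval E e s + (a.ctorIdx + 1) by ring, hm]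
      rfl
    · exact ((((hk.update le_rfl).update (by omega)).update le_rfl).update le_rfl).update le_rfl
  | inc e ih =>
    intro d o R hp hs hW
    have hW0 : W ≠ 0 := by rintro rfl; omega
    simp only [ew] at hW
    simp only [ce, codeAt_append] at hp
    obtain ⟨hp1, g1, g2, -⟩ := hp
    obtain ⟨R1, hr, hval, hk⟩ := ih d o R hp1 hs (by omega)
    have hev := eval_le hB e
    have n1 : rT (d + 1) ≠ rT d := rT_ne (by omega)
    constructor
    refine ⟨?_, ?_, ?_⟩
    · simp only [ce, List.length_append]
      refine hr.trans ?_
      refine reach_const g1 (by omega) ?_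
      exact reach_add g2 (by simp [n1.symm, hval]; omega) (by simp; omega) (reach_done (by simp; try omega))
    · simp [n1.symm, hval, eval]
    · exact (hk.update (by omega)).update le_rfl
  | add e f ihe ihf =>
    intro d o R hp hs hW
    have hW0 : W ≠ 0 := by rintro rfl; omega
    simp only [ew] at hW
    simp only [ce, codeAt_append] at hp
    obtain ⟨hp1, hp2, g1, g2, g3, -⟩ := hp
    obtain ⟨R1, hr, hval, hk⟩ := ihe d o R hp1 hs (by omega)
    obtain ⟨R2, hr2, hval2, hk2⟩ := ihf (d + 1) _ R1 hp2 (hk.sim hs) (by omega)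
    have hs' := hk2.sim (hk.sim hs)
    have hev := eval_le hB e
    have hev2 := eval_le hB f
    have hcap := hB.hcap
    have n1 : rT (d + 1) ≠ rT d := rT_ne (by omega)
    have n3 : (3 : ℕ) ≠ rT d := by simp only [rT]; omega
    have hd := (hk2.low (Nat.lt_succ_self d)).trans hval
    constructor
    refine ⟨?_, ?_, ?_⟩
    · simp only [ce, List.length_append]
      rw [← add_assoc]
      refine (hr.trans hr2).trans ?_
      refine reach_add g1 (by rw [hd]; omega) (by rw [hval2]; omega) ?_
      refine reach_sub g2 (by simp [hd, hval2]; omega) (by simp [n3, hs'.h3]; omega) ?_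
      rw [show o + ((ce e d).length + (ce f (d + 1)).length + [Instr.add (rT d) (rT d) (rT (d + 1)),
        .sub (rT (d + 1)) (rT d) 3, .sub (rT d) (rT d) (rT (d + 1))].length) = o + (ce e d).length + (ce f (d + 1)).length + 1 + 1 + 1 by
          simp; omega]
      exact reach_sub g3 (by simp [n1.symm, hd, hval2]; omega)
        (by simp [n1.symm, hd, hval2]; omega) (reach_done (by simp; try omega))
    · simp only [Function.update_self, Function.update_of_ne n1.symm, Function.update_of_ne n3,
        hd, hval2, hs'.h3, eval]
      omega
    · exact (((hk.trans hk2 (by omega)).update le_rfl).update (by omega)).update le_rfl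
  | sub e f ihe ihf =>
    intro d o R hp hs hW
    have hW0 : W ≠ 0 := by rintro rfl; omega
    simp only [ew] at hW
    simp only [ce, codeAt_append] at hp
    obtain ⟨hp1, hp2, g1, -⟩ := hp
    obtain ⟨R1, hr, hval, hk⟩ := ihe d o R hp1 hs (by omega)
    obtain ⟨R2, hr2, hval2, hk2⟩ := ihf (d + 1) _ R1 hp2 (hk.sim hs) (by omega)
    have hev := eval_le hB e
    have hev2 := eval_le hB f
    have hd := (hk2.low (Nat.lt_succ_self d)).trans hval
    constructor
    refine ⟨?_, ?_, ?_⟩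
    · simp only [ce, List.length_append]
      rw [← add_assoc, ← add_assoc, ← add_assoc]
      refine (hr.trans hr2).trans ?_
      exact reach_sub g1 (by rw [hd]; omega) (by rw [hval2]; omega) (reach_done (by simp; try omega))
    · simp [eval, hd, hval2]
    · exact (hk.trans hk2 (by omega)).update le_rfl

theorem cb_spec {E : Env} {p : Program} {W B : ℕ} {s : St} {M : ℕ → ℕ} (hB : Bnd E s B)
    (hn : 0 < E.n) (b : BExp) : ∀ (d o : ℕ) (R : ℕ → ℕ), CodeAt p o (cb b d) → Sim E s R M →
      64 * (B + bw b + 1) ≤ 2 ^ W →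
      ∃ R', Reach p W (cb b d).length ⟨o, R, M⟩ ⟨o + (cb b d).length, R', M⟩ ∧
        R' (rT d) = (if evalB E b s then 1 else 0) ∧ Keep d R R' := by
  induction b with
  | le e f =>
    intro d o R hp hs hW
    have hW0 : W ≠ 0 := by rintro rfl; omega
    simp only [bw] at hW
    simp only [cb, codeAt_append] at hp
    obtain ⟨hp1, hp2, g1, g2, g3, -⟩ := hp
    obtain ⟨R1, hr, hval, hk⟩ := ce_spec (W := W) hB e d o R hp1 hs (by omega)
    obtain ⟨R2, hr2, hval2, hk2⟩ := ce_spec (W := W) hB f (d + 1) _ R1 hp2 (hk.sim hs) (by omega)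
    have hev := eval_le hB e
    have hev2 := eval_le hB f
    have n1 : rT (d + 1) ≠ rT d := rT_ne (by omega)
    have hd := (hk2.low (Nat.lt_succ_self d)).trans hval
    constructor
    refine ⟨?_, ?_, ?_⟩
    · simp only [cb, List.length_append]
      rw [← add_assoc, ← add_assoc, ← add_assoc]
      refine (hr.trans hr2).trans ?_
      refine reach_sub g1 (by rw [hd]; omega) (by rw [hval2]; omega) ?_
      refine reach_const g2 (by omega) ?_
      exact reach_sub g3 (by simp; omega) (by simp [n1.symm, hd, hval2]; omega) (reach_done (by simp; try omega))
    · simp only [Function.update_self, Function.update_of_ne n1.symm, hd, hval2, evalB,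
        decide_eq_true_eq]
      split_ifs <;> omega
    · exact (((hk.trans hk2 (by omega)).update le_rfl).update (by omega)).update le_rfl
  | not b ih =>
    intro d o R hp hs hW
    have hW0 : W ≠ 0 := by rintro rfl; omega
    simp only [bw] at hW
    simp only [cb, codeAt_append] at hp
    obtain ⟨hp1, g1, g2, -⟩ := hp
    obtain ⟨R1, hr, hval, hk⟩ := ih d o R hp1 hs (by omega)
    have n1 : rT (d + 1) ≠ rT d := rT_ne (by omega)
    have hle : R1 (rT d) ≤ 1 := by rw [hval]; split_ifs <;> omega
    constructor
    refine ⟨?_, ?_, ?_⟩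
    · simp only [cb, List.length_append]
      refine hr.trans ?_
      refine reach_const g1 (by omega) ?_
      exact reach_sub g2 (by simp; omega) (by simp [n1.symm]; omega) (reach_done (by simp; try omega))
    · simp only [Function.update_self, Function.update_of_ne n1.symm, hval, evalB]
      rcases Bool.eq_false_or_eq_true (evalB E b s) with h | h <;> simp [h]
    · exact (hk.update (by omega)).update le_rfl
  | and b c ihb ihc =>
    intro d o R hp hs hW
    have hW0 : W ≠ 0 := by rintro rfl; omega
    simp only [bw] at hW
    simp only [cb, codeAt_append] at hp
    obtain ⟨hp1, hp2, g1, g2, g3, -⟩ := hp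
    obtain ⟨R1, hr, hval, hk⟩ := ihb d o R hp1 hs (by omega)
    obtain ⟨R2, hr2, hval2, hk2⟩ := ihc (d + 1) _ R1 hp2 (hk.sim hs) (by omega)
    have n1 : rT (d + 1) ≠ rT d := rT_ne (by omega)
    have n2 : rT (d + 2) ≠ rT d := rT_ne (by omega)
    have n3 : rT (d + 2) ≠ rT (d + 1) := rT_ne (by omega)
    have hd := (hk2.low (Nat.lt_succ_self d)).trans hval
    have hle : R2 (rT d) ≤ 1 := by rw [hd]; split_ifs <;> omega
    have hle2 : R2 (rT (d + 1)) ≤ 1 := by rw [hval2]; split_ifs <;> omega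
    constructor
    refine ⟨?_, ?_, ?_⟩
    · simp only [cb, List.length_append]
      rw [← add_assoc, ← add_assoc, ← add_assoc]
      refine (hr.trans hr2).trans ?_
      refine reach_const g1 (by omega) ?_
      refine reach_sub g2 (by simp; omega) (by simp [n3.symm]; omega) ?_
      exact reach_sub g3 (by simp [n1.symm, n2.symm]; omega) (by simp; omega) (reach_done (by simp; try omega))
    · simp only [Function.update_self, Function.update_of_ne n1.symm, Function.update_of_ne n2.symm,
        Function.update_of_ne n3.symm, hd, hval2, evalB]
      rcases Bool.eq_false_or_eq_true (evalB E b s) with h | h <;>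
        rcases Bool.eq_false_or_eq_true (evalB E c s) with h' | h' <;> simp [h, h']
    · exact (((hk.trans hk2 (by omega)).update (by omega)).update (by omega)).update le_rfl
  | adj e f =>
    intro d o R hp hs hW
    have hW0 : W ≠ 0 := by rintro rfl; omega
    simp only [bw] at hW
    simp only [cb, codeAt_append, times32_length] at hp
    obtain ⟨hp1, hp2, ⟨g1, g2, g3, g4, g5, g6, -⟩, hp3, g7, g8, g9, g10, -⟩ := hp
    obtain ⟨R1, hr, hval, hk⟩ := ce_spec (W := W) hB e d o R hp1 hs (by omega)
    obtain ⟨R2, hr2, hval2, hk2⟩ := ce_spec (W := W) hB f (d + 1) _ R1 hp2 (hk.sim hs) (by omega)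
    have hs' := hk2.sim (hk.sim hs)
    have hev := eval_le hB e
    have hev2 := eval_le hB f
    have hnn := hB.hnn
    have hbn := hB.hn
    have n1 : rT d ≠ rT (d + 1) := rT_ne (by omega)
    have n2 : rT d ≠ rT (d + 2) := rT_ne (by omega)
    have n3 : rT (d + 1) ≠ rT (d + 2) := rT_ne (by omega)
    have n4 : rT d ≠ rT (d + 3) := rT_ne (by omega)
    have n5 : rT (d + 1) ≠ rT (d + 3) := rT_ne (by omega)
    have n6 : rT (d + 2) ≠ rT (d + 3) := rT_ne (by omega)
    have m0 : ∀ d, (0 : ℕ) ≠ rT d := fun d => by simp only [rT]; omega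
    have m2 : ∀ d, (2 : ℕ) ≠ rT d := fun d => by simp only [rT]; omega
    have hd := (hk2.low (Nat.lt_succ_self d)).trans hval
    set i := eval E e s with hi
    set j := eval E f s with hj
    set i' := min i (E.n - 1) with hi'
    set j' := min j (E.n - 1) with hj'
    have e1 : i - (i - (E.n - 1)) = i' := by omega
    have e2 : j - (j - (E.n - 1)) = j' := by omega
    have hi'n : i' < E.n := by omega
    have hj'n : j' < E.n := by omega
    have hrow := hs'.hrow i' hi'n
    have hin := hs'.hin i' hi'n j' hj'n
    have hlt : i' * E.n + j' < E.n * E.n := by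
      calc i' * E.n + j' < i' * E.n + E.n := by omega
        _ = (i' + 1) * E.n := by ring
        _ ≤ _ := Nat.mul_le_mul_right _ hi'n
    have hone : 1 < 2 ^ W := by omega
    constructor
    refine ⟨?_, ?_, ?_⟩
    · simp only [cb, List.length_append, times32_length]
      rw [← add_assoc (ce e d).length]
      refine (hr.trans hr2).trans ?_
      rw [show ∀ q : ℕ, [Instr.const (rT (d + 2)) 1, .sub (rT (d + 2)) 0 (rT (d + 2)),
        .sub (rT (d + 3)) (rT d) (rT (d + 2)), .sub (rT d) (rT d) (rT (d + 3)),
        .sub (rT (d + 3)) (rT (d + 1)) (rT (d + 2)),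
        .sub (rT (d + 1)) (rT (d + 1)) (rT (d + 3))].length + (5 + q) = (q + 5) + 6 by
          intro q; simp; omega]
      refine reach_const g1 (by omega) ?_
      refine reach_sub g2 (by simp [m0, hs'.h0]; omega) (by simp; omega) ?_
      refine reach_sub g3 (by simp [n2, hd]; omega) (by simp [m0, hs'.h0]; omega) ?_
      refine reach_sub g4 (by simp [n2, n4, hd]; omega)
        (by simp [n2, m0, hs'.h0, hd]; omega) ?_
      refine reach_sub g5 (by simp [n1.symm, n3, n5, hval2]; omega)
        (by simp [n2.symm, n6, m0, hs'.h0]; omega) ?_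
      refine reach_sub g6 (by simp [n1.symm, n3, n5, hval2]; omega)
        (by simp [n1.symm, n2.symm, n3, n5, n6, m0, hs'.h0, hval2]; omega) ?_
      refine reach_times32 hp3 (by simp [n1, n2, n4, m0, hs'.h0, hd, e1]; omega) ?_
      refine reach_add g7 (by simp [n1, n2, n4, m0, hs'.h0, hd, e1]; omega)
        (by simp [m2, hs'.h2]; omega) ?_
      refine reach_load g8 (by simp [n1, n2, n4, m0, m2, hs'.h0, hs'.h2, hd, e1]; omega) ?_ ?_
      · simp [n1, n2, n4, m0, m2, hs'.h0, hs'.h2, hd, e1]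
        rw [add_comm, hrow]; omega
      refine reach_add g9 ?_ (by simp [n1.symm, n2.symm, n3, n5, n6, m0, hs'.h0, hval2, e2]; omega)
        ?_
      · simp [n1, n2, n4, m0, m2, hs'.h0, hs'.h2, hd, e1]
        rw [add_comm, hrow]; omega
      refine reach_load g10 ?_ ?_ (reach_done (by simp; try omega))
      · simp [n1, n1.symm, n2, n2.symm, n3, n4, n5, n6, m0, m2, hs'.h0, hs'.h2, hd, hval2, e1, e2]
        rw [add_comm (32 * i'), hrow]; omega
      · simp [n1, n1.symm, n2, n2.symm, n3, n4, n5, n6, m0, m2, hs'.h0, hs'.h2, hd, hval2, e1, e2]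
        rw [add_comm (32 * i'), hrow, hin]
        split_ifs <;> omega
    · simp [n1, n1.symm, n2, n2.symm, n3, n4, n5, n6, m0, m2, hs'.h0, hs'.h2, hd, hval2, e1, e2]
      rw [add_comm (32 * i'), hrow, hin]
      simp [evalB, Env.rel, ← hi, ← hj, ← hi', ← hj']
    · have h0 := hk.trans hk2 (Nat.le_succ d)
      have h1 := (h0.update (x := 1) (d' := d + 2) (by omega))
      repeat' first | exact h0 | refine Keep.update ?_ (by omega)

end LoopLang

namespace LoopLang

open RAM

theorem Sim.congr {E : Env} {s : St} {R R' M : ℕ → ℕ} (h : Sim E s R M)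
    (h5 : ∀ r < 5, R' r = R r) (hv : ∀ x, R' (rV x) = R (rV x)) : Sim E s R' M where
  h0 := (h5 0 (by omega)).trans h.h0
  h1 := (h5 1 (by omega)).trans h.h1
  h2 := (h5 2 (by omega)).trans h.h2
  h3 := (h5 3 (by omega)).trans h.h3
  h4 := (h5 4 (by omega)).trans h.h4
  hv x := (hv x).trans (h.hv x)
  hin := h.hin
  hrow := h.hrow
  ha := h.ha

theorem Sim.update_rC {E : Env} {s : St} {R M : ℕ → ℕ} (h : Sim E s R M) (d m : ℕ) :
    Sim E s (Function.update R (rC d) m) M := by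
  refine h.congr (fun r hr => ?_) fun x => ?_ <;> rw [Function.update_of_ne]
  · simp only [rC]; omega
  · simp only [rC, rV]; omega

theorem Sim.update_rT {E : Env} {s : St} {R M : ℕ → ℕ} (h : Sim E s R M) (d m : ℕ) :
    Sim E s (Function.update R (rT d) m) M := by
  refine h.congr (fun r hr => ?_) fun x => ?_ <;> rw [Function.update_of_ne]
  · simp only [rT]; omega
  · simp only [rT, rV]; omega

theorem Sim.setV {E : Env} {s : St} {R M : ℕ → ℕ} (h : Sim E s R M) (x : Var) (m : ℕ) :
    Sim E (s.setV x m) (Function.update R (rV x) m) M := by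
  have hne : ∀ r < 5, r ≠ rV x := fun r hr => by simp only [rV]; omega
  refine ⟨?_, ?_, ?_, ?_, ?_, fun y => ?_, h.hin, h.hrow, h.ha⟩
  · rw [Function.update_of_ne (hne 0 (by omega))]; exact h.h0
  · rw [Function.update_of_ne (hne 1 (by omega))]; exact h.h1
  · rw [Function.update_of_ne (hne 2 (by omega))]; exact h.h2
  · rw [Function.update_of_ne (hne 3 (by omega))]; exact h.h3
  · rw [Function.update_of_ne (hne 4 (by omega))]; exact h.h4
  · by_cases hy : y = x
    · subst hy; simp
    · rw [Function.update_of_ne]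
      · simp [hy, h.hv]
      · intro he
        exact hy (Var.idx_inj (by simp only [rV] at he; omega))

theorem mul_add_lt {i j n : ℕ} (hi : i < n) (hj : j < n) : i * n + j < n * n := by
  calc i * n + j < i * n + n := by omega
    _ = (i + 1) * n := by ring
    _ ≤ _ := Nat.mul_le_mul_right _ hi

theorem Sim.setA {E : Env} {s : St} {R M : ℕ → ℕ} (h : Sim E s R M) (b : Arr) (i m : ℕ) :
    Sim E (s.setA b i m) R (Function.update M (E.n * E.n + 32 * i + (b.ctorIdx + 1)) m) := by
  have hb := b.idx_lt
  refine ⟨h.h0, h.h1, h.h2, h.h3, h.h4, h.hv, fun i' hi j' hj => ?_, fun i' hi => ?_,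
    fun c j => ?_⟩
  · have := mul_add_lt hi hj
    rw [Function.update_of_ne (by omega)]
    exact h.hin i' hi j' hj
  · rw [Function.update_of_ne (by omega)]
    exact h.hrow i' hi
  · have hc := c.idx_lt
    by_cases hy : c = b ∧ j = i
    · obtain ⟨rfl, rfl⟩ := hy; simp
    · rw [Function.update_of_ne]
      · simp [hy, h.ha]
      · intro he
        exact hy ⟨Arr.idx_inj (by omega), by omega⟩

theorem Bnd.setV {E : Env} {s : St} {B m : ℕ} (h : Bnd E s B) (x : Var) (hm : m ≤ B) :
    Bnd E (s.setV x m) B :=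
  ⟨h.hn, h.hk, h.hnn, h.hcap, h.hP, fun y => by
    simp only [St.setV_v]; split_ifs; exacts [hm, h.hv y], h.ha⟩

theorem Bnd.setA {E : Env} {s : St} {B m : ℕ} (h : Bnd E s B) (b : Arr) (i : ℕ) (hm : m ≤ B) :
    Bnd E (s.setA b i m) B :=
  ⟨h.hn, h.hk, h.hnn, h.hcap, h.hP, h.hv, fun c j => by
    simp only [St.setA_a]; split_ifs; exacts [hm, h.ha c j]⟩

/-- Execution of a counted loop. -/
theorem reach_loop {p : Program} {W o e rI rN n : ℕ} (b : ℕ → ℕ)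
    (I : ℕ → (ℕ → ℕ) → (ℕ → ℕ) → Prop) (hp : p[o]? = some (.jumpLE rN rI e)) (hW : n < 2 ^ W)
    (hI : ∀ j R M, j ≤ n → I j R M → R rI = j ∧ R rN = n)
    (hstep : ∀ j R M, j < n → I j R M → ∃ R' M', Reach p W (b j) ⟨o + 1, R, M⟩ ⟨o, R', M'⟩ ∧
      I (j + 1) R' M') {R M : ℕ → ℕ} (h0 : I 0 R M) :
    ∃ R' M', Reach p W (∑ j ∈ Finset.range n, (b j + 1) + 1) ⟨o, R, M⟩ ⟨e, R', M'⟩ ∧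
      I n R' M' := by
  have key : ∀ j ≤ n, ∃ R' M', Reach p W (∑ j ∈ Finset.range j, (b j + 1)) ⟨o, R, M⟩ ⟨o, R', M'⟩ ∧
      I j R' M' := by
    intro j
    induction j with
    | zero => intro _; exact ⟨R, M, Reach.refl _, h0⟩
    | succ j ih =>
      intro hj
      obtain ⟨R1, M1, hr, hi⟩ := ih (by omega)
      obtain ⟨hi1, hi2⟩ := hI j R1 M1 (by omega) hi
      obtain ⟨R2, M2, hr2, hi'⟩ := hstep j R1 M1 (by omega) hi
      refine ⟨R2, M2, ?_, hi'⟩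
      rw [Finset.sum_range_succ]
      refine hr.trans (reach_jumpLE hp (by omega) (by omega) ?_)
      rw [if_neg (by omega)]
      exact hr2
  obtain ⟨R1, M1, hr, hi⟩ := key n le_rfl
  obtain ⟨hi1, hi2⟩ := hI n R1 M1 le_rfl hi
  refine ⟨R1, M1, hr.trans (reach_jumpLE hp (by omega) (by omega) ?_), hi⟩
  rw [if_pos (by omega)]
  exact Reach.refl _

theorem rQ_val {E : Env} {s : St} {R M : ℕ → ℕ} (h : Sim E s R M) (q : Bool) :
    R (rQ q) = E.bound q := by
  cases q
  · exact h.h0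
  · exact h.h4

theorem Bnd.bound {E : Env} {s : St} {B : ℕ} (h : Bnd E s B) (q : Bool) : E.bound q ≤ B := by
  cases q
  · exact h.hn
  · exact h.hP

theorem cc_spec {E : Env} {p : Program} {W : ℕ} (hn : 0 < E.n) (c : Cmd) :
    ∀ (d o : ℕ) (s : St) (R M : ℕ → ℕ) (B : ℕ), CodeAt p o (cc c d o) → Sim E s R M → Bnd E s B →
      64 * (B + cost E c s + 1) ≤ 2 ^ W →
      ∃ R' M', Reach p W (cost E c s) ⟨o, R, M⟩ ⟨o + (cc c d o).length, R', M'⟩ ∧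
        Sim E (run E c s) R' M' ∧ Bnd E (run E c s) (B + cost E c s) ∧
        ∀ d' < d, R' (rC d') = R (rC d') := by
  have hTC : ∀ d d', rC d ≠ rT d' := fun d d' => by simp only [rC, rT]; omega
  have hTV : ∀ x d', rV x ≠ rT d' := fun d d' => by simp only [rV, rT]; omega
  have hVC : ∀ x d', rV x ≠ rC d' := fun d d' => by simp only [rV, rC]; omega
  induction c with
  | skip =>
    intro d o s R M B hp hs hB hW
    exact ⟨R, M, Reach.refl _, hs, hB, fun _ _ => rfl⟩
  | set x e =>
    intro d o s R M B hp hs hB hW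
    simp only [cost] at hW
    simp only [cc, codeAt_append] at hp
    obtain ⟨hp1, g1, -⟩ := hp
    obtain ⟨R1, hr, hval, hk⟩ := ce_spec (W := W) hB e 0 o R hp1 hs (by omega)
    have hev := eval_le hB e
    have hlen := ce_length e 0
    refine ⟨Function.update R1 (rV x) (eval E e s), M, ?_, (hk.sim hs).setV x _,
      (hB.mono (by omega)).setV x (by simp only [cost]; omega), fun d' _ => ?_⟩
    · refine Reach.mono (hr.trans (m' := 1) (reach_move g1 (by rw [hval]; omega) ?_)) ?_
      · rw [hval]; exact reach_done (by simp [cc]; try omega)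
      · simp only [cost]; omega
    · rw [Function.update_of_ne (hVC _ _).symm]
      exact hk _ fun e _ => hTC _ _
  | put a e f =>
    intro d o s R M B hp hs hB hW
    have hW0 : W ≠ 0 := by rintro rfl; omega
    simp only [cost] at hW
    simp only [cc, codeAt_append, times32_length] at hp
    obtain ⟨hp1, hp2, hp3, g1, g2, g3, g4, -⟩ := hp
    obtain ⟨R1, hr, hval, hk⟩ := ce_spec (W := W) hB e 0 o R hp1 hs (by omega)
    obtain ⟨R2, hr2, hval2, hk2⟩ := ce_spec (W := W) hB f 1 _ R1 hp2 (hk.sim hs) (by omega)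
    have hs2 := hk2.sim (hk.sim hs)
    have hev := eval_le hB e
    have hev2 := eval_le hB f
    have hlen := ce_length e 0
    have hlen2 := ce_length f 1
    have hnn := hB.hnn
    have ha := a.idx_lt
    have hd := (hk2.low (Nat.lt_succ_self 0)).trans hval
    have n1 : rT 0 ≠ rT 1 := rT_ne (by omega)
    have n2 : rT 0 ≠ rT 2 := rT_ne (by omega)
    have n3 : rT 1 ≠ rT 2 := rT_ne (by omega)
    have m2 : ∀ d, (2 : ℕ) ≠ rT d := fun d => by simp only [rT]; omega
    have hb : Bnd E (s.setA a (eval E e s) (eval E f s)) (B + (ew e + ew f + 10)) :=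
      (hB.mono (by omega)).setA _ _ (by omega)
    refine ⟨Function.update (Function.update (Function.update (Function.update R2 (rT 0)
        (32 * R2 (rT 0))) (rT 2) (a.ctorIdx + 1)) (rT 0) (32 * eval E e s + (a.ctorIdx + 1)))
        (rT 0) (E.n * E.n + 32 * eval E e s + (a.ctorIdx + 1)),
      _, ?_, ((((hs2.update_rT 0 _).update_rT 2 _).update_rT 0 _).update_rT 0 _).setA a
        (eval E e s) (eval E f s), hb, fun d' _ => ?_⟩
    · refine Reach.mono ((hr.trans hr2).trans (m' := 9)
        (reach_times32 hp3 (by rw [hd]; omega) ?_)) ?_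
      · refine reach_const g1 (by omega) ?_
        refine reach_add g2 (by simp [n2, hd]; omega) (by simp; omega) ?_
        refine reach_add g3 (by simp [n2, hd]; omega) (by simp [m2, hs2.h2]; omega) ?_
        simp only [Function.update_self, Function.update_of_ne n2, Function.update_of_ne (m2 _), hd,
          hs2.h2]
        rw [show 32 * eval E e s + (a.ctorIdx + 1) + E.n * E.n
          = E.n * E.n + 32 * eval E e s + (a.ctorIdx + 1) by ring]
        refine reach_store g4 (by simp; omega)
          (by simp only [Function.update_of_ne n1.symm, Function.update_of_ne n3, hval2]; omega) ?_
        simp only [Function.update_self, Function.update_of_ne n1.symm, Function.update_of_ne n3,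
          hval2]
        exact reach_done (by simp [cc, times32_length]; omega)
      · simp only [cost]; omega
    · simp only [Function.update_of_ne (hTC _ _)]
      rw [hk2 _ fun e _ => hTC _ _, hk _ fun e _ => hTC _ _]
  | seq c c' ih ih' =>
    intro d o s R M B hp hs hB hW
    simp only [cost] at hW
    simp only [cc, codeAt_append] at hp
    obtain ⟨R1, M1, hr1, hs1, hB1, hk1⟩ := ih d o s R M B hp.1 hs hB (by omega)
    obtain ⟨R2, M2, hr2, hs2, hB2, hk2⟩ := ih' d _ _ R1 M1 _ hp.2 hs1 hB1 (by omega)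
    refine ⟨R2, M2, ?_, hs2, hB2.mono (by simp only [cost]; omega),
      fun d' hd => (hk2 d' hd).trans (hk1 d' hd)⟩
    simp only [cc, List.length_append, cost]
    rw [← add_assoc]
    exact hr1.trans hr2
  | ite b c c' ih ih' =>
    intro d o s R M B hp hs hB hW
    have hW0 : W ≠ 0 := by rintro rfl; omega
    simp only [cost] at hW
    simp only [cc, codeAt_append, List.length_cons, List.length_nil, zero_add,
      Nat.reduceAdd] at hp
    obtain ⟨hp1, ⟨g1, g2, -⟩, hp2, ⟨g3, -⟩, hp3⟩ := hp
    rw [show o + (cb b 0).length + 2 + (cc c' d (o + (cb b 0).length + 2)).length + 1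
      = o + (cb b 0).length + 3 + (cc c' d (o + (cb b 0).length + 2)).length by omega] at hp3
    obtain ⟨R1, hr, hval, hk⟩ := cb_spec (W := W) hB hn b 0 o R hp1 hs (by omega)
    have hlen := cb_length b 0
    have hs1 := (hk.sim hs).update_rT 1 1
    have n1 : rT 0 ≠ rT 1 := rT_ne (by omega)
    have hle : R1 (rT 0) ≤ 1 := by rw [hval]; split_ifs <;> omega
    have hC : ∀ d', Function.update R1 (rT 1) 1 (rC d') = R (rC d') := fun d' => by
      rw [Function.update_of_ne (hTC _ _), hk _ fun e _ => hTC _ _]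
    simp only [cc, List.length_append, List.length_cons, List.length_nil]
    rw [cost, run]
    by_cases hb : evalB E b s
    · simp only [hb, if_true] at hval hW ⊢
      obtain ⟨R2, M2, hr2, hs2, hB2, hk2⟩ := ih d _ s _ M B
        hp3 hs1 hB (by omega)
      refine ⟨R2, M2, Reach.mono (hr.trans (m' := cost E c s + 2) (reach_const g1 (by omega)
        (reach_jumpLE g2 (by simp; omega) (by simp [n1]; omega) ?_))) (by omega), hs2,
        hB2.mono (by omega), fun d' hd => (hk2 d' hd).trans (hC d')⟩
      rw [if_pos (by simp [n1, hval])]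
      exact hr2.trans (reach_done (by omega))
    · simp only [hb] at hval hW ⊢
      simp only [Bool.false_eq_true, if_false] at hval hW ⊢
      obtain ⟨R2, M2, hr2, hs2, hB2, hk2⟩ := ih' d _ s _ M B
        hp2 hs1 hB (by omega)
      refine ⟨R2, M2, Reach.mono (hr.trans (m' := cost E c' s + 1 + 2) (reach_const g1 (by omega)
        (reach_jumpLE g2 (by simp; omega) (by simp [n1]; omega) ?_))) (by omega), hs2,
        hB2.mono (by omega), fun d' hd => (hk2 d' hd).trans (hC d')⟩
      rw [if_neg (by simp [n1, hval])]
      refine Reach.trans (m' := 1) hr2 (reach_jump g3 ?_)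
      exact reach_done (by omega)
  | rep q x c ih =>
    intro d o s R M B hp hs hB hW
    have hW0 : W ≠ 0 := by rintro rfl; omega
    simp only [cost] at hW
    simp only [cc, codeAt_append, List.length_cons, List.length_nil] at hp
    obtain ⟨⟨g1, g2, g3, -⟩, hp1, g4, g5, g6, -⟩ := hp
    set f : ℕ → St → St := fun j s => run E c (s.setV x j) with hf
    set b : ℕ → ℕ := fun j => cost E c ((iter f j s).setV x j) with hb
    have hbd := hB.bound q
    have hmono : ∀ j ≤ E.bound q, ∑ j ∈ Finset.range j, (b j + 5)
        ≤ ∑ j ∈ Finset.range (E.bound q), (b j + 5) := fun j hj =>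
      Finset.sum_le_sum_of_subset (Finset.range_subset_range.2 hj)
    obtain ⟨R2, M2, hr2, hs2, hB2, hc2, hk2⟩ := reach_loop (p := p) (W := W) (o := o + 1)
      (e := o + 6 + (cc c (d + 1) (o + 3)).length) (rI := rC d) (rN := rQ q) (n := E.bound q)
      (fun j => b j + 4) (fun j R' M' => Sim E (iter f j s) R' M' ∧
        Bnd E (iter f j s) (B + ∑ j ∈ Finset.range j, (b j + 5)) ∧ R' (rC d) = j ∧
        ∀ d' < d, R' (rC d') = R (rC d')) g2 (by omega)
      (fun j R' M' hj h => ⟨h.2.2.1, rQ_val h.1 q⟩)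
      (by
        rintro j R1 M1 hj ⟨hs1, hB1, hc1, hk1⟩
        have hm := hmono (j + 1) hj
        rw [Finset.sum_range_succ] at hm
        have hs1' := hs1.setV x j
        have hB1' : Bnd E ((iter f j s).setV x j) (B + ∑ j ∈ Finset.range j, (b j + 5) + 0) :=
          hB1.setV x (by omega)
        obtain ⟨R3, M3, hr3, hs3, hB3, hk3⟩ := ih (d + 1) (o + 3) _ _ M1 _
          (by convert hp1 using 1) hs1' hB1' (by simp only [hb] at hm ⊢; omega)
        have hc3 : R3 (rC d) = j := by
          rw [hk3 d (by omega), Function.update_of_ne (hVC _ _).symm, hc1]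
        refine ⟨Function.update (Function.update R3 (rT 0) 1) (rC d) (j + 1), M3, ?_,
          (hs3.update_rT 0 1).update_rC d _, hB3.mono ?_, by simp, fun d' hd => ?_⟩
        · rw [show b j + 4 = (b j + 3) + 1 by omega]
          refine reach_move g3 (by omega) ?_
          rw [hc1]
          refine Reach.trans hr3 ?_
          refine reach_const g4 (by omega) ?_
          refine reach_add g5
            (by rw [Function.update_of_ne (hTC _ _), hc3]; omega) (by simp; omega) ?_
          refine reach_jump g6 ?_
          rw [Function.update_of_ne (hTC _ _), hc3, Function.update_self]
          exact Reach.refl _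
        · rw [Finset.sum_range_succ]
          simp only [hb]; omega
        · rw [Function.update_of_ne (by simp only [rC]; omega), Function.update_of_ne (hTC _ _),
            hk3 d' (by omega), Function.update_of_ne (hVC _ _).symm, hk1 d' hd])
      (R := Function.update R (rC d) 0) (M := M)
      ⟨hs.update_rC d 0, hB.mono (by simp), by simp, fun d' hd => by
        rw [Function.update_of_ne (by simp only [rC]; omega)]⟩
    have hcost : cost E (.rep q x c) s = 2 + ∑ j ∈ Finset.range (E.bound q), (b j + 5) := rfl
    refine ⟨R2, M2, ?_, hs2, hB2.mono (by rw [hcost]; omega), hk2⟩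
    refine Reach.mono (reach_const g1 (by omega) (hr2.trans (reach_done ?_))) ?_
    · simp only [cc, List.length_append, List.length_cons, List.length_nil]; omega
    · rw [hcost]
      have : ∑ j ∈ Finset.range (E.bound q), (b j + 4 + 1)
        = ∑ j ∈ Finset.range (E.bound q), (b j + 5) := rfl
      omega

end LoopLang

namespace LoopLang

open RAM

/-- `reg 2 := n * n`. -/
def squareCode : List Instr :=
  [.const (rT 1) 1, .jumpLE 0 (rT 0) 5, .add 2 2 0, .add (rT 0) (rT 0) (rT 1), .jump 1]

/-- The table of the first addresses of the rows of the input matrix. -/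
def rowCode : List Instr :=
  [.const (rT 0) 0, .jumpLE 0 (rT 0) 18, .move (rT 3) (rT 0)] ++ (times32 (rT 3) ++
    [.add (rT 3) (rT 3) 2, .store (rT 2) (rT 3), .add (rT 2) (rT 2) 0,
     .add (rT 0) (rT 0) (rT 1), .jump 6])

/-- The bound for saturating additions. -/
def capCode : List Instr :=
  [.add 3 2 0, .add 3 3 1, .add 3 3 (rT 1), .add 3 3 3, .add 3 3 3]

/-- `reg 4 := 4096 ^ k`. -/
def powCode : List Instr :=
  [.const 4 1, .const (rT 0) 0, .jumpLE 1 (rT 0) 40] ++ (List.replicate 12 (.add 4 4 4) ++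
    [.add (rT 0) (rT 0) (rT 1), .jump 25])

def prologue : List Instr := squareCode ++ (rowCode ++ (capCode ++ powCode))

/-- Copies the array `out` to the first cells of the memory. -/
def epilogue (o : ℕ) : List Instr :=
  [.const (rT 0) 0, .jumpLE 0 (rT 0) (o + 16), .move (rT 1) (rT 0)] ++ (times32 (rT 1) ++
    [.const (rT 2) (Arr.out.ctorIdx + 1), .add (rT 1) (rT 1) (rT 2), .add (rT 1) (rT 1) 2,
     .load (rT 1) (rT 1), .store (rT 1) (rT 0), .const (rT 2) 1, .add (rT 0) (rT 0) (rT 2),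
     .jump (o + 1)] ++ [.move 0 (rV .fl)])

def compile (c : Cmd) : Program :=
  prologue ++ (cc c 0 prologue.length ++ epilogue (prologue.length + (cc c 0 prologue.length).length))

/-- The state in which all numbers are zero. -/
def St.zero : St := ⟨fun _ => 0, fun _ _ => 0⟩

/-- Repeated doubling of a register. -/
theorem reach_doubles {p : Program} {W n r : ℕ} {τ : Config} {M : ℕ → ℕ} (m : ℕ) :
    ∀ {o : ℕ} {R : ℕ → ℕ}, CodeAt p o (List.replicate m (.add r r r)) → 2 ^ m * R r < 2 ^ W →
      Reach p W n ⟨o + m, Function.update R r (2 ^ m * R r), M⟩ τ →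
      Reach p W (n + m) ⟨o, R, M⟩ τ := by
  induction m with
  | zero => intro o R _ _ h; simpa using h
  | succ m ih =>
    intro o R hp hW h
    rw [List.replicate_succ] at hp
    have h1 : R r ≤ 2 ^ (m + 1) * R r := Nat.le_mul_of_pos_left _ (by positivity)
    have he : 2 ^ m * (R r + R r) = 2 ^ (m + 1) * R r := by ring
    refine reach_add hp.1 (by omega) (by omega) (ih hp.2 (by simpa [he] using hW) ?_)
    simp only [Function.update_self, Function.update_idem, he]
    rwa [show o + 1 + m = o + (m + 1) by omega]

theorem prologue_spec {E : Env} {p : Program} {W : ℕ} (hp : CodeAt p 0 prologue)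
    (hW : 64 * (E.cap + E.P + 1) ≤ 2 ^ W) {R M : ℕ → ℕ} (hR0 : R 0 = E.n) (hR1 : R 1 = E.k)
    (hR : ∀ r, 2 ≤ r → R r = 0)
    (hM : ∀ i < E.n, ∀ j < E.n, M (i * E.n + j) = if E.A i j then 1 else 0)
    (hM0 : ∀ i, E.n * E.n ≤ i → M i = 0) :
    ∃ R' M', Reach p W (20 * (E.n + E.k + 1)) ⟨0, R, M⟩ ⟨prologue.length, R', M'⟩ ∧
      Sim E St.zero R' M' := by
  have hW0 : W ≠ 0 := by rintro rfl; omega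
  have hcap : E.cap = 4 * (E.n * E.n + E.n + E.k + 1) := rfl
  have hP1 : 1 ≤ E.P := Nat.one_le_pow _ _ (by norm_num)
  simp only [prologue, squareCode, rowCode, capCode, powCode, codeAt_append, List.length_cons,
    List.length_nil, zero_add, Nat.reduceAdd, times32_length, List.length_append,
    List.length_replicate,
    show rT 0 = 6 from rfl, show rT 1 = 9 from rfl, show rT 2 = 12 from rfl,
    show rT 3 = 15 from rfl] at hp
  obtain ⟨⟨g0, g1, g2, g3, g4, -⟩, ⟨⟨a0, a1, a2, -⟩, a3, a4, a5, a6, a7, a8, -⟩,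
    ⟨b0, b1, b2, b3, b4, -⟩, ⟨d0, d1, d2, -⟩, e1, d3, d4, -⟩ := hp
  have hVr : ∀ x r, (r < 5 ∨ r = 6 ∨ r = 9 ∨ r = 12 ∨ r = 15) → rV x ≠ r := by
    intro x r; simp only [rV]; omega
  have hV5 : ∀ x, 2 ≤ rV x := fun x => by simp only [rV]; omega
  -- the square of `n`
  obtain ⟨R1, M1, hr1, hM1, q0, q1, q2, q6, q9, q12, qV⟩ := reach_loop (p := p) (W := W)
    (fun _ => 3) (fun j R' M' => M' = M ∧ R' 0 = E.n ∧ R' 1 = E.k ∧ R' 2 = j * E.n ∧ R' 6 = j ∧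
      R' 9 = 1 ∧ R' 12 = 0 ∧ ∀ x, R' (rV x) = 0) g1 (n := E.n) (by omega)
    (fun j R' M' _ h => ⟨h.2.2.2.2.1, h.2.1⟩)
    (by
      rintro j R' M' hj ⟨rfl, q0, q1, q2, q6, q9, q12, qV⟩
      have hle : j * E.n ≤ E.n * E.n := Nat.mul_le_mul_right _ hj.le
      refine ⟨_, _, reach_add g2 (by omega) (by omega) (reach_add g3 (by simp; omega)
        (by simp; omega) (reach_jump g4 (reach_done rfl))), rfl, by simp [q0], by simp [q1],
        by simp [q0, q2]; ring, by simp [q6, q9], by simp [q9], by simp [q12], fun x => ?_⟩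
      rw [Function.update_of_ne (hVr _ _ (by omega)), Function.update_of_ne (hVr _ _ (by omega)),
        qV])
    (R := Function.update R 9 1) (M := M)
    ⟨rfl, by simp [hR0], by simp [hR1], by simp [hR], by simp [hR], by simp, by simp [hR],
      fun x => by rw [Function.update_of_ne (hVr _ _ (by omega)), hR _ (hV5 x)]⟩
  subst hM1
  -- the rows
  obtain ⟨R2, M2, hr2, hin, hrow, hz, q0, q1, q2, q6, q9, q12, qV⟩ := reach_loop (p := p) (W := W)
    (fun _ => 11) (fun j R' M' =>
      (∀ i < E.n, ∀ j < E.n, M' (i * E.n + j) = if E.A i j then 1 else 0) ∧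
      (∀ i < j, M' (E.n * E.n + 32 * i) = i * E.n) ∧
      (∀ (b : Arr) i, M' (E.n * E.n + 32 * i + (b.ctorIdx + 1)) = 0) ∧
      R' 0 = E.n ∧ R' 1 = E.k ∧ R' 2 = E.n * E.n ∧ R' 6 = j ∧
      R' 9 = 1 ∧ R' 12 = j * E.n ∧ ∀ x, R' (rV x) = 0) a1 (n := E.n) (by omega)
    (fun j R' M' _ h => ⟨h.2.2.2.2.2.2.1, h.2.2.2.1⟩)
    (by
      rintro j R' M' hj ⟨hin, hrow, hz, q0, q1, q2, q6, q9, q12, qV⟩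
      have hle : j * E.n ≤ E.n * E.n := Nat.mul_le_mul_right _ hj.le
      have hadr : 32 * j + E.n * E.n = E.n * E.n + 32 * j := add_comm _ _
      refine ⟨_, _, reach_move a2 (by omega) (reach_times32 a3 (by simp; omega)
        (reach_add a4 (by simp; omega) (by simp; omega) (reach_store a5 (by simp; omega)
        (by simp; omega) (reach_add a6 (by simp; omega) (by simp; omega)
        (reach_add a7 (by simp; omega) (by simp; omega) (reach_jump a8 (reach_done rfl))))))),
        ?_, ?_, ?_, by simp [q0], by simp [q1], by simp [q2], by simp [q6, q9], by simp [q9],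
        by simp [q0, q12]; ring, fun x => ?_⟩
      · intro i hi i' hi'
        have := mul_add_lt hi hi'
        rw [Function.update_of_ne (by simp [q2]; omega)]
        exact hin i hi i' hi'
      · intro i hi
        simp only [Function.update_self, Function.update_idem, ne_eq, OfNat.ofNat_eq_ofNat, Nat.reduceEqDiff,
          not_false_eq_true, Function.update_of_ne, Nat.reduceEqDiff, q2, q6, q12, hadr]
        by_cases h : i = j
        · subst h; simp
        · rw [Function.update_of_ne (by omega)]
          exact hrow i (by omega)
      · intro b i
        have hb := b.idx_lt
        rw [Function.update_of_ne (by simp [q2, q6]; omega)]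
        exact hz b i
      · repeat rw [Function.update_of_ne (hVr _ _ (by omega))]
        rw [qV])
    (R := Function.update R1 6 0) (M := M1)
    ⟨hM, by simp, fun b i => hM0 _ (by omega), by simp [q0], by simp [q1], by simp [q2], by simp,
      by simp [q9], by simp [q12],
      fun x => by rw [Function.update_of_ne (hVr _ _ (by omega)), qV x]⟩
  -- the power
  have hpow : ∀ j ≤ E.k, 4096 ^ j ≤ E.P := fun j hj => Nat.pow_le_pow_right (by norm_num) hj
  obtain ⟨R3, M3, hr3, hM3, u0, u1, u2, u3, u4, u6, u9, uV⟩ := reach_loop (p := p) (W := W)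
    (fun _ => 14) (fun j R' M' => M' = M2 ∧ R' 0 = E.n ∧ R' 1 = E.k ∧ R' 2 = E.n * E.n ∧
      R' 3 = E.cap ∧ R' 4 = 4096 ^ j ∧ R' 6 = j ∧ R' 9 = 1 ∧ ∀ x, R' (rV x) = 0) d2
    (n := E.k) (by omega) (fun j R' M' _ h => ⟨h.2.2.2.2.2.2.1, h.2.2.1⟩)
    (by
      rintro j R' M' hj ⟨rfl, u0, u1, u2, u3, u4, u6, u9, uV⟩
      have hle := hpow (j + 1) hj
      rw [pow_succ] at hle
      constructor
      refine ⟨M', ?_, rfl, ?_⟩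
      · refine reach_doubles 12 e1 (by rw [u4]; omega) ?_
        exact reach_add d3 (by simp; omega) (by simp; omega) (reach_jump d4 (reach_done rfl))
      · refine ⟨by simp [u0], by simp [u1], by simp [u2], by simp [u3],
          by simp [u4, pow_succ]; ring, by simp [u6, u9], by simp [u9], fun x => ?_⟩
        repeat rw [Function.update_of_ne (hVr _ _ (by omega))]
        rw [uV])
    (R := Function.update (Function.update (Function.update R2 3 E.cap) 4 1) 6 0) (M := M2)
    ⟨rfl, by simp [q0], by simp [q1], by simp [q2], by simp, by simp, by simp, by simp [q9],
      fun x => by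
        repeat rw [Function.update_of_ne (hVr _ _ (by omega))]
        rw [qV x]⟩
  subst hM3
  refine ⟨R3, M3, ?_, u0, u1, u2, u3, u4, uV, hin, hrow, fun b i => hz b i⟩
  refine Reach.mono (m := (∑ j ∈ Finset.range E.n, (3 + 1) + 1) + 1 +
    (((∑ j ∈ Finset.range E.n, (11 + 1) + 1) + 1) +
    ((∑ j ∈ Finset.range E.k, (14 + 1) + 1) + 2 + 5))) ?_ (by simp; omega)
  refine Reach.trans (reach_const g0 (by omega) hr1) ?_
  refine Reach.trans (reach_const a0 (by omega) hr2) ?_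
  refine reach_add b0 (by omega) (by omega) ?_
  refine reach_add b1 (by simp; omega) (by simp; omega) ?_
  refine reach_add b2 (by simp; omega) (by simp; omega) ?_
  refine reach_add b3 (by simp; omega) (by simp; omega) ?_
  refine reach_add b4 (by simp; omega) (by simp; omega) ?_
  refine reach_const d0 (by omega) ?_
  refine reach_const d1 (by omega) ?_
  convert hr3 using 3
  · simp only [Function.update_self, Function.update_idem, ne_eq, OfNat.ofNat_eq_ofNat,
      Nat.reduceEqDiff, not_false_eq_true, Function.update_of_ne, q0, q1, q2, q9]
    congr 2
    omega
  · rfl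

theorem epilogue_spec {E : Env} {p : Program} {W B o : ℕ} {s : St} (hp : CodeAt p o (epilogue o))
    (hs1 : s.v .fl ≤ B) (hB : Bnd E s B) (hW : 64 * (B + 1) ≤ 2 ^ W) {R M : ℕ → ℕ}
    (hs : Sim E s R M) :
    ∃ R' M', Reach p W (20 * (E.n + 1)) ⟨o, R, M⟩ ⟨o + 17, R', M'⟩ ∧ R' 0 = s.v .fl ∧
      ∀ i < E.n, M' i = s.a .out i := by
  have hW0 : W ≠ 0 := by rintro rfl; omega
  simp only [epilogue, codeAt_append, List.length_cons,
    List.length_nil, zero_add, Nat.reduceAdd, times32_length, List.length_append,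
    List.length_replicate,
    show rT 0 = 6 from rfl, show rT 1 = 9 from rfl, show rT 2 = 12 from rfl,
    show rT 3 = 15 from rfl] at hp
  obtain ⟨⟨a0, a1, a2, -⟩, ⟨a3, a4, a5, a6, a7, a8, a9, a10, a11, -⟩, a12, -⟩ := hp
  rw [show o + 3 + 5 = o + 8 by omega] at a4 a5 a6 a7 a8 a9 a10 a11
  have hnn := hB.hnn
  have hn := hB.hn
  have hVr : ∀ x r, (r < 5 ∨ r = 6 ∨ r = 9 ∨ r = 12) → rV x ≠ r := by
    intro x r; simp only [rV]; omega
  obtain ⟨R1, M1, hr1, hin, hout, q0, q2, q6, qV⟩ := reach_loop (p := p) (W := W)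
    (fun _ => 14) (fun j R' M' => (∀ i < j, M' i = s.a .out i) ∧
      (∀ i, M' (E.n * E.n + 32 * i + (Arr.out.ctorIdx + 1)) = s.a .out i) ∧
      R' 0 = E.n ∧ R' 2 = E.n * E.n ∧ R' 6 = j ∧ R' (rV .fl) = s.v .fl) a1 (n := E.n) (by omega)
    (fun j R' M' _ h => ⟨h.2.2.2.2.1, h.2.2.1⟩)
    (by
      rintro j R' M' hj ⟨hin, hout, q0, q2, q6, qV⟩
      have hsq : E.n ≤ E.n * E.n := Nat.le_mul_self _
      have hadr : 32 * j + (Arr.out.ctorIdx + 1) + E.n * E.n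
        = E.n * E.n + 32 * j + (Arr.out.ctorIdx + 1) := by omega
      have hi := Arr.idx_lt .out
      have hj' := hB.ha .out j
      have hoj := hout j
      refine ⟨_, _, reach_move a2 (by omega) (reach_times32 a3 (by simp; omega)
        (reach_const a4 (by omega) (reach_add a5 (by simp; omega) (by simp; omega)
        (reach_add a6 (by simp; omega) (by simp; omega) (reach_load a7 (by simp; omega)
        (by simp only [Function.update_self, Function.update_idem, ne_eq, OfNat.ofNat_eq_ofNat, Nat.reduceEqDiff,
              not_false_eq_true, Function.update_of_ne, Nat.reduceEqDiff, q2, q6, hadr, hoj]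
            omega) (reach_store a8 (by simp; omega)
        (by simp only [Function.update_self, Function.update_idem, ne_eq, OfNat.ofNat_eq_ofNat, Nat.reduceEqDiff,
              not_false_eq_true, Function.update_of_ne, Nat.reduceEqDiff, q2, q6, hadr, hoj]
            omega) (reach_const a9 (by omega)
        (reach_add a10 (by simp; omega) (by simp; omega) (reach_jump a11 (reach_done rfl)))))))))),
        ?_, ?_, by simp [q0], by simp [q2], by simp [q6], ?_⟩
      · intro i hi'
        simp only [Function.update_self, Function.update_idem, ne_eq, OfNat.ofNat_eq_ofNat, Nat.reduceEqDiff,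
              not_false_eq_true, Function.update_of_ne, Nat.reduceEqDiff, q2, q6, hadr, hoj]
        by_cases h : i = j
        · subst h; simp
        · rw [Function.update_of_ne h]
          exact hin i (by omega)
      · intro i
        rw [Function.update_of_ne (by simp [q6]; omega)]
        exact hout i
      · repeat rw [Function.update_of_ne (hVr _ _ (by omega))]
        rw [qV])
    (R := Function.update R 6 0) (M := M)
    ⟨by simp, hs.ha .out, by simp [hs.h0], by simp [hs.h2], by simp,
      by rw [Function.update_of_ne (hVr _ _ (by omega)), hs.hv]⟩
  refine ⟨Function.update R1 0 (s.v .fl), M1, ?_, by simp, hin⟩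
  refine Reach.mono (m := (∑ j ∈ Finset.range E.n, (14 + 1) + 1) + 1 + 1) ?_ (by simp; omega)
  refine Reach.trans (reach_const a0 (by omega) hr1) ?_
  refine reach_move (by convert a12 using 2) (by rw [qV]; omega) ?_
  rw [qV]
  exact reach_done (by omega)

/-- The compiled program computes what the command does. -/
theorem compile_spec (c : Cmd) {E : Env} (hn : 0 < E.n) {W : ℕ} {σ : Config} (h0 : σ.pc = 0)
    (hR0 : σ.reg 0 = E.n) (hR1 : σ.reg 1 = E.k) (hR : ∀ r, 2 ≤ r → σ.reg r = 0)
    (hM : ∀ i < E.n, ∀ j < E.n, σ.mem (i * E.n + j) = if E.A i j then 1 else 0)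
    (hM0 : ∀ i, E.n * E.n ≤ i → σ.mem i = 0)
    (hW : 64 * (E.cap + E.P + cost E c St.zero + 1) ≤ 2 ^ W) :
    ∃ t τ, HaltsIn (compile c) σ t τ ∧
      t ≤ (cost E c St.zero + 40 * (E.n + E.k + 1)) * (2 * W + 1) ∧
      τ.reg 0 = (run E c St.zero).v .fl ∧ ∀ i < E.n, τ.mem i = (run E c St.zero).a .out i := by
  obtain ⟨pc, R, M⟩ := σ
  subst h0
  have hp1 : CodeAt (compile c) 0 prologue := codeAt_self [] prologue _
  have hp2 : CodeAt (compile c) prologue.length (cc c 0 prologue.length) := codeAt_self _ _ _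
  have hp3 : CodeAt (compile c) (prologue.length + (cc c 0 prologue.length).length)
      (epilogue (prologue.length + (cc c 0 prologue.length).length)) := by
    have := codeAt_self (prologue ++ cc c 0 prologue.length)
      (epilogue (prologue.length + (cc c 0 prologue.length).length)) []
    simpa only [compile, List.append_assoc, List.append_nil, List.length_append] using this
  obtain ⟨R1, M1, hr1, hs1⟩ := prologue_spec hp1 (W := W) (by omega) hR0 hR1 hR hM hM0
  have hB : Bnd E St.zero (E.cap + E.P) := by
    have : E.cap = 4 * (E.n * E.n + E.n + E.k + 1) := rfl
    refine ⟨?_, ?_, ?_, ?_, ?_, fun _ => Nat.zero_le _, fun _ _ => Nat.zero_le _⟩ <;> omega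
  obtain ⟨R2, M2, hr2, hs2, hB2, -⟩ := cc_spec (W := W) hn c 0 _ _ R1 M1 _ hp2 hs1 hB (by omega)
  obtain ⟨R3, M3, ⟨t, hr, ht⟩, h3, h3'⟩ :=
    epilogue_spec hp3 (hB2.hv _) hB2 (W := W) (by omega) hs2
  obtain ⟨t', hr', ht'⟩ := hr1.trans hr2
  refine ⟨_, _, ⟨runs_trans hr' hr, ?_⟩, ?_, h3, h3'⟩
  · simp only [Halted, compile, List.length_append]
    simp [epilogue, times32]
    omega
  · refine (Nat.add_le_add ht' ht).trans ?_
    rw [← add_mul]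
    exact Nat.mul_le_mul_right _ (by omega)

end LoopLang

/-! ## Decomposition of a graph into pieces -/

namespace Pieces

open Finset

/-- A sequence of pieces: vertex `x` is in the piece `pc x`, if this is not `0`. -/
structure Data where
  pc : ℕ → ℕ
  mark : ℕ → ℕ
  side : ℕ → ℕ
  att : ℕ → ℕ
  top : ℕ

/-- The sum of the products of spins along ordered edges between two sets. -/
def corr (e : ℕ → ℕ → Bool) (σ : ℕ → ℤ) (A B : Finset ℕ) : ℤ :=
  ∑ x ∈ A, ∑ y ∈ B, if e x y then σ x * σ y else 0

/-- The sum of the spins of the neighbours of a vertex. -/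
def field (e : ℕ → ℕ → Bool) (σ : ℕ → ℤ) (v : ℕ) (A : Finset ℕ) : ℤ :=
  ∑ x ∈ A, if e v x then σ x else 0

def spin (f : ℕ → ℕ) (x : ℕ) : ℤ := 2 * (f x : ℤ) - 1

variable {n : ℕ} {e : ℕ → ℕ → Bool} {D D' : Data}

def Data.piece (D : Data) (n t : ℕ) : Finset ℕ := {x ∈ range n | D.pc x = t}

def Data.later (D : Data) (n t : ℕ) : Finset ℕ := {x ∈ range n | D.pc x = 0 ∨ t < D.pc x}

def Data.marked (D : Data) (n : ℕ) : Finset ℕ := {x ∈ range n | D.mark x ≠ 0}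

/-- Whatever the spins of the later vertices are, piece `t` can be oriented such that it
contributes `g` more than its number of vertices. -/
def Gain (n : ℕ) (e : ℕ → ℕ → Bool) (D : Data) (t : ℕ) (g : ℤ) : Prop :=
  corr e (spin D.side) (D.piece n t) (D.piece n t) + #(D.piece n t) + g ≤ 0 ∨
  ∃ v ∈ D.later n t, (∀ x ∈ D.piece n t, ∀ y ∈ D.later n t, e x y → y = v) ∧
    corr e (spin D.side) (D.piece n t) (D.piece n t) + #(D.piece n t) + g ≤
      2 * |field e (spin D.side) v (D.piece n t)|

structure Removed (n : ℕ) (e : ℕ → ℕ → Bool) (D : Data) (c : ℤ) : Prop where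
  pc_le : ∀ x < n, D.pc x ≤ D.top
  top_le : D.top ≤ #{x ∈ range n | D.pc x ≠ 0}
  side_le : ∀ x, D.side x ≤ 1
  same : ∀ x < n, ∀ y < n, D.pc x ≠ 0 → D.pc y = D.pc x → x ≠ y → D.mark x = 0 → D.mark y = 0 →
    e x y ∧ D.att x = D.att y
  att : ∀ x < n, ∀ y < n, D.pc x ≠ 0 → D.mark x = 0 → D.mark y = 0 →
    (D.att x = y + 1 ↔ e x y ∧ (D.pc y = 0 ∨ D.pc x < D.pc y))
  gain : ∃ g : ℕ → ℤ, (∀ t, 1 ≤ t → t ≤ D.top → Gain n e D t (g t)) ∧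
    (#(D.marked n) : ℤ) ≤ 3 * ∑ t ∈ Icc 1 D.top, g t + c

theorem corr_congr {σ σ' : ℕ → ℤ} {A B : Finset ℕ} (hA : ∀ x ∈ A, σ x = σ' x)
    (hB : ∀ x ∈ B, σ x = σ' x) : corr e σ A B = corr e σ' A B :=
  sum_congr rfl fun x hx => sum_congr rfl fun y hy => by rw [hA x hx, hB y hy]

theorem field_congr {σ σ' : ℕ → ℤ} {A : Finset ℕ} {v : ℕ} (hA : ∀ x ∈ A, σ x = σ' x) :
    field e σ v A = field e σ' v A :=
  sum_congr rfl fun x hx => by rw [hA x hx]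

theorem Gain.congr {t : ℕ} {g : ℤ} (h : Gain n e D t g) (hP : D'.piece n t = D.piece n t)
    (hL : D'.later n t = D.later n t) (hs : ∀ x ∈ D.piece n t, D'.side x = D.side x) :
    Gain n e D' t g := by
  have hσ : ∀ x ∈ D.piece n t, spin D'.side x = spin D.side x := fun x hx => by
    simp only [spin, hs x hx]
  unfold Gain at h ⊢
  rw [hP, hL, corr_congr hσ hσ]
  refine h.imp_right ?_
  rintro ⟨v, hv, h1, h2⟩
  exact ⟨v, hv, h1, by rwa [field_congr hσ]⟩

/-- The data change by a new piece `P`. -/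
structure Step (n : ℕ) (D D' : Data) (P : Finset ℕ) : Prop where
  nonempty : P.Nonempty
  lt : ∀ x ∈ P, x < n
  free : ∀ x ∈ P, D.pc x = 0
  pc : ∀ x, D'.pc x = if x ∈ P then D.top + 1 else D.pc x
  top : D'.top = D.top + 1
  side : ∀ x ∉ P, D'.side x = D.side x
  side_le : ∀ x ∈ P, D'.side x ≤ 1
  att : ∀ x ∉ P, D'.att x = D.att x
  mark : ∀ x, D'.mark x = 0 → D.mark x = 0

theorem Step.piece_new {c : ℤ} (h : Removed n e D c) {P : Finset ℕ} (hs : Step n D D' P) :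
    D'.piece n (D.top + 1) = P := by
  ext x
  simp only [Data.piece, mem_filter, mem_range, hs.pc]
  constructor
  · rintro ⟨hx, hx'⟩
    by_contra hP
    rw [if_neg hP] at hx'
    have := h.pc_le x hx
    omega
  · intro hx
    exact ⟨hs.lt x hx, by simp [hx]⟩

theorem Step.later_new {c : ℤ} (h : Removed n e D c) {P : Finset ℕ} (hs : Step n D D' P) :
    D'.later n (D.top + 1) = {x ∈ range n | D.pc x = 0 ∧ x ∉ P} := by
  ext x
  simp only [Data.later, mem_filter, mem_range, hs.pc]
  refine and_congr_right fun hx => ?_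
  have := h.pc_le x hx
  by_cases hP : x ∈ P
  · simp [hP]
  · simp only [hP, if_false, not_false_eq_true, and_true]
    omega

theorem Removed.step {c d g : ℤ} (h : Removed n e D c) {P : Finset ℕ} (hs : Step n D D' P)
    (hsame : ∀ x ∈ P, ∀ y ∈ P, x ≠ y → D'.mark x = 0 → D'.mark y = 0 →
      e x y ∧ D'.att x = D'.att y)
    (hatt : ∀ x ∈ P, ∀ y < n, D'.mark x = 0 → D'.mark y = 0 →
      (D'.att x = y + 1 ↔ e x y ∧ D.pc y = 0 ∧ y ∉ P))
    (hg : Gain n e D' (D.top + 1) g)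
    (hm : (#(D'.marked n) : ℤ) ≤ #(D.marked n) + 3 * g + d) : Removed n e D' (c + d) := by
  have hpc : ∀ x, x ∉ P → D'.pc x = D.pc x := fun x hx => by rw [hs.pc, if_neg hx]
  have hpc' : ∀ x ∈ P, D'.pc x = D.top + 1 := fun x hx => by rw [hs.pc, if_pos hx]
  refine ⟨fun x hx => ?_, ?_, fun x => ?_, fun x hx y hy h1 h2 hne hmx hmy => ?_,
    fun x hx y hy h1 hmx hmy => ?_, ?_⟩
  · have := h.pc_le x hx
    rw [hs.pc, hs.top]
    split_ifs <;> omega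
  · rw [hs.top]
    obtain ⟨p, hp⟩ := hs.nonempty
    have : insert p {x ∈ range n | D.pc x ≠ 0} ⊆ ({x ∈ range n | D'.pc x ≠ 0} : Finset ℕ) := by
      intro x hx
      simp only [mem_insert, mem_filter, mem_range] at hx ⊢
      rcases hx with rfl | ⟨hx, hx'⟩
      · exact ⟨hs.lt _ hp, by rw [hpc' _ hp]; omega⟩
      · refine ⟨hx, ?_⟩
        rw [hs.pc]
        split_ifs
        · omega
        · exact hx'
    have h2 := card_le_card this
    rw [card_insert_of_notMem (by simp [hs.free p hp])] at h2
    have := h.top_le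
    omega
  · by_cases hx : x ∈ P
    · exact hs.side_le x hx
    · rw [hs.side x hx]; exact h.side_le x
  · by_cases hxP : x ∈ P <;> by_cases hyP : y ∈ P
    · exact hsame x hxP y hyP hne hmx hmy
    · rw [hpc' x hxP, hpc y hyP] at h2
      have := h.pc_le y hy
      omega
    · rw [hpc' y hyP, hpc x hxP] at h2
      have := h.pc_le x hx
      omega
    · rw [hpc x hxP] at h1
      rw [hpc y hyP, hpc x hxP] at h2
      rw [hs.att x hxP, hs.att y hyP]
      exact h.same x hx y hy h1 h2 hne (hs.mark x hmx) (hs.mark y hmy)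
  · by_cases hxP : x ∈ P
    · rw [hatt x hxP y hy hmx hmy, hpc' x hxP]
      refine and_congr_right fun _ => ?_
      have := h.pc_le y hy
      by_cases hyP : y ∈ P
      · simp [hyP, hpc' y hyP]
      · rw [hpc y hyP]; simp only [hyP, not_false_eq_true, and_true]; omega
    · rw [hpc x hxP] at h1
      rw [hs.att x hxP, h.att x hx y hy h1 (hs.mark x hmx) (hs.mark y hmy), hpc x hxP]
      refine and_congr_right fun _ => ?_
      have := h.pc_le x hx
      by_cases hyP : y ∈ P
      · rw [hpc' y hyP, hs.free y hyP]; simp only [true_or, true_iff]; omega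
      · rw [hpc y hyP]
  · obtain ⟨γ, hγ, hc⟩ := h.gain
    refine ⟨Function.update γ (D.top + 1) g, fun t ht ht' => ?_, ?_⟩
    · rw [hs.top] at ht'
      rcases Nat.lt_or_ge D.top t with htt | htt
      · obtain rfl : t = D.top + 1 := by omega
        simpa using hg
      · rw [Function.update_of_ne (by omega)]
        have hP : D'.piece n t = D.piece n t := by
          ext x
          simp only [Data.piece, mem_filter, mem_range, hs.pc]
          refine and_congr_right fun _ => ?_
          by_cases hx : x ∈ P
          · simp only [hx, if_true, hs.free x hx]; omega
          · simp [hx]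
        refine (hγ t ht htt).congr hP ?_ fun x hx => hs.side x fun hxP => ?_
        · ext x
          simp only [Data.later, mem_filter, mem_range, hs.pc]
          refine and_congr_right fun _ => ?_
          by_cases hx : x ∈ P
          · simp only [hx, if_true, hs.free x hx, true_or, iff_true]; omega
          · simp [hx]
        · have := hs.free x hxP
          simp only [Data.piece, mem_filter] at hx
          omega
    · rw [hs.top, sum_Icc_succ_top (by omega), Function.update_self]
      have : ∑ t ∈ Icc 1 D.top, Function.update γ (D.top + 1) g t = ∑ t ∈ Icc 1 D.top, γ t :=
        sum_congr rfl fun t ht => by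
          rw [Function.update_of_ne (by simp only [mem_Icc] at ht; omega)]
      rw [this]
      linarith

theorem spin_sq {f : ℕ → ℕ} {x : ℕ} (h : f x ≤ 1) : spin f x * spin f x = 1 := by
  unfold spin
  interval_cases f x <;> norm_num

theorem sum_spin {f : ℕ → ℕ} {A : Finset ℕ} (h : ∀ x ∈ A, f x ≤ 1) :
    ∑ x ∈ A, spin f x = 2 * #{x ∈ A | f x = 1} - #A := by
  have : ∀ x ∈ A, spin f x = 2 * (if f x = 1 then 1 else 0) - 1 := fun x hx => by
    have := h x hx
    unfold spin
    interval_cases f x <;> simp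
  rw [sum_congr rfl this, sum_sub_distrib, ← mul_sum, card_filter]
  simp

theorem corr_clique {σ : ℕ → ℤ} {A : Finset ℕ} (hirr : ∀ x, e x x = false)
    (hσ : ∀ x ∈ A, σ x * σ x = 1) (hA : ∀ x ∈ A, ∀ y ∈ A, x ≠ y → e x y) :
    corr e σ A A = (∑ x ∈ A, σ x) ^ 2 - #A := by
  have : corr e σ A A = ∑ x ∈ A, (σ x * ∑ y ∈ A, σ y - 1) := by
    refine sum_congr rfl fun x hx => ?_
    rw [mul_sum, ← add_sum_erase A _ hx, ← add_sum_erase A (fun y => σ x * σ y) hx, hσ x hx,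
      hirr x]
    simp only [Bool.false_eq_true, if_false, zero_add, add_sub_cancel_left]
    refine sum_congr rfl fun y hy => ?_
    rw [mem_erase] at hy
    rw [if_pos (hA x hx y hy.2 hy.1.symm)]
  rw [this, sum_sub_distrib, ← sum_mul]
  simp
  ring

/-- The numbers of ones in a clique piece: half of the piece, rounded up, neighbours of the pivot
first. -/
structure Split (e : ℕ → ℕ → Bool) (f : ℕ → ℕ) (v : ℕ) (X : Finset ℕ) : Prop where
  le : ∀ x ∈ X, f x ≤ 1
  ones : #{x ∈ X | f x = 1} = (#X + 1) / 2
  nbrs : #{x ∈ X | e v x ∧ f x = 1} = min #{x ∈ X | e v x} ((#X + 1) / 2)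

theorem field_eq {f : ℕ → ℕ} {v : ℕ} {X : Finset ℕ} (h : ∀ x ∈ X, f x ≤ 1) :
    field e (spin f) v X = 2 * #{x ∈ X | e v x ∧ f x = 1} - #{x ∈ X | e v x} := by
  unfold field
  rw [← sum_filter, sum_spin fun x hx => h x (mem_filter.1 hx).1, filter_filter]

/-- Removing a clique that is attached to a single vertex. -/
theorem Removed.pivot {c : ℤ} (hirr : ∀ x, e x x = false) (hsym : ∀ x y, e x y = e y x)
    (h : Removed n e D c) {X : Finset ℕ} {v : ℕ} (hs : Step n D D' X)
    (hX : ∀ x ∈ X, ∀ y ∈ X, x ≠ y → e x y) (hv : v < n) (hv0 : D.pc v = 0) (hvX : v ∉ X)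
    (hout : ∀ x ∈ X, ∀ y < n, D.pc y = 0 → y ∉ X → e x y → y = v) (hsome : ∃ x ∈ X, e v x)
    (hsp : Split e D'.side v X) (hatt : ∀ x ∈ X, D'.att x = v + 1)
    (hm : ∀ x, D'.mark x = if x = v ∧ ∃ y ∈ X, ¬ e v y then 1 else D.mark x) :
    Removed n e D' c := by
  have hcor := corr_clique (e := e) (σ := spin D'.side) hirr (fun x hx => spin_sq (hsp.le x hx)) hX
  rw [sum_spin hsp.le, hsp.ones] at hcor
  have hfld := field_eq (e := e) (v := v) hsp.le
  rw [hsp.nbrs] at hfld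
  have hvl : v ∈ D'.later n (D.top + 1) := by
    rw [hs.later_new h]; simp [hv, hv0, hvX]
  have hon : ∀ x ∈ D'.piece n (D.top + 1), ∀ y ∈ D'.later n (D.top + 1), e x y → y = v := by
    rw [hs.later_new h, hs.piece_new h]
    intro x hx y hy hxy
    simp only [mem_filter, mem_range] at hy
    exact hout x hx y hy.1 hy.2.1 hy.2.2 hxy
  have hcard : #{x ∈ X | e v x} ≤ #X := card_filter_le _ _
  have hpos : 0 < #{x ∈ X | e v x} := by
    obtain ⟨x, hx, hvx⟩ := hsome
    exact card_pos.2 ⟨x, by simp [hx, hvx]⟩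
  have hsame : ∀ x ∈ X, ∀ y ∈ X, x ≠ y → D'.mark x = 0 → D'.mark y = 0 →
      e x y ∧ D'.att x = D'.att y := fun x hx y hy hne _ _ =>
    ⟨hX x hx y hy hne, by rw [hatt x hx, hatt y hy]⟩
  by_cases hall : ∃ y ∈ X, ¬ e v y
  · have hlt : #{x ∈ X | e v x} < #X := by
      obtain ⟨y, hy, hvy⟩ := hall
      exact card_lt_card (filter_ssubset.2 ⟨y, hy, hvy⟩)
    have hmv : D'.mark v ≠ 0 := by rw [hm]; simp only [true_and]; rw [if_pos hall]; simp
    have key := h.step (g := 1) (d := 0) hs hsame (fun x hx y hy hmx hmy => ?_) (Or.inr ⟨v, hvl, hon, ?_⟩) ?_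
    · simpa using key
    · rw [hatt x hx]
      constructor
      · intro hvy
        obtain rfl : v = y := by omega
        exact absurd hmy hmv
      · rintro ⟨hxy, hy0, hyX⟩
        obtain rfl := hout x hx y hy hy0 hyX hxy
        rfl
    · rw [hs.piece_new h, hcor, hfld]
      set p := #X
      set a := #{x ∈ X | e v x}
      have h2 : (2 * ((p + 1) / 2) : ℤ) - p = 0 ∨ (2 * ((p + 1) / 2) : ℤ) - p = 1 := by omega
      have h3 : (1 : ℤ) ≤ 2 * (min a ((p + 1) / 2) : ℕ) - a := by omega
      have h4 := le_abs_self ((2 : ℤ) * (min a ((p + 1) / 2) : ℕ) - a)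
      push_cast at h4 h3 ⊢
      rcases h2 with h2 | h2 <;> rw [h2] <;> linarith
    · have : D'.marked n ⊆ insert v (D.marked n) := by
        intro x hx
        simp only [Data.marked, mem_filter, mem_insert, hm] at hx ⊢
        by_cases hxv : x = v
        · exact Or.inl hxv
        · rw [if_neg (by tauto)] at hx
          exact Or.inr hx
      have := (card_le_card this).trans (card_insert_le _ _)
      push_cast
      omega
  · have hm' : D'.mark = D.mark := funext fun x => by rw [hm, if_neg fun h => hall h.2]
    push Not at hall
    have hfil : ({x ∈ X | e v x} : Finset ℕ) = X := filter_true_of_mem fun x hx => by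
      simpa using hall x hx
    rw [hfil] at hfld
    have key := h.step (g := 0) (d := 0) hs hsame (fun x hx y hy hmx hmy => ?_) (Or.inr ⟨v, hvl, hon, ?_⟩) ?_
    · simpa using key
    · rw [hatt x hx]
      constructor
      · intro hvy
        obtain rfl : v = y := by omega
        exact ⟨by rw [hsym]; simpa using hall x hx, hv0, hvX⟩
      · rintro ⟨hxy, hy0, hyX⟩
        obtain rfl := hout x hx y hy hy0 hyX hxy
        rfl
    · rw [hs.piece_new h, hcor, hfld]
      set p := #X
      have h2 : (2 * ((p + 1) / 2) : ℤ) - p = 0 ∨ (2 * ((p + 1) / 2) : ℤ) - p = 1 := by omega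
      have h3 : min p ((p + 1) / 2) = (p + 1) / 2 := by omega
      rw [h3]
      push_cast
      rcases h2 with h2 | h2 <;> rw [h2] <;> norm_num
    · simp only [Data.marked, hm']; simp

theorem marked_card_le {Q : Finset ℕ} (hm : ∀ x, D'.mark x ≠ 0 → x ∈ Q ∨ D.mark x ≠ 0) :
    #(D'.marked n) ≤ #(D.marked n) + #Q := by
  have : D'.marked n ⊆ D.marked n ∪ Q := by
    intro x hx
    simp only [Data.marked, mem_filter, mem_union] at hx ⊢
    have := hm x hx.2
    tauto
  exact (card_le_card this).trans (card_union_le _ _)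

/-- Removing the vertices of an induced path. -/
theorem Removed.path {c : ℤ} (hirr : ∀ x, e x x = false) (hsym : ∀ x y, e x y = e y x)
    (h : Removed n e D c) {x y z : ℕ} (hs : Step n D D' {x, y, z}) (hxy : e x y) (hyz : e y z)
    (hxz : e x z = false) (hne : x ≠ z) (hsx : D'.side x = D'.side z)
    (hsy : D'.side y = 1 - D'.side x)
    (hm : ∀ a, D'.mark a = if a ∈ ({x, y, z} : Finset ℕ) then 1 else D.mark a) :
    Removed n e D' c := by
  have nxy : x ≠ y := by rintro rfl; simp [hirr] at hxy
  have nyz : y ≠ z := by rintro rfl; simp [hirr] at hyz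
  have hm1 : ∀ a ∈ ({x, y, z} : Finset ℕ), D'.mark a ≠ 0 := fun a ha => by
    rw [hm, if_pos ha]; simp
  have key := h.step (g := 1) (d := 0) hs (fun a ha b _ _ hma _ => absurd hma (hm1 a ha))
    (fun a ha b _ hma _ => absurd hma (hm1 a ha)) (Or.inl ?_) ?_
  · simpa using key
  · rw [hs.piece_new h, card_insert_of_notMem (by simp [nxy, hne]),
      card_insert_of_notMem (by simp [nyz]), card_singleton]
    have hyx : e y x := by rw [hsym]; exact hxy
    have hzy : e z y := by rw [hsym]; exact hyz
    have hzx : e z x = false := by rw [hsym]; exact hxz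
    have h1 := hs.side_le x (by simp)
    have : corr e (spin D'.side) {x, y, z} {x, y, z} = -4 := by
      unfold corr
      simp only [sum_insert (show x ∉ ({y, z} : Finset ℕ) by simp [nxy, hne]),
        sum_insert (show y ∉ ({z} : Finset ℕ) by simp [nyz]), sum_singleton, hxy, hyz, hxz, hyx,
        hzy, hzx, hirr, spin, ← hsx, hsy]
      interval_cases D'.side x <;> norm_num
    rw [this]
    norm_num
  · have := marked_card_le (n := n) (D := D) (D' := D') (Q := {x, y, z}) fun a ha => by
      by_contra hc
      push Not at hc
      rw [hm, if_neg hc.1] at ha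
      exact ha hc.2
    have h3 : #({x, y, z} : Finset ℕ) ≤ 3 := card_le_three
    push_cast
    omega

/-- Removing a clique minus one edge with both ends of this edge marked. -/
theorem Removed.nearClique {c : ℤ} (hirr : ∀ x, e x x = false) (hsym : ∀ x y, e x y = e y x)
    (h : Removed n e D c) {Q : Finset ℕ} {u w : ℕ} (hs : Step n D D' (insert u Q)) (huQ : u ∉ Q)
    (hQ : ∀ x ∈ Q, ∀ y ∈ Q, x ≠ y → e x y) (hw : w ∈ Q) (hQ2 : 2 ≤ #Q)
    (huw : ∀ x ∈ Q, e u x = true ↔ x ≠ w)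
    (hout : ∀ x ∈ Q, x ≠ w → ∀ y < n, D.pc y = 0 → y ∉ insert u Q → e x y = false)
    (hsp : Split e D'.side u Q) (hsu : D'.side u = 0) (hatt : ∀ x ∈ Q, D'.att x = u + 1)
    (hm : ∀ x, D'.mark x = if x = u ∨ x = w then 1 else D.mark x) :
    Removed n e D' c := by
  have hmu : D'.mark u ≠ 0 := by rw [hm]; simp
  have hmw : D'.mark w ≠ 0 := by rw [hm]; simp
  have key := h.step (g := 1) (d := 0) hs (fun x hx y hy hne hmx hmy => ?_)
    (fun x hx y hy hmx hmy => ?_) (Or.inl ?_) ?_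
  · simpa using key
  · have hxQ : x ∈ Q := (mem_insert.1 hx).resolve_left (by rintro rfl; exact hmu hmx)
    have hyQ : y ∈ Q := (mem_insert.1 hy).resolve_left (by rintro rfl; exact hmu hmy)
    exact ⟨hQ x hxQ y hyQ hne, by rw [hatt x hxQ, hatt y hyQ]⟩
  · have hxQ : x ∈ Q := (mem_insert.1 hx).resolve_left (by rintro rfl; exact hmu hmx)
    have hxw : x ≠ w := by rintro rfl; exact hmw hmx
    rw [hatt x hxQ]
    constructor
    · intro hvy
      obtain rfl : u = y := by omega
      exact absurd hmy hmu
    · rintro ⟨hxy, hy0, hyP⟩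
      rw [hout x hxQ hxw y hy hy0 hyP] at hxy
      simp at hxy
  · rw [hs.piece_new h, card_insert_of_notMem huQ]
    have hnb : ({x ∈ Q | e u x} : Finset ℕ) = Q.erase w := by
      ext x
      simp only [mem_filter, mem_erase]
      constructor
      · rintro ⟨hx, hux⟩; exact ⟨(huw x hx).1 hux, hx⟩
      · rintro ⟨hxw, hx⟩; exact ⟨hx, (huw x hx).2 hxw⟩
    have hnbrs := hsp.nbrs
    rw [hnb, card_erase_of_mem hw] at hnbrs
    have hsw : D'.side w = 0 := by
      have h1 := hsp.le w hw
      by_contra h0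
      have h1 : D'.side w = 1 := by omega
      have : ({x ∈ Q | e u x ∧ D'.side x = 1} : Finset ℕ) ⊂ {x ∈ Q | D'.side x = 1} := by
        refine ⟨fun x hx => ?_, fun hsub => ?_⟩
        · simp only [mem_filter] at hx ⊢; tauto
        · have := hsub (mem_filter.2 ⟨hw, h1⟩)
          simp only [mem_filter] at this
          exact (huw w hw).1 this.2.1 rfl
      have := card_lt_card this
      rw [hnbrs, hsp.ones] at this
      omega
    have hcor := corr_clique (e := e) (σ := spin D'.side) hirr
      (fun x hx => spin_sq (hsp.le x hx)) hQ
    have hsum : ∑ x ∈ Q, spin D'.side x = 2 * ((#Q + 1) / 2 : ℕ) - #Q := by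
      rw [sum_spin hsp.le, hsp.ones]
    have hfl : ∑ x ∈ Q, (if e u x then spin D'.side u * spin D'.side x else 0)
        = -(∑ x ∈ Q, spin D'.side x + 1) := by
      rw [← sum_filter, hnb, ← add_sum_erase Q _ hw]
      have : spin D'.side w = -1 := by simp [spin, hsw]
      have hu : spin D'.side u = -1 := by simp [spin, hsu]
      rw [this, hu, ← mul_sum]
      ring
    have hfl' : ∑ x ∈ Q, (if e x u then spin D'.side x * spin D'.side u else 0)
        = -(∑ x ∈ Q, spin D'.side x + 1) := by
      rw [← hfl]
      exact sum_congr rfl fun x _ => by rw [hsym x u, mul_comm]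
    have : corr e (spin D'.side) (insert u Q) (insert u Q)
        = corr e (spin D'.side) Q Q - 2 * (∑ x ∈ Q, spin D'.side x + 1) := by
      unfold corr
      simp only [sum_insert huQ, hirr, sum_add_distrib, hfl, hfl']
      simp
      ring
    rw [this, hcor, hsum]
    set q := #Q
    have h2 : (2 * ((q + 1) / 2) : ℤ) - q = 0 ∨ (2 * ((q + 1) / 2) : ℤ) - q = 1 := by omega
    push_cast
    rcases h2 with h2 | h2 <;> rw [h2] <;> linarith
  · have := marked_card_le (n := n) (D := D) (D' := D') (Q := {u, w}) fun a ha => by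
      by_contra hc
      simp only [mem_insert, mem_singleton] at hc
      push Not at hc
      rw [hm, if_neg (by tauto)] at ha
      exact ha hc.2
    have h3 : #({u, w} : Finset ℕ) ≤ 2 := card_le_two
    push_cast
    omega

/-- Removing a single vertex. -/
theorem Removed.single {c : ℤ} (hirr : ∀ x, e x x = false) (h : Removed n e D c) {u : ℕ}
    (hs : Step n D D' {u}) (hm : ∀ x, D'.mark x = if x = u then 1 else D.mark x) :
    Removed n e D' (c + 4) := by
  have hmu : D'.mark u ≠ 0 := by rw [hm]; simp
  refine h.step (g := -1) hs (fun x hx y hy hne hmx hmy => ?_)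
    (fun x hx y hy hmx hmy => ?_) (Or.inl ?_) ?_
  · rw [mem_singleton.1 hx] at hmx; exact absurd hmx hmu
  · rw [mem_singleton.1 hx] at hmx; exact absurd hmx hmu
  · rw [hs.piece_new h]
    simp [corr, hirr]
  · have := marked_card_le (n := n) (D := D) (D' := D') (Q := {u}) fun a ha => by
      by_contra hc
      push Not at hc
      rw [hm, if_neg (by simpa using hc.1)] at ha
      exact ha hc.2
    rw [card_singleton] at this
    push_cast
    omega

/-- If every piece is oriented at least as well as its opposite with respect to the later pieces,
then the gains of the pieces add up. -/
theorem total_gain {σ : ℕ → ℤ} (hsym : ∀ x y, e x y = e y x) (hpc : ∀ x < n, D.pc x ≠ 0)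
    (hle : ∀ x < n, D.pc x ≤ D.top) (hside : ∀ x, D.side x ≤ 1)
    (hσ : ∀ t, 1 ≤ t → t ≤ D.top → ∃ ε : ℤ, ε * ε = 1 ∧ ∀ x ∈ D.piece n t,
      σ x = ε * spin D.side x)
    (hmaj : ∀ t, 1 ≤ t → t ≤ D.top → corr e σ (D.piece n t) (D.later n t) ≤ 0) {g : ℕ → ℤ}
    (hg : ∀ t, 1 ≤ t → t ≤ D.top → Gain n e D t (g t)) :
    corr e σ (range n) (range n) + n + ∑ t ∈ Icc 1 D.top, g t ≤ 0 := by
  have hsq : ∀ x < n, σ x * σ x = 1 := fun x hx => by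
    obtain ⟨ε, hε, h⟩ := hσ (D.pc x) (Nat.one_le_iff_ne_zero.2 (hpc x hx)) (hle x hx)
    rw [h x (by simp [Data.piece, hx]), mul_mul_mul_comm, hε, spin_sq (hside x), one_mul]
  have hlater : ∀ t, D.later n t = {x ∈ range n | t < D.pc x} := fun t => by
    ext x
    simp only [Data.later, mem_filter, mem_range]
    refine and_congr_right fun hx => ?_
    have := hpc x hx
    omega
  have hpiece : ∀ t, 1 ≤ t → t ≤ D.top → corr e σ (D.piece n t) (D.piece n t)
      + 2 * corr e σ (D.piece n t) (D.later n t) + #(D.piece n t) + g t ≤ 0 := by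
    intro t ht ht'
    obtain ⟨ε, hε, hσt⟩ := hσ t ht ht'
    have h1 : corr e σ (D.piece n t) (D.piece n t)
        = corr e (spin D.side) (D.piece n t) (D.piece n t) := by
      refine sum_congr rfl fun x hx => sum_congr rfl fun y hy => ?_
      rw [hσt x hx, hσt y hy, mul_mul_mul_comm, hε, one_mul]
    rw [h1]
    rcases hg t ht ht' with h | ⟨v, hv, hon, h⟩
    · linarith [hmaj t ht ht']
    · have h2 : corr e σ (D.piece n t) (D.later n t)
          = ε * σ v * field e (spin D.side) v (D.piece n t) := by
        unfold corr field
        rw [mul_sum]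
        refine sum_congr rfl fun x hx => ?_
        rw [sum_eq_single_of_mem v hv fun y hy hne => ?_]
        · rw [hsym x v, hσt x hx]
          split_ifs <;> ring
        · rw [if_neg fun hxy => hne (hon x hx y hy hxy)]
      have h3 : |corr e σ (D.piece n t) (D.later n t)| = |field e (spin D.side) v (D.piece n t)| := by
        rw [h2, abs_mul]
        have hvn : v < n := by
          simp only [Data.later, mem_filter, mem_range] at hv; exact hv.1
        have : |ε * σ v| = 1 := by
          rw [← sq_eq_sq₀ (abs_nonneg _) (by norm_num), sq_abs]
          linear_combination (σ v * σ v) * hε + hsq v hvn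
        rw [this, one_mul]
      rw [abs_of_nonpos (hmaj t ht ht')] at h3
      linarith
  have key : ∀ t ≤ D.top, corr e σ (range n) (range n) = corr e σ (D.later n t) (D.later n t)
      + ∑ s ∈ Icc 1 t, (corr e σ (D.piece n s) (D.piece n s)
        + 2 * corr e σ (D.piece n s) (D.later n s)) ∧
      (n : ℤ) = #(D.later n t) + ∑ s ∈ Icc 1 t, (#(D.piece n s) : ℤ) := by
    intro t
    induction t with
    | zero =>
      intro _
      have : D.later n 0 = range n := by
        rw [hlater]
        exact filter_true_of_mem fun x hx => Nat.pos_of_ne_zero (hpc x (mem_range.1 hx))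
      simp [this]
    | succ t ih =>
      intro ht
      obtain ⟨h1, h2⟩ := ih (by omega)
      have hu : D.later n t = D.piece n (t + 1) ∪ D.later n (t + 1) := by
        rw [hlater, hlater]
        ext x
        simp only [Data.piece, mem_filter, mem_union, mem_range]
        rw [← and_or_left]
        refine and_congr_right fun _ => ?_
        omega
      have hd : Disjoint (D.piece n (t + 1)) (D.later n (t + 1)) := by
        rw [hlater]
        refine disjoint_filter.2 fun x _ hx => by omega
      rw [sum_Icc_succ_top (by omega), sum_Icc_succ_top (by omega), h1]
      refine ⟨?_, ?_⟩
      · rw [hu]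
        have hs : corr e σ (D.later n (t + 1)) (D.piece n (t + 1))
            = corr e σ (D.piece n (t + 1)) (D.later n (t + 1)) := by
          unfold corr
          rw [sum_comm]
          exact sum_congr rfl fun x _ => sum_congr rfl fun y _ => by rw [hsym y x, mul_comm]
        have hx : corr e σ (D.piece n (t + 1) ∪ D.later n (t + 1))
            (D.piece n (t + 1) ∪ D.later n (t + 1)) =
            corr e σ (D.piece n (t + 1)) (D.piece n (t + 1))
            + corr e σ (D.piece n (t + 1)) (D.later n (t + 1))
            + (corr e σ (D.later n (t + 1)) (D.piece n (t + 1))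
            + corr e σ (D.later n (t + 1)) (D.later n (t + 1))) := by
          simp only [corr, sum_union hd, sum_add_distrib]
        rw [hx, hs]
        ring
      · rw [hu, card_union_of_disjoint hd] at h2
        push_cast at h2
        linarith
  obtain ⟨h1, h2⟩ := key D.top le_rfl
  have h0 : D.later n D.top = ∅ := by
    rw [hlater]
    exact filter_false_of_mem fun x hx => by have := hle x (mem_range.1 hx); omega
  rw [h0] at h1 h2
  rw [h1, h2]
  have := sum_nonpos fun t ht => hpiece t (mem_Icc.1 ht).1 (mem_Icc.1 ht).2
  simp only [sum_add_distrib] at this ⊢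
  simp only [corr, sum_empty, card_empty] at this ⊢
  push_cast
  linarith

end Pieces

/-! ## Optimal colourings of weighted clique forests -/

namespace Pieces

open Finset

/-- The number of ordered edges inside `R` that are cut by the colouring `χ`. -/
def cutIn (e : ℕ → ℕ → Bool) (χ : ℕ → Bool) (R : Finset ℕ) : ℕ :=
  ∑ x ∈ R, ∑ y ∈ R, if e x y ∧ χ x ≠ χ y then 1 else 0

/-- Twice the value of a colouring with respect to vertex weights `w₀` and `w₁`. -/
def val (e : ℕ → ℕ → Bool) (w₀ w₁ : ℕ → ℕ) (χ : ℕ → Bool) (R : Finset ℕ) : ℕ :=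
  2 * (∑ x ∈ R, if χ x then w₁ x else w₀ x) + cutIn e χ R

def ones (χ : ℕ → Bool) (X : Finset ℕ) : ℕ := #{x ∈ X | χ x}

variable {e : ℕ → ℕ → Bool} {w₀ w₁ : ℕ → ℕ}

theorem val_congr {χ χ' : ℕ → Bool} {R : Finset ℕ} (h : ∀ x ∈ R, χ x = χ' x) :
    val e w₀ w₁ χ R = val e w₀ w₁ χ' R := by
  unfold val cutIn
  congr 1
  · congr 1
    exact sum_congr rfl fun x hx => by rw [h x hx]
  · exact sum_congr rfl fun x hx => sum_congr rfl fun y hy => by rw [h x hx, h y hy]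

theorem val_mono {χ : ℕ → Bool} {R R' : Finset ℕ} (h : R ⊆ R') :
    val e w₀ w₁ χ R ≤ val e w₀ w₁ χ R' := by
  unfold val cutIn
  refine Nat.add_le_add (Nat.mul_le_mul_left _ (sum_le_sum_of_subset h)) ?_
  exact (sum_le_sum fun x _ => sum_le_sum_of_subset h).trans (sum_le_sum_of_subset h)

theorem ones_congr {χ χ' : ℕ → Bool} {R : Finset ℕ} (h : ∀ x ∈ R, χ x = χ' x) :
    ones χ R = ones χ' R := by
  unfold ones
  rw [filter_congr fun x hx => by rw [h x hx]]

theorem ones_le (χ : ℕ → Bool) (X : Finset ℕ) : ones χ X ≤ #X := card_filter_le _ _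

theorem card_ne_true (χ : ℕ → Bool) (X : Finset ℕ) (c : Bool) :
    #{x ∈ X | χ x ≠ c} = if c then #X - ones χ X else ones χ X := by
  have h := card_filter_add_card_filter_not (s := X) (fun x => χ x = true)
  cases c
  · simp [ones]
  · simp only [ne_eq, if_true, ones] at h ⊢
    omega

theorem cutIn_union (hsym : ∀ x y, e x y = e y x) {χ : ℕ → Bool} {X R : Finset ℕ}
    (hd : Disjoint X R) : cutIn e χ (X ∪ R) = cutIn e χ X + cutIn e χ R
      + 2 * ∑ x ∈ X, ∑ y ∈ R, if e x y ∧ χ x ≠ χ y then 1 else 0 := by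
  have h : ∑ x ∈ R, ∑ y ∈ X, (if e x y ∧ χ x ≠ χ y then 1 else 0)
      = ∑ x ∈ X, ∑ y ∈ R, if e x y ∧ χ x ≠ χ y then 1 else 0 := by
    rw [sum_comm]
    exact sum_congr rfl fun x _ => sum_congr rfl fun y _ => by simp only [hsym y x, ne_comm]
  simp only [cutIn, sum_union hd, sum_add_distrib]
  rw [h]
  ring

theorem val_union (hsym : ∀ x y, e x y = e y x) {χ : ℕ → Bool} {X R : Finset ℕ}
    (hd : Disjoint X R) : val e w₀ w₁ χ (X ∪ R) = val e w₀ w₁ χ X + val e w₀ w₁ χ R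
      + 2 * ∑ x ∈ X, ∑ y ∈ R, if e x y ∧ χ x ≠ χ y then 1 else 0 := by
  unfold val
  rw [cutIn_union hsym hd, sum_union hd]
  ring

/-- `T j` is the best value on `X` with `j` vertices of colour one. -/
structure Table (e : ℕ → ℕ → Bool) (w₀ w₁ : ℕ → ℕ) (X : Finset ℕ) (T : ℕ → ℕ) : Prop where
  le : ∀ χ, val e w₀ w₁ χ X ≤ 2 * T (ones χ X)
  ex : ∀ j ≤ #X, ∃ χ, ones χ X = j ∧ val e w₀ w₁ χ X = 2 * T j

theorem Table.empty {T : ℕ → ℕ} (h : T 0 = 0) : Table e w₀ w₁ ∅ T := by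
  refine ⟨fun χ => by simp [val, cutIn], fun j hj => ⟨fun _ => true, ?_, ?_⟩⟩
  · simp at hj; simp [ones, hj]
  · simp at hj; simp [val, cutIn, hj, h]

theorem ones_insert {χ : ℕ → Bool} {X : Finset ℕ} {x : ℕ} (hx : x ∉ X) :
    ones χ (insert x X) = ones χ X + if χ x then 1 else 0 := by
  unfold ones
  rw [filter_insert]
  split_ifs
  · rw [card_insert_of_notMem (by simp [hx])]
  · rfl

theorem val_insert (hsym : ∀ x y, e x y = e y x) (hirr : ∀ x, e x x = false) {χ : ℕ → Bool}
    {X : Finset ℕ} {x : ℕ} (hx : x ∉ X) (hX : ∀ y ∈ X, e x y) :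
    val e w₀ w₁ χ (insert x X) = val e w₀ w₁ χ X
      + 2 * if χ x then w₁ x + (#X - ones χ X) else w₀ x + ones χ X := by
  rw [insert_eq, val_union hsym (by simpa using hx)]
  have h1 : val e w₀ w₁ χ {x} = 2 * if χ x then w₁ x else w₀ x := by simp [val, cutIn, hirr]
  have h2 : ∑ a ∈ ({x} : Finset ℕ), ∑ y ∈ X, (if e a y ∧ χ a ≠ χ y then 1 else 0)
      = #{y ∈ X | χ y ≠ χ x} := by
    rw [sum_singleton, card_filter]
    refine sum_congr rfl fun y hy => ?_
    simp only [hX y hy, true_and, ne_comm]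
  rw [h1, h2, card_ne_true]
  split_ifs <;> ring

theorem Table.insert (hsym : ∀ x y, e x y = e y x) (hirr : ∀ x, e x x = false)
    {X : Finset ℕ} {T T' : ℕ → ℕ} (h : Table e w₀ w₁ X T) {x : ℕ} (hx : x ∉ X)
    (hX : ∀ y ∈ X, e x y) (h0 : ∀ j ≤ #X, T j + w₀ x + j ≤ T' j)
    (h1 : ∀ j ≤ #X, T j + w₁ x + (#X - j) ≤ T' (j + 1))
    (h2 : ∀ j ≤ #X + 1, (j ≤ #X ∧ T' j = T j + w₀ x + j) ∨
      ∃ i, j = i + 1 ∧ i ≤ #X ∧ T' j = T i + w₁ x + (#X - i)) :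
    Table e w₀ w₁ (insert x X) T' := by
  refine ⟨fun χ => ?_, fun j hj => ?_⟩
  · rw [val_insert hsym hirr hx hX, ones_insert hx]
    have hle := h.le χ
    have ho := ones_le χ X
    split_ifs
    · have := h1 _ ho; omega
    · have := h0 _ ho; simp only [add_zero]; omega
  · rw [card_insert_of_notMem hx] at hj
    rcases h2 j hj with ⟨hj', hT⟩ | ⟨i, rfl, hi, hT⟩
    · obtain ⟨χ, hχ, hv⟩ := h.ex j hj'
      have hc : ∀ y ∈ X, Function.update χ x false y = χ y := fun y hy =>
        Function.update_of_ne (by rintro rfl; exact hx hy) _ _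
      refine ⟨Function.update χ x false, ?_, ?_⟩
      · rw [ones_insert hx, ones_congr hc, hχ]; simp
      · rw [val_insert hsym hirr hx hX, ones_congr hc, val_congr hc, hχ, hv, hT]; simp; ring
    · obtain ⟨χ, hχ, hv⟩ := h.ex i hi
      have hc : ∀ y ∈ X, Function.update χ x true y = χ y := fun y hy =>
        Function.update_of_ne (by rintro rfl; exact hx hy) _ _
      refine ⟨Function.update χ x true, ?_, ?_⟩
      · rw [ones_insert hx, ones_congr hc, hχ]; simp
      · rw [val_insert hsym hirr hx hX, ones_congr hc, val_congr hc, hχ, hv, hT]; simp; ring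

/-- `b` is the largest of the numbers `f j` for `j ≤ p`. -/
def IsMax (f : ℕ → ℕ) (p b : ℕ) : Prop := (∀ j ≤ p, f j ≤ b) ∧ ∃ j ≤ p, f j = b

/-- Eliminating a clique without edges to the rest. -/
theorem eliminate_free (hsym : ∀ x y, e x y = e y x) {X R : Finset ℕ} {T : ℕ → ℕ}
    (h : Table e w₀ w₁ X T) (hd : Disjoint X R) (hno : ∀ x ∈ X, ∀ y ∈ R, e x y = false) {b : ℕ}
    (hb : IsMax T (#X) b) (tot θ : ℕ) :
    (∃ χ, θ ≤ 2 * tot + val e w₀ w₁ χ (X ∪ R)) ↔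
      ∃ χ, θ ≤ 2 * (tot + b) + val e w₀ w₁ χ R := by
  have h0 : ∀ χ : ℕ → Bool, ∑ x ∈ X, ∑ y ∈ R, (if e x y ∧ χ x ≠ χ y then 1 else 0) = 0 := fun χ =>
    sum_eq_zero fun x hx => sum_eq_zero fun y hy => by simp [hno x hx y hy]
  constructor
  · rintro ⟨χ, hχ⟩
    refine ⟨χ, hχ.trans ?_⟩
    rw [val_union hsym hd, h0]
    have := h.le χ
    have := hb.1 _ (ones_le χ X)
    omega
  · rintro ⟨χ, hχ⟩
    obtain ⟨j, hj, hbj⟩ := hb.2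
    obtain ⟨χ', hχ', hv⟩ := h.ex j hj
    have hX : val e w₀ w₁ (fun x => if x ∈ X then χ' x else χ x) X = val e w₀ w₁ χ' X :=
      val_congr fun x hx => by simp [hx]
    have hR : val e w₀ w₁ (fun x => if x ∈ X then χ' x else χ x) R = val e w₀ w₁ χ R :=
      val_congr fun x hx => by simp [disjoint_right.1 hd hx]
    refine ⟨fun x => if x ∈ X then χ' x else χ x, hχ.trans ?_⟩
    rw [val_union hsym hd, h0, hX, hR]
    omega

theorem val_update (χ : ℕ → Bool) {R : Finset ℕ} {v : ℕ} (hv : v ∈ R) (b₀ b₁ : ℕ) :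
    val e (Function.update w₀ v (w₀ v + b₀)) (Function.update w₁ v (w₁ v + b₁)) χ R
      = val e w₀ w₁ χ R + 2 * if χ v then b₁ else b₀ := by
  unfold val
  rw [← add_sum_erase R _ hv, ← add_sum_erase R (fun x => if χ x then w₁ x else w₀ x) hv]
  have : ∑ x ∈ R.erase v, (if χ x then Function.update w₁ v (w₁ v + b₁) x else
      Function.update w₀ v (w₀ v + b₀) x) = ∑ x ∈ R.erase v, if χ x then w₁ x else w₀ x :=
    sum_congr rfl fun x hx => by
      rw [Function.update_of_ne (ne_of_mem_erase hx), Function.update_of_ne (ne_of_mem_erase hx)]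
  rw [this]
  simp only [Function.update_self]
  split_ifs <;> ring

/-- Eliminating a clique that is attached to a single vertex. -/
theorem eliminate_attached (hsym : ∀ x y, e x y = e y x) {X R : Finset ℕ} {T : ℕ → ℕ}
    (h : Table e w₀ w₁ X T) (hd : Disjoint X R) {v : ℕ} (hv : v ∈ R)
    (hon : ∀ x ∈ X, ∀ y ∈ R, e x y ↔ y = v) {b₀ b₁ : ℕ}
    (hb₀ : IsMax (fun j => T j + j) (#X) b₀) (hb₁ : IsMax (fun j => T j + (#X - j)) (#X) b₁)
    (tot θ : ℕ) :
    (∃ χ, θ ≤ 2 * tot + val e w₀ w₁ χ (X ∪ R)) ↔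
      ∃ χ, θ ≤ 2 * tot + val e (Function.update w₀ v (w₀ v + b₀))
        (Function.update w₁ v (w₁ v + b₁)) χ R := by
  have h0 : ∀ χ : ℕ → Bool, ∑ x ∈ X, ∑ y ∈ R, (if e x y ∧ χ x ≠ χ y then 1 else 0)
      = if χ v then #X - ones χ X else ones χ X := fun χ => by
    rw [← card_ne_true, card_filter]
    refine sum_congr rfl fun x hx => ?_
    rw [sum_eq_single_of_mem v hv fun y hy hne => ?_]
    · simp [(hon x hx v hv).2 rfl]
    · rw [if_neg fun hc => hne ((hon x hx y hy).1 hc.1)]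
  constructor
  · rintro ⟨χ, hχ⟩
    refine ⟨χ, hχ.trans ?_⟩
    rw [val_union hsym hd, h0, val_update χ hv]
    have := h.le χ
    have := hb₀.1 _ (ones_le χ X)
    have := hb₁.1 _ (ones_le χ X)
    simp only at *
    split_ifs <;> omega
  · rintro ⟨χ, hχ⟩
    have hvX : v ∉ X := disjoint_right.1 hd hv
    have key : ∃ χ' : ℕ → Bool, val e w₀ w₁ χ' X
        + 2 * (if χ v then #X - ones χ' X else ones χ' X) = 2 * if χ v then b₁ else b₀ := by
      by_cases hc : χ v
      · obtain ⟨j, hj, hbj⟩ := hb₁.2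
        obtain ⟨χ', hχ', hw⟩ := h.ex j hj
        refine ⟨χ', ?_⟩
        simp only [hc, if_true]
        simp only at hbj
        rw [hw, hχ', ← hbj]; ring
      · obtain ⟨j, hj, hbj⟩ := hb₀.2
        obtain ⟨χ', hχ', hw⟩ := h.ex j hj
        refine ⟨χ', ?_⟩
        simp only [hc, if_false, Bool.false_eq_true]
        simp only at hbj
        rw [hw, hχ', ← hbj]; ring
    obtain ⟨χ', hχ'⟩ := key
    have hX : val e w₀ w₁ (fun x => if x ∈ X then χ' x else χ x) X = val e w₀ w₁ χ' X :=
      val_congr fun x hx => by simp [hx]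
    have hR : val e w₀ w₁ (fun x => if x ∈ X then χ' x else χ x) R = val e w₀ w₁ χ R :=
      val_congr fun x hx => by simp [disjoint_right.1 hd hx]
    have ho : ones (fun x => if x ∈ X then χ' x else χ x) X = ones χ' X :=
      ones_congr fun x hx => by simp [hx]
    refine ⟨fun x => if x ∈ X then χ' x else χ x, hχ.trans ?_⟩
    rw [val_update χ hv, val_union hsym hd, h0, hX, hR, ho]
    simp only [hvX, if_false]
    omega

/-- The value of a clique forest after colours of the other vertices are fixed. -/
theorem cutIn_fixed (hsym : ∀ x y, e x y = e y x) {S R : Finset ℕ} (hd : Disjoint S R)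
    {χ : ℕ → Bool}
    (h0 : ∀ x ∈ R, w₀ x = #{y ∈ S | e x y ∧ χ y = true})
    (h1 : ∀ x ∈ R, w₁ x = #{y ∈ S | e x y ∧ χ y = false}) :
    cutIn e χ (S ∪ R) = cutIn e χ S + val e w₀ w₁ χ R := by
  rw [cutIn_union hsym hd, val]
  have : ∑ x ∈ S, ∑ y ∈ R, (if e x y ∧ χ x ≠ χ y then 1 else 0)
      = ∑ x ∈ R, if χ x then w₁ x else w₀ x := by
    rw [sum_comm]
    refine sum_congr rfl fun x hx => ?_
    rw [h0 x hx, h1 x hx, card_filter, card_filter]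
    split_ifs with hc
    · refine sum_congr rfl fun y _ => ?_
      rw [hsym y x, hc]; simp
    · refine sum_congr rfl fun y _ => ?_
      rw [hsym y x]; simp [hc]
  rw [this]
  ring

end Pieces

/-! ## Reasoning about programs of the loop language -/

namespace LoopLang

open Finset

infixr:65 " ;; " => Cmd.seq

instance : Coe Var Exp := ⟨Exp.var⟩
instance (m : ℕ) : OfNat Exp m := ⟨Exp.lit m⟩
instance : CoeFun Arr fun _ => Exp → Exp := ⟨Exp.get⟩

def BExp.lt (e f : Exp) : BExp := .not (.le f e)
def BExp.eq (e f : Exp) : BExp := .and (.le e f) (.le f e)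
def BExp.or (b c : BExp) : BExp := .not (.and (.not b) (.not c))
/-- Adjacency of the vertices with given numbers in the order `ord`. -/
def BExp.edge (e f : Exp) : BExp := .adj (.get .ord e) (.get .ord f)
def Cmd.when (b : BExp) (c : Cmd) : Cmd := .ite b c .skip
def Cmd.loop (x : Var) (c : Cmd) : Cmd := .rep false x c

variable {E : Env} {s : St}

@[simp] theorem eval_zero : eval E 0 s = 0 := rfl
@[simp] theorem eval_one : eval E 1 s = 1 := rfl
@[simp] theorem eval_two : eval E 2 s = 2 := rfl
@[simp] theorem eval_var (x : Var) : eval E (.var x) s = s.v x := rfl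
@[simp] theorem eval_nn : eval E .nn s = E.n := rfl
@[simp] theorem eval_kk : eval E .kk s = E.k := rfl
@[simp] theorem eval_get (a : Arr) (e : Exp) : eval E (.get a e) s = s.a a (eval E e s) := rfl
@[simp] theorem eval_inc (e : Exp) : eval E (.inc e) s = eval E e s + 1 := rfl
@[simp] theorem eval_add (e f : Exp) :
    eval E (.add e f) s = min (eval E e s + eval E f s) E.cap := rfl
@[simp] theorem eval_sub (e f : Exp) : eval E (.sub e f) s = eval E e s - eval E f s := rfl
@[simp] theorem evalB_le (e f : Exp) :
    evalB E (.le e f) s = true ↔ eval E e s ≤ eval E f s := decide_eq_true_iff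
@[simp] theorem evalB_not (b : BExp) : evalB E (.not b) s = true ↔ ¬ evalB E b s = true := by
  simp [evalB]
@[simp] theorem evalB_and (b c : BExp) :
    evalB E (.and b c) s = true ↔ evalB E b s = true ∧ evalB E c s = true := by
  simp [evalB]
@[simp] theorem evalB_adj (e f : Exp) :
    evalB E (.adj e f) s = true ↔ E.rel id (eval E e s) (eval E f s) = true := Iff.rfl
@[simp] theorem evalB_lt (e f : Exp) :
    evalB E (.lt e f) s = true ↔ eval E e s < eval E f s := by
  simp [BExp.lt]
@[simp] theorem evalB_eq (e f : Exp) :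
    evalB E (.eq e f) s = true ↔ eval E e s = eval E f s := by
  rw [BExp.eq, evalB_and, evalB_le, evalB_le, le_antisymm_iff]
@[simp] theorem evalB_or (b c : BExp) :
    evalB E (.or b c) s = true ↔ evalB E b s = true ∨ evalB E c s = true := by
  simp only [BExp.or, evalB_not, evalB_and]
  tauto
@[simp] theorem evalB_edge (e f : Exp) :
    evalB E (.edge e f) s = true ↔ E.rel (s.a .ord) (eval E e s) (eval E f s) = true := Iff.rfl

@[simp] theorem run_skip : run E .skip s = s := rfl
@[simp] theorem run_set (x : Var) (e : Exp) : run E (.set x e) s = s.setV x (eval E e s) := rfl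
@[simp] theorem run_put (a : Arr) (e f : Exp) :
    run E (.put a e f) s = s.setA a (eval E e s) (eval E f s) := rfl
@[simp] theorem run_seq (c d : Cmd) : run E (c ;; d) s = run E d (run E c s) := rfl
@[simp] theorem run_ite (b : BExp) (c d : Cmd) :
    run E (.ite b c d) s = if evalB E b s then run E c s else run E d s := rfl
@[simp] theorem run_when (b : BExp) (c : Cmd) :
    run E (.when b c) s = if evalB E b s then run E c s else s := rfl

/-! ### Variables and arrays that a command leaves alone -/

def Cmd.wv : Cmd → Var → Bool
  | .skip, _ => false
  | .set x _, y => decide (y = x)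
  | .put .., _ => false
  | .seq c d, y => c.wv y || d.wv y
  | .ite _ c d, y => c.wv y || d.wv y
  | .rep _ x c, y => decide (y = x) || c.wv y

def Cmd.wa : Cmd → Arr → Bool
  | .skip, _ => false
  | .set .., _ => false
  | .put a _ _, b => decide (b = a)
  | .seq c d, b => c.wa b || d.wa b
  | .ite _ c d, b => c.wa b || d.wa b
  | .rep _ _ c, b => c.wa b

/-- The states agree except for what `c` may change. -/
structure Fr (c : Cmd) (s s' : St) : Prop where
  v : ∀ y, c.wv y = false → s'.v y = s.v y
  a : ∀ b, c.wa b = false → s'.a b = s.a b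

theorem Fr.refl (c : Cmd) (s : St) : Fr c s s := ⟨fun _ _ => rfl, fun _ _ => rfl⟩

theorem Fr.trans {c : Cmd} {s s' s'' : St} (h : Fr c s s') (h' : Fr c s' s'') : Fr c s s'' :=
  ⟨fun y hy => (h'.v y hy).trans (h.v y hy), fun b hb => (h'.a b hb).trans (h.a b hb)⟩

theorem Fr.mono {c d : Cmd} {s s' : St} (h : Fr c s s') (hv : ∀ y, d.wv y = false → c.wv y = false)
    (ha : ∀ b, d.wa b = false → c.wa b = false) : Fr d s s' :=
  ⟨fun y hy => h.v y (hv y hy), fun b hb => h.a b (ha b hb)⟩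

theorem iter_fr {q : Bool} {x : Var} {c : Cmd} (hc : ∀ s, Fr c s (run E c s)) (s : St) (m : ℕ) :
    Fr (.rep q x c) s (iter (fun j s => run E c (s.setV x j)) m s) := by
  induction m with
  | zero => exact .refl _ _
  | succ m ih =>
    refine ih.trans ⟨fun y hy => ?_, fun b hb => ?_⟩
    · simp only [Cmd.wv, Bool.or_eq_false_iff, decide_eq_false_iff_not] at hy
      simp only [iter]
      rw [(hc _).v y hy.2]
      simp [hy.1]
    · simp only [iter]
      rw [(hc _).a b hb]
      rfl

theorem run_fr (c : Cmd) : ∀ s, Fr c s (run E c s) := by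
  induction c with
  | skip => exact fun s => .refl _ _
  | set x e =>
    exact fun s => ⟨fun y hy => by simp [of_decide_eq_false hy], fun _ _ => rfl⟩
  | put a e f =>
    exact fun s => ⟨fun _ _ => rfl, fun b hb => St.setA_ne _ _ _ (of_decide_eq_false hb)⟩
  | seq c d hc hd =>
    intro s
    refine Fr.trans ((hc s).mono ?_ ?_) ((hd _).mono ?_ ?_) <;>
      simp +contextual [Cmd.wv, Cmd.wa]
  | ite b c d hc hd =>
    intro s
    rw [run_ite]
    split_ifs
    · refine (hc s).mono ?_ ?_ <;> simp +contextual [Cmd.wv, Cmd.wa]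
    · refine (hd s).mono ?_ ?_ <;> simp +contextual [Cmd.wv, Cmd.wa]
  | rep q x c hc => exact fun s => iter_fr hc s _

/-- The rule for loops. -/
theorem rep_inv {q : Bool} {x : Var} {c : Cmd} (I : ℕ → St → Prop) (h0 : I 0 s)
    (hs : ∀ j < E.bound q, ∀ s', Fr (.rep q x c) s s' → I j s' → I (j + 1) (run E c (s'.setV x j))) :
    I (E.bound q) (run E (.rep q x c) s) := by
  have : ∀ m ≤ E.bound q, I m (iter (fun j s => run E c (s.setV x j)) m s) := by
    intro m
    induction m with
    | zero => exact fun _ => h0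
    | succ m ih => exact fun hm => hs m hm _ (iter_fr (run_fr c) s m) (ih (by omega))
  exact this _ le_rfl

theorem loop_inv {x : Var} {c : Cmd} (I : ℕ → St → Prop) (h0 : I 0 s)
    (hs : ∀ j < E.n, ∀ s', Fr (.loop x c) s s' → I j s' → I (j + 1) (run E c (s'.setV x j))) :
    I E.n (run E (.loop x c) s) :=
  rep_inv (q := false) I h0 hs

/-! ### Common loops -/

/-- `b` has the value `p j` if the variable `x` is set to `j`, whatever the variables outside `l`
are. -/
def Tests (E : Env) (s : St) (x : Var) (l : List Var) (b : BExp) (p : ℕ → Prop) : Prop :=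
  ∀ j < E.n, ∀ s' : St, s'.a = s.a → (∀ y, y ∉ l → y ≠ x → s'.v y = s.v y) →
    (evalB E b (s'.setV x j) = true ↔ p j)

/-- `c := c + 1` for all `x` with `b`. -/
def countC (x : Var) (b : BExp) (c : Var) : Cmd :=
  .set c 0 ;; .loop x (.when b (.set c (.inc c)))

theorem card_range_succ (p : ℕ → Prop) [DecidablePred p] (j : ℕ) :
    #{i ∈ range (j + 1) | p i} = #{i ∈ range j | p i} + if p j then 1 else 0 := by
  rw [range_add_one, filter_insert]
  split_ifs
  · rw [card_insert_of_notMem (by simp)]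
  · rfl

theorem count_spec {x c : Var} {b : BExp} {p : ℕ → Prop} [DecidablePred p] (hxc : x ≠ c)
    (hb : Tests E s x [c] b p) : (run E (countC x b c) s).v c = #{j ∈ range E.n | p j} := by
  rw [countC, run_seq]
  refine loop_inv (fun j s' => s'.v c = #{i ∈ range j | p i}) (by simp) fun j hj s' hf hI => ?_
  have ha : s'.a = s.a := by
    funext a
    rw [hf.a a (by rfl)]; rfl
  have hv : ∀ y, y ∉ [c] → y ≠ x → s'.v y = s.v y := fun y hy hyx => by
    rw [hf.v y (by simp at hy; simp [Cmd.loop, Cmd.when, Cmd.wv, hy, hyx])]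
    simp at hy
    simp [hy]
  have h := hb j hj s' ha hv
  simp only [run_when, run_set, card_range_succ]
  by_cases hp : p j
  · simp [h.2 hp, hp, hxc.symm, hI]
  · have : ¬ evalB E b (s'.setV x j) = true := fun hh => hp (h.1 hh)
    simp [this, hp, hxc.symm, hI]

/-- `z := x` for all `x` with `b`. -/
def findC (x : Var) (b : BExp) (z : Var) : Cmd := .loop x (.when b (.set z x))

theorem find_spec {x z : Var} {b : BExp} {p : ℕ → Prop} (hxz : x ≠ z)
    (hb : Tests E s x [z] b p) :
    ((run E (findC x b z) s).v z = s.v z ∧ ∀ j < E.n, ¬ p j) ∨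
      (run E (findC x b z) s).v z < E.n ∧ p ((run E (findC x b z) s).v z) := by
  rw [findC]
  refine loop_inv (fun j s' => (s'.v z = s.v z ∧ ∀ i < j, ¬ p i) ∨ s'.v z < E.n ∧ p (s'.v z))
    (by simp) fun j hj s' hf hI => ?_
  have ha : s'.a = s.a := by
    funext a
    rw [hf.a a (by rfl)]
  have hv : ∀ y, y ∉ [z] → y ≠ x → s'.v y = s.v y := fun y hy hyx => by
    rw [hf.v y (by simp at hy; simp [Cmd.loop, Cmd.when, Cmd.wv, hy, hyx])]
  have h := hb j hj s' ha hv
  simp only [run_when, run_set]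
  by_cases hp : p j
  · simp [h.2 hp, hp, hj]
  · have : ¬ evalB E b (s'.setV x j) = true := fun hh => hp (h.1 hh)
    simp only [this, St.setV_v, hxz.symm, if_false, Bool.false_eq_true]
    refine hI.imp_left fun hI => ⟨hI.1, fun i hi => ?_⟩
    rcases Nat.lt_succ_iff_lt_or_eq.1 hi with hi | rfl
    exacts [hI.2 i hi, hp]

/-- `c := 1` if `b` for some `x`. -/
def anyC (x : Var) (b : BExp) (c : Var) : Cmd :=
  .set c 0 ;; .loop x (.when b (.set c 1))

theorem any_spec {x c : Var} {b : BExp} {p : ℕ → Prop} (hxc : x ≠ c)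
    (hb : Tests E s x [c] b p) : (run E (anyC x b c) s).v c = 1 ∧ (∃ j < E.n, p j) ∨
      (run E (anyC x b c) s).v c = 0 ∧ ∀ j < E.n, ¬ p j := by
  rw [anyC, run_seq]
  refine loop_inv (fun j s' => s'.v c = 1 ∧ (∃ i < E.n, p i) ∨ s'.v c = 0 ∧ ∀ i < j, ¬ p i)
    (by simp) fun j hj s' hf hI => ?_
  have ha : s'.a = s.a := by
    funext a
    rw [hf.a a (by rfl)]; rfl
  have hv : ∀ y, y ∉ [c] → y ≠ x → s'.v y = s.v y := fun y hy hyx => by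
    rw [hf.v y (by simp at hy; simp [Cmd.loop, Cmd.when, Cmd.wv, hy, hyx])]
    simp at hy
    simp [hy]
  have h := hb j hj s' ha hv
  simp only [run_when, run_set]
  by_cases hp : p j
  · simp only [h.2 hp, if_true]
    exact Or.inl ⟨by simp, j, hj, hp⟩
  · have : ¬ evalB E b (s'.setV x j) = true := fun hh => hp (h.1 hh)
    simp only [this, St.setV_v, hxc.symm, if_false, Bool.false_eq_true]
    refine hI.imp_right fun hI => ⟨hI.1, fun i hi => ?_⟩
    rcases Nat.lt_succ_iff_lt_or_eq.1 hi with hi | rfl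
    exacts [hI.2 i hi, hp]

/-- Store `f` at `x` for all `x` with `b`. -/
def fillC (x : Var) (b : BExp) (a : Arr) (f : Exp) : Cmd := .loop x (.when b (.put a x f))

theorem fill_spec {x : Var} {b : BExp} {a : Arr} {f : Exp} {p : ℕ → Prop} [DecidablePred p]
    {g : ℕ → ℕ}
    (hb : ∀ j < E.n, ∀ s' : St, (∀ c, c ≠ a → s'.a c = s.a c) → s'.a a j = s.a a j →
      (∀ y, y ≠ x → s'.v y = s.v y) →
      (evalB E b (s'.setV x j) = true ↔ p j) ∧ (p j → eval E f (s'.setV x j) = g j)) (i : ℕ) :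
    (run E (fillC x b a f) s).a a i = if i < E.n ∧ p i then g i else s.a a i := by
  rw [fillC]
  revert i
  refine loop_inv (fun j s' => ∀ i, s'.a a i = if i < j ∧ p i then g i else s.a a i)
    (by simp) fun j hj s' hf hI i => ?_
  have h := hb j hj s' (fun c hc => hf.a c (by simp [Cmd.loop, Cmd.when, Cmd.wa, hc]))
    (by rw [hI]; simp) fun y hy => hf.v y (by simp [Cmd.loop, Cmd.when, Cmd.wv, hy])
  simp only [run_when, run_put]
  by_cases hp : p j
  · simp only [h.1.2 hp, if_true, h.2 hp, eval_var, St.setV_v, St.setA_a, true_and, St.setV_a, hI]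
    by_cases hi : i = j
    · simp [hi, hp]
    · simp only [hi, if_false]
      simp only [show i < j + 1 ↔ i < j by omega]
  · have : ¬ evalB E b (s'.setV x j) = true := fun hh => hp (h.1.1 hh)
    simp only [this, if_false, Bool.false_eq_true, St.setV_a, hI]
    by_cases hi : i = j
    · simp [hi, hp]
    · simp only [show i < j + 1 ↔ i < j by omega]

/-! ### Syntactic cost bounds -/

/-- No exponentially long loops, and loops are nested at most `d` deep. -/
def Cmd.deg : Cmd → ℕ
  | .seq c d => max c.deg d.deg
  | .ite _ c d => max c.deg d.deg
  | .rep _ _ c => c.deg + 1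
  | _ => 0

def Cmd.poly : Cmd → Bool
  | .seq c d => c.poly && d.poly
  | .ite _ c d => c.poly && d.poly
  | .rep q _ c => !q && c.poly
  | _ => true

def Cmd.wt : Cmd → ℕ
  | .skip => 0
  | .set _ e => ew e + 1
  | .put _ e f => ew e + ew f + 10
  | .seq c d => c.wt + d.wt
  | .ite b c d => bw b + 4 + c.wt + d.wt
  | .rep _ _ c => c.wt + 7

theorem cost_le (hn : 1 ≤ E.n) (c : Cmd) (hc : c.poly = true) {d : ℕ} (hd : c.deg ≤ d) (s : St) :
    cost E c s ≤ c.wt * E.n ^ d := by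
  induction c generalizing d s with
  | skip => simp [cost]
  | set x e => exact Nat.le_mul_of_pos_right _ (Nat.pow_pos hn)
  | put a e f => exact Nat.le_mul_of_pos_right _ (Nat.pow_pos hn)
  | seq c c' h h' =>
    simp only [Cmd.poly, Bool.and_eq_true, Cmd.deg, max_le_iff] at hc hd
    simp only [cost, Cmd.wt, add_mul]
    exact Nat.add_le_add (h hc.1 hd.1 s) (h' hc.2 hd.2 _)
  | ite b c c' h h' =>
    simp only [Cmd.poly, Bool.and_eq_true, Cmd.deg, max_le_iff] at hc hd
    simp only [cost, Cmd.wt, add_mul]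
    have h1 := h hc.1 hd.1 s
    have h2 := h' hc.2 hd.2 s
    have h3 : 1 ≤ E.n ^ d := Nat.pow_pos hn
    have h4 : bw b ≤ bw b * E.n ^ d := Nat.le_mul_of_pos_right _ h3
    split_ifs <;> omega
  | rep q x c h =>
    simp only [Cmd.poly, Bool.and_eq_true, Cmd.deg, Bool.not_eq_true'] at hc hd
    obtain ⟨rfl, hc⟩ := hc
    obtain ⟨d, rfl⟩ : ∃ d', d = d' + 1 := ⟨d - 1, by omega⟩
    simp only [cost, Cmd.wt]
    have h3 : 1 ≤ E.n ^ d := Nat.pow_pos hn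
    have h4 : 1 ≤ E.n ^ (d + 1) := Nat.pow_pos hn
    calc 2 + ∑ j ∈ range (E.bound false),
          (cost E c ((iter (fun j s => run E c (s.setV x j)) j s).setV x j) + 5)
        ≤ 2 * E.n ^ (d + 1) + ∑ j ∈ range E.n, (c.wt * E.n ^ d + 5 * E.n ^ d) :=
          Nat.add_le_add (by omega) (sum_le_sum fun j _ =>
            Nat.add_le_add (h hc (by omega) _) (by omega))
      _ = (c.wt + 7) * E.n ^ (d + 1) := by
          rw [sum_const, card_range, smul_eq_mul]; ring

end LoopLang

/-! ## Ordering the vertices -/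

namespace LoopLang

open Finset

variable {E : Env} {s : St}

section
open Var Arr

/-- Search for a pair of vertices with `b`. -/
def find2C (b : BExp) : Cmd :=
  .set fd 0 ;; .loop x (.loop y (.when b (.set px x ;; .set py y ;; .set fd 1)))

def newNbr : BExp := .and (.eq (vis x) 0) (.and (.eq (vis y) 1) (.adj x y))

/-- Choose as the `i`-th vertex a new neighbour of an old vertex. -/
def orderStep : Cmd :=
  .set px 0 ;; find2C newNbr ;;
  .put ord i px ;; .put vis px 1

def order : Cmd := .loop i orderStep

/-- The smallest neighbour of every vertex, or `n`. -/
def lowest : Cmd :=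
  .loop x (.put mn x .nn ;; .loop y (.set z (.sub (.sub .nn 1) y) ;; .when (.edge x z) (.put mn x z)))

end

theorem find2_spec {b : BExp} {p : ℕ → ℕ → Prop}
    (hb : ∀ j < E.n, ∀ l < E.n, ∀ s' : St, s'.a = s.a →
      (∀ y, y ≠ .fd → y ≠ .px → y ≠ .py → y ≠ .x → y ≠ .y → s'.v y = s.v y) →
      (evalB E b ((s'.setV .x j).setV .y l) = true ↔ p j l)) :
    ((run E (find2C b) s).v .fd = 1 ∧ (run E (find2C b) s).v .px < E.n ∧
      (run E (find2C b) s).v .py < E.n ∧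
      p ((run E (find2C b) s).v .px) ((run E (find2C b) s).v .py)) ∨
    ((run E (find2C b) s).v .fd = 0 ∧ (run E (find2C b) s).v .px = s.v .px ∧
      ∀ j < E.n, ∀ l < E.n, ¬ p j l) := by
  rw [find2C, run_seq]
  let Found (s' : St) : Prop := s'.v .fd = 1 ∧ s'.v .px < E.n ∧ s'.v .py < E.n ∧
    p (s'.v .px) (s'.v .py)
  refine loop_inv (fun j s' => Found s' ∨ (s'.v .fd = 0 ∧ s'.v .px = s.v .px ∧
    ∀ i < j, ∀ l < E.n, ¬ p i l)) (by simp) fun j hj s₁ hf₁ h₁ => ?_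
  refine (loop_inv (fun l s' => Found s' ∨ (s'.v .fd = 0 ∧ s'.v .px = s.v .px ∧
    (∀ i < j, ∀ l < E.n, ¬ p i l) ∧ ∀ l' < l, ¬ p j l')) ?_ fun l hl s₂ hf₂ h₂ => ?_).imp_right ?_
  · refine h₁.imp (by simp [Found]) ?_
    rintro ⟨h1, h2, h3⟩
    exact ⟨by simpa using h1, by simpa using h2, h3, by simp⟩
  · have hb' := hb j hj l hl s₂ (by
      funext c
      rw [hf₂.a c rfl, St.setV_a, hf₁.a c rfl]; rfl) (fun y h1 h2 h3 h4 h5 => by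
      rw [hf₂.v y (by simp [Cmd.loop, Cmd.when, Cmd.wv, *]), St.setV_v, if_neg h4,
        hf₁.v y (by simp [Cmd.loop, Cmd.when, Cmd.wv, *])]
      simp [h1])
    have hx : s₂.v .x = j := by rw [hf₂.v .x rfl]; simp
    rw [show (s₂.setV .x j) = s₂ by
      rw [← hx]
      cases s₂
      simp only [St.setV, St.mk.injEq, and_true]
      funext y
      split_ifs with h
      · rw [h]
      · rfl] at hb'
    simp only [run_when]
    by_cases hp : p j l
    · rw [if_pos (hb'.2 hp)]
      left
      simp [Found, hx, hj, hl, hp]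
    · rw [if_neg fun h => hp (hb'.1 h)]
      refine h₂.imp (by simp [Found]) ?_
      rintro ⟨h1, h2, h3, h4⟩
      refine ⟨by simpa using h1, by simpa using h2, h3, fun l' hl' => ?_⟩
      rcases Nat.lt_succ_iff_lt_or_eq.1 hl' with hl' | rfl
      exacts [h4 l' hl', hp]
  · rintro ⟨h1, h2, h3, h4⟩
    refine ⟨h1, h2, fun i hi => ?_⟩
    rcases Nat.lt_succ_iff_lt_or_eq.1 hi with hi | rfl
    exacts [h3 i hi, h4]

/-- `o` lists the vertices, each one except for the first after one of its neighbours. -/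
structure IsOrder (E : Env) (o : ℕ → ℕ) : Prop where
  lt : ∀ i < E.n, o i < E.n
  inj : ∀ i < E.n, ∀ j < E.n, o i = o j → i = j
  prev : ∀ i < E.n, 0 < i → ∃ j < i, E.rel o i j = true

theorem exists_edge_out {A : ℕ → ℕ → Bool} {n : ℕ}
    (hc : ∀ S : Finset ℕ, S ⊆ range n → S.Nonempty → S ≠ range n →
      ∃ x ∈ range n, x ∉ S ∧ ∃ y ∈ S, A x y = true) {o : ℕ → ℕ} {j : ℕ} (hj : 0 < j) (hjn : j < n)
    (ho : ∀ i < j, o i < n) : ∃ x < n, (∀ i < j, o i ≠ x) ∧ ∃ i < j, A x (o i) = true := by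
  obtain ⟨x, hx, hxS, y, hy, hxy⟩ := hc ((range j).image o)
    (fun x hx => by
      obtain ⟨i, hi, rfl⟩ := mem_image.1 hx
      exact mem_range.2 (ho i (mem_range.1 hi)))
    ⟨o 0, mem_image.2 ⟨0, by simpa using hj, rfl⟩⟩
    (fun h => by
      have := card_image_le (s := range j) (f := o)
      rw [h, card_range, card_range] at this
      omega)
  obtain ⟨i, hi, rfl⟩ := mem_image.1 hy
  refine ⟨x, mem_range.1 hx, fun i' hi' h => hxS (mem_image.2 ⟨i', by simpa using hi', h⟩), i,
    mem_range.1 hi, hxy⟩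

theorem order_spec (hc : ∀ S : Finset ℕ, S ⊆ range E.n → S.Nonempty → S ≠ range E.n →
      ∃ x ∈ range E.n, x ∉ S ∧ ∃ y ∈ S, E.A x y = true) (hs : ∀ x, s.a .vis x = 0) :
    IsOrder E ((run E order s).a .ord) := by
  have key : ∀ o : ℕ → ℕ, (∀ i < E.n, o i < E.n) → ∀ i < E.n, ∀ j < E.n,
      E.rel o i j = E.A (o i) (o j) := fun o ho i hi j hj => by
    have := ho i hi
    have := ho j hj
    simp only [Env.rel]
    rw [min_eq_left (by omega), min_eq_left (by omega)]
  rw [order]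
  have := loop_inv (E := E) (s := s) (x := .i) (c := orderStep) (fun j s' =>
    (∀ i < j, s'.a .ord i < E.n) ∧
    (∀ i < j, ∀ i' < j, s'.a .ord i = s'.a .ord i' → i = i') ∧
    (∀ i < j, 0 < i → ∃ l < i, E.A (s'.a .ord i) (s'.a .ord l) = true) ∧
    (∀ x, s'.a .vis x = 1 ∧ (∃ i < j, s'.a .ord i = x) ∨
      s'.a .vis x = 0 ∧ ∀ i < j, s'.a .ord i ≠ x)) ?_ ?_
  · obtain ⟨h1, h2, h3, -⟩ := this
    refine ⟨h1, h2, fun i hi hi0 => ?_⟩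
    obtain ⟨l, hl, h⟩ := h3 i hi hi0
    exact ⟨l, hl, by rwa [key _ h1 i hi l (by omega)]⟩
  · simp [hs]
  · intro j hj s₁ hf₁ ⟨h1, h2, h3, h4⟩
    rw [orderStep, run_seq, run_seq, run_seq]
    set s₂ := run E (.set .px 0) (s₁.setV .i j) with hs₂
    have hfind := find2_spec (E := E) (s := s₂)
      (b := newNbr)
      (p := fun x y => s₁.a .vis x = 0 ∧ s₁.a .vis y = 1 ∧ E.rel id x y = true)
      (fun x hx y hy s' ha hv => by simp [newNbr, ha, hs₂])
    set s₃ := run E (find2C _) s₂ with hs₃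
    have hfr := run_fr (E := E) (find2C newNbr) s₂
    rw [← hs₃] at hfr
    have hord : s₃.a .ord = s₁.a .ord := by rw [hfr.a .ord rfl]; rfl
    have hvis : s₃.a .vis = s₁.a .vis := by rw [hfr.a .vis rfl]; rfl
    have hi : s₃.v .i = j := by rw [hfr.v .i rfl, hs₂]; simp
    have hnew : s₃.v .px < E.n ∧ (∀ i < j, s₁.a .ord i ≠ s₃.v .px) ∧
        (0 < j → ∃ i < j, E.A (s₃.v .px) (s₁.a .ord i) = true) := by
      rcases hfind with ⟨-, h5, h6, h7, h8, h9⟩ | ⟨-, h5, h6⟩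
      · simp only [Env.rel, id] at h9
        rw [min_eq_left (by omega), min_eq_left (by omega)] at h9
        refine ⟨h5, ?_, fun _ => ?_⟩
        · rcases h4 (s₃.v .px) with h | h
          · omega
          · exact h.2
        · rcases h4 (s₃.v .py) with ⟨-, i, hi, h⟩ | h
          · exact ⟨i, hi, by rwa [h]⟩
          · omega
      · have h0 : s₃.v .px = 0 := by rw [h5, hs₂]; simp
        rcases Nat.eq_zero_or_pos j with rfl | hj0
        · rw [h0]
          exact ⟨hj, by simp, by simp⟩
        · exfalso
          obtain ⟨x, hx, hxo, i, hi, hxi⟩ := exists_edge_out hc hj0 hj h1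
          refine h6 x hx (s₁.a .ord i) (h1 i hi) ⟨?_, ?_, ?_⟩
          · rcases h4 x with ⟨-, i, hi, h⟩ | h
            · exact absurd h (hxo i hi)
            · exact h.1
          · rcases h4 (s₁.a .ord i) with h | h
            · exact h.1
            · exact absurd rfl (h.2 i hi)
          · have := h1 i hi
            simp only [Env.rel, id]
            rwa [min_eq_left (by omega), min_eq_left (by omega)]
    clear_value s₃
    obtain ⟨h5, h6, h7⟩ := hnew
    have hfin : ∀ i, (run E (.put .vis (.var .px) 1) (run E (.put .ord (.var .i) (.var .px)) s₃)).a .ord i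
        = if i = j then s₃.v .px else s₁.a .ord i := fun i => by simp [hi, hord]
    have hfin' : ∀ x, (run E (.put .vis (.var .px) 1) (run E (.put .ord (.var .i) (.var .px)) s₃)).a .vis x
        = if x = s₃.v .px then 1 else s₁.a .vis x := fun i => by simp [hvis]
    simp only [hfin, hfin']
    refine ⟨fun i hi => ?_, fun i hi i' hi' h => ?_, fun i hi hi0 => ?_, fun x => ?_⟩
    · split_ifs
      exacts [h5, h1 i (by omega)]
    · split_ifs at h with e1 e2 e2
      · omega
      · exact absurd h.symm (h6 i' (by omega))
      · exact absurd h (h6 i (by omega))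
      · exact h2 i (by omega) i' (by omega) h
    · rcases Nat.lt_succ_iff_lt_or_eq.1 hi with hi' | rfl
      · obtain ⟨l, hl, h⟩ := h3 i hi' hi0
        refine ⟨l, hl, ?_⟩
        rwa [if_neg (by omega), if_neg (by omega)]
      · obtain ⟨l, hl, h⟩ := h7 hi0
        refine ⟨l, hl, ?_⟩
        rwa [if_pos rfl, if_neg (by omega)]
    · by_cases hx : x = s₃.v .px
      · left
        exact ⟨by simp [hx], j, by omega, by simp [hx]⟩
      · simp only [hx, if_false]
        refine (h4 x).imp (fun ⟨h, i, hi, h'⟩ => ⟨h, i, by omega, ?_⟩) fun ⟨h, h'⟩ =>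
          ⟨h, fun i hi => ?_⟩
        · rwa [if_neg (by omega)]
        · split_ifs with hij
          · exact fun h => hx h.symm
          · exact h' i (by omega)

theorem lowest_spec : ∀ x < E.n, ∀ b ≤ E.n, (run E lowest s).a .mn x < b ↔
    ∃ y < b, E.rel (s.a .ord) x y = true := by
  rw [lowest]
  refine loop_inv (fun j s' => ∀ x < j, ∀ b ≤ E.n, s'.a .mn x < b ↔
    ∃ y < b, E.rel (s.a .ord) x y = true) (by simp) fun j hj s₁ hf₁ h₁ => ?_
  rw [run_seq]
  have := loop_inv (E := E) (s := run E (.put .mn (.var .x) .nn) (s₁.setV .x j)) (x := .y)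
    (c := .set .z (.sub (.sub .nn 1) (.var .y)) ;;
      .when (.edge (.var .x) (.var .z)) (.put .mn (.var .x) (.var .z)))
    (fun l s' => (∀ x, x ≠ j → s'.a .mn x = s₁.a .mn x) ∧ ∀ b ≤ E.n, s'.a .mn j < b ↔
      ∃ y < b, E.n - l ≤ y ∧ E.rel (s.a .ord) j y = true) ?_ ?_
  · intro x hx b hb
    rcases Nat.lt_succ_iff_lt_or_eq.1 hx with hx | rfl
    · rw [← h₁ x hx b hb, ← this.1 x (by omega)]
    · simpa using this.2 b hb
  · refine ⟨fun x hx => by simp [hx], fun b hb => ?_⟩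
    simp only [run_put, eval_var, St.setV_v, if_true, eval_nn, St.setA_a, and_self]
    constructor
    · intro h; omega
    · rintro ⟨y, hy, hy', -⟩; omega
  · intro l hl s₂ hf₂ ⟨h2, h3⟩
    have hx : s₂.v .x = j := by rw [hf₂.v .x rfl]; simp
    have ho : s₂.a .ord = s.a .ord := by
      rw [hf₂.a .ord rfl, run_put, St.setA_ne _ _ _ (show Arr.ord ≠ .mn by decide), St.setV_a, hf₁.a .ord rfl]
    simp only [run_seq, run_set, run_when, evalB_edge, eval_sub, eval_nn, eval_one, eval_var,
      St.setV_v, St.setV_a, run_put, if_true, hx, ho, reduceCtorEq, if_false]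
    split_ifs with hr
    · refine ⟨fun x hx => by simp [hx, h2], fun b hb => ?_⟩
      simp only [St.setA_a, and_self, if_true]
      constructor
      · intro h
        exact ⟨_, h, by omega, hr⟩
      · rintro ⟨y, hy, hy', -⟩; omega
    · refine ⟨h2, fun b hb => ?_⟩
      simp only [St.setV_a, h3 b hb]
      refine exists_congr fun y => and_congr_right fun hy => ⟨fun ⟨h, h'⟩ => ⟨by omega, h'⟩, fun ⟨h, h'⟩ => ⟨?_, h'⟩⟩
      by_contra hc
      obtain rfl : y = E.n - 1 - l := by omega
      exact hr h'

end LoopLang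

/-! ## The stages of the decomposition -/

namespace Pieces

open Finset

variable {n : ℕ} {e : ℕ → ℕ → Bool} {D D' : Data} {pc pc' comp : ℕ → ℕ} {b u : ℕ}

/-- `x` has a neighbour below `b`. -/
def Low (e : ℕ → ℕ → Bool) (b x : ℕ) : Prop := ∃ z < b, e x z = true

/-- The remaining vertices from `b` on. -/
def active (n : ℕ) (pc : ℕ → ℕ) (b : ℕ) : Finset ℕ := {x ∈ range n | b ≤ x ∧ pc x = 0}

/-- The component with number `r`. -/
def cls (n : ℕ) (pc comp : ℕ → ℕ) (b r : ℕ) : Finset ℕ := {x ∈ active n pc b | comp x = r}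

theorem mem_active {x : ℕ} : x ∈ active n pc b ↔ x < n ∧ b ≤ x ∧ pc x = 0 := by
  simp [active]

theorem mem_cls {r x : ℕ} : x ∈ cls n pc comp b r ↔ x ∈ active n pc b ∧ comp x = r := by
  simp [cls]

/-- The remaining vertices from `b` on form a disjoint union of cliques, with numbers `comp`, each
of which has a neighbour below `b`. -/
structure Stage (n : ℕ) (e : ℕ → ℕ → Bool) (pc comp : ℕ → ℕ) (b : ℕ) : Prop where
  zero : ∀ x < b, pc x = 0
  eq : ∀ x ∈ active n pc b, ∀ y ∈ active n pc b, (comp x = comp y ↔ x = y ∨ e x y = true)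
  num : ∀ x ∈ active n pc b, b ≤ comp x ∧ comp x < n
  low : ∀ x ∈ active n pc b, ∃ y ∈ active n pc b, comp y = comp x ∧ Low e b y

/-- A component is ready for vertex `u` if it has a neighbour below `u` and, unless it is a single
vertex, two vertices with neighbours up to `u`. -/
def Ready (e : ℕ → ℕ → Bool) (u : ℕ) (Q : Finset ℕ) : Prop :=
  (Q.Nonempty → ∃ y ∈ Q, Low e u y) ∧
  (2 ≤ #Q → ∃ y ∈ Q, ∃ z ∈ Q, y ≠ z ∧ Low e (u + 1) y ∧ Low e (u + 1) z)

/-- The clique `X` becomes a new piece, attached to `v`. -/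
structure Carve (e : ℕ → ℕ → Bool) (D D' : Data) (X : Finset ℕ) (v : ℕ) : Prop where
  top : D'.top = D.top + 1
  pc : ∀ x, D'.pc x = if x ∈ X then D.top + 1 else D.pc x
  att : ∀ x, D'.att x = if x ∈ X then v + 1 else D.att x
  side : ∀ x ∉ X, D'.side x = D.side x
  split : Split e D'.side v X
  mark : ∀ x, D'.mark x = if x = v ∧ ∃ y ∈ X, ¬ e v y then 1 else D.mark x

theorem Carve.step {X : Finset ℕ} {v : ℕ} (h : Carve e D D' X v) (hX : X.Nonempty)
    (hX' : X ⊆ active n D.pc b) : Step n D D' X where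
  nonempty := hX
  lt x hx := (mem_active.1 (hX' hx)).1
  free x hx := (mem_active.1 (hX' hx)).2.2
  pc := h.pc
  top := h.top
  side := h.side
  side_le := h.split.le
  att x hx := by rw [h.att, if_neg hx]
  mark x hx := by
    rw [h.mark] at hx
    split_ifs at hx
    exact hx

theorem Low.mono {b b' x : ℕ} (h : Low e b x) (hb : b ≤ b') : Low e b' x :=
  h.imp fun _ h => ⟨h.1.trans_le hb, h.2⟩

theorem low_succ {u x : ℕ} : Low e (u + 1) x ↔ Low e u x ∨ e x u = true := by
  constructor
  · rintro ⟨z, hz, h⟩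
    rcases Nat.lt_succ_iff_lt_or_eq.1 hz with hz | rfl
    exacts [.inl ⟨z, hz, h⟩, .inr h]
  · rintro (h | h)
    exacts [h.mono (by omega), ⟨u, by omega, h⟩]

theorem active_carve {X : Finset ℕ} {t : ℕ} (ht : t ≠ 0)
    (hpc : ∀ x, pc' x = if x ∈ X then t else pc x) :
    active n pc' b = active n pc b \ X := by
  ext x
  simp only [mem_sdiff, mem_active, hpc]
  by_cases hx : x ∈ X <;> simp [hx, ht]

theorem cls_carve {X : Finset ℕ} {t r : ℕ} (ht : t ≠ 0)
    (hpc : ∀ x, pc' x = if x ∈ X then t else pc x) :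
    cls n pc' comp b r = cls n pc comp b r \ X := by
  ext x
  rw [mem_cls, active_carve ht hpc]
  simp only [mem_sdiff, mem_cls]
  tauto

/-- Removing a part of a component. -/
theorem Stage.carve {X : Finset ℕ} {t r : ℕ} (h : Stage n e pc comp b) (ht : t ≠ 0)
    (hpc : ∀ x, pc' x = if x ∈ X then t else pc x) (hX : X ⊆ cls n pc comp b r)
    (hlow : ∀ x ∈ cls n pc comp b r, x ∉ X → ∃ y ∈ cls n pc comp b r, y ∉ X ∧ Low e b y) :
    Stage n e pc' comp b := by
  have hA := active_carve (n := n) (b := b) ht hpc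
  refine ⟨fun x hx => ?_, ?_, ?_, ?_⟩
  · rw [hpc, if_neg fun hxX => ?_, h.zero x hx]
    have := (mem_active.1 (mem_cls.1 (hX hxX)).1).2.1
    omega
  · rw [hA]
    intro x hx y hy
    exact h.eq x (mem_sdiff.1 hx).1 y (mem_sdiff.1 hy).1
  · rw [hA]
    intro x hx
    exact h.num x (mem_sdiff.1 hx).1
  · rw [hA]
    intro x hx
    obtain ⟨hx, hxX⟩ := mem_sdiff.1 hx
    by_cases hr : comp x = r
    · obtain ⟨y, hy, hyX, hl⟩ := hlow x (mem_cls.2 ⟨hx, hr⟩) hxX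
      exact ⟨y, mem_sdiff.2 ⟨(mem_cls.1 hy).1, hyX⟩, by rw [hr, (mem_cls.1 hy).2], hl⟩
    · obtain ⟨y, hy, hc, hl⟩ := h.low x hx
      exact ⟨y, mem_sdiff.2 ⟨hy, fun hyX => hr (by rw [← hc, (mem_cls.1 (hX hyX)).2])⟩, hc, hl⟩

section Rules

variable {c : ℤ} (hirr : ∀ x, e x x = false) (hsym : ∀ x y, e x y = e y x)
  (hD : Removed n e D c) {r : ℕ}

include hirr hsym hD

/-- Only one vertex of a component has neighbours up to `u`. -/
theorem Stage.carve_to_one (h : Stage n e D.pc comp b) {w : ℕ}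
    (hw : w ∈ cls n D.pc comp b r) (hlw : Low e b w)
    (honly : ∀ x ∈ cls n D.pc comp b r, Low e b x → x = w) (h2 : 2 ≤ #(cls n D.pc comp b r))
    (hc : Carve e D D' ((cls n D.pc comp b r).erase w) w) :
    Removed n e D' c ∧ Stage n e D'.pc comp b := by
  have hsub : (cls n D.pc comp b r).erase w ⊆ cls n D.pc comp b r := erase_subset _ _
  have hadj : ∀ x ∈ cls n D.pc comp b r, ∀ y ∈ cls n D.pc comp b r, x ≠ y → e x y = true := by
    intro x hx y hy hne
    rw [mem_cls] at hx hy
    exact ((h.eq x hx.1 y hy.1).1 (by rw [hx.2, hy.2])).resolve_left hne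
  have hne : ((cls n D.pc comp b r).erase w).Nonempty := by
    rw [← card_pos, card_erase_of_mem hw]; omega
  have hwa := mem_active.1 (mem_cls.1 hw).1
  refine ⟨hD.pivot hirr hsym (hc.step hne (hsub.trans (filter_subset _ _)))
    (fun x hx y hy => hadj x (hsub hx) y (hsub hy)) hwa.1 hwa.2.2 (notMem_erase _ _)
    (fun x hx y hy hy0 hyX hxy => ?_) ?_ hc.split (fun x hx => by rw [hc.att, if_pos hx]) hc.mark,
    h.carve (r := r) (Nat.succ_ne_zero _) hc.pc hsub fun x hx hxX => ?_⟩
  · by_contra hyw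
    obtain ⟨hxw, hxQ⟩ := mem_erase.1 hx
    by_cases hyb : y < b
    · exact hxw (honly x hxQ ⟨y, hyb, hxy⟩)
    · have hya : y ∈ active n D.pc b := mem_active.2 ⟨hy, by omega, hy0⟩
      have := (h.eq x (mem_cls.1 hxQ).1 y hya).2 (.inr hxy)
      exact hyX (mem_erase.2 ⟨hyw, mem_cls.2 ⟨hya, by rw [← this, (mem_cls.1 hxQ).2]⟩⟩)
  · obtain ⟨x, hx⟩ := hne
    exact ⟨x, hx, hadj w hw x (hsub hx) (mem_erase.1 hx).1.symm⟩
  · exact ⟨w, hw, notMem_erase _ _, hlw⟩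

/-- A component has no neighbour below `u` but the neighbour `u`. -/
theorem Stage.carve_all (h : Stage n e D.pc comp (u + 1)) (hu : u < n)
    (hne : (cls n D.pc comp (u + 1) r).Nonempty)
    (hno : ∀ x ∈ cls n D.pc comp (u + 1) r, ¬ Low e u x)
    (hc : Carve e D D' (cls n D.pc comp (u + 1) r) u) :
    Removed n e D' c ∧ Stage n e D'.pc comp (u + 1) := by
  refine ⟨hD.pivot hirr hsym (hc.step hne (filter_subset _ _))
    (fun x hx y hy hne => ?_) hu (h.zero u (by omega)) (fun hu' => ?_)
    (fun x hx y hy hy0 hyX hxy => ?_) ?_ hc.split (fun x hx => by rw [hc.att, if_pos hx]) hc.mark,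
    h.carve (r := r) (Nat.succ_ne_zero _) hc.pc (Subset.refl _) fun x hx hxX => absurd hx hxX⟩
  · rw [mem_cls] at hx hy
    exact ((h.eq x hx.1 y hy.1).1 (by rw [hx.2, hy.2])).resolve_left hne
  · have := (mem_active.1 (mem_cls.1 hu').1).2.1
    omega
  · by_contra hyu
    by_cases hyb : y < u
    · exact hno x hx ⟨y, hyb, hxy⟩
    · have hya : y ∈ active n D.pc (u + 1) := mem_active.2 ⟨hy, by omega, hy0⟩
      have := (h.eq x (mem_cls.1 hx).1 y hya).2 (.inr hxy)
      exact hyX (mem_cls.2 ⟨hya, by rw [← this, (mem_cls.1 hx).2]⟩)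
  · obtain ⟨x, hx⟩ := hne
    obtain ⟨y, hy, hcy, hl⟩ := h.low x (mem_cls.1 hx).1
    have hy' : y ∈ cls n D.pc comp (u + 1) r := mem_cls.2 ⟨hy, by rw [hcy, (mem_cls.1 hx).2]⟩
    exact ⟨y, hy', by rw [hsym]; exact (low_succ.1 hl).resolve_left (hno y hy')⟩

end Rules

/-- Removing `u` and some other vertices. -/
theorem Stage.remove {X : Finset ℕ} {t : ℕ} (h : Stage n e pc comp (u + 1)) (ht : t ≠ 0)
    (hpc : ∀ x, pc' x = if x ∈ insert u X then t else pc x) (hX : X ⊆ active n pc (u + 1))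
    (hlow : ∀ x ∈ active n pc (u + 1), x ∉ X →
      ∃ y ∈ active n pc (u + 1), y ∉ X ∧ comp y = comp x ∧ Low e u y) :
    Stage n e pc' comp u := by
  have hA : active n pc' u = active n pc (u + 1) \ X := by
    ext x
    simp only [mem_sdiff, mem_active, hpc, mem_insert]
    by_cases hx : x ∈ X
    · simp [hx, ht]
    · by_cases hxu : x = u
      · simp [hxu, ht]
      · simp only [hx, hxu, or_self, if_false, not_false_eq_true, and_true]
        refine and_congr_right fun _ => and_congr_left fun _ => ?_
        omega
  refine ⟨fun x hx => ?_, ?_, ?_, ?_⟩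
  · rw [hpc, if_neg fun hxX => ?_, h.zero x (by omega)]
    rcases mem_insert.1 hxX with rfl | hxX
    · omega
    · have := (mem_active.1 (hX hxX)).2.1
      omega
  · rw [hA]
    intro x hx y hy
    exact h.eq x (mem_sdiff.1 hx).1 y (mem_sdiff.1 hy).1
  · rw [hA]
    intro x hx
    have := h.num x (mem_sdiff.1 hx).1
    omega
  · rw [hA]
    intro x hx
    obtain ⟨y, hy, hyX, hcy, hl⟩ := hlow x (mem_sdiff.1 hx).1 (mem_sdiff.1 hx).2
    exact ⟨y, mem_sdiff.2 ⟨hy, hyX⟩, hcy, hl⟩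

/-- Keeping `u` as a new component or as a vertex of the component `r` of all its neighbours. -/
theorem Stage.keep {r : ℕ} {comp' : ℕ → ℕ}
    (hsym : ∀ x y, e x y = e y x) (h : Stage n e pc comp (u + 1))
    (hun : u < n) (hready : ∀ r, Ready e u (cls n pc comp (u + 1) r)) (hu : Low e u u)
    (hr : u ≤ r ∧ r < n) (hcomp : ∀ x, comp' x = if x = u then r else comp x)
    (hadj : ∀ x ∈ active n pc (u + 1), comp x = r ↔ e u x = true) :
    Stage n e pc comp' u := by
  have hA : active n pc u = insert u (active n pc (u + 1)) := by
    ext x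
    simp only [mem_insert, mem_active]
    constructor
    · rintro ⟨h1, h2, h3⟩
      by_cases hxu : x = u
      · exact .inl hxu
      · exact .inr ⟨h1, by omega, h3⟩
    · rintro (rfl | ⟨h1, h2, h3⟩)
      · exact ⟨hun, le_rfl, h.zero x (by omega)⟩
      · exact ⟨h1, by omega, h3⟩
  have hne : ∀ x ∈ active n pc (u + 1), x ≠ u := fun x hx => by
    have := (mem_active.1 hx).2.1
    omega
  refine ⟨fun x hx => h.zero x (by omega), ?_, ?_, ?_⟩
  · rw [hA]
    intro x hx y hy
    rcases mem_insert.1 hx with rfl | hx <;> rcases mem_insert.1 hy with rfl | hy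
    · simp
    · rw [hcomp, hcomp, if_pos rfl, if_neg (hne y hy), eq_comm, hadj y hy]
      simp [(hne y hy).symm]
    · rw [hcomp, hcomp, if_pos rfl, if_neg (hne x hx), hadj x hx, hsym]
      simp [hne x hx]
    · rw [hcomp, hcomp, if_neg (hne x hx), if_neg (hne y hy)]
      exact h.eq x hx y hy
  · rw [hA]
    intro x hx
    rcases mem_insert.1 hx with rfl | hx
    · simpa [hcomp] using hr
    · have := h.num x hx
      rw [hcomp, if_neg (hne x hx)]
      omega
  · rw [hA]
    intro x hx
    rcases mem_insert.1 hx with rfl | hx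
    · exact ⟨x, mem_insert_self _ _, rfl, hu⟩
    · obtain ⟨y, hy, hl⟩ := (hready (comp x)).1 ⟨x, mem_cls.2 ⟨hx, rfl⟩⟩
      rw [mem_cls] at hy
      exact ⟨y, mem_insert_of_mem hy.1, by
        rw [hcomp, hcomp, if_neg (hne x hx), if_neg (hne y hy.1), hy.2], hl⟩

/-- The vertices `x` and `y` form an induced path with `u`, and removing them leaves no component
without neighbour below `u`. -/
def Good (n : ℕ) (e : ℕ → ℕ → Bool) (pc comp : ℕ → ℕ) (u x y : ℕ) : Prop :=
  x ∈ active n pc (u + 1) ∧ y ∈ active n pc (u + 1) ∧ x ≠ y ∧ e u x = true ∧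
  (comp x = comp y ∧ e u y = false ∧ (#(cls n pc comp (u + 1) (comp x)) = 2 ∨
    ∃ z ∈ cls n pc comp (u + 1) (comp x), z ≠ x ∧ z ≠ y ∧ Low e u z) ∨
   comp x ≠ comp y ∧ e u y = true ∧
    (#(cls n pc comp (u + 1) (comp x)) = 1 ∨
      ∃ z ∈ cls n pc comp (u + 1) (comp x), z ≠ x ∧ Low e u z) ∧
    (#(cls n pc comp (u + 1) (comp y)) = 1 ∨
      ∃ z ∈ cls n pc comp (u + 1) (comp y), z ≠ y ∧ Low e u z))

theorem Stage.path {c : ℤ} (hirr : ∀ x, e x x = false) (hsym : ∀ x y, e x y = e y x)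
    (hD : Removed n e D c) (h : Stage n e D.pc comp (u + 1)) (hu : u < n)
    (hready : ∀ r, Ready e u (cls n D.pc comp (u + 1) r)) {x y : ℕ}
    (hg : Good n e D.pc comp u x y) (htop : D'.top = D.top + 1)
    (hpc : ∀ z, D'.pc z = if z ∈ ({u, x, y} : Finset ℕ) then D.top + 1 else D.pc z)
    (hmark : ∀ z, D'.mark z = if z ∈ ({u, x, y} : Finset ℕ) then 1 else D.mark z)
    (hatt : D'.att = D.att) (hside : ∀ z ∉ ({u, x, y} : Finset ℕ), D'.side z = D.side z)
    (hsu : D'.side u = 0) (hsx : D'.side x = 1)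
    (hsy : D'.side y = if comp x = comp y then 0 else 1) :
    Removed n e D' c ∧ Stage n e D'.pc comp u := by
  obtain ⟨hx, hy, hxy, hux, hg⟩ := hg
  have hxa := mem_active.1 hx
  have hya := mem_active.1 hy
  have hstep : Step n D D' {u, x, y} := by
    refine ⟨⟨u, by simp⟩, ?_, ?_, hpc, htop, hside, ?_, fun z _ => by rw [hatt], fun z hz => ?_⟩
    · simp only [mem_insert, mem_singleton]
      rintro z (rfl | rfl | rfl) <;> omega
    · simp only [mem_insert, mem_singleton]
      rintro z (rfl | rfl | rfl)
      exacts [h.zero _ (by omega), hxa.2.2, hya.2.2]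
    · simp only [mem_insert, mem_singleton]
      rintro z (rfl | rfl | rfl)
      · omega
      · omega
      · rw [hsy]; split_ifs <;> omega
    · rw [hmark] at hz
      split_ifs at hz
      exact hz
  refine ⟨?_, h.remove (X := {x, y}) (Nat.succ_ne_zero _) hpc ?_ fun z hz hzX => ?_⟩
  · rcases hg with ⟨hc, huy, -⟩ | ⟨hc, huy, -⟩
    · have hex : e x y = true := ((h.eq x hx y hy).1 hc).resolve_left hxy
      rw [if_pos hc] at hsy
      refine hD.path hirr hsym hstep hux hex huy (by omega) ?_ ?_ hmark
      · rw [hsu, hsy]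
      · rw [hsu, hsx]
    · have hex : e x y = false := by
        by_contra hex
        exact hc ((h.eq x hx y hy).2 (.inr (by simpa using hex)))
      rw [if_neg hc] at hsy
      have hset : ({u, x, y} : Finset ℕ) = {x, u, y} := insert_comm _ _ _
      rw [hset] at hstep hmark
      refine hD.path hirr hsym hstep (by rw [hsym]; exact hux) huy hex hxy ?_ ?_ hmark
      · rw [hsx, hsy]
      · rw [hsu, hsx]
  · simp [insert_subset_iff, hx, hy]
  · simp only [mem_insert, mem_singleton, not_or] at hzX
    by_cases hzx : comp z = comp x
    · have hzc : z ∈ cls n D.pc comp (u + 1) (comp x) := mem_cls.2 ⟨hz, hzx⟩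
      have hxc : x ∈ cls n D.pc comp (u + 1) (comp x) := mem_cls.2 ⟨hx, rfl⟩
      rcases hg with ⟨hc, -, h2 | ⟨a, ha, hax, hay, hl⟩⟩ | ⟨hc, -, h1 | ⟨a, ha, hax, hl⟩, -⟩
      · have hyc : y ∈ cls n D.pc comp (u + 1) (comp x) := mem_cls.2 ⟨hy, hc.symm⟩
        have : ({z, x, y} : Finset ℕ) ⊆ cls n D.pc comp (u + 1) (comp x) := by
          simp [insert_subset_iff, hzc, hxc, hyc]
        have := card_le_card this
        rw [h2, card_insert_of_notMem (by simp [hzX]), card_pair hxy] at this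
        omega
      · exact ⟨a, (mem_cls.1 ha).1, by simp [hax, hay], by rw [(mem_cls.1 ha).2, hzx], hl⟩
      · exact absurd (card_le_one.1 h1.le z hzc x hxc) hzX.1
      · refine ⟨a, (mem_cls.1 ha).1, ?_, by rw [(mem_cls.1 ha).2, hzx], hl⟩
        simp only [mem_insert, mem_singleton, not_or]
        exact ⟨hax, by rintro rfl; exact hc (mem_cls.1 ha).2.symm⟩
    by_cases hzy : comp z = comp y
    · have hzc : z ∈ cls n D.pc comp (u + 1) (comp y) := mem_cls.2 ⟨hz, hzy⟩
      have hyc : y ∈ cls n D.pc comp (u + 1) (comp y) := mem_cls.2 ⟨hy, rfl⟩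
      rcases hg with ⟨hc, -⟩ | ⟨hc, -, -, h1 | ⟨a, ha, hay, hl⟩⟩
      · exact absurd (hzy.trans hc.symm) hzx
      · exact absurd (card_le_one.1 h1.le z hzc y hyc) hzX.2
      · refine ⟨a, (mem_cls.1 ha).1, ?_, by rw [(mem_cls.1 ha).2, hzy], hl⟩
        simp only [mem_insert, mem_singleton, not_or]
        exact ⟨by rintro rfl; exact hc (mem_cls.1 ha).2, hay⟩
    · obtain ⟨a, ha, hl⟩ := (hready (comp z)).1 ⟨z, mem_cls.2 ⟨hz, rfl⟩⟩
      rw [mem_cls] at ha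
      refine ⟨a, ha.1, ?_, ha.2, hl⟩
      simp only [mem_insert, mem_singleton, not_or]
      exact ⟨by rintro rfl; exact hzx ha.2.symm, by rintro rfl; exact hzy ha.2.symm⟩

/-- If there is no good pair, then the neighbours of `u` are a component, possibly up to one
vertex. -/
theorem no_good (hsym : ∀ x y, e x y = e y x)
    (hready : ∀ r, Ready e u (cls n pc comp (u + 1) r)) (hno : ∀ x y, ¬ Good n e pc comp u x y)
    {x : ℕ} (hx : x ∈ active n pc (u + 1)) (hux : e u x = true) :
    (∀ y ∈ active n pc (u + 1), e u y = true → comp y = comp x) ∧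
    ((∀ y ∈ cls n pc comp (u + 1) (comp x), e u y = true) ∨
      ∃ w ∈ cls n pc comp (u + 1) (comp x), 2 ≤ #(cls n pc comp (u + 1) (comp x)) ∧
        (∀ y ∈ cls n pc comp (u + 1) (comp x), e u y = true ↔ y ≠ w) ∧
        ∀ y ∈ cls n pc comp (u + 1) (comp x), Low e u y → y = w) := by
  constructor
  · intro y hy huy
    by_contra hne
    have key : ∀ x ∈ active n pc (u + 1), e u x = true → ∃ x' ∈ active n pc (u + 1),
        comp x' = comp x ∧ e u x' = true ∧ (#(cls n pc comp (u + 1) (comp x')) = 1 ∨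
          ∃ z ∈ cls n pc comp (u + 1) (comp x'), z ≠ x' ∧ Low e u z) := by
      intro x hx hux
      by_cases h1 : #(cls n pc comp (u + 1) (comp x)) = 1
      · exact ⟨x, hx, rfl, hux, .inl h1⟩
      have hxc : x ∈ cls n pc comp (u + 1) (comp x) := mem_cls.2 ⟨hx, rfl⟩
      have hpos := card_pos.2 ⟨x, hxc⟩
      obtain ⟨z, hz, hlz⟩ := (hready (comp x)).1 ⟨x, hxc⟩
      by_cases hzx : z = x
      · subst hzx
        obtain ⟨a, ha, b, hb, hab, hla, hlb⟩ := (hready (comp z)).2 (by omega)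
        have hex : ∃ a ∈ cls n pc comp (u + 1) (comp z), a ≠ z ∧ Low e (u + 1) a := by
          by_cases haz : a = z
          · exact ⟨b, hb, by rintro rfl; exact hab haz, hlb⟩
          · exact ⟨a, ha, haz, hla⟩
        obtain ⟨a, ha, haz, hla⟩ := hex
        rcases low_succ.1 hla with hla | hla
        · exact ⟨z, hx, rfl, hux, .inr ⟨a, ha, haz, hla⟩⟩
        · rw [mem_cls] at ha
          refine ⟨a, ha.1, ha.2, by rw [hsym]; exact hla, .inr ⟨z, ?_, haz.symm, hlz⟩⟩
          rw [ha.2]; exact hxc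
      · exact ⟨x, hx, rfl, hux, .inr ⟨z, hz, hzx, hlz⟩⟩
    obtain ⟨x', hx', hcx, hux', h1⟩ := key x hx hux
    obtain ⟨y', hy', hcy, huy', h2⟩ := key y hy huy
    have hcne : comp x' ≠ comp y' := by rw [hcx, hcy]; exact fun h => hne h.symm
    exact hno x' y' ⟨hx', hy', by rintro rfl; exact hcne rfl, hux', .inr ⟨hcne, huy', h1, h2⟩⟩
  · by_cases hall : ∀ y ∈ cls n pc comp (u + 1) (comp x), e u y = true
    · exact .inl hall
    right
    push Not at hall
    obtain ⟨w, hw, huw⟩ := hall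
    set Q := cls n pc comp (u + 1) (comp x) with hQ
    have hxQ : x ∈ Q := mem_cls.2 ⟨hx, rfl⟩
    have hkey : ∀ a ∈ Q, e u a = true → ∀ b ∈ Q, ¬ e u b = true → #Q ≠ 2 ∧
        ∀ z ∈ Q, Low e u z → z = a ∨ z = b := by
      intro a ha hua b hb hub
      have ha' := mem_cls.1 ha
      have hb' := mem_cls.1 hb
      have := hno a b
      simp only [Good, ha'.1, hb'.1, hua, ha'.2, hb'.2, true_and, ne_eq, not_true_eq_false,
        false_and, or_false, ← hQ] at this
      have hab : a ≠ b := by rintro rfl; exact hub hua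
      simp only [hab, not_false_eq_true, Bool.not_eq_true _ ▸ hub, true_and] at this
      push Not at this
      refine ⟨this.1, fun z hz hl => ?_⟩
      by_contra hc
      push Not at hc
      exact this.2 z hz hc.1 hc.2 hl
    have hxw : x ≠ w := by rintro rfl; exact huw hux
    have h2 : 2 ≤ #Q := by
      have : ({x, w} : Finset ℕ) ⊆ Q := by simp [insert_subset_iff, hxQ, hw]
      have := card_le_card this
      rwa [card_pair hxw] at this
    have honly : ∀ y ∈ Q, ¬ e u y = true → y = w := by
      intro w' hw' huw'
      by_contra hne
      have hlow : ∀ a ∈ Q, e u a = true → ∀ z ∈ Q, Low e u z → z = a := by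
        intro a ha hua z hz hl
        have h3 := (hkey a ha hua w hw huw).2 z hz hl
        have h4 := (hkey a ha hua w' hw' huw').2 z hz hl
        by_contra hza
        exact hne ((h4.resolve_left hza).symm.trans (h3.resolve_left hza))
      obtain ⟨z, hz, hlz⟩ := (hready (comp x)).1 ⟨x, hxQ⟩
      have hun : ∀ a ∈ Q, Low e (u + 1) a → a = z := by
        intro a ha hla
        rcases low_succ.1 hla with hla | hla
        · exact (hlow x hxQ hux a ha hla).trans (hlow x hxQ hux z hz hlz).symm
        · exact (hlow a ha (by rw [hsym]; exact hla) z hz hlz).symm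
      obtain ⟨a, ha, b, hb, hab, hla, hlb⟩ := (hready (comp x)).2 h2
      exact hab ((hun a ha hla).trans (hun b hb hlb).symm)
    refine ⟨w, hw, h2, fun y hy => ⟨?_, fun hyw => ?_⟩, fun y hy hl => ?_⟩
    · rintro huy rfl; exact huw huy
    · by_contra huy; exact hyw (honly y hy huy)
    · have h3 := (hkey x hxQ hux w hw huw).1
      obtain ⟨x', hx', hxx', hx'w⟩ : ∃ x' ∈ Q, x' ≠ x ∧ x' ≠ w := by
        by_contra hc
        push Not at hc
        have : Q ⊆ {x, w} := fun z hz => by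
          simp only [mem_insert, mem_singleton]
          by_contra hz'
          push Not at hz'
          exact hz'.2 (hc z hz hz'.1)
        have := card_le_card this
        rw [card_pair hxw] at this
        omega
      have hux' : e u x' = true := by
        by_contra hc; exact hx'w (honly x' hx' hc)
      have h4 := (hkey x hxQ hux w hw huw).2 y hy hl
      have h5 := (hkey x' hx' hux' w hw huw).2 y hy hl
      by_contra hyw
      exact hxx' ((h5.resolve_right hyw).symm.trans (h4.resolve_right hyw))

/-- The neighbours of `u` are a component without one vertex. -/
theorem Stage.near {c : ℤ} (hirr : ∀ x, e x x = false) (hsym : ∀ x y, e x y = e y x)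
    (hD : Removed n e D c) (h : Stage n e D.pc comp (u + 1)) (hu : u < n)
    (hready : ∀ r, Ready e u (cls n D.pc comp (u + 1) r)) {r w : ℕ} {D₁ : Data}
    (hw : w ∈ cls n D.pc comp (u + 1) r) (h2 : 2 ≤ #(cls n D.pc comp (u + 1) r))
    (huw : ∀ y ∈ cls n D.pc comp (u + 1) r, e u y = true ↔ y ≠ w)
    (hlow : ∀ y ∈ cls n D.pc comp (u + 1) r, Low e u y → y = w)
    (hc : Carve e D D₁ (cls n D.pc comp (u + 1) r) u) (htop : D'.top = D₁.top)
    (hatt : D'.att = D₁.att) (hpc : ∀ x, D'.pc x = if x = u then D.top + 1 else D₁.pc x)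
    (hside : ∀ x, D'.side x = if x = u then 0 else D₁.side x)
    (hmark : ∀ x, D'.mark x =
      if x ∈ cls n D.pc comp (u + 1) r ∧ ¬ e u x = true then 1 else D₁.mark x) :
    Removed n e D' c ∧ Stage n e D'.pc comp u := by
  set Q := cls n D.pc comp (u + 1) r with hQ
  have huQ : u ∉ Q := fun hu' => by
    have := (mem_active.1 (mem_cls.1 hu').1).2.1
    omega
  have hneu : ∀ x ∈ Q, x ≠ u := fun x hx h => huQ (h ▸ hx)
  have hpc' : ∀ x, D'.pc x = if x ∈ insert u Q then D.top + 1 else D.pc x := fun x => by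
    rw [hpc, hc.pc]
    by_cases hxu : x = u <;> simp [hxu]
  have hmark' : ∀ x, D'.mark x = if x = u ∨ x = w then 1 else D.mark x := fun x => by
    have hex : ∃ y ∈ Q, ¬ e u y = true := ⟨w, hw, fun h => (huw w hw).1 h rfl⟩
    rw [hmark, hc.mark]
    by_cases hxu : x = u
    · rw [if_pos (show x = u ∧ ∃ y ∈ Q, ¬ e u y = true from ⟨hxu, hex⟩)]; simp [hxu]
    · rw [if_neg (show ¬(x = u ∧ ∃ y ∈ Q, ¬ e u y = true) from fun h => hxu h.1)]
      by_cases hxw : x = w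
      · rw [if_pos ⟨hxw ▸ hw, fun h => (huw x (hxw ▸ hw)).1 h hxw⟩]; simp [hxw]
      · rw [if_neg fun h => h.2 ((huw x h.1).2 hxw)]; simp [hxu, hxw]
  have hsideQ : ∀ x ∈ Q, D'.side x = D₁.side x := fun x hx => by rw [hside, if_neg (hneu x hx)]
  have hsplit : Split e D'.side u Q := by
    refine ⟨fun x hx => by rw [hsideQ x hx]; exact hc.split.le x hx, ?_, ?_⟩
    · rw [← hc.split.ones, filter_congr fun x hx => by rw [hsideQ x hx]]
    · rw [← hc.split.nbrs, filter_congr fun x hx => by rw [hsideQ x hx]]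
  have hstep : Step n D D' (insert u Q) := by
    refine ⟨⟨u, by simp⟩, ?_, ?_, hpc', by rw [htop, hc.top], fun x hx => ?_, ?_, fun x hx => ?_,
      fun x hx => ?_⟩
    · intro x hx
      rcases mem_insert.1 hx with rfl | hx
      exacts [hu, (mem_active.1 (mem_cls.1 hx).1).1]
    · intro x hx
      rcases mem_insert.1 hx with rfl | hx
      exacts [h.zero _ (by omega), (mem_active.1 (mem_cls.1 hx).1).2.2]
    · rw [mem_insert, not_or] at hx
      rw [hside, if_neg hx.1, hc.side x hx.2]
    · intro x hx
      rcases mem_insert.1 hx with rfl | hx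
      · rw [hside, if_pos rfl]; omega
      · exact hsplit.le x hx
    · rw [mem_insert, not_or] at hx
      rw [hatt, hc.att, if_neg hx.2]
    · rw [hmark'] at hx
      split_ifs at hx
      exact hx
  refine ⟨hD.nearClique hirr hsym hstep huQ (fun x hx y hy hne => ?_) hw h2 huw
    (fun x hx hxw y hy hy0 hyP => ?_) hsplit (by rw [hside, if_pos rfl])
    (fun x hx => by rw [hatt, hc.att, if_pos hx]) hmark',
    h.remove (X := Q) (Nat.succ_ne_zero _) hpc' (filter_subset _ _) fun x hx hxQ => ?_⟩
  · rw [hQ, mem_cls] at hx hy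
    exact ((h.eq x hx.1 y hy.1).1 (by rw [hx.2, hy.2])).resolve_left hne
  · by_contra hxy
    rw [Bool.not_eq_false] at hxy
    rw [mem_insert, not_or] at hyP
    by_cases hyb : y < u
    · exact hxw (hlow x hx ⟨y, hyb, hxy⟩)
    · have hya : y ∈ active n D.pc (u + 1) := mem_active.2 ⟨hy, by omega, hy0⟩
      have := (h.eq x (mem_cls.1 hx).1 y hya).2 (.inr hxy)
      exact hyP.2 (mem_cls.2 ⟨hya, by rw [← this, (mem_cls.1 hx).2]⟩)
  · obtain ⟨a, ha, hl⟩ := (hready (comp x)).1 ⟨x, mem_cls.2 ⟨hx, rfl⟩⟩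
    rw [mem_cls] at ha
    refine ⟨a, ha.1, fun haQ => hxQ (mem_cls.2 ⟨hx, ?_⟩), ha.2, hl⟩
    rw [← ha.2, (mem_cls.1 haQ).2]

end Pieces

/-! ## The decomposition algorithm -/

namespace LoopLang

open Finset Pieces

variable {E : Env} {s : St}

section
open Var Arr

/-- The vertex is active. -/
def actB (e : Exp) : BExp := .and (.lt u e) (.eq (pc e) 0)
/-- The vertex `x` is in the component `r`. -/
def inQ : BExp := .and (actB x) (.eq (comp x) r)
def inX : BExp := .and inQ (.not (.eq x v))
def inXnbr : BExp := .and inX (.edge v x)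
def inXfar : BExp := .and inX (.not (.edge v x))

def assign : Cmd :=
  .ite (.lt Var.cnt (.sub sz Var.cnt)) (.put side x 1 ;; .set Var.cnt (.inc Var.cnt))
    (.put side x 0)

/-- Give the vertices with `b` the side `1` while there are less than half of `sz` of them. -/
def splitPass (b : BExp) : Cmd := .loop x (.when b assign)

/-- Make the component `r` without `v` a new piece attached to `v`. -/
def carve : Cmd :=
  .set top (.inc top) ;; countC x inX sz ;; .set Var.cnt 0 ;; splitPass inXnbr ;;
  splitPass inXfar ;; anyC x inXfar bad ;; fillC x inX att (.inc v) ;; fillC x inX pc top ;;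
  .when (.eq bad 1) (.put mark v 1)

end

theorem splitPass_spec {b : BExp} {p : ℕ → Prop} [DecidablePred p]
    (hb : ∀ j < E.n, ∀ s' : St, (∀ c, c ≠ .side → s'.a c = s.a c) →
      (∀ y, y ≠ .cnt → y ≠ .x → s'.v y = s.v y) → (evalB E b (s'.setV .x j) = true ↔ p j))
    (hcnt : s.v .cnt ≤ (s.v .sz + 1) / 2) :
    let s' := run E (splitPass b) s
    s'.v .cnt = min (s.v .cnt + #{x ∈ range E.n | p x}) ((s.v .sz + 1) / 2) ∧
    s'.v .cnt = s.v .cnt + #{x ∈ range E.n | p x ∧ s'.a .side x = 1} ∧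
    ∀ x, if x < E.n ∧ p x then s'.a .side x ≤ 1 else s'.a .side x = s.a .side x := by
  intro s'
  refine loop_inv (fun j s' =>
    s'.v .cnt = min (s.v .cnt + #{x ∈ range j | p x}) ((s.v .sz + 1) / 2) ∧
    s'.v .cnt = s.v .cnt + #{x ∈ range j | p x ∧ s'.a .side x = 1} ∧
    ∀ x, if x < j ∧ p x then s'.a .side x ≤ 1 else s'.a .side x = s.a .side x)
    (by simp [hcnt]) fun j hj s₁ hf ⟨h1, h2, h3⟩ => ?_
  have hbj := hb j hj s₁ (fun c hc => hf.a c (by simp [Cmd.loop, Cmd.when, assign, Cmd.wa, hc]))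
    fun y h1 h2 => hf.v y (by simp [Cmd.loop, Cmd.when, assign, Cmd.wv, *])
  have hsz : s₁.v .sz = s.v .sz := hf.v .sz rfl
  rw [run_when, card_range_succ, card_range_succ]
  by_cases hp : p j
  · rw [if_pos (hbj.2 hp)]
    obtain ⟨m, hm, ha, hv, hmlt⟩ : ∃ m ≤ 1,
        (∀ x, (run E assign (s₁.setV .x j)).a .side x = if x = j then m else s₁.a .side x) ∧
        (run E assign (s₁.setV .x j)).v .cnt = s₁.v .cnt + m ∧
        (m = 1 ↔ s₁.v .cnt < s.v .sz - s₁.v .cnt) := by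
      by_cases hlt : s₁.v .cnt < s.v .sz - s₁.v .cnt
      · refine ⟨1, le_rfl, fun x => ?_, ?_, by simp [hlt]⟩ <;> simp [assign, hsz, hlt]
      · refine ⟨0, by omega, fun x => ?_, ?_, by simp [hlt]⟩ <;> simp [assign, hsz, hlt]
    have hcount : #{x ∈ range j | p x ∧ (run E assign (s₁.setV .x j)).a .side x = 1}
        = #{x ∈ range j | p x ∧ s₁.a .side x = 1} := by
      refine congrArg card (filter_congr fun x hx => ?_)
      rw [ha, if_neg (mem_range.1 hx).ne]
    rw [hcount, hv, ha, if_pos rfl, if_pos hp]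
    simp only [hp, true_and]
    refine ⟨by omega, by split_ifs <;> omega, fun x => ?_⟩
    rw [ha]
    by_cases hx : x = j
    · simp [hx, hp, hm]
    · rw [if_neg hx]
      simpa only [show x < j + 1 ↔ x < j by omega] using h3 x
  · rw [if_neg fun h => hp (hbj.1 h), if_neg hp, if_neg fun h => hp h.1]
    refine ⟨h1, h2, fun x => ?_⟩
    by_cases hx : x = j
    · have := h3 x
      simp only [hx, lt_irrefl, false_and, if_false] at this
      simp [hx, hp, this]
    · simpa only [show x < j + 1 ↔ x < j by omega, St.setV_a] using h3 x

def St.data (s : St) : Data := ⟨s.a .pc, s.a .mark, s.a .side, s.a .att, s.v .top⟩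

/-- The component with number `r` in the state `s`. -/
def St.cls (E : Env) (s : St) (r : ℕ) : Finset ℕ :=
  Pieces.cls E.n (s.a .pc) (s.a .comp) (s.v .u + 1) r

theorem St.mem_cls {r x : ℕ} : x ∈ s.cls E r ↔
    (x < E.n ∧ s.v .u < x ∧ s.a .pc x = 0) ∧ s.a .comp x = r := by
  rw [St.cls, Pieces.mem_cls, mem_active, Nat.succ_le_iff]

theorem evalB_inX (s : St) : evalB E inX s = true ↔
    ((s.v .u < s.v .x ∧ s.a .pc (s.v .x) = 0) ∧ s.a .comp (s.v .x) = s.v .r) ∧ s.v .x ≠ s.v .v := by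
  simp [inX, inQ, actB]

theorem card_filter_split {p q : ℕ → Prop} [DecidablePred p] [DecidablePred q] (X : Finset ℕ) :
    #{x ∈ X | p x ∧ q x} + #{x ∈ X | p x ∧ ¬ q x} = #{x ∈ X | p x} := by
  rw [← filter_filter, ← filter_filter]
  exact card_filter_add_card_filter_not _

theorem carve_spec : Carve (E.rel (s.a .ord)) s.data (run E carve s).data
    ((s.cls E (s.v .r)).erase (s.v .v)) (s.v .v) := by
  set X := (s.cls E (s.v .r)).erase (s.v .v) with hX
  set e := E.rel (s.a .ord) with he
  have hXm : ∀ x, x ∈ X ↔ x < E.n ∧ (((s.v .u < x ∧ s.a .pc x = 0) ∧ s.a .comp x = s.v .r) ∧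
      x ≠ s.v .v) := fun x => by
    rw [hX, mem_erase, St.mem_cls]; tauto
  have hXf : ∀ q : ℕ → Prop, ∀ [DecidablePred q], ({x ∈ range E.n | (((s.v .u < x ∧ s.a .pc x = 0) ∧ s.a .comp x = s.v .r) ∧
      x ≠ s.v .v) ∧ q x} : Finset ℕ) = {x ∈ X | q x} := fun q _ => by
    ext x; simp only [mem_filter, hXm, mem_range]; tauto
  have hXc : ({x ∈ range E.n | ((s.v .u < x ∧ s.a .pc x = 0) ∧ s.a .comp x = s.v .r) ∧
      x ≠ s.v .v} : Finset ℕ) = X := by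
    ext x; rw [mem_filter, hXm, mem_range]
  simp only [carve, run_seq]
  set s₁ := run E (.set .top (.inc (.var .top))) s with hs₁
  have v₁ : ∀ y, y ≠ .top → s₁.v y = s.v y := fun y hy => by simp [hs₁, hy]
  have a₁ : s₁.a = s.a := rfl
  have t₁ : s₁.v .top = s.v .top + 1 := by simp [hs₁]
  clear_value s₁
  have hsz : (run E (countC .x inX .sz) s₁).v .sz = #X := by
    rw [← hXc]
    exact count_spec (by decide) fun j hj s' ha hv => by
      rw [evalB_inX]; simp [ha, hv, a₁, v₁]
  have f₂ := run_fr (E := E) (countC .x inX .sz) s₁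
  set s₂ := run E (countC .x inX .sz) s₁
  clear_value s₂
  set s₃ := run E (.set .cnt 0) s₂ with hs₃
  have v₃ : ∀ y, y ≠ .top → y ≠ .sz → y ≠ .cnt → y ≠ .x → s₃.v y = s.v y := fun y h1 h2 h3 h4 => by
    rw [← v₁ y h1, ← f₂.v y (by simp [countC, Cmd.loop, Cmd.when, Cmd.wv, *])]
    simp [hs₃, h3]
  have a₃ : s₃.a = s.a := by
    funext c; rw [← a₁, ← f₂.a c rfl]; rfl
  have t₃ : s₃.v .top = s.v .top + 1 := by rw [← t₁, ← f₂.v .top rfl]; simp [hs₃]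
  have z₃ : s₃.v .sz = #X := by rw [← hsz]; simp [hs₃]
  have c₃ : s₃.v .cnt = 0 := by simp [hs₃]
  clear_value s₃
  have g₄ := splitPass_spec (E := E) (s := s₃) (b := inXnbr)
    (p := fun x => (((s.v .u < x ∧ s.a .pc x = 0) ∧ s.a .comp x = s.v .r) ∧ x ≠ s.v .v) ∧
      e (s.v .v) x = true)
    (fun j hj s' ha hv => by
      rw [inXnbr, evalB_and, evalB_inX]; simp [ha, hv, a₃, v₃, he]) (by omega)
  have f₄ := run_fr (E := E) (splitPass inXnbr) s₃
  simp only [hXf] at g₄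
  set s₄ := run E (splitPass inXnbr) s₃
  clear_value s₄
  have v₄ : ∀ y, y ≠ .top → y ≠ .sz → y ≠ .cnt → y ≠ .x → s₄.v y = s.v y := fun y h1 h2 h3 h4 => by
    rw [← v₃ y h1 h2 h3 h4, ← f₄.v y
      (by simp [splitPass, assign, Cmd.loop, Cmd.when, Cmd.wv, *])]
  have a₄ : ∀ c, c ≠ .side → s₄.a c = s.a c := fun c hc => by
    rw [← a₃, ← f₄.a c (by simp [splitPass, assign, Cmd.loop, Cmd.when, Cmd.wa, *])]
  have z₄ : s₄.v .sz = #X := by rw [← z₃, ← f₄.v .sz rfl]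
  have t₄ : s₄.v .top = s.v .top + 1 := by rw [← t₃, ← f₄.v .top rfl]
  have g₅ := splitPass_spec (E := E) (s := s₄) (b := inXfar)
    (p := fun x => (((s.v .u < x ∧ s.a .pc x = 0) ∧ s.a .comp x = s.v .r) ∧ x ≠ s.v .v) ∧
      ¬ e (s.v .v) x = true)
    (fun j hj s' ha hv => by
      rw [inXfar, evalB_and, evalB_inX]; simp [ha, hv, a₄, v₄, he])
    (by rw [z₄, g₄.1, z₃]; omega)
  have f₅ := run_fr (E := E) (splitPass inXfar) s₄
  simp only [hXf] at g₅
  set s₅ := run E (splitPass inXfar) s₄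
  clear_value s₅
  have v₅ : ∀ y, y ≠ .top → y ≠ .sz → y ≠ .cnt → y ≠ .x → s₅.v y = s.v y := fun y h1 h2 h3 h4 => by
    rw [← v₄ y h1 h2 h3 h4, ← f₅.v y
      (by simp [splitPass, assign, Cmd.loop, Cmd.when, Cmd.wv, *])]
  have a₅ : ∀ c, c ≠ .side → s₅.a c = s.a c := fun c hc => by
    rw [← a₄ c hc, ← f₅.a c (by simp [splitPass, assign, Cmd.loop, Cmd.when, Cmd.wa, *])]
  have t₅ : s₅.v .top = s.v .top + 1 := by rw [← t₄, ← f₅.v .top rfl]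
  have g₆ := any_spec (E := E) (s := s₅) (x := .x) (c := .bad) (b := inXfar)
    (p := fun x => (((s.v .u < x ∧ s.a .pc x = 0) ∧ s.a .comp x = s.v .r) ∧ x ≠ s.v .v) ∧
      ¬ e (s.v .v) x = true) (by decide)
    (fun j hj s' ha hv => by
      rw [inXfar, evalB_and, evalB_inX]; simp [ha, hv, a₅, v₅, he])
  have f₆ := run_fr (E := E) (anyC .x inXfar .bad) s₅
  set s₆ := run E (anyC .x inXfar .bad) s₅
  clear_value s₆
  have v₆ : ∀ y, y ≠ .top → y ≠ .sz → y ≠ .cnt → y ≠ .x → y ≠ .bad → s₆.v y = s.v y :=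
    fun y h1 h2 h3 h4 h5 => by
      rw [← v₅ y h1 h2 h3 h4, ← f₆.v y (by simp [anyC, Cmd.loop, Cmd.when, Cmd.wv, *])]
  have a₆ : s₆.a = s₅.a := by funext c; rw [f₆.a c rfl]
  have t₆ : s₆.v .top = s.v .top + 1 := by rw [← t₅, ← f₆.v .top rfl]
  have g₇ := fill_spec (E := E) (s := s₆) (x := .x) (b := inX) (a := .att) (f := .inc (.var .v))
    (p := fun x => (((s.v .u < x ∧ s.a .pc x = 0) ∧ s.a .comp x = s.v .r) ∧ x ≠ s.v .v))
    (g := fun _ => s.v .v + 1)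
    (fun j hj s' ha _ hv => by rw [evalB_inX]; simp [ha, hv, a₆, a₅, v₆])
  have f₇ := run_fr (E := E) (fillC .x inX .att (.inc (.var .v))) s₆
  set s₇ := run E (fillC .x inX .att (.inc (.var .v))) s₆
  clear_value s₇
  have v₇ : ∀ y, y ≠ .x → s₇.v y = s₆.v y := fun y h1 =>
    f₇.v y (by simp [fillC, Cmd.loop, Cmd.when, Cmd.wv, *])
  have a₇ : ∀ c, c ≠ .att → s₇.a c = s₅.a c := fun c hc => by
    rw [← a₆, f₇.a c (by simp [fillC, Cmd.loop, Cmd.when, Cmd.wa, *])]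
  have g₈ := fill_spec (E := E) (s := s₇) (x := .x) (b := inX) (a := .pc) (f := .var .top)
    (p := fun x => (((s.v .u < x ∧ s.a .pc x = 0) ∧ s.a .comp x = s.v .r) ∧ x ≠ s.v .v))
    (g := fun _ => s.v .top + 1)
    (fun j hj s' ha ha' hv => by
      rw [evalB_inX]
      simp [ha, ha', hv, a₇, a₅, v₇, v₆, t₆])
  have f₈ := run_fr (E := E) (fillC .x inX .pc (.var .top)) s₇
  set s₈ := run E (fillC .x inX .pc (.var .top)) s₇
  clear_value s₈
  have v₈ : ∀ y, y ≠ .x → s₈.v y = s₆.v y := fun y h1 => by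
    rw [← v₇ y h1]
    exact f₈.v y (by simp [fillC, Cmd.loop, Cmd.when, Cmd.wv, *])
  have a₈ : ∀ c, c ≠ .pc → s₈.a c = s₇.a c := fun c hc => by
    rw [f₈.a c (by simp [fillC, Cmd.loop, Cmd.when, Cmd.wa, *])]
  have f₉ := run_fr (E := E) (.when (.eq (.var .bad) 1) (.put .mark (.var .v) 1)) s₈
  have m₉ : ∀ x, (run E (.when (.eq (.var .bad) 1) (.put .mark (.var .v) 1)) s₈).a .mark x
      = if x = s.v .v ∧ s₆.v .bad = 1 then 1 else s.a .mark x := fun x => by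
    have h1 : s₈.v .v = s.v .v := by rw [v₈ _ (by decide), v₆] <;> decide
    have h2 : s₈.v .bad = s₆.v .bad := v₈ _ (by decide)
    have h3 : s₈.a .mark = s.a .mark := by rw [a₈, a₇, a₅] <;> decide
    simp only [run_when, evalB_eq, eval_var, eval_one, run_put, h1, h2]
    split_ifs with h4 h5 h5
    · simp [h3, h5.1]
    · have : x ≠ s.v .v := fun h => h5 ⟨h, h4⟩
      simp [h3, this]
    · exact absurd h5.2 h4
    · rw [h3]
  set s₉ := run E (.when (.eq (.var .bad) 1) (.put .mark (.var .v) 1)) s₈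
  clear_value s₉
  have hside : s₉.a .side = s₅.a .side := by rw [f₉.a _ rfl, a₈, a₇] <;> decide
  have hin : ∀ x ∈ X, s₉.a .side x ≤ 1 := fun x hx => by
    rw [hside]
    have h4 := g₄.2.2 x
    have h5 := g₅.2.2 x
    have hx' := (hXm x).1 hx
    by_cases hex : e (s.v .v) x = true
    · rw [if_pos ⟨hx'.1, hx'.2, hex⟩] at h4
      rw [if_neg fun h => h.2.2 hex] at h5
      omega
    · rwa [if_pos ⟨hx'.1, hx'.2, hex⟩] at h5
  have hnb : #{x ∈ X | e (s.v .v) x = true ∧ s₉.a .side x = 1}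
      = min #{x ∈ X | e (s.v .v) x = true} ((#X + 1) / 2) := by
    have h1 := g₄.1
    have h2 := g₄.2.1
    rw [c₃, z₃, zero_add] at h1
    rw [c₃, zero_add, h1] at h2
    rw [h2, ← hXf fun x => e (s.v .v) x = true ∧ s₉.a .side x = 1]
    refine congrArg card (filter_congr fun x hx => ?_)
    rw [hside, ← and_assoc]
    have h5 := g₅.2.2 x
    refine and_congr_right fun hex => ?_
    replace hex := hex.2
    rw [if_neg fun h => h.2.2 hex] at h5
    rw [h5]
  refine ⟨?_, fun x => ?_, fun x => ?_, fun x hx => ?_, ⟨hin, ?_, hnb⟩, fun x => ?_⟩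
  · change s₉.v .top = s.v .top + 1
    rw [f₉.v _ rfl, v₈ _ (by decide), t₆]
  · change s₉.a .pc x = if x ∈ X then s.v .top + 1 else s.a .pc x
    rw [f₉.a _ rfl, g₈, a₇ _ (by decide), a₅ _ (by decide)]
    simp only [hXm]
  · change s₉.a .att x = if x ∈ X then s.v .v + 1 else s.a .att x
    rw [f₉.a _ rfl, a₈ _ (by decide), g₇, a₆, a₅ _ (by decide)]
    simp only [hXm]
  · change s₉.a .side x = s.a .side x
    have h4 := g₄.2.2 x
    have h5 := g₅.2.2 x
    rw [hXm] at hx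
    rw [if_neg fun h => hx ⟨h.1, h.2.1⟩] at h4 h5
    rw [hside, h5, h4, a₃]
  · change #{x ∈ X | s₉.a .side x = 1} = _
    have h1 := g₅.1
    have h2 := g₅.2.1
    have h3 := card_filter_split (p := fun x => s₉.a .side x = 1)
      (q := fun x => e (s.v .v) x = true) X
    have h4 : #{x ∈ X | s₉.a .side x = 1 ∧ ¬ e (s.v .v) x = true}
        = s₅.v .cnt - s₄.v .cnt := by
      rw [h2, Nat.add_sub_cancel_left,
        ← hXf fun x => s₉.a .side x = 1 ∧ ¬ e (s.v .v) x = true]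
      refine congrArg card (filter_congr fun x hx => ?_)
      rw [hside]
      tauto
    have h5 := card_filter_add_card_filter_not (s := X) (fun x => e (s.v .v) x = true)
    have h6 := g₄.1
    simp only [and_comm (a := s₉.a .side _ = 1) (b := e (s.v .v) _ = true)] at h3
    rw [hnb] at h3
    rw [c₃, z₃, zero_add] at h6
    rw [z₄] at h1
    omega
  · change s₉.a .mark x = if x = s.v .v ∧ ∃ y ∈ X, ¬ e (s.v .v) y = true then 1 else s.a .mark x
    rw [m₉]
    have : s₆.v .bad = 1 ↔ ∃ y ∈ X, ¬ e (s.v .v) y = true := by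
      rcases g₆ with ⟨h, j, hj, h'⟩ | ⟨h, h'⟩
      · exact ⟨fun _ => ⟨j, (hXm j).2 ⟨hj, h'.1⟩, h'.2⟩, fun _ => h⟩
      · refine ⟨fun h'' => by omega, fun ⟨y, hy, hy'⟩ => ?_⟩
        rw [hXm] at hy
        exact absurd ⟨hy.2, hy'⟩ (h' y hy.1)
    simp only [this]

end LoopLang

/-! ## One stage of the decomposition algorithm -/

namespace LoopLang

open Finset Pieces

variable {E : Env} {s : St}

section
open Var Arr

/-- Remove all vertices of the component `r`, or all but one of them, if `u` does not need them. -/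
def prune : Cmd :=
  countC x inQ cd ;; countC x (.and inQ (.le (mn x) u)) cw ;;
  findC x (.and inQ (.le (mn x) u)) w ;; countC x (.and inQ (.lt (mn x) u)) cp ;;
  .when (.and (.le 2 cd) (.eq cw 1)) (.set v w ;; carve) ;;
  .when (.and (.le 1 cd) (.eq cp 0)) (.set v u ;; carve)

end

/-- What the decomposition needs to know about the order `o` and the numbers `m` of the smallest
neighbours. -/
structure Ctx (E : Env) (o m : ℕ → ℕ) : Prop where
  irr : ∀ x, E.rel o x x = false
  sym : ∀ x y, E.rel o x y = E.rel o y x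
  low : ∀ x < E.n, ∀ b ≤ E.n, m x < b ↔ Low (E.rel o) b x
  prev : ∀ x < E.n, 0 < x → Low (E.rel o) x x

/-- The state of the decomposition before vertex `b - 1` is treated. -/
structure St.Inv (E : Env) (o m : ℕ → ℕ) (s : St) (b : ℕ) : Prop where
  ord : s.a .ord = o
  mn : s.a .mn = m
  removed : Removed E.n (E.rel o) s.data 0
  stage : Stage E.n (E.rel o) (s.a .pc) (s.a .comp) b

theorem evalB_inQ (s : St) : evalB E inQ s = true ↔
    (s.v .u < s.v .x ∧ s.a .pc (s.v .x) = 0) ∧ s.a .comp (s.v .x) = s.v .r := by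
  simp [inQ, actB]

variable {o m : ℕ → ℕ}

theorem cls_of_carve {s s' : St} {X : Finset ℕ} {e : ℕ → ℕ → Bool} {v : ℕ}
    (h : Carve e s.data s'.data X v) (hu : s'.v .u = s.v .u) (hc : s'.a .comp = s.a .comp) (r : ℕ) :
    s'.cls E r = s.cls E r \ X := by
  unfold St.cls
  rw [hu, hc]
  exact cls_carve (Nat.succ_ne_zero _) h.pc

/-- Carving keeps the order and the smallest neighbours. -/
theorem carve_run {x : Var} (hx : x = .w ∨ x = .u) {r : ℕ} (hr : s.v .r = r) (ho : s.a .ord = o) :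
    let s' := run E (.set .v (.var x) ;; carve) s
    Carve (E.rel o) s.data s'.data ((s.cls E r).erase (s.v x)) (s.v x) ∧
      Fr (.set .v (.var x) ;; carve) s s' ∧
      ∀ r', s'.cls E r' = s.cls E r' \ (s.cls E r).erase (s.v x) := by
  subst hr ho
  intro s'
  have h := carve_spec (E := E) (s := run E (.set .v (.var x)) s)
  have hf := run_fr (E := E) (.set .v (.var x) ;; carve) s
  have h' : Carve (E.rel (s.a .ord)) s.data s'.data ((s.cls E (s.v .r)).erase (s.v x)) (s.v x) := by
    rcases hx with rfl | rfl <;> exact h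
  exact ⟨h', hf, fun r' => cls_of_carve h' (hf.v _ rfl) (hf.a _ rfl) r'⟩

theorem prune_spec (hE : Ctx E o m) {u r : ℕ} (hu : s.v .u = u) (hun : u < E.n) (hr : s.v .r = r)
    (hI : s.Inv E o m (u + 1)) :
    let s' := run E prune s
    s'.Inv E o m (u + 1) ∧ Ready (E.rel o) u (s'.cls E r) ∧
      ∀ r', r' ≠ r → s'.cls E r' = s.cls E r' := by
  intro s'
  set e := E.rel o with he
  set Q := s.cls E r with hQ
  have hQm : ∀ x, x ∈ Q ↔ x < E.n ∧ ((u < x ∧ s.a .pc x = 0) ∧ s.a .comp x = r) := fun x => by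
    rw [hQ, St.mem_cls, hu]; tauto
  have hlow : ∀ x ∈ Q, (m x ≤ u ↔ Low e (u + 1) x) ∧ (m x < u ↔ Low e u x) := fun x hx => by
    have hx' := ((hQm x).1 hx).1
    rw [← Nat.lt_succ_iff]
    exact ⟨hE.low x hx' _ hun, hE.low x hx' _ hun.le⟩
  have hstage := hI.stage
  have hcls : ∀ {s : St}, s.v .u = u → s.cls E r = cls E.n (s.a .pc) (s.a .comp) (u + 1) r :=
    fun h => by rw [St.cls, h]
  -- the counts
  have hs' : s' = run E prune s := rfl
  simp only [prune, run_seq] at hs'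
  have g₁ : (run E (countC .x inQ .cd) s).v .cd = #Q := by
    have : ({x ∈ range E.n | (u < x ∧ s.a .pc x = 0) ∧ s.a .comp x = r} : Finset ℕ) = Q := by
      ext x; rw [mem_filter, mem_range, hQm]
    rw [← this]
    exact count_spec (by decide) fun j hj s' ha hv => by rw [evalB_inQ]; simp [ha, hv, hu, hr]
  have f₁ := run_fr (E := E) (countC .x inQ .cd) s
  set s₁ := run E (countC .x inQ .cd) s
  clear_value s₁
  have a₁ : s₁.a = s.a := by funext c; rw [f₁.a c rfl]
  have hu₁ : s₁.v .u = u := by rw [f₁.v _ rfl, hu]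
  have hr₁ : s₁.v .r = r := by rw [f₁.v _ rfl, hr]
  have hcount : ∀ (q : ℕ → Prop) [DecidablePred q], ({x ∈ range E.n |
      ((u < x ∧ s.a .pc x = 0) ∧ s.a .comp x = r) ∧ q x} : Finset ℕ) = {x ∈ Q | q x} :=
    fun q _ => by ext x; simp only [mem_filter, mem_range, hQm]; tauto
  have g₂ : (run E (countC .x (.and inQ (.le (.get .mn (.var .x)) (.var .u))) .cw) s₁).v .cw
      = #{x ∈ Q | m x ≤ u} := by
    rw [← hcount]
    exact count_spec (by decide) fun j hj s' ha hv => by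
      rw [evalB_and, evalB_inQ]; simp [ha, hv, hu₁, hr₁, a₁, hI.mn]
  have f₂ := run_fr (E := E) (countC .x (.and inQ (.le (.get .mn (.var .x)) (.var .u))) .cw) s₁
  set s₂ := run E (countC .x (.and inQ (.le (.get .mn (.var .x)) (.var .u))) .cw) s₁
  clear_value s₂
  have a₂ : s₂.a = s.a := by funext c; rw [f₂.a c rfl, a₁]
  have hu₂ : s₂.v .u = u := by rw [f₂.v _ rfl, hu₁]
  have hr₂ : s₂.v .r = r := by rw [f₂.v _ rfl, hr₁]
  have g₃ := find_spec (E := E) (s := s₂) (x := .x) (z := .w)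
    (b := .and inQ (.le (.get .mn (.var .x)) (.var .u)))
    (p := fun x => ((u < x ∧ s.a .pc x = 0) ∧ s.a .comp x = r) ∧ m x ≤ u) (by decide)
    (fun j hj s' ha hv => by
      rw [evalB_and, evalB_inQ]; simp [ha, hv, hu₂, hr₂, a₂, hI.mn])
  have f₃ := run_fr (E := E) (findC .x (.and inQ (.le (.get .mn (.var .x)) (.var .u))) .w) s₂
  set s₃ := run E (findC .x (.and inQ (.le (.get .mn (.var .x)) (.var .u))) .w) s₂
  clear_value s₃
  have a₃ : s₃.a = s.a := by funext c; rw [f₃.a c rfl, a₂]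
  have hu₃ : s₃.v .u = u := by rw [f₃.v _ rfl, hu₂]
  have hr₃ : s₃.v .r = r := by rw [f₃.v _ rfl, hr₂]
  have g₄ : (run E (countC .x (.and inQ (.lt (.get .mn (.var .x)) (.var .u))) .cp) s₃).v .cp
      = #{x ∈ Q | m x < u} := by
    rw [← hcount]
    exact count_spec (by decide) fun j hj s' ha hv => by
      rw [evalB_and, evalB_inQ]; simp [ha, hv, hu₃, hr₃, a₃, hI.mn]
  have f₄ := run_fr (E := E) (countC .x (.and inQ (.lt (.get .mn (.var .x)) (.var .u))) .cp) s₃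
  set s₄ := run E (countC .x (.and inQ (.lt (.get .mn (.var .x)) (.var .u))) .cp) s₃
  clear_value s₄
  have a₄ : s₄.a = s.a := by funext c; rw [f₄.a c rfl, a₃]
  have hu₄ : s₄.v .u = u := by rw [f₄.v _ rfl, hu₃]
  have hr₄ : s₄.v .r = r := by rw [f₄.v _ rfl, hr₃]
  have hcd : s₄.v .cd = #Q := by rw [f₄.v _ rfl, f₃.v _ rfl, f₂.v _ rfl, g₁]
  have hcw : s₄.v .cw = #{x ∈ Q | m x ≤ u} := by rw [f₄.v _ rfl, f₃.v _ rfl, g₂]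
  have hw : s₄.v .w = s₃.v .w := f₄.v _ rfl
  have hcls₄ : ∀ r, s₄.cls E r = s.cls E r := fun r => by rw [St.cls, a₄, hu₄, ← hu]; rfl
  have hdata : s₄.data = s.data := by
    have : s₄.v .top = s.v .top := by
      rw [f₄.v _ rfl, f₃.v _ rfl, f₂.v _ rfl, f₁.v _ rfl]
    simp only [St.data, a₄, this]
  have hI₄ : s₄.Inv E o m (u + 1) :=
    ⟨by rw [a₄, hI.ord], by rw [a₄, hI.mn], by rw [hdata]; exact hI.removed, by
      rw [a₄]; exact hI.stage⟩
  -- the first removal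
  set s₅ := run E (.when (.and (.le 2 (.var .cd)) (.eq (.var .cw) 1))
    (.set .v (.var .w) ;; carve)) s₄ with hs₅
  have f₅ := run_fr (E := E) (.when (.and (.le 2 (.var .cd)) (.eq (.var .cw) 1))
    (.set .v (.var .w) ;; carve)) s₄
  rw [← hs₅] at f₅
  have hlowQ : Q.Nonempty → ∃ y ∈ Q, Low e (u + 1) y := by
    rintro ⟨x, hx⟩
    rw [hQ, hcls hu, Pieces.mem_cls] at hx
    obtain ⟨y, hy, hc, hl⟩ := hstage.low x hx.1
    exact ⟨y, by rw [hQ, hcls hu, Pieces.mem_cls]; exact ⟨hy, by rw [hc, hx.2]⟩, hl⟩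
  have key₅ : s₅.Inv E o m (u + 1) ∧ s₅.cls E r ⊆ Q ∧ (∀ x ∈ Q, Low e u x → x ∈ s₅.cls E r) ∧
      (Q.Nonempty → (s₅.cls E r).Nonempty) ∧
      (2 ≤ #(s₅.cls E r) → ∃ y ∈ s₅.cls E r, ∃ z ∈ s₅.cls E r, y ≠ z ∧ Low e (u + 1) y ∧
        Low e (u + 1) z) ∧ ∀ r', r' ≠ r → s₅.cls E r' = s.cls E r' := by
    rw [run_when] at hs₅
    by_cases hc : 2 ≤ #Q ∧ #{x ∈ Q | m x ≤ u} = 1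
    · rw [if_pos (by simp [hcd, hcw, hc])] at hs₅
      obtain ⟨h2, h1⟩ := hc
      obtain ⟨w, hwQ⟩ := card_eq_one.1 h1
      have hwm : s₄.v .w = w := by
        rcases g₃ with ⟨-, h⟩ | ⟨hlt, h⟩
        · have : w ∈ ({x ∈ Q | m x ≤ u} : Finset ℕ) := by rw [hwQ]; simp
          rw [mem_filter, hQm] at this
          exact absurd ⟨this.1.2, this.2⟩ (h w this.1.1)
        · rw [hw]
          have : s₃.v .w ∈ ({x ∈ Q | m x ≤ u} : Finset ℕ) :=
            mem_filter.2 ⟨(hQm _).2 ⟨hlt, h.1⟩, h.2⟩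
          rwa [hwQ, mem_singleton] at this
      have hw' : w ∈ Q ∧ m w ≤ u := by
        rw [← mem_filter (p := fun x => m x ≤ u), hwQ, mem_singleton]
      obtain ⟨hcar, hf, hcl⟩ := carve_run (E := E) (s := s₄) (x := .w) (.inl rfl) hr₄ hI₄.ord
      rw [← hs₅] at hcar hf hcl
      rw [hwm] at hcar hcl
      simp only [hcls₄, ← hQ] at hcar hcl
      have hQe : Q = cls E.n (s₄.a .pc) (s₄.a .comp) (u + 1) r := by rw [a₄, hQ, hcls hu]
      rw [hQe] at hcar
      obtain ⟨hrem, hst⟩ := hI₄.stage.carve_to_one (r := r) (w := w) hE.irr hE.sym hI₄.removed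
        (hQe ▸ hw'.1) ((hlow w hw'.1).1.1 hw'.2) (fun x hx hl => by
          have hxQ : x ∈ Q := hQe ▸ hx
          have : x ∈ ({x ∈ Q | m x ≤ u} : Finset ℕ) :=
            mem_filter.2 ⟨hxQ, (hlow x hxQ).1.2 hl⟩
          rwa [hwQ, mem_singleton] at this) (hQe ▸ h2) hcar
      have hcr : s₅.cls E r = {w} := by
        rw [hcl, sdiff_erase hw'.1, sdiff_self]; rfl
      refine ⟨⟨by rw [hf.a _ rfl, hI₄.ord], by rw [hf.a _ rfl, hI₄.mn], hrem, by
        rw [hf.a .comp rfl]; exact hst⟩, ?_, ?_, fun _ => by rw [hcr]; simp,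
        fun h => by rw [hcr] at h; simp at h, fun r' hr' => ?_⟩
      · rw [hcr, singleton_subset_iff]; exact hw'.1
      · intro x hx hl
        have : x ∈ ({x ∈ Q | m x ≤ u} : Finset ℕ) :=
          mem_filter.2 ⟨hx, (hlow x hx).1.2 (hl.mono (by omega))⟩
        rw [hcr, ← hwQ]; exact this
      · rw [hcl]
        refine sdiff_eq_self_of_disjoint (disjoint_left.2 fun x hx hx' => ?_)
        have h1 := (St.mem_cls.1 hx).2
        have h2 := (St.mem_cls.1 (mem_erase.1 hx').2).2
        exact hr' (h1.symm.trans h2)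
    · rw [if_neg (by simpa [hcd, hcw] using hc)] at hs₅
      rw [hs₅, hcls₄, ← hQ]
      refine ⟨hI₄, Subset.refl _, fun x hx _ => hx, id, fun h2 => ?_, fun r' _ => hcls₄ r'⟩
      obtain ⟨y, hy, hl⟩ := hlowQ (card_pos.1 (by omega))
      have hpos : 0 < #{x ∈ Q | m x ≤ u} :=
        card_pos.2 ⟨y, mem_filter.2 ⟨hy, (hlow y hy).1.2 hl⟩⟩
      obtain ⟨a, ha, b, hb, hab⟩ := one_lt_card.1
        (show 1 < #{x ∈ Q | m x ≤ u} by
          have := not_and.1 hc h2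
          omega)
      rw [mem_filter] at ha hb
      exact ⟨a, ha.1, b, hb.1, hab, (hlow a ha.1).1.1 ha.2, (hlow b hb.1).1.1 hb.2⟩
  obtain ⟨hI₅, hsub, hkeep, hne, hready, hoth⟩ := key₅
  have hu₅ : s₅.v .u = u := by rw [f₅.v _ rfl, hu₄]
  have hr₅ : s₅.v .r = r := by rw [f₅.v _ rfl, hr₄]
  have hcd₅ : s₅.v .cd = #Q := by rw [f₅.v _ rfl, hcd]
  have hcp₅ : s₅.v .cp = #{x ∈ Q | m x < u} := by rw [f₅.v _ rfl, g₄]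
  clear_value s₅
  -- the second removal
  rw [run_when] at hs'
  by_cases hc : 1 ≤ #Q ∧ #{x ∈ Q | m x < u} = 0
  · rw [if_pos (by simpa [hcd₅, hcp₅] using hc)] at hs'
    obtain ⟨h1, h0⟩ := hc
    obtain ⟨hcar, hf, hcl⟩ := carve_run (E := E) (s := s₅) (x := .u) (.inr rfl) hr₅ hI₅.ord
    rw [← hs'] at hcar hf hcl
    have hQ₅ := hcls hu₅
    have hno : u ∉ s₅.cls E r := fun h => by
      rw [St.mem_cls] at h; omega
    rw [hu₅, erase_eq_of_notMem hno] at hcar hcl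
    rw [hQ₅] at hcar
    obtain ⟨hrem, hst⟩ := hI₅.stage.carve_all hE.irr hE.sym hI₅.removed hun
      (hQ₅ ▸ hne (card_pos.1 h1)) (fun x hx hl => by
        have hxQ := hsub (hQ₅ ▸ hx)
        have : x ∈ ({x ∈ Q | m x < u} : Finset ℕ) := mem_filter.2 ⟨hxQ, (hlow x hxQ).2.2 hl⟩
        rw [card_eq_zero.1 h0] at this
        simp at this) hcar
    have hcr : s'.cls E r = ∅ := by rw [hcl, sdiff_self]; rfl
    refine ⟨⟨by rw [hf.a _ rfl, hI₅.ord], by rw [hf.a _ rfl, hI₅.mn], hrem, by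
        rw [hf.a .comp rfl]; exact hst⟩, ?_, fun r' hr' => ?_⟩
    · rw [hcr]
      exact ⟨fun h => by simp at h, fun h => by simp at h⟩
    · rw [hcl, ← hoth r' hr']
      refine sdiff_eq_self_of_disjoint (disjoint_left.2 fun x hx hx' => ?_)
      exact hr' ((St.mem_cls.1 hx).2.symm.trans (St.mem_cls.1 hx').2)
  · rw [if_neg (by simpa [hcd₅, hcp₅] using hc)] at hs'
    rw [hs']
    refine ⟨hI₅, ⟨fun h => ?_, hready⟩, hoth⟩
    have h1 : 1 ≤ #Q := card_pos.2 (h.mono hsub)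
    obtain ⟨x, hx⟩ := card_pos.1 (Nat.pos_of_ne_zero (not_and.1 hc h1))
    rw [mem_filter] at hx
    have hl := (hlow x hx.1).2.1 hx.2
    exact ⟨x, hkeep x hx.1 hl, hl⟩

end LoopLang

/-! ## The whole decomposition algorithm -/

namespace LoopLang

open Finset Pieces

variable {E : Env} {s : St}

section
open Var Arr

/-- The sizes of all components and the numbers of their vertices with neighbours below `u`. -/
def tally : Cmd :=
  .loop r (countC x inQ cd ;; .put size r cd ;;
    countC x (.and inQ (.lt (mn x) u)) cp ;; .put Arr.cnt r cp)

/-- Whether a vertex has a neighbour below `u`, as a number. -/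
def ind (e : Exp) : Exp := .sub 1 (.sub (.inc (mn e)) u)

def spare (e : Exp) : BExp :=
  .or (.eq (size (comp e)) 1) (.lt (ind e) (Arr.cnt (comp e)))

def goodB : BExp :=
  .and (actB x) (.and (actB y) (.and (.not (.eq x y)) (.and (.edge u x) (.or
    (.and (.eq (comp x) (comp y)) (.and (.not (.edge u y))
      (.or (.eq (size (comp x)) 2) (.lt (.add (ind x) (ind y)) (Arr.cnt (comp x))))))
    (.and (.not (.eq (comp x) (comp y))) (.and (.edge u y) (.and (spare x) (spare y))))))))

def pathC : Cmd :=
  .set top (.inc top) ;; .put pc u top ;; .put pc px top ;; .put pc py top ;;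
  .put mark u 1 ;; .put mark px 1 ;; .put mark py 1 ;; .put side u 0 ;; .put side px 1 ;;
  .ite (.eq (comp px) (comp py)) (.put side py 0) (.put side py 1)

def nearC : Cmd :=
  .set v u ;; carve ;; fillC x (.and (.eq (pc x) top) (.not (.edge u x))) mark 1 ;;
  .put pc u top ;; .put side u 0

def joinC : Cmd :=
  .set w .nn ;; findC x (.and (actB x) (.edge u x)) w ;;
  .ite (.eq w .nn) (.put comp u u) (.set r (comp w) ;;
    anyC x (.and inQ (.not (.edge u x))) bad ;; .ite (.eq bad 0) (.put comp u r) nearC)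

def singleC : Cmd :=
  .set top (.inc top) ;; .put pc u top ;; .put mark u 1 ;; .put side u 0

def stageC : Cmd :=
  .set u (.sub (.sub .nn 1) t) ;; .loop r prune ;; .ite (.eq u 0) singleC
    (tally ;; find2C goodB ;; .ite (.eq fd 1) pathC joinC)

def decompose : Cmd := .loop t stageC

end

variable {o m : ℕ → ℕ} {u : ℕ}

theorem St.Inv.congr {s s' : St} {b : ℕ} (h : s.Inv E o m b) (ho : s'.a .ord = s.a .ord)
    (hm : s'.a .mn = s.a .mn) (hp : s'.a .pc = s.a .pc) (hk : s'.a .mark = s.a .mark)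
    (hs : s'.a .side = s.a .side) (ha : s'.a .att = s.a .att) (ht : s'.v .top = s.v .top)
    (hc : s'.a .comp = s.a .comp) : s'.Inv E o m b :=
  ⟨ho.trans h.ord, hm.trans h.mn, by
    have : s'.data = s.data := by simp only [St.data, *]
    rw [this]; exact h.removed, by rw [hp, hc]; exact h.stage⟩

theorem cls_congr {s s' : St} (hu : s'.v .u = s.v .u) (hp : s'.a .pc = s.a .pc)
    (hc : s'.a .comp = s.a .comp) (r : ℕ) : s'.cls E r = s.cls E r := by
  rw [St.cls, hu, hp, hc]; rfl

theorem pruneAll_spec (hE : Ctx E o m) (hu : s.v .u = u) (hun : u < E.n)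
    (hI : s.Inv E o m (u + 1)) :
    let s' := run E (.loop .r prune) s
    s'.Inv E o m (u + 1) ∧ ∀ r, Ready (E.rel o) u (s'.cls E r) := by
  intro s'
  have key : s'.Inv E o m (u + 1) ∧ ∀ r < E.n, Ready (E.rel o) u (s'.cls E r) := by
    refine loop_inv (fun j s' => s'.Inv E o m (u + 1) ∧
      ∀ r < j, Ready (E.rel o) u (s'.cls E r)) ⟨hI, by simp⟩ fun j hj s₁ hf ⟨hI₁, h₁⟩ => ?_
    have hu₁ : s₁.v .u = u := by rw [hf.v _ rfl, hu]
    obtain ⟨hI₂, hr, hoth⟩ := prune_spec (s := s₁.setV .r j) (r := j) (u := u) hE (by simpa using hu₁)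
      hun (by simp) (hI₁.congr rfl rfl rfl rfl rfl rfl rfl rfl)
    refine ⟨hI₂, fun r hr' => ?_⟩
    rcases Nat.lt_succ_iff_lt_or_eq.1 hr' with hr' | rfl
    · rw [hoth r (by omega)]
      exact h₁ r hr'
    · exact hr
  have hu' : s'.v .u = u := by
    rw [show s'.v .u = s.v .u from (run_fr (E := E) (.loop .r prune) s).v _ rfl, hu]
  refine ⟨key.1, fun r => ?_⟩
  by_cases hr : r < E.n
  · exact key.2 r hr
  · have : s'.cls E r = ∅ := by
      refine eq_empty_of_forall_notMem fun x hx => hr ?_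
      rw [St.cls, hu', Pieces.mem_cls] at hx
      rw [← hx.2]
      exact (key.1.stage.num x hx.1).2
    rw [this]
    exact ⟨fun h => by simp at h, fun h => by simp at h⟩

theorem tally_spec (hu : s.v .u = u) :
    let s' := run E tally s
    ∀ r < E.n, s'.a .size r = #(s.cls E r) ∧ s'.a .cnt r = #{x ∈ s.cls E r | s.a .mn x < u} := by
  refine loop_inv (fun j s' => ∀ r < j, s'.a .size r = #(s.cls E r) ∧
    s'.a .cnt r = #{x ∈ s.cls E r | s.a .mn x < u}) (by simp) fun j hj s₁ hf h => ?_
  have hu₁ : s₁.v .u = u := by rw [hf.v _ rfl, hu]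
  have hm : s₁.a .mn = s.a .mn := hf.a _ rfl
  have hcls : ∀ r, s₁.cls E r = s.cls E r := fun r => cls_congr (hf.v _ rfl) (hf.a _ rfl) (hf.a _ rfl) r
  simp only [← hcls, ← hm] at h ⊢
  simp only [run_seq]
  set s₂ := s₁.setV .r j with hs₂
  have hu₂ : s₂.v .u = u := by simpa [hs₂] using hu₁
  have hr₂ : s₂.v .r = j := by simp [hs₂]
  have a₂ : s₂.a = s₁.a := rfl
  clear_value s₂
  have hmem : ∀ x, x ∈ s₁.cls E j ↔ x < E.n ∧ ((u < x ∧ s₁.a .pc x = 0) ∧ s₁.a .comp x = j) :=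
    fun x => by rw [St.mem_cls, hu₁]; tauto
  have g₃ : (run E (countC .x inQ .cd) s₂).v .cd = #(s₁.cls E j) := by
    have : ({x ∈ range E.n | (u < x ∧ s₁.a .pc x = 0) ∧ s₁.a .comp x = j} : Finset ℕ)
        = s₁.cls E j := by
      ext x; rw [mem_filter, mem_range, hmem]
    rw [← this]
    exact count_spec (by decide) fun j hj s' ha hv => by rw [evalB_inQ]; simp [ha, hv, hu₂, hr₂, a₂]
  have f₃ := run_fr (E := E) (countC .x inQ .cd) s₂
  set s₃ := run E (countC .x inQ .cd) s₂
  clear_value s₃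
  have a₃ : s₃.a = s₁.a := by funext c; rw [f₃.a c rfl, a₂]
  have hu₃ : s₃.v .u = u := by rw [f₃.v _ rfl, hu₂]
  have hr₃ : s₃.v .r = j := by rw [f₃.v _ rfl, hr₂]
  set s₄ := run E (.put .size (.var .r) (.var .cd)) s₃ with hs₄
  have v₄ : s₄.v = s₃.v := rfl
  have a₄ : ∀ c, c ≠ .size → s₄.a c = s₁.a c := fun c hc => by
    rw [← a₃]; exact St.setA_ne _ _ _ hc
  have z₄ : ∀ i, s₄.a .size i = if i = j then #(s₁.cls E j) else s₁.a .size i := fun i => by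
    simp [hs₄, g₃, hr₃, a₃]
  clear_value s₄
  have g₅ : (run E (countC .x (.and inQ (.lt (.get .mn (.var .x)) (.var .u))) .cp) s₄).v .cp
      = #{x ∈ s₁.cls E j | s₁.a .mn x < u} := by
    have : ({x ∈ range E.n | ((u < x ∧ s₁.a .pc x = 0) ∧ s₁.a .comp x = j) ∧ s₁.a .mn x < u} : Finset ℕ)
        = {x ∈ s₁.cls E j | s₁.a .mn x < u} := by
      ext x; simp only [mem_filter, mem_range, hmem]; tauto
    rw [← this]
    exact count_spec (by decide) fun j hj s' ha hv => by
      rw [evalB_and, evalB_inQ]; simp [ha, hv, hu₃, hr₃, a₄, v₄]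
  have f₅ := run_fr (E := E) (countC .x (.and inQ (.lt (.get .mn (.var .x)) (.var .u))) .cp) s₄
  set s₅ := run E (countC .x (.and inQ (.lt (.get .mn (.var .x)) (.var .u))) .cp) s₄
  clear_value s₅
  have hr₅ : s₅.v .r = j := by rw [f₅.v _ rfl, v₄, hr₃]
  intro r hr
  simp only [run_put, eval_var, hr₅, g₅, St.setA_a, reduceCtorEq, false_and, if_false, true_and]
  rw [f₅.a _ rfl, f₅.a _ rfl, z₄, a₄ _ (by decide)]
  rcases Nat.lt_succ_iff_lt_or_eq.1 hr with hr | rfl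
  · rw [if_neg hr.ne, if_neg hr.ne]; exact h r hr
  · simp

theorem card_lt_iff_of_subset {A L : Finset ℕ} (h : A ⊆ L) : #A < #L ↔ ∃ z ∈ L, z ∉ A := by
  constructor
  · intro hlt
    by_contra hc
    push Not at hc
    exact absurd (card_le_card hc) (by omega)
  · rintro ⟨z, hz, hzA⟩
    exact card_lt_card ⟨h, fun h' => hzA (h' hz)⟩

theorem goodB_iff (hE : Ctx E o m) (hun : u < E.n) (hu : s.v .u = u) (hI : s.Inv E o m (u + 1))
    (hsize : ∀ r < E.n, s.a .size r = #(s.cls E r))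
    (hcnt : ∀ r < E.n, s.a .cnt r = #{x ∈ s.cls E r | m x < u})
    {x y : ℕ} (hx : x < E.n) (hy : y < E.n) (hsx : s.v .x = x) (hsy : s.v .y = y) :
    evalB E goodB s = true ↔ Good E.n (E.rel o) (s.a .pc) (s.a .comp) u x y := by
  have hcls : ∀ r, cls E.n (s.a .pc) (s.a .comp) (u + 1) r = s.cls E r := fun r => by
    rw [St.cls, hu]
  have hind : ∀ z, 1 - (m z + 1 - u) = if m z < u then 1 else 0 := fun z => by
    split_ifs <;> omega
  have hind1 : ∀ z, (if m z < u then 1 else 0) ≤ 1 := fun z => by split_ifs <;> omega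
  have hcap : 4 ≤ E.cap := by unfold Env.cap; omega
  simp only [goodB, evalB_and, evalB_or, evalB_not, evalB_eq, evalB_lt, evalB_edge, actB, spare,
    ind, eval_var, eval_get, eval_sub, eval_add, eval_inc, eval_zero, eval_one, eval_two, hsx, hsy,
    hu, hI.ord, hI.mn, hind, Good, hcls, mem_active, Nat.succ_le_iff, hx, hy, true_and,
    Bool.not_eq_true]
  rw [min_eq_left (by have := hind1 x; have := hind1 y; omega)]
  refine and_congr_right fun hxa => and_congr_right fun hya => and_congr_right fun hxy =>
    and_congr_right fun hux => or_congr (and_congr_right fun hc => and_congr_right fun huy => ?_)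
    (and_congr_right fun hc => and_congr_right fun huy => ?_)
  · have hxA : x ∈ active E.n (s.a .pc) (u + 1) := mem_active.2 ⟨hx, hxa⟩
    have hcx := (hI.stage.num x hxA).2
    have hxc : x ∈ s.cls E (s.a .comp x) := St.mem_cls.2 ⟨⟨hx, by rw [hu]; exact hxa⟩, rfl⟩
    have hyc : y ∈ s.cls E (s.a .comp x) := St.mem_cls.2 ⟨⟨hy, by rw [hu]; exact hya⟩, hc.symm⟩
    rw [hsize _ hcx, hcnt _ hcx]
    refine or_congr_right ?_
    have hA : (if m x < u then 1 else 0) + (if m y < u then 1 else 0)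
        = #{z ∈ ({x, y} : Finset ℕ) | m z < u} := by
      rw [card_filter, sum_pair hxy]
    rw [hA, card_lt_iff_of_subset (filter_subset_filter _ (by simp [insert_subset_iff, hxc, hyc]))]
    refine exists_congr fun z => ?_
    simp only [mem_filter, mem_insert, mem_singleton]
    constructor
    · rintro ⟨⟨hz, hm⟩, h⟩
      exact ⟨hz, fun h' => h ⟨.inl h', hm⟩, fun h' => h ⟨.inr h', hm⟩,
        (hE.low z (St.mem_cls.1 hz).1.1 u hun.le).1 hm⟩
    · rintro ⟨hz, h1, h2, hl⟩
      exact ⟨⟨hz, (hE.low z (St.mem_cls.1 hz).1.1 u hun.le).2 hl⟩, fun h => by tauto⟩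
  · have key : ∀ x, x < E.n → u < x ∧ s.a .pc x = 0 →
        ((s.a .size (s.a .comp x) = 1 ∨ (if m x < u then 1 else 0) < s.a .cnt (s.a .comp x)) ↔
        (#(s.cls E (s.a .comp x)) = 1 ∨ ∃ z ∈ s.cls E (s.a .comp x), z ≠ x ∧ Low (E.rel o) u z)) := by
      intro x hx hxa
      have hxA : x ∈ active E.n (s.a .pc) (u + 1) := mem_active.2 ⟨hx, hxa⟩
      have hcx := (hI.stage.num x hxA).2
      have hxc : x ∈ s.cls E (s.a .comp x) := St.mem_cls.2 ⟨⟨hx, by rw [hu]; exact hxa⟩, rfl⟩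
      rw [hsize _ hcx, hcnt _ hcx]
      refine or_congr_right ?_
      have hA : (if m x < u then 1 else 0) = #{z ∈ ({x} : Finset ℕ) | m z < u} := by
        rw [card_filter, sum_singleton]
      rw [hA, card_lt_iff_of_subset (filter_subset_filter _ (by simp [hxc]))]
      refine exists_congr fun z => ?_
      simp only [mem_filter, mem_singleton]
      constructor
      · rintro ⟨⟨hz, hm⟩, h⟩
        exact ⟨hz, fun h' => h ⟨h', hm⟩, (hE.low z (St.mem_cls.1 hz).1.1 u hun.le).1 hm⟩
      · rintro ⟨hz, h1, hl⟩
        exact ⟨⟨hz, (hE.low z (St.mem_cls.1 hz).1.1 u hun.le).2 hl⟩, fun h => h1 h.1⟩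
    rw [key x hx hxa, key y hy hya]

theorem path_spec (hE : Ctx E o m) (hu : s.v .u = u) (hun : u < E.n) (hI : s.Inv E o m (u + 1))
    (hready : ∀ r, Ready (E.rel o) u (s.cls E r))
    (hg : Good E.n (E.rel o) (s.a .pc) (s.a .comp) u (s.v .px) (s.v .py)) :
    (run E pathC s).Inv E o m u := by
  have hf := run_fr (E := E) pathC s
  have hux : u ≠ s.v .px := by
    have := (mem_active.1 hg.1).2.1; omega
  have huy : u ≠ s.v .py := by
    have := (mem_active.1 hg.2.1).2.1; omega
  have hxy := hg.2.2.1
  have := hI.stage.path (D := s.data) (D' := (run E pathC s).data) hE.irr hE.sym hI.removed hun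
    (fun r => by have := hready r; rwa [St.cls, hu] at this) hg ?_ ?_ ?_ ?_ ?_ ?_ ?_ ?_
  · exact ⟨by rw [hf.a _ rfl, hI.ord], by rw [hf.a _ rfl, hI.mn], this.1, by
      rw [hf.a .comp rfl]; exact this.2⟩
  all_goals simp only [St.data, pathC, run_seq]
  · simp only [run_ite]; split_ifs <;> simp
  · intro z; simp only [run_ite]; split_ifs <;> (simp_all; try tauto)
  · intro z; simp only [run_ite]; split_ifs <;> (simp_all; try tauto)
  · exact hf.a .att rfl
  · intro z hz
    simp only [mem_insert, mem_singleton, not_or] at hz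
    simp only [run_ite]
    split_ifs <;> simp [hu, hz]
  · simp only [run_ite]; split_ifs <;> simp [hu, hux, huy]
  · simp only [run_ite]; split_ifs <;> simp [hu, hxy, hux, hux.symm]
  · simp only [run_ite]
    simp only [evalB_eq]
    split_ifs <;> simp_all

theorem near_spec (hE : Ctx E o m) (hu : s.v .u = u) (hun : u < E.n) (hI : s.Inv E o m (u + 1))
    (hready : ∀ r, Ready (E.rel o) u (s.cls E r)) {r w : ℕ} (hr : s.v .r = r)
    (hw : w ∈ s.cls E r) (h2 : 2 ≤ #(s.cls E r))
    (huw : ∀ y ∈ s.cls E r, E.rel o u y = true ↔ y ≠ w)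
    (hlow : ∀ y ∈ s.cls E r, Low (E.rel o) u y → y = w) : (run E nearC s).Inv E o m u := by
  have hf := run_fr (E := E) nearC s
  obtain ⟨hcar, f₁, -⟩ := carve_run (E := E) (s := s) (x := .u) (.inr rfl) hr hI.ord
  have hQm : ∀ x, x ∈ s.cls E r ↔ x < E.n ∧ ((u < x ∧ s.a .pc x = 0) ∧ s.a .comp x = r) :=
    fun x => by rw [St.mem_cls, hu]; tauto
  have hno : u ∉ s.cls E r := fun h => by rw [hQm] at h; omega
  rw [hu, erase_eq_of_notMem hno] at hcar
  have hQ : s.cls E r = cls E.n (s.a .pc) (s.a .comp) (u + 1) r := by rw [St.cls, hu]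
  rw [hQ] at hcar hw h2 huw hlow
  have hrun : run E nearC s = run E (.put .side (.var .u) 0) (run E (.put .pc (.var .u) (.var .top))
      (run E (fillC .x (.and (.eq (.get .pc (.var .x)) (.var .top)) (.not (.edge (.var .u) (.var .x))))
        .mark 1) (run E (.set .v (.var .u) ;; carve) s))) := rfl
  set s₁ := run E (.set .v (.var .u) ;; carve) s
  clear_value s₁
  have g₂ := fill_spec (E := E) (s := s₁) (x := .x)
    (b := .and (.eq (.get .pc (.var .x)) (.var .top)) (.not (.edge (.var .u) (.var .x))))
    (a := .mark) (f := 1)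
    (p := fun x => x ∈ s.cls E r ∧ ¬ E.rel o u x = true) (g := fun _ => 1)
    (fun j hj s' ha _ hv => by
      refine ⟨?_, fun _ => rfl⟩
      have h1 : s₁.a .pc j = s₁.v .top ↔ j ∈ s.cls E r := by
        rw [hQ, show s₁.v .top = s.v .top + 1 from hcar.top, show s₁.a .pc j = _ from hcar.pc j]
        split_ifs with h
        · simp only [h, iff_true]; rfl
        · simp only [h, iff_false]
          have : s.a .pc j ≤ s.v .top := hI.removed.pc_le j hj
          change s.a .pc j ≠ _
          omega
      simp [ha, hv, h1, f₁.a .ord rfl, hI.ord, f₁.v .u rfl, hu])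
  have f₂ := run_fr (E := E) (fillC .x (.and (.eq (.get .pc (.var .x)) (.var .top))
    (.not (.edge (.var .u) (.var .x)))) .mark 1) s₁
  set s₂ := run E (fillC .x (.and (.eq (.get .pc (.var .x)) (.var .top))
    (.not (.edge (.var .u) (.var .x)))) .mark 1) s₁
  clear_value s₂
  have hu₂ : s₂.v .u = u := by rw [f₂.v _ rfl, f₁.v _ rfl, hu]
  have ht₂ : s₂.v .top = s.v .top + 1 := by rw [f₂.v _ rfl]; exact hcar.top
  have := hI.stage.near (D := s.data) (D' := (run E nearC s).data) hE.irr hE.sym hI.removed hun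
    (fun r => by have := hready r; rwa [St.cls, hu] at this) hw h2 huw hlow hcar ?_ ?_ ?_ ?_ ?_
  · exact ⟨by rw [hf.a _ rfl, hI.ord], by rw [hf.a _ rfl, hI.mn], this.1, by
      rw [hf.a .comp rfl]; exact this.2⟩
  · rw [hrun]; exact f₂.v .top rfl
  · rw [hrun]; exact f₂.a .att rfl
  · intro x
    rw [hrun]
    simp only [St.data, run_put, eval_var, St.setA_a, St.setA_v, hu₂, ht₂, reduceCtorEq,
      false_and, if_false, true_and, f₂.a .pc rfl]
  · intro x
    rw [hrun]
    simp only [St.data, run_put, eval_var, St.setA_a, St.setA_v, hu₂, eval_zero, reduceCtorEq,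
      false_and, if_false, true_and, f₂.a .side rfl]
  · intro x
    rw [hrun]
    simp only [St.data, run_put, eval_var, St.setA_a, St.setA_v, reduceCtorEq, false_and, if_false,
      g₂, ← hQ]
    refine if_congr ⟨fun h => h.2, fun h => ⟨((hQm x).1 h.1).1, h⟩⟩ rfl rfl

theorem join_spec (hE : Ctx E o m) (hu : s.v .u = u) (hun : u < E.n) (hu0 : 0 < u)
    (hI : s.Inv E o m (u + 1)) (hready : ∀ r, Ready (E.rel o) u (s.cls E r))
    (hno : ∀ x y, ¬ Good E.n (E.rel o) (s.a .pc) (s.a .comp) u x y) :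
    (run E joinC s).Inv E o m u := by
  have hrun : run E joinC s = run E (.ite (.eq (.var .w) .nn) (.put .comp (.var .u) (.var .u))
      (.set .r (.get .comp (.var .w)) ;; anyC .x (.and inQ (.not (.edge (.var .u) (.var .x)))) .bad ;;
        .ite (.eq (.var .bad) 0) (.put .comp (.var .u) (.var .r)) nearC))
      (run E (findC .x (.and (actB (.var .x)) (.edge (.var .u) (.var .x))) .w)
        (run E (.set .w .nn) s)) := rfl
  rw [hrun]
  have g₁ := find_spec (E := E) (s := run E (.set .w .nn) s) (x := .x) (z := .w)
    (b := .and (actB (.var .x)) (.edge (.var .u) (.var .x)))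
    (p := fun x => (u < x ∧ s.a .pc x = 0) ∧ E.rel o u x = true) (by decide)
    (fun j hj s' ha hv => by simp [actB, ha, hv, hu, hI.ord])
  have f₁ := run_fr (E := E) (.set .w .nn ;;
    findC .x (.and (actB (.var .x)) (.edge (.var .u) (.var .x))) .w) s
  rw [run_seq] at f₁
  set s₁ := run E (findC .x (.and (actB (.var .x)) (.edge (.var .u) (.var .x))) .w)
        (run E (.set .w .nn) s)
  clear_value s₁
  have hu₁ : s₁.v .u = u := by rw [f₁.v _ rfl, hu]
  have a₁ : s₁.a = s.a := by funext c; exact f₁.a c rfl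
  have hI₁ : s₁.Inv E o m (u + 1) := hI.congr (f₁.a _ rfl) (f₁.a _ rfl) (f₁.a _ rfl) (f₁.a _ rfl)
    (f₁.a _ rfl) (f₁.a _ rfl) (f₁.v _ rfl) (f₁.a _ rfl)
  have hready' : ∀ r, Ready (E.rel o) u (cls E.n (s.a .pc) (s.a .comp) (u + 1) r) := fun r => by
    have := hready r; rwa [St.cls, hu] at this
  have hkeep : ∀ {s' : St} {r : ℕ}, s'.Inv E o m (u + 1) → s'.a .comp = s.a .comp →
      s'.a .pc = s.a .pc → u ≤ r ∧ r < E.n →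
      (∀ x ∈ active E.n (s.a .pc) (u + 1), s.a .comp x = r ↔ E.rel o u x = true) →
      (s'.setA .comp u r).Inv E o m u := fun {s' r} h hc hp hr hadj =>
    ⟨h.ord, h.mn, h.removed, by
      change Stage _ _ (s'.a .pc) _ _
      rw [hp]
      refine hI.stage.keep hE.sym hun hready' (hE.prev u hun hu0) hr (fun x => ?_) hadj
      simp [hc]⟩
  simp only [run_ite, evalB_eq, eval_var, eval_nn]
  by_cases hw : s₁.v .w = E.n
  · rw [if_pos hw]
    have hnone : ∀ x ∈ active E.n (s.a .pc) (u + 1), ¬ E.rel o u x = true := fun x hx hux => by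
      rw [mem_active] at hx
      rcases g₁ with ⟨-, h⟩ | ⟨h, -⟩
      · exact h x hx.1 ⟨hx.2, hux⟩
      · omega
    rw [run_put, eval_var, hu₁]
    refine hkeep hI₁ (by rw [a₁]) (by rw [a₁]) ⟨le_rfl, hun⟩ fun x hx => ?_
    have := (hI.stage.num x hx).1
    exact ⟨fun h => by omega, fun h => absurd h (hnone x hx)⟩
  · rw [if_neg hw]
    obtain ⟨hwn, hwa, hwu⟩ : s₁.v .w < E.n ∧ (u < s₁.v .w ∧ s.a .pc (s₁.v .w) = 0) ∧
        E.rel o u (s₁.v .w) = true := by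
      rcases g₁ with ⟨h, -⟩ | h
      · exact absurd (by simpa using h) hw
      · exact h
    have hwA : s₁.v .w ∈ active E.n (s.a .pc) (u + 1) := mem_active.2 ⟨hwn, hwa⟩
    obtain ⟨hsame, hcase⟩ := no_good hE.sym hready' hno hwA hwu
    set w := s₁.v .w with hw_def
    set r := s.a .comp w with hr
    have hcls : cls E.n (s.a .pc) (s.a .comp) (u + 1) r = s.cls E r := by rw [St.cls, hu]
    rw [hcls] at hcase
    rw [run_seq, run_seq, run_set]
    have er : eval E (.get .comp (.var .w)) s₁ = r := by simp [a₁, hr, hw_def]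
    rw [er]
    have hQm : ∀ x, x ∈ s.cls E r ↔ x < E.n ∧ ((u < x ∧ s.a .pc x = 0) ∧ s.a .comp x = r) :=
      fun x => by rw [St.mem_cls, hu]; tauto
    have g₂ := any_spec (E := E) (s := s₁.setV .r r) (x := .x) (c := .bad)
      (b := .and inQ (.not (.edge (.var .u) (.var .x))))
      (p := fun x => ((u < x ∧ s.a .pc x = 0) ∧ s.a .comp x = r) ∧ ¬ E.rel o u x = true) (by decide)
      (fun j hj s' ha hv => by
        rw [evalB_and, evalB_inQ]; simp [ha, hv, hu₁, a₁, hI.ord])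
    have f₂ := run_fr (E := E) (anyC .x (.and inQ (.not (.edge (.var .u) (.var .x)))) .bad)
      (s₁.setV .r r)
    set s₂ := run E (anyC .x (.and inQ (.not (.edge (.var .u) (.var .x)))) .bad) (s₁.setV .r r)
    clear_value s₂
    have hu₂ : s₂.v .u = u := by rw [f₂.v _ rfl]; simpa using hu₁
    have hr₂ : s₂.v .r = r := by rw [f₂.v _ rfl]; simp
    have a₂ : s₂.a = s.a := by funext c; rw [← a₁]; exact f₂.a c rfl
    have hI₂ : s₂.Inv E o m (u + 1) := hI₁.congr (f₂.a _ rfl) (f₂.a _ rfl) (f₂.a _ rfl)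
      (f₂.a _ rfl) (f₂.a _ rfl) (f₂.a _ rfl) (f₂.v _ rfl) (f₂.a _ rfl)
    have hcls₂ : ∀ r, s₂.cls E r = s.cls E r := fun r => by rw [St.cls, St.cls, a₂, hu₂, hu]
    simp only [run_ite, evalB_eq, eval_var, eval_zero]
    by_cases hall : ∀ y ∈ s.cls E r, E.rel o u y = true
    · have hb : s₂.v .bad = 0 := by
        rcases g₂ with ⟨-, j, hj, hj', hj''⟩ | ⟨h, -⟩
        · exact absurd (hall j ((hQm j).2 ⟨hj, hj'⟩)) hj''
        · exact h
      rw [if_pos hb, run_put, eval_var, eval_var, hu₂, hr₂]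
      have hnum := hI.stage.num w hwA
      refine hkeep hI₂ (by rw [a₂]) (by rw [a₂]) ⟨by omega, hnum.2⟩ fun x hx =>
        ⟨fun h => hall x ?_, hsame x hx⟩
      rw [← hcls]
      exact Pieces.mem_cls.2 ⟨hx, h⟩
    · have hb : ¬ s₂.v .bad = 0 := by
        push Not at hall
        obtain ⟨y, hy, hyu⟩ := hall
        rcases g₂ with ⟨h, -⟩ | ⟨-, h⟩
        · omega
        · have hy := (hQm y).1 hy
          exact absurd ⟨hy.2, by simpa using hyu⟩ (h y hy.1)
      rw [if_neg hb]
      obtain ⟨w', hw', h2, huw', hlow'⟩ := hcase.resolve_left hall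
      refine near_spec hE hu₂ hun hI₂ (fun r => by rw [hcls₂]; exact hready r) hr₂ (w := w') ?_ ?_ ?_ ?_
      all_goals rw [hcls₂]; assumption

/-- The state after the decomposition. -/
structure St.Decomposed (E : Env) (o : ℕ → ℕ) (s : St) : Prop where
  ord : s.a .ord = o
  removed : Removed E.n (E.rel o) s.data 4
  pos : ∀ x < E.n, s.a .pc x ≠ 0
  first : s.a .mark 0 ≠ 0

theorem single_spec (hE : Ctx E o m) (hu : s.v .u = 0) (hn : 0 < E.n) (hI : s.Inv E o m 1)
    (hready : ∀ r, Ready (E.rel o) 0 (s.cls E r)) : (run E singleC s).Decomposed E o := by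
  have hf := run_fr (E := E) singleC s
  have hpc0 := hI.stage.zero 0 (by omega)
  have hpc : ∀ x, (run E singleC s).data.pc x = if x ∈ ({0} : Finset ℕ) then s.data.top + 1
      else s.data.pc x := fun x => by simp [St.data, singleC, hu]
  have hm : ∀ x, (run E singleC s).data.mark x = if x = 0 then 1 else s.data.mark x := fun x => by
    simp [St.data, singleC, hu]
  have hside : ∀ x, (run E singleC s).data.side x = if x = 0 then 0 else s.data.side x :=
    fun x => by simp [St.data, singleC, hu]
  have hstep : Step E.n s.data (run E singleC s).data {0} := by
    refine ⟨by simp, by simpa using hn, by simpa [St.data] using hpc0, hpc, by simp [St.data, singleC],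
      fun x hx => ?_, by simp [hside], fun x _ => by simp [St.data, singleC], fun x hx => ?_⟩
    · rw [hside, if_neg (by simpa using hx)]
    · rw [hm] at hx
      split_ifs at hx
      exact hx
  refine ⟨by rw [hf.a _ rfl, hI.ord], by simpa using hI.removed.single hE.irr hstep hm,
    fun x hx h => ?_, by have := hm 0; simp [St.data] at this; simp [this]⟩
  have h' := hpc x
  rw [show (run E singleC s).data.pc x = 0 from h] at h'
  split_ifs at h' with hx0
  rw [mem_singleton] at hx0
  have hxA : x ∈ s.cls E (s.a .comp x) := St.mem_cls.2 ⟨⟨hx, by omega, h'.symm⟩, rfl⟩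
  obtain ⟨y, -, z, hz, -⟩ := (hready _).1 ⟨x, hxA⟩
  omega

theorem decompose_spec (hE : Ctx E o m) (hn : 0 < E.n) (ho : s.a .ord = o) (hm : s.a .mn = m)
    (hpc : s.a .pc = fun _ => 0) (hmark : s.a .mark = fun _ => 0) (hside : s.a .side = fun _ => 0)
    (htop : s.v .top = 0) : (run E decompose s).Decomposed E o := by
  have key := loop_inv (E := E) (s := s) (x := .t) (c := stageC) (fun j s' =>
    (j < E.n → s'.Inv E o m (E.n - j)) ∧ (j = E.n → s'.Decomposed E o)) ?_ ?_
  · exact key.2 rfl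
  · refine ⟨fun _ => ⟨ho, hm, ⟨?_, ?_, ?_, ?_, ?_, fun _ => 0, ?_, ?_⟩, ⟨?_, ?_, ?_, ?_⟩⟩,
      fun h => by omega⟩
    any_goals simp [St.data, hpc, hmark, hside, htop, Data.marked]
    all_goals intro x hx; first | (rw [mem_active] at hx; omega) | (intro hx'; omega)
  · rintro j hj s₁ hf ⟨hI, -⟩
    replace hI := hI hj
    have hrun : run E stageC (s₁.setV .t j) = run E (.ite (.eq (.var .u) 0) singleC
        (tally ;; find2C goodB ;; .ite (.eq (.var .fd) 1) pathC joinC)) (run E (.loop .r prune)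
        (run E (.set .u (.sub (.sub .nn 1) (.var .t))) (s₁.setV .t j))) := rfl
    rw [hrun]
    obtain ⟨u, hu⟩ : ∃ u, u = E.n - 1 - j := ⟨_, rfl⟩
    set s₂ := run E (.set .u (.sub (.sub .nn 1) (.var .t))) (s₁.setV .t j) with hs₂
    have hu₂ : s₂.v .u = u := by simp [hs₂, hu]
    have hI₂ : s₂.Inv E o m (u + 1) := by
      rw [show u + 1 = E.n - j by omega]
      exact hI.congr rfl rfl rfl rfl rfl rfl rfl rfl
    have hun : u < E.n := by omega
    clear_value s₂
    obtain ⟨hI₃, hready⟩ := pruneAll_spec hE hu₂ hun hI₂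
    have f₃ := run_fr (E := E) (.loop .r prune) s₂
    set s₃ := run E (.loop .r prune) s₂
    have hu₃ : s₃.v .u = u := by rw [f₃.v _ rfl, hu₂]
    clear_value s₃
    simp only [run_ite, evalB_eq, eval_var, eval_zero, hu₃]
    by_cases hu0 : u = 0
    · rw [if_pos hu0]
      subst hu0
      exact ⟨fun h => by omega, fun _ => single_spec hE hu₃ hn hI₃ hready⟩
    rw [if_neg hu0]
    refine ⟨fun _ => ?_, fun h => by omega⟩
    rw [show E.n - (j + 1) = u by omega]
    have g₄ := tally_spec (E := E) hu₃
    have f₄ := run_fr (E := E) tally s₃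
    rw [run_seq, run_seq]
    set s₄ := run E tally s₃
    clear_value s₄
    have hu₄ : s₄.v .u = u := by rw [f₄.v _ rfl, hu₃]
    have hI₄ : s₄.Inv E o m (u + 1) := hI₃.congr (f₄.a _ rfl) (f₄.a _ rfl) (f₄.a _ rfl)
      (f₄.a _ rfl) (f₄.a _ rfl) (f₄.a _ rfl) (f₄.v _ rfl) (f₄.a _ rfl)
    have hcls₄ : ∀ r, s₄.cls E r = s₃.cls E r :=
      cls_congr (f₄.v _ rfl) (f₄.a _ rfl) (f₄.a _ rfl)
    have g₅ := find2_spec (E := E) (s := s₄) (b := goodB)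
      (p := Good E.n (E.rel o) (s₄.a .pc) (s₄.a .comp) u) (fun x hx y hy s' ha hv => by
        have hu' : s'.v .u = u := by rw [hv] <;> simp [hu₄]
        have hc : ∀ r, ((s'.setV .x x).setV .y y).cls E r = s₄.cls E r := fun r => by
          rw [St.cls, St.cls]; simp [ha, hu', hu₄]
        have hI' : ((s'.setV .x x).setV .y y).Inv E o m (u + 1) :=
          hI₄.congr (by simp [ha]) (by simp [ha]) (by simp [ha]) (by simp [ha]) (by simp [ha])
            (by simp [ha]) (by simp [hv]) (by simp [ha])
        rw [goodB_iff hE hun (by simpa using hu') hI' (fun r hr => ?_) (fun r hr => ?_) hx hy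
          (by simp) (by simp)]
        · simp [ha]
        · rw [hc, hcls₄, ← (g₄ r hr).1]; simp [ha]
        · rw [hc, hcls₄, ← hI₃.mn, ← (g₄ r hr).2]; simp [ha])
    have f₅ := run_fr (E := E) (find2C goodB) s₄
    set s₅ := run E (find2C goodB) s₄
    clear_value s₅
    have hu₅ : s₅.v .u = u := by rw [f₅.v _ rfl, hu₄]
    have hI₅ : s₅.Inv E o m (u + 1) := hI₄.congr (f₅.a _ rfl) (f₅.a _ rfl) (f₅.a _ rfl)
      (f₅.a _ rfl) (f₅.a _ rfl) (f₅.a _ rfl) (f₅.v _ rfl) (f₅.a _ rfl)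
    have hready₅ : ∀ r, Ready (E.rel o) u (s₅.cls E r) := fun r => by
      rw [cls_congr (f₅.v _ rfl) (f₅.a _ rfl) (f₅.a _ rfl), hcls₄]; exact hready r
    rw [← f₅.a .pc rfl, ← f₅.a .comp rfl] at g₅
    simp only [run_ite, evalB_eq, eval_var, eval_one]
    rcases g₅ with ⟨h1, -, -, hg⟩ | ⟨h0, -, hno⟩
    · rw [if_pos h1]
      exact path_spec hE hu₅ hun hI₅ hready₅ hg
    · rw [if_neg (by omega)]
      refine join_spec hE hu₅ hun (by omega) hI₅ hready₅ fun x y hg => ?_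
      exact hno x (mem_active.1 hg.1).1 y (mem_active.1 hg.2.1).1 hg

end LoopLang

/-! ## Tables of the dynamic program -/

namespace LoopLang

open Finset Pieces

variable {E : Env} {s : St}

section
open Var Arr

/-- The number of pairs `x`, `y` with `b`. -/
def count2C (b : BExp) (c : Var) : Cmd :=
  .set c 0 ;; .loop x (.loop y (.when b (.set c (.inc c))))

/-- The largest value of `f` for `j` up to `p`. -/
def maxC (f : Exp) (b : Var) : Cmd :=
  .set b 0 ;; .loop j (.when (.and (.le j p) (.lt b f)) (.set b f))

/-- The new entry with number `z` of the table after adding the vertex `x`. -/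
def entry : Cmd :=
  .set nw 0 ;; .when (.le z p) (.set nw (.add (.add (tab z) (w0 x)) z)) ;;
  .when (.le 1 z) (
    .set c0 (.add (.add (tab (.sub z 1)) (w1 x)) (.sub p (.sub z 1))) ;;
    .when (.lt nw c0) (.set nw c0))

/-- Add the vertex `x` to the table. -/
def extend : Cmd :=
  .loop j (.set z (.sub (.sub .nn 1) j) ;; .when (.le z (.inc p)) (entry ;; .put tab z nw)) ;;
  .set a (att x) ;; .set p (.inc p)

end

theorem count2_spec {b : BExp} {c : Var} {p : ℕ → ℕ → Prop} [∀ i, DecidablePred (p i)]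
    (hc : c ≠ .x ∧ c ≠ .y)
    (hb : ∀ j < E.n, ∀ l < E.n, ∀ s' : St, s'.a = s.a →
      (∀ y, y ≠ c → y ≠ .x → y ≠ .y → s'.v y = s.v y) →
      (evalB E b ((s'.setV .x j).setV .y l) = true ↔ p j l)) :
    (run E (count2C b c) s).v c = ∑ i ∈ range E.n, #{l ∈ range E.n | p i l} := by
  obtain ⟨hcx, hcy⟩ := hc
  rw [count2C, run_seq]
  refine loop_inv (fun j s' => s'.v c = ∑ i ∈ range j, #{l ∈ range E.n | p i l}) (by simp)
    fun j hj s₁ hf₁ h₁ => ?_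
  rw [sum_range_succ]
  refine loop_inv (fun l s' => s'.v c = ∑ i ∈ range j, #{l ∈ range E.n | p i l}
    + #{i ∈ range l | p j i}) (by simpa [hcx] using h₁) fun l hl s₂ hf₂ h₂ => ?_
  have hb' := hb j hj l hl s₂ (by
      funext c
      rw [hf₂.a c rfl, St.setV_a, hf₁.a c rfl]; rfl) (fun y h1 h2 h3 => by
      rw [hf₂.v y (by simp [Cmd.loop, Cmd.when, Cmd.wv, *]), St.setV_v, if_neg h2,
        hf₁.v y (by simp [Cmd.loop, Cmd.when, Cmd.wv, *])]
      simp [h1])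
  have hx : s₂.v .x = j := by
    rw [hf₂.v .x (by simp [Cmd.loop, Cmd.when, Cmd.wv, hcx.symm])]; simp
  rw [show (s₂.setV .x j) = s₂ by
    rw [← hx]
    cases s₂
    simp only [St.setV, St.mk.injEq, and_true]
    funext y
    split_ifs with h
    · rw [h]
    · rfl] at hb'
  rw [run_when, card_range_succ]
  by_cases hp : p j l
  · rw [if_pos (hb'.2 hp), if_pos hp]
    simp [hcy, h₂, add_assoc]
  · rw [if_neg fun h => hp (hb'.1 h), if_neg hp]
    simp [hcy, h₂]

theorem max_spec {f : Exp} {b : Var} {g : ℕ → ℕ} {p : ℕ} (hb : b ≠ .j ∧ b ≠ .p) (hp : s.v .p = p)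
    (hpn : p < E.n)
    (hf : ∀ j ≤ p, ∀ s' : St, s'.a = s.a → (∀ y, y ≠ b → y ≠ .j → s'.v y = s.v y) →
      eval E f (s'.setV .j j) = g j) : IsMax g p ((run E (maxC f b) s).v b) := by
  obtain ⟨hbj, hbp⟩ := hb
  rw [maxC, run_seq]
  have key := loop_inv (E := E) (s := run E (.set b 0) s) (x := .j)
    (c := .when (.and (.le (.var .j) (.var .p)) (.lt (.var b) f)) (.set b f))
    (fun j s' => (∀ i < j, i ≤ p → g i ≤ s'.v b) ∧ (s'.v b = 0 ∨ ∃ i ≤ p, g i = s'.v b)) ?_ ?_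
  · refine ⟨fun j hj => key.1 j (by omega) hj, key.2.elim (fun h => ⟨0, by omega, ?_⟩) id⟩
    have := key.1 0 (by omega) (by omega)
    omega
  · simp
  · intro j hj s₁ hf₁ ⟨h1, h2⟩
    have hp₁ : s₁.v .p = p := by
      rw [hf₁.v _ (by simp [Cmd.loop, Cmd.when, Cmd.wv, hbp.symm])]; simp [hbp.symm, hp]
    by_cases hjp : j ≤ p
    · have he := hf j hjp s₁ (by funext c; rw [hf₁.a c rfl]; rfl) fun y hy hyj => by
        rw [hf₁.v y (by simp [Cmd.loop, Cmd.when, Cmd.wv, *])]; simp [hy]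
      simp only [run_when, evalB_and, evalB_le, eval_var, St.setV_v, if_true, evalB_lt, he, hp₁,
        hbj, if_false, reduceCtorEq, hjp, true_and, run_set]
      split_ifs with hlt
      · simp only [St.setV_v, if_true]
        refine ⟨fun i hi hip => ?_, .inr ⟨j, hjp, rfl⟩⟩
        rcases Nat.lt_succ_iff_lt_or_eq.1 hi with hi | rfl
        · exact (h1 i hi hip).trans hlt.le
        · exact le_rfl
      · simp only [St.setV_v, hbj, if_false]
        refine ⟨fun i hi hip => ?_, h2⟩
        rcases Nat.lt_succ_iff_lt_or_eq.1 hi with hi | rfl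
        · exact h1 i hi hip
        · omega
    · rw [run_when, if_neg (by simp [hp₁, hjp])]
      simp only [St.setV_v, hbj, if_false]
      exact ⟨fun i hi hip => h1 i (by omega) hip, h2⟩

theorem entry_spec {T : ℕ → ℕ} {z p x : ℕ} (hz : s.v .z = z) (hp : s.v .p = p) (hx : s.v .x = x)
    (hzp : z ≤ p + 1) (hT : ∀ j ≤ z, s.a .tab j = T j)
    (h0 : z ≤ p → T z + s.a .w0 x + z ≤ E.cap)
    (h1 : ∀ i, z = i + 1 → T i + s.a .w1 x + (p - i) ≤ E.cap) :
    let r := (run E entry s).v .nw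
    (z ≤ p → T z + s.a .w0 x + z ≤ r) ∧ (∀ i, z = i + 1 → T i + s.a .w1 x + (p - i) ≤ r) ∧
    ((z ≤ p ∧ r = T z + s.a .w0 x + z) ∨
      ∃ i, z = i + 1 ∧ i ≤ p ∧ r = T i + s.a .w1 x + (p - i)) := by
  have hTz := hT z le_rfl
  rcases Nat.eq_zero_or_pos z with rfl | hz0
  · have e : (run E entry s).v .nw = T 0 + s.a .w0 x + 0 := by
      have := h0 (by omega)
      simp [entry, hz, hp, hx, hTz]
      omega
    simp only [e]
    exact ⟨fun _ => le_rfl, fun i hi => by omega, .inl ⟨by omega, trivial⟩⟩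
  · obtain ⟨i, rfl⟩ : ∃ i, z = i + 1 := ⟨z - 1, by omega⟩
    have hTi := hT i (by omega)
    have h1 := h1 i rfl
    by_cases hzp' : i + 1 ≤ p
    · have h0 := h0 hzp'
      have e : (run E entry s).v .nw = max (T (i + 1) + s.a .w0 x + (i + 1))
          (T i + s.a .w1 x + (p - i)) := by
        simp only [entry, run_seq, run_set, run_when, evalB_le, evalB_lt, eval_var, eval_add,
          eval_get, eval_sub, eval_one, eval_zero, St.setV_v, St.setV_a, hz, hp, hx, hzp', if_true,
          reduceCtorEq, if_false, hTz, Nat.add_sub_cancel, hTi, le_add_iff_nonneg_left, zero_le]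
        split_ifs <;> simp <;> omega
      simp only [e]
      refine ⟨fun _ => le_max_left _ _, fun i' hi' => ?_, ?_⟩
      · obtain rfl : i = i' := by omega
        exact le_max_right _ _
      · rcases max_choice (T (i + 1) + s.a .w0 x + (i + 1)) (T i + s.a .w1 x + (p - i)) with h | h
        · exact .inl ⟨hzp', h⟩
        · exact .inr ⟨i, rfl, by omega, h⟩
    · have e : (run E entry s).v .nw = T i + s.a .w1 x + (p - i) := by
        simp only [entry, run_seq, run_set, run_when, evalB_le, evalB_lt, eval_var, eval_add,
          eval_get, eval_sub, eval_one, eval_zero, St.setV_v, St.setV_a, hz, hp, hx, hzp', if_true,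
          reduceCtorEq, if_false, hTz, Nat.add_sub_cancel, hTi, le_add_iff_nonneg_left, zero_le]
        split_ifs <;> simp <;> omega
      simp only [e]
      exact ⟨fun h => absurd h hzp', fun i' hi' => by obtain rfl : i = i' := by omega
                                                      exact le_rfl, .inr ⟨i, rfl, by omega, rfl⟩⟩

theorem extend_spec {e : ℕ → ℕ → Bool} (hsym : ∀ x y, e x y = e y x) (hirr : ∀ x, e x x = false)
    {X : Finset ℕ} {x : ℕ} (hx : s.v .x = x) (hp : s.v .p = #X) (hXn : #X + 1 < E.n) (hxX : x ∉ X)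
    (hadj : ∀ y ∈ X, e x y = true) (hT : Table e (s.a .w0) (s.a .w1) X (s.a .tab))
    (h0 : ∀ j ≤ #X, s.a .tab j + s.a .w0 x + j ≤ E.cap)
    (h1 : ∀ j ≤ #X, s.a .tab j + s.a .w1 x + (#X - j) ≤ E.cap) :
    let s' := run E extend s
    s'.v .p = #X + 1 ∧ s'.v .a = s.a .att x ∧
      Table e (s.a .w0) (s.a .w1) (insert x X) (s'.a .tab) := by
  intro s'
  have hrun : s' = run E (.set .p (.inc (.var .p))) (run E (.set .a (.get .att (.var .x)))
    (run E (.loop .j (.set .z (.sub (.sub .nn 1) (.var .j)) ;; .when (.le (.var .z) (.inc (.var .p)))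
      (entry ;; .put .tab (.var .z) (.var .nw)))) s)) := rfl
  set T := s.a .tab with hTdef
  let Good (T' : ℕ → ℕ) (z : ℕ) : Prop :=
    (z ≤ #X → T z + s.a .w0 x + z ≤ T' z) ∧
    (∀ i, z = i + 1 → T i + s.a .w1 x + (#X - i) ≤ T' z) ∧
    ((z ≤ #X ∧ T' z = T z + s.a .w0 x + z) ∨
      ∃ i, z = i + 1 ∧ i ≤ #X ∧ T' z = T i + s.a .w1 x + (#X - i))
  have key := loop_inv (E := E) (s := s) (x := .j)
    (c := .set .z (.sub (.sub .nn 1) (.var .j)) ;; .when (.le (.var .z) (.inc (.var .p)))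
      (entry ;; .put .tab (.var .z) (.var .nw)))
    (fun j s' => (∀ z, z + j < E.n → s'.a .tab z = T z) ∧
      ∀ z ≤ #X + 1, E.n ≤ z + j → Good (s'.a .tab) z) ⟨fun _ _ => rfl, fun z hz hz' => by omega⟩ ?_
  · have f := run_fr (E := E) (.loop .j (.set .z (.sub (.sub .nn 1) (.var .j)) ;;
      .when (.le (.var .z) (.inc (.var .p))) (entry ;; .put .tab (.var .z) (.var .nw)))) s
    refine ⟨?_, ?_, ?_⟩
    · rw [hrun]
      simp only [run_set, St.setV_v, if_true, eval_inc, eval_var, reduceCtorEq, if_false]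
      rw [f.v _ rfl, hp]
    · rw [hrun]
      simp only [run_set, St.setV_v, if_true, eval_inc, eval_var, eval_get, reduceCtorEq, if_false]
      rw [f.a _ rfl, f.v _ rfl, hx]
    · have hG : ∀ z ≤ #X + 1, Good (s'.a .tab) z := fun z hz => key.2 z hz (by omega)
      refine hT.insert hsym hirr hxX hadj (fun j hj => (hG j (by omega)).1 hj)
        (fun j hj => (hG (j + 1) (by omega)).2.1 j rfl) fun j hj => ?_
      exact (hG j hj).2.2
  · intro j hj s₁ hf ⟨h2, h3⟩
    rw [run_seq]
    set s₂ := run E (.set .z (.sub (.sub .nn 1) (.var .j))) (s₁.setV .j j) with hs₂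
    have hz₂ : s₂.v .z = E.n - 1 - j := by simp [hs₂]
    have hp₂ : s₂.v .p = #X := by rw [← hp, ← hf.v .p rfl]; simp [hs₂]
    have hx₂ : s₂.v .x = x := by rw [← hx, ← hf.v .x rfl]; simp [hs₂]
    have a₂ : s₂.a = s₁.a := rfl
    have hw0 : s₂.a .w0 = s.a .w0 := by rw [a₂, hf.a .w0 rfl]
    have hw1 : s₂.a .w1 = s.a .w1 := by rw [a₂, hf.a .w1 rfl]
    clear_value s₂
    rw [run_when]
    simp only [evalB_le, eval_var, eval_inc, hz₂, hp₂]
    split_ifs with hle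
    · have he := entry_spec (E := E) (s := s₂) (T := T) hz₂ hp₂ hx₂ hle
        (fun i hi => by rw [a₂]; exact h2 i (by omega)) (by rw [hw0]; exact h0 _)
        (fun i hi => by rw [hw1]; exact h1 i (by omega))
      have fe := run_fr (E := E) entry s₂
      rw [run_seq]
      set s₃ := run E entry s₂
      clear_value s₃
      have htab : ∀ z, (run E (.put .tab (.var .z) (.var .nw)) s₃).a .tab z
          = if z = E.n - 1 - j then s₃.v .nw else s₁.a .tab z := fun z => by
        simp only [run_put, eval_var, St.setA_a, true_and]
        rw [fe.v _ rfl, fe.a _ rfl, hz₂, a₂]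
      rw [hw0, hw1] at he
      refine ⟨fun z hz => ?_, fun z hz hz' => ?_⟩
      · clear he
        rw [htab, if_neg (by omega)]; exact h2 z (by omega)
      · by_cases hzz : z = E.n - 1 - j
        · simp only [Good, htab, if_pos hzz]
          rw [hzz]
          exact he
        · simp only [Good, htab, if_neg hzz]
          exact h3 z hz (by clear he; omega)
    · rw [a₂]
      refine ⟨fun z hz => h2 z (by omega), fun z hz hz' => h3 z hz (by omega)⟩

end LoopLang

/-! ## Optimal extensions of partial colourings -/

namespace Pieces

open Finset

/-- The unmarked vertices form a clique forest. -/
structure Forest (n : ℕ) (e : ℕ → ℕ → Bool) (pc mark att : ℕ → ℕ) : Prop where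
  pos : ∀ x < n, 1 ≤ pc x ∧ pc x ≤ n
  same : ∀ x < n, ∀ y < n, pc y = pc x → x ≠ y → mark x = 0 → mark y = 0 →
    e x y = true ∧ att x = att y
  att : ∀ x < n, ∀ y < n, mark x = 0 → mark y = 0 →
    (att x = y + 1 ↔ e x y = true ∧ pc x < pc y)
  first : mark 0 ≠ 0

theorem Forest.mono {n : ℕ} {e : ℕ → ℕ → Bool} {pc mark mark' att : ℕ → ℕ}
    (h : Forest n e pc mark att) (hm : ∀ x, mark' x = 0 → mark x = 0) :
    Forest n e pc mark' att :=
  ⟨h.pos, fun x hx y hy hp hne h1 h2 => h.same x hx y hy hp hne (hm x h1) (hm y h2),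
    fun x hx y hy h1 h2 => h.att x hx y hy (hm x h1) (hm y h2), fun h0 => h.first (hm 0 h0)⟩

/-- The unmarked vertices of the pieces after `t`. -/
def unmarked (n : ℕ) (pc mark : ℕ → ℕ) (t : ℕ) : Finset ℕ :=
  {x ∈ range n | mark x = 0 ∧ t < pc x}

def cliqueOf (n : ℕ) (pc mark : ℕ → ℕ) (t : ℕ) : Finset ℕ :=
  {x ∈ range n | mark x = 0 ∧ pc x = t}

/-- The colouring `χ` extends the colouring `col` of the marked vertices. -/
def Extends (n : ℕ) (mark col : ℕ → ℕ) (χ : ℕ → Bool) : Prop :=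
  ∀ x < n, mark x ≠ 0 → (χ x = true ↔ col x = 1)

/-- The largest (ordered) cut of a colouring that extends `col` has size `b`. -/
def IsBest (n : ℕ) (e : ℕ → ℕ → Bool) (mark col : ℕ → ℕ) (b : ℕ) : Prop :=
  ∀ θ, (∃ χ, Extends n mark col χ ∧ θ ≤ cutIn e χ (range n)) ↔ θ ≤ b

/-- The numbers `w₀`, `w₁` and `tot` describe the best colourings of the remaining vertices `R`. -/
def Remains (n : ℕ) (e : ℕ → ℕ → Bool) (mark col w₀ w₁ : ℕ → ℕ) (tot : ℕ) (R : Finset ℕ) : Prop :=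
  ∀ θ, (∃ χ, Extends n mark col χ ∧ θ ≤ cutIn e χ (range n)) ↔
    ∃ χ, θ ≤ 2 * tot + val e w₀ w₁ χ R

variable {n : ℕ} {e : ℕ → ℕ → Bool} {pc mark att col w₀ w₁ : ℕ → ℕ} {tot : ℕ} {R : Finset ℕ}

theorem cutIn_le (χ : ℕ → Bool) (R : Finset ℕ) : cutIn e χ R ≤ #R * #R := by
  unfold cutIn
  refine (sum_le_card_nsmul _ _ #R fun x _ => ?_).trans (by simp)
  refine (sum_le_card_nsmul _ _ 1 fun y _ => ?_).trans (by simp)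
  split_ifs <;> omega

theorem Remains.le (h : Remains n e mark col w₀ w₁ tot R) (χ : ℕ → Bool) :
    2 * tot + val e w₀ w₁ χ R ≤ n * n := by
  obtain ⟨χ', -, hχ⟩ := (h _).2 ⟨χ, le_rfl⟩
  exact hχ.trans ((cutIn_le _ _).trans (by simp))

theorem Remains.weight_le (h : Remains n e mark col w₀ w₁ tot R) {x : ℕ} (hx : x ∈ R) :
    2 * w₀ x ≤ n * n ∧ 2 * w₁ x ≤ n * n := by
  have key : ∀ c : Bool, 2 * (if c then w₁ x else w₀ x) ≤ n * n := fun c => by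
    have h1 := h.le fun _ => c
    have h2 : (if c then w₁ x else w₀ x) ≤ ∑ x ∈ R, if c then w₁ x else w₀ x :=
      single_le_sum (f := fun x => if c then w₁ x else w₀ x) (fun _ _ => Nat.zero_le _) hx
    unfold val at h1
    simp only at h1 h2
    omega
  exact ⟨key false, key true⟩

theorem Remains.table_le (h : Remains n e mark col w₀ w₁ tot R) {X : Finset ℕ} (hX : X ⊆ R)
    {T : ℕ → ℕ} (hT : Table e w₀ w₁ X T) {j : ℕ} (hj : j ≤ #X) : 2 * T j ≤ n * n := by
  obtain ⟨χ, -, hχ⟩ := hT.ex j hj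
  rw [← hχ]
  exact (val_mono hX).trans (le_trans (by omega) (h.le χ))

theorem Remains.empty (h : Remains n e mark col w₀ w₁ tot ∅) : IsBest n e mark col (2 * tot) :=
  fun θ => (h θ).trans (by simp [val, cutIn])

theorem two_mul_sum_lt {f : ℕ → ℕ → ℕ} (hs : ∀ x y, f x y = f y x) (h0 : ∀ x, f x x = 0) :
    2 * ∑ x ∈ range n, ∑ y ∈ range n, (if y < x then f x y else 0)
      = ∑ x ∈ range n, ∑ y ∈ range n, f x y := by
  have h1 : ∑ x ∈ range n, ∑ y ∈ range n, (if x < y then f x y else 0)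
      = ∑ x ∈ range n, ∑ y ∈ range n, (if y < x then f x y else 0) := by
    rw [sum_comm]
    exact sum_congr rfl fun x _ => sum_congr rfl fun y _ => by rw [hs]
  rw [two_mul]
  nth_rewrite 1 [← h1]
  rw [← sum_add_distrib]
  refine sum_congr rfl fun x _ => ?_
  rw [← sum_add_distrib]
  refine sum_congr rfl fun y _ => ?_
  rcases lt_trichotomy x y with h | rfl | h
  · simp [h, h.not_gt]
  · simp [h0]
  · simp [h, h.not_gt]

theorem remains_start (hsym : ∀ x y, e x y = e y x) (hpc : ∀ x < n, 1 ≤ pc x) (hcol : ∀ x, col x ≤ 1)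
    (h0 : ∀ x < n, w₀ x = #{y ∈ range n | mark y ≠ 0 ∧ e x y = true ∧ col y = 1})
    (h1 : ∀ x < n, w₁ x = #{y ∈ range n | mark y ≠ 0 ∧ e x y = true ∧ ¬ col y = 1})
    (ht : tot = ∑ x ∈ range n, #{y ∈ range n | y < x ∧ mark x ≠ 0 ∧ mark y ≠ 0 ∧
      e x y = true ∧ col x ≠ col y}) :
    Remains n e mark col w₀ w₁ tot (unmarked n pc mark 0) := by
  classical
  set S : Finset ℕ := {x ∈ range n | mark x ≠ 0} with hS
  set U := unmarked n pc mark 0 with hU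
  have hdis : Disjoint S U := by
    refine disjoint_left.2 fun x hx hx' => ?_
    simp only [hS, hU, unmarked, mem_filter] at hx hx'
    exact hx.2 hx'.2.1
  have huni : S ∪ U = range n := by
    ext x
    simp only [hS, hU, unmarked, mem_union, mem_filter, mem_range]
    constructor
    · rintro (h | h) <;> exact h.1
    · intro hx
      have := hpc x hx
      by_cases hm : mark x = 0
      · exact .inr ⟨hx, hm, by omega⟩
      · exact .inl ⟨hx, hm⟩
  have htot : ∀ χ, Extends n mark col χ → cutIn e χ S = 2 * tot := by
    intro χ hχ
    have hne : ∀ x ∈ S, ∀ y ∈ S, (χ x ≠ χ y ↔ col x ≠ col y) := by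
      intro x hx y hy
      simp only [hS, mem_filter, mem_range] at hx hy
      have e1 := hχ x hx.1 hx.2
      have e2 := hχ y hy.1 hy.2
      have c1 := hcol x
      have c2 := hcol y
      rw [Ne, Bool.eq_iff_iff, e1, e2]
      omega
    rw [ht, cutIn]
    have : ∀ x ∈ S, ∑ y ∈ S, (if e x y = true ∧ χ x ≠ χ y then 1 else 0)
        = ∑ y ∈ range n, if mark y ≠ 0 ∧ e x y = true ∧ col x ≠ col y then 1 else 0 := fun x hx => by
      rw [hS, sum_filter]
      refine sum_congr rfl fun y hy => ?_
      by_cases hm : mark y = 0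
      · simp [hm]
      · simp only [hm, ne_eq, not_false_eq_true, if_true, true_and]
        refine if_congr (and_congr_right fun _ => hne x hx y ?_) rfl rfl
        rw [hS, mem_filter]; exact ⟨hy, hm⟩
    rw [sum_congr rfl this, hS, sum_filter]
    have h2 := two_mul_sum_lt (n := n) (f := fun x y => if mark x ≠ 0 ∧ mark y ≠ 0 ∧ e x y = true ∧
      col x ≠ col y then 1 else 0) (fun x y => by
        rw [hsym x y]
        exact if_congr (by tauto) rfl rfl) (fun x => by simp)
    have e1 : ∀ x, (if mark x ≠ 0 then ∑ y ∈ range n,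
        (if mark y ≠ 0 ∧ e x y = true ∧ col x ≠ col y then 1 else 0) else 0)
        = ∑ y ∈ range n, if mark x ≠ 0 ∧ mark y ≠ 0 ∧ e x y = true ∧ col x ≠ col y
          then 1 else 0 := fun x => by
      by_cases hm : mark x = 0 <;> simp [hm]
    rw [sum_congr rfl fun x _ => e1 x, ← h2]
    congr 1
    refine sum_congr rfl fun x _ => ?_
    rw [card_filter]
    refine sum_congr rfl fun y _ => ?_
    by_cases hlt : y < x <;> simp [hlt]
  have hw : ∀ (χ : ℕ → Bool) (c : Bool) (q : ℕ → Prop) [DecidablePred q], Extends n mark col χ →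
      (∀ y, q y ↔ (col y = 1 ↔ c = true)) → ∀ x,
      #{y ∈ range n | mark y ≠ 0 ∧ e x y = true ∧ q y} = #{y ∈ S | e x y = true ∧ χ y = c} := by
    intro χ c q _ hχ hq x
    rw [hS, filter_filter]
    refine congrArg card (filter_congr fun y hy => ?_)
    refine and_congr_right fun hm => and_congr_right fun _ => ?_
    rw [hq, ← hχ y (mem_range.1 hy) hm]
    cases χ y <;> cases c <;> simp
  have hval : ∀ χ, Extends n mark col χ → cutIn e χ (range n) = 2 * tot + val e w₀ w₁ χ U := by
    intro χ hχ
    have hUn : ∀ x ∈ U, x < n := fun x hx => by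
      simp only [hU, unmarked, mem_filter, mem_range] at hx; exact hx.1
    rw [← huni, cutIn_fixed (w₀ := w₀) (w₁ := w₁) hsym hdis, htot χ hχ]
    · exact fun x hx => by rw [h0 x (hUn x hx)]; exact hw χ true _ hχ (by simp) x
    · exact fun x hx => by rw [h1 x (hUn x hx)]; exact hw χ false _ hχ (by simp) x
  intro θ
  constructor
  · rintro ⟨χ, hχ, h⟩
    exact ⟨χ, by rwa [← hval χ hχ]⟩
  · rintro ⟨χ, h⟩
    have hχ' : Extends n mark col fun x => if mark x = 0 then χ x else decide (col x = 1) :=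
      fun x _ hm => by simp [hm]
    refine ⟨_, hχ', ?_⟩
    rw [hval _ hχ', val_congr (χ' := χ) fun x hx => ?_]
    · exact h
    · simp only [hU, unmarked, mem_filter] at hx
      simp [hx.2.1]

theorem unmarked_eq (t : ℕ) :
    unmarked n pc mark t = cliqueOf n pc mark (t + 1) ∪ unmarked n pc mark (t + 1) := by
  ext x
  simp only [unmarked, cliqueOf, mem_union, mem_filter, mem_range, ← and_or_left]
  refine and_congr_right fun _ => and_congr_right fun _ => ?_
  omega

theorem cliqueOf_disjoint (t : ℕ) :
    Disjoint (cliqueOf n pc mark (t + 1)) (unmarked n pc mark (t + 1)) :=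
  disjoint_filter.2 fun x _ h1 h2 => by omega

/-- Eliminating the next clique. -/
theorem Remains.next (hsym : ∀ x y, e x y = e y x) (hF : Forest n e pc mark att) {t a : ℕ}
    (h : Remains n e mark col w₀ w₁ tot (unmarked n pc mark t)) {T : ℕ → ℕ}
    (hT : Table e w₀ w₁ (cliqueOf n pc mark (t + 1)) T)
    (ha : ∀ x ∈ cliqueOf n pc mark (t + 1), att x = a)
    (ha0 : cliqueOf n pc mark (t + 1) = ∅ → a = 0) {b₀ b₁ b : ℕ} {w₀' w₁' : ℕ → ℕ} {tot' : ℕ}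
    (hb₀ : IsMax (fun j => T j + j) #(cliqueOf n pc mark (t + 1)) b₀)
    (hb₁ : IsMax (fun j => T j + (#(cliqueOf n pc mark (t + 1)) - j))
      #(cliqueOf n pc mark (t + 1)) b₁)
    (hb : IsMax T #(cliqueOf n pc mark (t + 1)) b)
    (hatt : 1 ≤ a ∧ a ≤ n ∧ mark (a - 1) = 0 → tot' = tot ∧
      w₀' = Function.update w₀ (a - 1) (w₀ (a - 1) + b₀) ∧
      w₁' = Function.update w₁ (a - 1) (w₁ (a - 1) + b₁))
    (hfree : ¬ (1 ≤ a ∧ a ≤ n ∧ mark (a - 1) = 0) → tot' = tot + b ∧ w₀' = w₀ ∧ w₁' = w₁) :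
    Remains n e mark col w₀' w₁' tot' (unmarked n pc mark (t + 1)) := by
  intro θ
  have hX : ∀ {x}, x ∈ cliqueOf n pc mark (t + 1) ↔ x < n ∧ mark x = 0 ∧ pc x = t + 1 := by
    simp [cliqueOf]
  have hR : ∀ {x}, x ∈ unmarked n pc mark (t + 1) ↔ x < n ∧ mark x = 0 ∧ t + 1 < pc x := by
    simp [unmarked]
  have hedge : ∀ x ∈ cliqueOf n pc mark (t + 1), ∀ y ∈ unmarked n pc mark (t + 1),
      (e x y = true ↔ a = y + 1) := by
    intro x hx y hy
    rw [← ha x hx]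
    rw [hX] at hx
    rw [hR] at hy
    rw [hF.att x hx.1 y hy.1 hx.2.1 hy.2.1, hx.2.2]
    exact ⟨fun h => ⟨h, hy.2.2⟩, fun h => h.1⟩
  rw [h θ, unmarked_eq]
  by_cases hc : 1 ≤ a ∧ a ≤ n ∧ mark (a - 1) = 0
  · obtain ⟨rfl, rfl, rfl⟩ := hatt hc
    obtain ⟨x, hx⟩ := nonempty_iff_ne_empty.2 fun h => by have := ha0 h; omega
    have hv : a - 1 ∈ unmarked n pc mark (t + 1) := by
      rw [hR]
      have hx' := hX.1 hx
      have := (hF.att x hx'.1 (a - 1) (by omega) hx'.2.1 hc.2.2).1 (by rw [ha x hx]; omega)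
      exact ⟨by omega, hc.2.2, by rw [← hx'.2.2]; exact this.2⟩
    exact eliminate_attached hsym hT (cliqueOf_disjoint t) hv
      (fun x hx y hy => (hedge x hx y hy).trans (by omega)) hb₀ hb₁ _ _
  · obtain ⟨rfl, rfl, rfl⟩ := hfree hc
    refine eliminate_free hsym hT (cliqueOf_disjoint t) (fun x hx y hy => ?_) hb _ _
    by_contra hxy
    rw [Bool.not_eq_false, hedge x hx y hy] at hxy
    rw [hR] at hy
    refine hc ⟨by omega, by omega, ?_⟩
    rw [hxy, Nat.add_sub_cancel]
    exact hy.2.1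

end Pieces

/-! ## Computing the best extension of a partial colouring -/

namespace LoopLang

open Finset Pieces

variable {E : Env} {s : St}

section
open Var Arr

/-- The edges from every vertex to the marked vertices of each colour, and the number of
edges that are cut between marked vertices. -/
def bestInit : Cmd :=
  .loop x (
    countC .y (.and (.not (.eq (mark y) 0)) (.and (.edge x y) (.eq (col y) 1))) .cnt ;;
    .put w0 x Var.cnt ;;
    countC .y (.and (.not (.eq (mark y) 0)) (.and (.edge x y) (.not (.eq (col y) 1)))) .cnt ;;
    .put w1 x Var.cnt) ;;
  count2C (.and (.lt y x) (.and (.not (.eq (mark x) 0)) (.and (.not (.eq (mark y) 0))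
    (.and (.edge x y) (.not (.eq (col x) (col y))))))) tot

def gatherC : Cmd :=
  .set p 0 ;; .put tab 0 0 ;; .set a 0 ;;
  .loop x (.when (.and (.eq (mark x) 0) (.eq (pc x) (.inc t))) extend)

def foldC : Cmd :=
  .ite (.and (.le 1 a) (.and (.le a .nn) (.eq (mark (.sub a 1)) 0)))
    (.put w0 (.sub a 1) (.add (w0 (.sub a 1)) b0) ;; .put w1 (.sub a 1) (.add (w1 (.sub a 1)) b1))
    (.set tot (.add tot bn))

/-- Eliminate the clique with number `t + 1`. -/
def pieceC : Cmd :=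
  gatherC ;; maxC (.add (tab j) j) b0 ;; maxC (.add (tab j) (.sub p j)) b1 ;; maxC (tab j) bn ;;
  foldC

/-- Twice the value of `tot` is the size of the largest ordered cut that extends `col`. -/
def bestC : Cmd := bestInit ;; .loop t pieceC

end

theorem le_cap {m : ℕ} (h : 2 * m ≤ E.n * E.n) {m' : ℕ} (h' : 2 * m' ≤ E.n * E.n) {j : ℕ}
    (hj : j ≤ E.n) : m + m' + j ≤ E.cap := by
  unfold Env.cap
  omega

theorem bestInit_spec (hsym : ∀ x y, E.rel (s.a .ord) x y = E.rel (s.a .ord) y x)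
    (hpc : ∀ x < E.n, 1 ≤ s.a .pc x) (hcol : ∀ x, s.a .col x ≤ 1) :
    Remains E.n (E.rel (s.a .ord)) (s.a .mark) (s.a .col) ((run E bestInit s).a .w0)
      ((run E bestInit s).a .w1) ((run E bestInit s).v .tot)
      (unmarked E.n (s.a .pc) (s.a .mark) 0) := by
  have key : (∀ x < E.n, (run E bestInit s).a .w0 x = #{y ∈ range E.n | s.a .mark y ≠ 0 ∧
      E.rel (s.a .ord) x y = true ∧ s.a .col y = 1}) ∧
      (∀ x < E.n, (run E bestInit s).a .w1 x = #{y ∈ range E.n | s.a .mark y ≠ 0 ∧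
      E.rel (s.a .ord) x y = true ∧ ¬ s.a .col y = 1}) := by
    rw [bestInit, run_seq]
    set s₁ := run E (.loop .x _) s with hs₁
    have f := run_fr (E := E) (count2C (.and (.lt (.var .y) (.var .x)) (.and (.not (.eq (.get .mark (.var .x)) 0))
      (.and (.not (.eq (.get .mark (.var .y)) 0))
      (.and (.edge (.var .x) (.var .y)) (.not (.eq (.get .col (.var .x)) (.get .col (.var .y)))))))) .tot) s₁
    rw [f.a .w0 rfl, f.a .w1 rfl, hs₁]
    refine loop_inv (fun j s' => (∀ x < j, s'.a .w0 x = #{y ∈ range E.n | s.a .mark y ≠ 0 ∧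
      E.rel (s.a .ord) x y = true ∧ s.a .col y = 1}) ∧
      (∀ x < j, s'.a .w1 x = #{y ∈ range E.n | s.a .mark y ≠ 0 ∧
      E.rel (s.a .ord) x y = true ∧ ¬ s.a .col y = 1})) (by simp) fun j hj s' hf h => ?_
    rw [run_seq, run_seq, run_seq]
    have c1 := count_spec (E := E) (s := s'.setV .x j) (x := .y) (c := .cnt)
      (b := .and (.not (.eq (.get .mark (.var .y)) 0)) (.and (.edge (.var .x) (.var .y)) (.eq (.get .col (.var .y)) 1)))
      (p := fun y => s.a .mark y ≠ 0 ∧ E.rel (s.a .ord) j y = true ∧ s.a .col y = 1) (by decide)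
      (fun l hl t ha hv => by
        have hx : t.v .x = j := by rw [hv .x (by decide) (by decide)]; simp
        simp [ha, hx, hf.a .mark rfl, hf.a .ord rfl, hf.a .col rfl])
    have f1 := run_fr (E := E) (countC .y (.and (.not (.eq (.get .mark (.var .y)) 0))
      (.and (.edge (.var .x) (.var .y)) (.eq (.get .col (.var .y)) 1))) .cnt) (s'.setV .x j)
    set s₂ := run E (countC _ _ _) (s'.setV .x j)
    clear_value s₂
    set s₃ := run E (.put .w0 (.var .x) (.var .cnt)) s₂ with hs₃
    have a3 : ∀ b, b ≠ .w0 → b ≠ .w1 → s₃.a b = s'.a b := fun b hb hb' => by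
      rw [hs₃, run_put, St.setA_ne _ _ _ hb, f1.a b rfl, St.setV_a]
    have hx3 : s₃.v .x = j := by rw [hs₃, run_put, St.setA_v, f1.v .x rfl]; simp
    have c2 := count_spec (E := E) (s := s₃) (x := .y) (c := .cnt)
      (b := .and (.not (.eq (.get .mark (.var .y)) 0)) (.and (.edge (.var .x) (.var .y)) (.not (.eq (.get .col (.var .y)) 1))))
      (p := fun y => s.a .mark y ≠ 0 ∧ E.rel (s.a .ord) j y = true ∧ ¬ s.a .col y = 1) (by decide)
      (fun l hl t ha hv => by
        have hx : t.v .x = j := by rw [hv .x (by decide) (by decide), hx3]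
        simp [ha, hx, a3, hf.a .mark rfl, hf.a .ord rfl, hf.a .col rfl])
    have f2 := run_fr (E := E) (countC .y (.and (.not (.eq (.get .mark (.var .y)) 0))
      (.and (.edge (.var .x) (.var .y)) (.not (.eq (.get .col (.var .y)) 1)))) .cnt) s₃
    set s₄ := run E (countC _ _ _) s₃
    clear_value s₄
    have w0 : ∀ x, (run E (.put .w1 (.var .x) (.var .cnt)) s₄).a .w0 x =
        if x = j then s₂.v .cnt else s'.a .w0 x := fun x => by
      have hx2 : s₂.v .x = j := by rw [f1.v .x rfl]; simp
      simp [f2.a .w0 rfl, hs₃, f1.a .w0 rfl, hx2]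
    have w1 : ∀ x, (run E (.put .w1 (.var .x) (.var .cnt)) s₄).a .w1 x =
        if x = j then s₄.v .cnt else s'.a .w1 x := fun x => by
      simp [f2.a .w1 rfl, hs₃, f1.a .w1 rfl, f2.v .x rfl, ← hx3]
    refine ⟨fun x hx => ?_, fun x hx => ?_⟩
    · rw [w0]
      split_ifs with e
      · rw [c1, e]
      · exact h.1 x (by omega)
    · rw [w1]
      split_ifs with e
      · rw [c2, e]
      · exact h.2 x (by omega)
  refine remains_start hsym hpc hcol key.1 key.2 ?_
  rw [bestInit, run_seq]
  set s₁ := run E (.loop .x _) s with hs₁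
  have f := run_fr (E := E) (.loop .x (
    countC .y (.and (.not (.eq (.get .mark (.var .y)) 0)) (.and (.edge (.var .x) (.var .y)) (.eq (.get .col (.var .y)) 1))) .cnt ;;
    .put .w0 (.var .x) (.var .cnt) ;;
    countC .y (.and (.not (.eq (.get .mark (.var .y)) 0)) (.and (.edge (.var .x) (.var .y)) (.not (.eq (.get .col (.var .y)) 1)))) .cnt ;;
    .put .w1 (.var .x) (.var .cnt))) s
  rw [← hs₁] at f
  clear_value s₁
  exact count2_spec (p := fun x y => y < x ∧ s.a .mark x ≠ 0 ∧ s.a .mark y ≠ 0 ∧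
      E.rel (s.a .ord) x y = true ∧ s.a .col x ≠ s.a .col y) (by decide) fun j hj l hl s' ha hv => by
    simp [ha, f.a .mark rfl, f.a .ord rfl, f.a .col rfl]

variable {e : ℕ → ℕ → Bool}

theorem gather_spec (hsym : ∀ x y, e x y = e y x) (hirr : ∀ x, e x x = false)
    (hF : Forest E.n e (s.a .pc) (s.a .mark) (s.a .att)) {t : ℕ} (ht : s.v .t = t) {tot : ℕ}
    (h : Remains E.n e (s.a .mark) (s.a .col) (s.a .w0) (s.a .w1) tot
      (unmarked E.n (s.a .pc) (s.a .mark) t)) :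
    let s' := run E gatherC s
    let X := cliqueOf E.n (s.a .pc) (s.a .mark) (t + 1)
    s'.v .p = #X ∧ Table e (s.a .w0) (s.a .w1) X (s'.a .tab) ∧
      (∀ x ∈ X, s.a .att x = s'.v .a) ∧ (X = ∅ → s'.v .a = 0) := by
  intro s' X
  have hX : ∀ {x}, x ∈ X ↔ x < E.n ∧ s.a .mark x = 0 ∧ s.a .pc x = t + 1 := by
    simp [X, cliqueOf]
  have hXU : X ⊆ unmarked E.n (s.a .pc) (s.a .mark) t := fun x hx => by
    rw [hX] at hx
    simp only [unmarked, mem_filter, mem_range]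
    omega
  have hXn : #X < E.n ∨ E.n = 0 := by
    rcases Nat.eq_zero_or_pos E.n with h0 | h0
    · exact .inr h0
    · left
      have : X ⊆ (range E.n).erase 0 := fun x hx => by
        rw [hX] at hx
        rw [mem_erase, mem_range]
        exact ⟨by rintro rfl; exact hF.first hx.2.1, hx.1⟩
      have h2 := card_le_card this
      rw [card_erase_of_mem (by simpa using h0), card_range] at h2
      omega
  let Y (j : ℕ) : Finset ℕ := {x ∈ X | x < j}
  have hYX : ∀ j, Y j ⊆ X := fun j => filter_subset _ _
  have key := loop_inv (E := E) (s := run E (.set .a 0) (run E (.put .tab 0 0) (run E (.set .p 0) s)))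
    (x := .x) (c := .when (.and (.eq (.get .mark (.var .x)) 0) (.eq (.get .pc (.var .x)) (.inc (.var .t)))) extend)
    (fun j s' => s'.v .p = #(Y j) ∧ Table e (s.a .w0) (s.a .w1) (Y j) (s'.a .tab) ∧
      (∀ x ∈ Y j, s.a .att x = s'.v .a) ∧ (Y j = ∅ → s'.v .a = 0)) ?_ ?_
  · have hYn : Y E.n = X := filter_true_of_mem fun x hx => (hX.1 hx).1
    rw [hYn] at key
    exact key
  · have hY0 : Y 0 = ∅ := by simp [Y]
    rw [hY0]
    exact ⟨by simp, Table.empty (by simp), by simp, by simp⟩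
  · intro j hj s₁ hf ⟨h1, h2, h3, h4⟩
    have a₁ : ∀ b, b ≠ .tab → s₁.a b = s.a b := fun b hb => by
      rw [hf.a b (by simp [Cmd.loop, Cmd.when, Cmd.wa, extend, entry, hb])]
      simp only [run_set, St.setV_a, run_put]
      rw [St.setA_ne _ _ _ hb]
      rfl
    have t₁ : s₁.v .t = t := by rw [hf.v .t rfl]; simp [ht]
    rw [run_when]
    have hc : evalB E (.and (.eq (.get .mark (.var .x)) 0) (.eq (.get .pc (.var .x)) (.inc (.var .t)))) (s₁.setV .x j)
        = true ↔ j ∈ X := by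
      rw [hX]
      simp [a₁, t₁, hj]
    simp only [hc]
    split_ifs with hjX
    · have hjX' := hX.1 hjX
      have hjY : j ∉ Y j := by simp [Y]
      have hYs : Y (j + 1) = insert j (Y j) := by
        ext x
        simp only [Y, mem_filter, mem_insert]
        constructor
        · rintro ⟨hx, hxj⟩
          rcases Nat.lt_succ_iff_lt_or_eq.1 hxj with h | h
          exacts [.inr ⟨hx, h⟩, .inl h]
        · rintro (rfl | ⟨hx, hxj⟩)
          exacts [⟨hjX, by omega⟩, ⟨hx, by omega⟩]
      have hcard : #(Y j) + 1 ≤ #X := by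
        rw [← card_insert_of_notMem hjY, ← hYs]
        exact card_le_card (hYX _)
      have hle : ∀ i ≤ #(Y j), 2 * s₁.a .tab i ≤ E.n * E.n := fun i hi =>
        h.table_le ((hYX j).trans hXU) h2 hi
      have hw := h.weight_le (hXU hjX)
      have := extend_spec (E := E) (s := s₁.setV .x j) (e := e) hsym hirr (X := Y j) (x := j) (by simp)
        (by simpa using h1) (by omega) hjY
        (fun y hy => by
          have hy' := hX.1 (hYX j hy)
          exact (hF.same j hj y hy'.1 (by omega) (fun e => hjY (e ▸ hy)) hjX'.2.1 hy'.2.1).1)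
        (by simpa [a₁] using h2)
        (fun i hi => by
          simp only [St.setV_a]
          rw [a₁ .w0 (by decide)]
          exact le_cap (hle i hi) hw.1 (by omega))
        (fun i hi => by
          simp only [St.setV_a]
          rw [a₁ .w1 (by decide)]
          exact le_cap (hle i hi) hw.2 (by omega))
      obtain ⟨h5, h6, h7⟩ := this
      rw [hYs, card_insert_of_notMem hjY]
      simp only [St.setV_a] at h6 h7
      rw [a₁ .w0 (by decide), a₁ .w1 (by decide)] at h7
      rw [a₁ .att (by decide)] at h6
      refine ⟨h5, h7, fun x hx => ?_, fun h0 => absurd h0 (insert_ne_empty _ _)⟩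
      rw [h6]
      have hx' := hX.1 (hYX (j + 1) (hYs ▸ hx))
      by_cases hxj : x = j
      · rw [hxj]
      · exact ((hF.same j hj x hx'.1 (by omega) (Ne.symm hxj) hjX'.2.1 hx'.2.1).2).symm
    · have hYs : Y (j + 1) = Y j := by
        refine filter_congr fun x hx => ?_
        have : x ≠ j := fun e => hjX (e ▸ hx)
        omega
      rw [hYs]
      exact ⟨by simpa using h1, h2, by simpa using h3, by simpa using h4⟩

theorem piece_spec (hsym : ∀ x y, e x y = e y x) (hirr : ∀ x, e x x = false)
    (hF : Forest E.n e (s.a .pc) (s.a .mark) (s.a .att)) {t : ℕ} (ht : s.v .t = t) (hn : 0 < E.n)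
    (h : Remains E.n e (s.a .mark) (s.a .col) (s.a .w0) (s.a .w1) (s.v .tot)
      (unmarked E.n (s.a .pc) (s.a .mark) t)) :
    Remains E.n e (s.a .mark) (s.a .col) ((run E pieceC s).a .w0) ((run E pieceC s).a .w1)
      ((run E pieceC s).v .tot) (unmarked E.n (s.a .pc) (s.a .mark) (t + 1)) := by
  have hg := gather_spec (E := E) hsym hirr hF ht h
  have fg := run_fr (E := E) gatherC s
  rw [pieceC, run_seq, run_seq, run_seq, run_seq]
  set s₁ := run E gatherC s
  clear_value s₁
  set X := cliqueOf E.n (s.a .pc) (s.a .mark) (t + 1) with hXdef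
  obtain ⟨hp, hT, ha, ha0⟩ := hg
  have hX : ∀ {x}, x ∈ X ↔ x < E.n ∧ s.a .mark x = 0 ∧ s.a .pc x = t + 1 := by
    simp [X, cliqueOf]
  have hXU : X ⊆ unmarked E.n (s.a .pc) (s.a .mark) t := fun x hx => by
    rw [hX] at hx
    simp only [unmarked, mem_filter, mem_range]
    omega
  have hXn : #X < E.n := by
    have : X ⊆ (range E.n).erase 0 := fun x hx => by
      rw [hX] at hx
      rw [mem_erase, mem_range]
      exact ⟨by rintro rfl; exact hF.first hx.2.1, hx.1⟩
    have h2 := card_le_card this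
    rw [card_erase_of_mem (by simpa using hn), card_range] at h2
    omega
  have hle : ∀ i ≤ #X, 2 * s₁.a .tab i ≤ E.n * E.n := fun i hi => h.table_le hXU hT hi
  have hb₀ := max_spec (E := E) (s := s₁) (f := .add (.get .tab (.var .j)) (.var .j)) (b := .b0)
    (g := fun j => s₁.a .tab j + j) (by decide) hp hXn (fun j hj s' ha hv => by
      have := le_cap (hle j hj) (m' := 0) (by omega) (j := j) (by omega)
      simp only [eval_add, eval_get, eval_var, St.setV_v, if_true, St.setV_a, ha]
      omega)
  have f₂ := run_fr (E := E) (maxC (.add (.get .tab (.var .j)) (.var .j)) .b0) s₁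
  set s₂ := run E (maxC _ .b0) s₁
  clear_value s₂
  have hp₂ : s₂.v .p = #X := by rw [f₂.v .p rfl, hp]
  have tab₂ : s₂.a .tab = s₁.a .tab := f₂.a .tab rfl
  have hb₁ := max_spec (E := E) (s := s₂) (f := .add (.get .tab (.var .j)) (.sub (.var .p) (.var .j))) (b := .b1)
    (g := fun j => s₁.a .tab j + (#X - j)) (by decide) hp₂ hXn (fun j hj s' ha hv => by
      have := le_cap (hle j hj) (m' := 0) (by omega) (j := #X - j) (by omega)
      have hp' : s'.v .p = #X := by rw [hv .p (by decide) (by decide), hp₂]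
      simp only [eval_add, eval_get, eval_var, eval_sub, St.setV_v, if_true, St.setV_a, ha, tab₂,
        reduceCtorEq, if_false, hp']
      omega)
  have f₃ := run_fr (E := E) (maxC (.add (.get .tab (.var .j)) (.sub (.var .p) (.var .j))) .b1) s₂
  set s₃ := run E (maxC _ .b1) s₂
  clear_value s₃
  have hp₃ : s₃.v .p = #X := by rw [f₃.v .p rfl, hp₂]
  have tab₃ : s₃.a .tab = s₁.a .tab := (f₃.a .tab rfl).trans tab₂
  have hb := max_spec (E := E) (s := s₃) (f := .get .tab (.var .j)) (b := .bn)
    (g := s₁.a .tab) (by decide) hp₃ hXn (fun j hj s' ha hv => by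
      simp only [eval_get, eval_var, St.setV_v, if_true, St.setV_a, ha, tab₃])
  have f₄ := run_fr (E := E) (maxC (.get .tab (.var .j)) .bn) s₃
  set s₄ := run E (maxC _ .bn) s₃
  clear_value s₄
  have arr : ∀ b, b ≠ .tab → s₄.a b = s.a b := fun b hb => by
    rw [f₄.a b rfl, f₃.a b rfl, f₂.a b rfl, fg.a b (by simp [gatherC, Cmd.loop, Cmd.when, Cmd.wa, extend, entry, hb])]
  have hw0 := arr .w0 (by decide)
  have hw1 := arr .w1 (by decide)
  have hmk := arr .mark (by decide)
  have hb₀4 : s₄.v .b0 = s₂.v .b0 := by rw [f₄.v .b0 rfl, f₃.v .b0 rfl]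
  have hb₁4 : s₄.v .b1 = s₃.v .b1 := by rw [f₄.v .b1 rfl]
  have ha4 : s₄.v .a = s₁.v .a := by rw [f₄.v .a rfl, f₃.v .a rfl, f₂.v .a rfl]
  have ht4 : s₄.v .tot = s.v .tot := by rw [f₄.v .tot rfl, f₃.v .tot rfl, f₂.v .tot rfl, fg.v .tot rfl]
  rw [foldC, run_ite]
  simp only [evalB_and, evalB_le, eval_one, eval_var, eval_nn, evalB_eq, eval_get, eval_sub,
    eval_zero, hmk, ha4]
  refine h.next hsym hF hT ha ha0 hb₀ hb₁ hb (fun hc => ?_) fun hc => ?_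
  · rw [if_pos hc]
    have hX0 : X.Nonempty := nonempty_iff_ne_empty.2 fun h => by have := ha0 h; omega
    obtain ⟨x, hx⟩ := hX0
    have hv : s₁.v .a - 1 ∈ unmarked E.n (s.a .pc) (s.a .mark) t := by
      have hx' := hX.1 hx
      have := (hF.att x hx'.1 (s₁.v .a - 1) (by omega) hx'.2.1 hc.2.2).1 (by rw [ha x hx]; omega)
      simp only [unmarked, mem_filter, mem_range]
      exact ⟨by omega, hc.2.2, by omega⟩
    have hw := h.weight_le hv
    obtain ⟨j₀, hj₀, hj₀'⟩ := hb₀.2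
    obtain ⟨j₁, hj₁, hj₁'⟩ := hb₁.2
    have c0 := le_cap (hle j₀ hj₀) hw.1 (j := j₀) (by omega)
    have c1 := le_cap (hle j₁ hj₁) hw.2 (j := #X - j₁) (by omega)
    simp only at hj₀' hj₁'
    refine ⟨?_, ?_, ?_⟩
    · simp [ht4]
    · funext x
      simp only [run_seq, run_put, St.setA_a, reduceCtorEq, false_and, if_false, true_and, eval_sub,
        eval_var, eval_one, eval_add, eval_get, hw0, ha4, hb₀4, Function.update_apply]
      rw [min_eq_left (by omega)]
    · funext x
      simp only [run_seq, run_put, St.setA_a, St.setA_v, reduceCtorEq, false_and, if_false, true_and, eval_sub,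
        eval_var, eval_one, eval_add, eval_get, hw1, ha4, hb₁4, Function.update_apply]
      rw [min_eq_left (by omega)]
  · rw [if_neg hc]
    obtain ⟨j, hj, hj'⟩ := hb.2
    have h1 := h.le fun _ => true
    have c0 := le_cap (hle j hj) (m' := s.v .tot) (by omega) (j := 0) (by omega)
    refine ⟨?_, by simpa using hw0, by simpa using hw1⟩
    simp only [run_set, eval_add, eval_var, St.setV_v, if_true, ht4]
    rw [min_eq_left (by omega)]

theorem best_spec (hsym : ∀ x y, E.rel (s.a .ord) x y = E.rel (s.a .ord) y x)
    (hirr : ∀ x, E.rel (s.a .ord) x x = false) (hn : 0 < E.n)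
    (hF : Forest E.n (E.rel (s.a .ord)) (s.a .pc) (s.a .mark) (s.a .att))
    (hcol : ∀ x, s.a .col x ≤ 1) :
    IsBest E.n (E.rel (s.a .ord)) (s.a .mark) (s.a .col) (2 * (run E bestC s).v .tot) := by
  have h0 := bestInit_spec (E := E) hsym (fun x hx => (hF.pos x hx).1) hcol
  rw [bestC, run_seq]
  have f0 := run_fr (E := E) bestInit s
  set s₀ := run E bestInit s
  clear_value s₀
  have := loop_inv (E := E) (s := s₀) (x := .t) (c := pieceC) (fun t s' =>
    Remains E.n (E.rel (s.a .ord)) (s.a .mark) (s.a .col) (s'.a .w0) (s'.a .w1) (s'.v .tot)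
      (unmarked E.n (s.a .pc) (s.a .mark) t)) h0 fun t ht s₁ hf h => ?_
  · rw [show unmarked E.n (s.a .pc) (s.a .mark) E.n = ∅ from filter_eq_empty_iff.2 fun x hx => by
      have := (hF.pos x (mem_range.1 hx)).2
      omega] at this
    exact this.empty
  · have e1 : s₁.a .mark = s.a .mark := (hf.a _ rfl).trans (f0.a _ rfl)
    have e2 : s₁.a .col = s.a .col := (hf.a _ rfl).trans (f0.a _ rfl)
    have e3 : s₁.a .pc = s.a .pc := (hf.a _ rfl).trans (f0.a _ rfl)
    have e4 : s₁.a .att = s.a .att := (hf.a _ rfl).trans (f0.a _ rfl)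
    have := piece_spec (E := E) (s := s₁.setV .t t) (e := E.rel (s.a .ord)) hsym hirr
      (by simpa [e1, e3, e4] using hF) (t := t) (by simp) hn (by simpa [e1, e2, e3] using h)
    simpa only [St.setV_a, e1, e2, e3] using this

end LoopLang

/-! ## The colouring by majorities -/

namespace LoopLang

open Finset Pieces

variable {E : Env} {s : St}

/-! ### The cost of the dynamic program -/

theorem cost_rep_le {q : Bool} {x : Var} {c : Cmd} (f : ℕ → ℕ) (h : ∀ j < E.bound q, ∀ s',
    Fr (.rep q x c) s s' → cost E c (s'.setV x j) ≤ f j) :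
    cost E (.rep q x c) s ≤ 2 + ∑ j ∈ range (E.bound q), (f j + 5) := by
  rw [cost]
  refine Nat.add_le_add_left (sum_le_sum fun j hj => Nat.add_le_add_right (h j (mem_range.1 hj) _ ?_) _) _
  exact iter_fr (run_fr c) s j

/-- The test whether `x` is in the clique with number `t + 1`. -/
def inClique : BExp := .and (.eq (.get .mark (.var .x)) 0) (.eq (.get .pc (.var .x)) (.inc (.var .t)))

theorem cost_gather (hn : 1 ≤ E.n) (s : St) : cost E gatherC s ≤ gatherC.wt * E.n +
    extend.wt * E.n * #(cliqueOf E.n (s.a .pc) (s.a .mark) (s.v .t + 1)) := by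
  set s₁ := run E (.set .a 0) (run E (.put .tab 0 0) (run E (.set .p 0) s)) with hs₁
  have h := cost_rep_le (E := E) (s := s₁) (q := false) (x := .x) (c := .when inClique extend)
    (fun x => (bw inClique + 4) + if s.a .mark x = 0 ∧ s.a .pc x = s.v .t + 1 then extend.wt * E.n
      else 0) fun j hj s' hf => by
      rw [Cmd.when, cost]
      have e1 : evalB E inClique (s'.setV .x j) = true ↔ s.a .mark j = 0 ∧ s.a .pc j = s.v .t + 1 := by
        have a1 : s'.a .mark = s.a .mark := hf.a .mark rfl
        have a2 : s'.a .pc = s.a .pc := hf.a .pc rfl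
        have a3 : s'.v .t = s.v .t := hf.v .t rfl
        simp [inClique, a1, a2, a3]
      simp only [e1]
      have e2 := cost_le hn extend (d := 1) (by decide) (by decide) (s'.setV .x j)
      rw [pow_one] at e2
      have e4 : cost E .skip (s'.setV .x j) = 0 := rfl
      split_ifs <;> omega
  have h1 : cost E gatherC s = 2 + (12 + (2 + cost E (.rep false .x (.when inClique extend)) s₁)) :=
    rfl
  have h2 : gatherC.wt = 2 + (12 + (2 + (bw inClique + 4 + extend.wt + 0 + 7))) := rfl
  have h3 : ∑ x ∈ range (E.bound false), ((bw inClique + 4) +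
      (if s.a .mark x = 0 ∧ s.a .pc x = s.v .t + 1 then extend.wt * E.n else 0) + 5)
      = E.n * (bw inClique + 9) +
        extend.wt * E.n * #(cliqueOf E.n (s.a .pc) (s.a .mark) (s.v .t + 1)) := by
    rw [sum_add_distrib, sum_add_distrib, ← sum_filter]
    simp only [sum_const, card_range, smul_eq_mul, cliqueOf, Env.bound, Bool.false_eq_true, if_false]
    ring
  rw [h3] at h
  rw [h1, h2]
  nlinarith [Nat.zero_le (extend.wt * E.n)]

theorem cost_piece (hn : 1 ≤ E.n) (s : St) : cost E pieceC s ≤ pieceC.wt * E.n +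
    extend.wt * E.n * #(cliqueOf E.n (s.a .pc) (s.a .mark) (s.v .t + 1)) := by
  have h1 := cost_gather hn s
  rw [pieceC, cost]
  set d := maxC (.add (.get .tab (.var .j)) (.var .j)) .b0 ;;
    maxC (.add (.get .tab (.var .j)) (.sub (.var .p) (.var .j))) .b1 ;;
    maxC (.get .tab (.var .j)) .bn ;; foldC with hd
  have h2 := cost_le hn d (d := 1) (by decide) (by decide) (run E gatherC s)
  rw [pow_one] at h2
  rw [Cmd.wt]
  linarith

theorem cost_best (hn : 1 ≤ E.n) (s : St) :
    cost E bestC s ≤ (bestC.wt + extend.wt) * E.n ^ 2 := by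
  rw [bestC, cost, Cmd.wt]
  have h1 := cost_le hn bestInit (d := 2) (by decide) (by decide) s
  set s₀ := run E bestInit s
  have h2 := cost_rep_le (E := E) (s := s₀) (q := false) (x := .t) (c := pieceC)
    (fun t => pieceC.wt * E.n + extend.wt * E.n * #(cliqueOf E.n (s₀.a .pc) (s₀.a .mark) (t + 1)))
    fun t ht s' hf => by
      have := cost_piece hn (s'.setV .t t)
      have a1 : s'.a .mark = s₀.a .mark := hf.a .mark rfl
      have a2 : s'.a .pc = s₀.a .pc := hf.a .pc rfl
      simpa [a1, a2] using this
  have h3 : ∑ t ∈ range E.n, #(cliqueOf E.n (s₀.a .pc) (s₀.a .mark) (t + 1)) ≤ E.n := by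
    unfold cliqueOf
    rw [← card_biUnion fun i _ j _ hij => disjoint_filter.2 fun x _ h h' => by omega]
    refine (card_le_card (biUnion_subset.2 fun t _ => filter_subset _ _)).trans (by simp)
  have h4 : ∑ t ∈ range (E.bound false), (pieceC.wt * E.n + extend.wt * E.n *
      #(cliqueOf E.n (s₀.a .pc) (s₀.a .mark) (t + 1)) + 5) = E.n * (pieceC.wt * E.n + 5)
      + extend.wt * E.n * ∑ t ∈ range E.n, #(cliqueOf E.n (s₀.a .pc) (s₀.a .mark) (t + 1)) := by
    simp only [Env.bound, Bool.false_eq_true, if_false]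
    rw [sum_add_distrib, sum_add_distrib, mul_sum]
    simp only [sum_const, card_range, smul_eq_mul]
    ring
  rw [h4] at h2
  have h5 := Nat.mul_le_mul_left (extend.wt * E.n) h3
  have h6 : E.n ≤ E.n ^ 2 := Nat.le_self_pow (by decide) _
  have h7 : (Cmd.loop .t pieceC).wt = pieceC.wt + 7 := rfl
  have h8 : cost E (Cmd.loop .t pieceC) s₀ = cost E (.rep false .t pieceC) s₀ := rfl
  rw [h7, h8]
  nlinarith

/-! ### Majorities -/

section
open Var Arr

def toLater (b : BExp) : BExp := .and (.eq (pc x) t) (.and (.lt t (pc y)) (.and (.edge x y) b))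

/-- Colour the piece with number `n - i` such that at least half of the edges to later pieces
are cut. -/
def orientC : Cmd :=
  .set t (.sub .nn i) ;; count2C (toLater (.not (.eq (side x) (col y)))) c0 ;;
  count2C (toLater (.eq (side x) (col y))) c1 ;;
  .ite (.le c1 c0) (fillC .x (.eq (pc x) t) .col (side x))
    (fillC .x (.eq (pc x) t) .col (.sub 1 (side x)))

/-- Colour by majorities, and forget the colouring if its cut is too small. -/
def majorityC : Cmd :=
  .loop i orientC ;; count2C (.edge x y) c0 ;;
  .set thr (.add (.add c0 .nn) (.add (.add .kk .kk) (.add .kk .kk))) ;;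
  count2C (.and (.edge x y) (.not (.eq (col x) (col y)))) c1 ;;
  .ite (.le thr (.inc (.add c1 c1))) (.set fd 1)
    (.set fd 0 ;; fillC .x (.le 0 0) .col 0)

end

theorem corr_eq_sub {e : ℕ → ℕ → Bool} {σ : ℕ → ℤ} {ε : ℤ} {f g : ℕ → ℕ} {A B : Finset ℕ}
    (hf : ∀ x ∈ A, f x ≤ 1) (hg : ∀ x ∈ B, g x ≤ 1) (hA : ∀ x ∈ A, σ x = ε * spin f x)
    (hB : ∀ x ∈ B, σ x = spin g x) :
    corr e σ A B = ε * ((∑ x ∈ A, #{y ∈ B | e x y = true ∧ f x = g y} : ℕ) -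
      (∑ x ∈ A, #{y ∈ B | e x y = true ∧ ¬ f x = g y} : ℕ)) := by
  push_cast
  rw [corr, ← sum_sub_distrib, mul_sum]
  refine sum_congr rfl fun x hx => ?_
  rw [card_filter, card_filter]
  push_cast
  rw [← sum_sub_distrib, mul_sum]
  refine sum_congr rfl fun y hy => ?_
  rw [hA x hx, hB y hy]
  have h1 := hf x hx
  have h2 := hg y hy
  unfold spin
  by_cases he : e x y = true
  · simp only [he, if_true, true_and]
    interval_cases f x <;> interval_cases g y <;> simp
  · simp [he]

theorem corr_self {e : ℕ → ℕ → Bool} {f : ℕ → ℕ} {A : Finset ℕ} (hf : ∀ x ∈ A, f x ≤ 1) :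
    corr e (spin f) A A = (∑ x ∈ A, #{y ∈ A | e x y = true} : ℕ) -
      2 * (∑ x ∈ A, #{y ∈ A | e x y = true ∧ ¬ f x = f y} : ℕ) := by
  rw [corr_eq_sub (ε := 1) hf hf (by simp) (by simp)]
  have : ∀ x ∈ A, #{y ∈ A | e x y = true} = #{y ∈ A | e x y = true ∧ f x = f y}
      + #{y ∈ A | e x y = true ∧ ¬ f x = f y} := fun x _ => by
    rw [← card_filter_add_card_filter_not (s := {y ∈ A | e x y = true}) (fun y => f x = f y),
      filter_filter, filter_filter]
  rw [sum_congr rfl this, sum_add_distrib]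
  push_cast
  ring

theorem sum_piece_later {n t : ℕ} {D : Data} {q : ℕ → ℕ → Prop} [∀ x, DecidablePred (q x)]
    (hpos : ∀ x < n, D.pc x ≠ 0) :
    ∑ x ∈ range n, #{y ∈ range n | D.pc x = t ∧ t < D.pc y ∧ q x y}
      = ∑ x ∈ D.piece n t, #{y ∈ D.later n t | q x y} := by
  rw [Data.piece, sum_filter]
  refine sum_congr rfl fun x _ => ?_
  split_ifs with h
  · rw [Data.later, filter_filter]
    refine congrArg card (filter_congr fun y hy => ?_)
    have := hpos y (mem_range.1 hy)
    tauto
  · simp [h]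

theorem orient_spec {i : ℕ} (hi : s.v .i = i) (hpos : ∀ x < E.n, s.a .pc x ≠ 0)
    (hside : ∀ x, s.a .side x ≤ 1) (hcol : ∀ x, s.a .col x ≤ 1) :
    let s' := run E orientC s
    (∀ x, s'.a .col x ≤ 1) ∧ (∀ x, s.a .pc x ≠ E.n - i → s'.a .col x = s.a .col x) ∧
    (∃ ε : ℤ, ε * ε = 1 ∧ ∀ x ∈ s.data.piece E.n (E.n - i),
      spin (s'.a .col) x = ε * spin s.data.side x) ∧
    corr (E.rel (s.a .ord)) (spin (s'.a .col)) (s.data.piece E.n (E.n - i))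
      (s.data.later E.n (E.n - i)) ≤ 0 := by
  intro s'
  set t := E.n - i with ht
  have hrun : s' = run E orientC s := rfl
  rw [orientC, run_seq, run_seq, run_seq, run_ite] at hrun
  set s₁ := run E (.set .t (.sub .nn (.var .i))) s with hs₁
  have t₁ : s₁.v .t = t := by simp [hs₁, hi, ht]
  have a₁ : s₁.a = s.a := rfl
  have hc0 := count2_spec (E := E) (s := s₁) (c := .c0)
    (b := toLater (.not (.eq (.get .side (.var .x)) (.get .col (.var .y)))))
    (p := fun x y => s.a .pc x = t ∧ t < s.a .pc y ∧ (E.rel (s.a .ord) x y = true ∧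
      ¬ s.a .side x = s.a .col y)) (by decide) fun j hj l hl s' ha hv => by
    have hv' := hv .t (by decide) (by decide) (by decide)
    simp [toLater, ha, a₁, hv', t₁]
  have f2 := run_fr (E := E)
    (count2C (toLater (.not (.eq (.get .side (.var .x)) (.get .col (.var .y))))) .c0) s₁
  set s₂ := run E (count2C _ .c0) s₁
  clear_value s₂
  have t₂ : s₂.v .t = t := by rw [f2.v .t rfl, t₁]
  have a₂ : s₂.a = s.a := by funext b; rw [f2.a b rfl, a₁]
  have hc1 := count2_spec (E := E) (s := s₂) (c := .c1)
    (b := toLater (.eq (.get .side (.var .x)) (.get .col (.var .y))))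
    (p := fun x y => s.a .pc x = t ∧ t < s.a .pc y ∧ (E.rel (s.a .ord) x y = true ∧
      s.a .side x = s.a .col y)) (by decide) fun j hj l hl s' ha hv => by
    have hv' := hv .t (by decide) (by decide) (by decide)
    simp [toLater, ha, a₂, hv', t₂]
  have f3 := run_fr (E := E)
    (count2C (toLater (.eq (.get .side (.var .x)) (.get .col (.var .y)))) .c1) s₂
  set s₃ := run E (count2C _ .c1) s₂
  clear_value s₃
  have t₃ : s₃.v .t = t := by rw [f3.v .t rfl, t₂]
  have a₃ : s₃.a = s.a := by funext b; rw [f3.a b rfl, a₂]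
  have hc03 : s₃.v .c0 = s₂.v .c0 := f3.v .c0 rfl
  have m0 := sum_piece_later (t := t) (D := s.data) (q := fun x y => E.rel (s.a .ord) x y = true ∧
      ¬ s.a .side x = s.a .col y) hpos
  have m1 := sum_piece_later (t := t) (D := s.data) (q := fun x y => E.rel (s.a .ord) x y = true ∧
      s.a .side x = s.a .col y) hpos
  replace m0 := hc0.trans m0
  replace m1 := hc1.trans m1
  have key : ∀ (ε : ℤ) (f : Exp) (g : ℕ → ℕ), (∀ x, g x ≤ 1) → ε * ε = 1 →
      (∀ x, spin g x = ε * spin (s.a .side) x) → ε * ((s₃.v .c1 : ℤ) - s₂.v .c0) ≤ 0 →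
      (∀ j (s' : St), (∀ c, c ≠ .col → s'.a c = s.a c) → eval E f (s'.setV .x j) = g j) →
      s' = run E (fillC .x (.eq (.get .pc (.var .x)) (.var .t)) .col f) s₃ →
      (∀ x, s'.a .col x ≤ 1) ∧ (∀ x, s.a .pc x ≠ t → s'.a .col x = s.a .col x) ∧
      (∃ ε : ℤ, ε * ε = 1 ∧ ∀ x ∈ s.data.piece E.n t, spin (s'.a .col) x = ε * spin s.data.side x) ∧
      corr (E.rel (s.a .ord)) (spin (s'.a .col)) (s.data.piece E.n t) (s.data.later E.n t) ≤ 0 := by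
    intro ε f g hg hε hsp hle hf hr
    have hfill : ∀ x, s'.a .col x = if x < E.n ∧ s.a .pc x = t then g x else s.a .col x := by
      intro x
      rw [hr, fill_spec (p := fun x => s.a .pc x = t) (g := g) fun j hj s' ha _ hv => ?_, a₃]
      refine ⟨?_, fun _ => hf j s' fun c hc => by rw [ha c hc, a₃]⟩
      have hv' := hv .t (by decide)
      simp [ha, a₃, hv', t₃]
    have hP : ∀ x ∈ s.data.piece E.n t, spin (s'.a .col) x = ε * spin s.data.side x := fun x hx => by
      simp only [Data.piece, mem_filter, mem_range] at hx
      refine Eq.trans ?_ (hsp x)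
      rw [spin, spin, hfill, if_pos (show x < E.n ∧ s.a .pc x = t from hx)]
    refine ⟨fun x => ?_, fun x hx => ?_, ⟨ε, hε, hP⟩, ?_⟩
    · rw [hfill]
      split_ifs
      exacts [hg x, hcol x]
    · rw [hfill, if_neg (by tauto)]
    · rw [corr_eq_sub (f := s.a .side) (g := s.a .col) (fun x _ => hside x) (fun x _ => hcol x) hP
        fun x hx => ?_, ← m0, ← m1]
      · exact hle
      · simp only [Data.later, mem_filter, mem_range] at hx
        have := hpos x hx.1
        rw [spin, spin, hfill, if_neg]
        rintro ⟨-, h⟩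
        have h' : s.data.pc x = t := h
        have : s.data.pc x ≠ 0 := this
        omega
  split_ifs at hrun with hle
  · simp only [evalB_le, eval_var, hc03] at hle
    exact key 1 _ (s.a .side) hside (by simp) (by simp) (by omega)
      (fun j s' h => by simp [h]) hrun
  · simp only [evalB_le, eval_var, hc03] at hle
    refine key (-1) _ (fun x => 1 - s.a .side x) (fun x => by omega) (by simp) (fun x => ?_) (by omega)
      (fun j s' h => by simp [h]) hrun
    have := hside x
    unfold spin
    push_cast [Nat.cast_sub this]
    ring

/-- The size of an ordered cut of a colouring with numbers. -/
theorem sum_card_eq_cutIn {n : ℕ} {e : ℕ → ℕ → Bool} {col : ℕ → ℕ} (hcol : ∀ x, col x ≤ 1) :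
    ∑ x ∈ range n, #{y ∈ range n | e x y = true ∧ ¬ col x = col y}
      = cutIn e (fun x => decide (col x = 1)) (range n) := by
  refine sum_congr rfl fun x _ => ?_
  rw [card_filter]
  refine sum_congr rfl fun y _ => if_congr (and_congr_right fun _ => ?_) rfl rfl
  have h1 := hcol x
  have h2 := hcol y
  rw [Ne, decide_eq_decide]
  omega

/-- Twice the bound for cuts, with ordered edges. -/
def Env.goal (E : Env) (o : ℕ → ℕ) : ℕ :=
  ∑ x ∈ range E.n, #{y ∈ range E.n | E.rel o x y = true} + E.n + 4 * E.k

/-- The colouring has a cut of the required size. -/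
def Env.Big (E : Env) (o : ℕ → ℕ) (χ : ℕ → Bool) : Prop :=
  E.goal o ≤ 2 * cutIn (E.rel o) χ (range E.n) + 1

theorem majority_spec {o : ℕ → ℕ} (hs : s.Decomposed E o) (hsym : ∀ x y, E.rel o x y = E.rel o y x)
    (hcol : ∀ x, s.a .col x = 0) :
    let s' := run E majorityC s
    s'.v .thr = E.goal o ∧ (∀ x, s'.a .col x ≤ 1) ∧
    (s'.v .fd = 1 ∧ E.Big o (fun x => decide (s'.a .col x = 1)) ∨
      s'.v .fd = 0 ∧ (∀ x < E.n, s'.a .col x = 0) ∧ #(s.data.marked E.n) ≤ 12 * E.k) := by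
  intro s'
  have hrem := hs.removed
  have hside : ∀ x, s.a .side x ≤ 1 := hrem.side_le
  have key := loop_inv (E := E) (s := s) (x := .i) (c := orientC) (fun i s' =>
    (∀ x, s'.a .col x ≤ 1) ∧ ∀ t, E.n - i < t → t ≤ E.n →
      (∃ ε : ℤ, ε * ε = 1 ∧ ∀ x ∈ s.data.piece E.n t, spin (s'.a .col) x = ε * spin s.data.side x) ∧
      corr (E.rel o) (spin (s'.a .col)) (s.data.piece E.n t) (s.data.later E.n t) ≤ 0)
    ⟨fun x => by rw [hcol]; omega, fun t h1 h2 => by omega⟩ fun i hi s₁ hf ⟨h1, h2⟩ => ?_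
  · have f1 := run_fr (E := E) (.loop .i orientC) s
    have hr : s' = run E majorityC s := rfl
    rw [majorityC, run_seq, run_seq, run_seq, run_seq, run_ite] at hr
    set s₁ := run E (.loop .i orientC) s
    clear_value s₁
    obtain ⟨hc1, hpieces⟩ := key
    have ord₁ : s₁.a .ord = o := (f1.a .ord rfl).trans hs.ord
    have hM := count2_spec (E := E) (s := s₁) (c := .c0) (b := .edge (.var .x) (.var .y))
      (p := fun x y => E.rel o x y = true) (by decide) fun j hj l hl s' ha hv => by
        simp [ha, ord₁]
    have f2 := run_fr (E := E) (count2C (.edge (.var .x) (.var .y)) .c0) s₁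
    set s₂ := run E (count2C _ .c0) s₁
    clear_value s₂
    have a₂ : s₂.a = s₁.a := by funext b; rw [f2.a b rfl]
    set s₃ := run E (.set .thr _) s₂ with hs₃
    have a₃ : s₃.a = s₁.a := a₂
    have hMle : ∑ x ∈ range E.n, #{y ∈ range E.n | E.rel o x y = true} ≤ E.n * E.n :=
      (sum_le_card_nsmul _ _ E.n fun x _ => (card_filter_le _ _).trans (by simp)).trans (by simp)
    have thr₃ : s₃.v .thr = E.goal o := by
      simp only [hs₃, run_set, St.setV_v, if_true, eval_add, eval_var, eval_nn, eval_kk, hM, Env.goal]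
      unfold Env.cap
      omega
    clear_value s₃
    have hC := count2_spec (E := E) (s := s₃) (c := .c1)
      (b := .and (.edge (.var .x) (.var .y)) (.not (.eq (.get .col (.var .x)) (.get .col (.var .y)))))
      (p := fun x y => E.rel o x y = true ∧ ¬ s₁.a .col x = s₁.a .col y) (by decide)
      fun j hj l hl s' ha hv => by simp [ha, a₃, ord₁]
    rw [sum_card_eq_cutIn hc1] at hC
    have f4 := run_fr (E := E)
      (count2C (.and (.edge (.var .x) (.var .y)) (.not (.eq (.get .col (.var .x)) (.get .col (.var .y))))) .c1) s₃
    set s₄ := run E (count2C _ .c1) s₃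
    clear_value s₄
    have a₄ : s₄.a = s₁.a := by funext b; rw [f4.a b rfl, a₃]
    have thr₄ : s₄.v .thr = E.goal o := by rw [f4.v .thr rfl, thr₃]
    have hcut := cutIn_le (e := E.rel o) (fun x => decide (s₁.a .col x = 1)) (range E.n)
    rw [card_range] at hcut
    have htest : evalB E (.le (.var .thr) (.inc (.add (.var .c1) (.var .c1)))) s₄ = true ↔
        E.Big o (fun x => decide (s₁.a .col x = 1)) := by
      simp only [evalB_le, eval_var, eval_inc, eval_add, thr₄, hC, Env.Big]
      have : cutIn (E.rel o) (fun x => decide (s₁.a .col x = 1)) (range E.n) +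
        cutIn (E.rel o) (fun x => decide (s₁.a .col x = 1)) (range E.n) ≤ E.cap := by
        unfold Env.cap
        omega
      rw [min_eq_left this, two_mul]
    split_ifs at hr with hbig
    · rw [hr]
      simp only [run_set, St.setV_v, reduceCtorEq, if_false, if_true, St.setV_a, a₄]
      exact ⟨thr₄, hc1, .inl ⟨rfl, htest.1 hbig⟩⟩
    · have hfill : ∀ x, s'.a .col x = if x < E.n ∧ True then 0 else s₁.a .col x := by
        intro x
        rw [hr, run_seq, fill_spec (p := fun _ => True) (g := fun _ => 0) fun j hj s' ha _ hv => ?_, ← a₄]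
        · rfl
        · simp
      have hcol0 : ∀ x < E.n, s'.a .col x = 0 := fun x hx => by
        rw [hfill, if_pos ⟨hx, trivial⟩]
      have f5 := run_fr (E := E) (fillC .x (.le 0 0) .col 0) (run E (.set .fd 0) s₄)
      rw [← run_seq, ← hr] at f5
      refine ⟨?_, fun x => by rw [hfill]; have := hc1 x; split_ifs <;> omega, .inr ⟨?_, hcol0, ?_⟩⟩
      · rw [f5.v .thr rfl]; simp [thr₄]
      · rw [f5.v .fd rfl]; simp
      · have hnb : ¬ E.Big o (fun x => decide (s₁.a .col x = 1)) := fun h => hbig (htest.2 h)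
        obtain ⟨g, hg, hmk⟩ := hrem.gain
        have htop : s.data.top ≤ E.n := hrem.top_le.trans ((card_filter_le _ _).trans (by simp))
        have := total_gain (σ := spin (s₁.a .col)) hsym hs.pos hrem.pc_le hrem.side_le
          (fun t h1 h2 => (hpieces t (by omega) (by omega)).1)
          (fun t h1 h2 => (hpieces t (by omega) (by omega)).2) hg
        rw [corr_self fun x _ => hc1 x, sum_card_eq_cutIn hc1] at this
        simp only [Env.Big, Env.goal, not_le] at hnb
        omega
  · have := orient_spec (E := E) (s := s₁.setV .i i) (i := i) (by simp)
      (by simpa [hf.a .pc rfl] using hs.pos) (by simpa [hf.a .side rfl] using hside) (by simpa using h1)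
    have e1 : s₁.a .pc = s.a .pc := hf.a .pc rfl
    have e2 : s₁.a .side = s.a .side := hf.a .side rfl
    have e3 : s₁.a .ord = o := (hf.a .ord rfl).trans hs.ord
    obtain ⟨c1, c2, c3, c4⟩ := this
    simp only [St.setV_a, e1, e3] at c2 c4
    set s₂ := run E orientC (s₁.setV .i i)
    clear_value s₂
    have d1 : ∀ t, (s₁.setV .i i).data.piece E.n t = s.data.piece E.n t := fun t => by
      unfold Data.piece
      exact filter_congr fun x _ => by simp [St.data, e1]
    have d2 : ∀ t, (s₁.setV .i i).data.later E.n t = s.data.later E.n t := fun t => by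
      unfold Data.later
      exact filter_congr fun x _ => by simp [St.data, e1]
    rw [d1, d2] at c4
    rw [d1] at c3
    refine ⟨c1, fun t h3 h4 => ?_⟩
    by_cases ht : t = E.n - i
    · rw [ht]
      refine ⟨?_, c4⟩
      have : (s₁.setV .i i).data.side = s.data.side := e2
      rwa [this] at c3
    · have h2 := h2 t (by omega) h4
      have hP : ∀ x ∈ s.data.piece E.n t, spin (s₂.a .col) x = spin (s₁.a .col) x := fun x hx => by
        simp only [Data.piece, mem_filter, mem_range] at hx
        have hx' : s.a .pc x = t := hx.2
        rw [spin, spin, c2 x (by omega)]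
      have hL : ∀ x ∈ s.data.later E.n t, spin (s₂.a .col) x = spin (s₁.a .col) x := fun x hx => by
        simp only [Data.later, mem_filter, mem_range] at hx
        have hx' : s.a .pc x = 0 ∨ t < s.a .pc x := hx.2
        have := hs.pos x hx.1
        rw [spin, spin, c2 x (by omega)]
      rw [corr_congr hP hL]
      obtain ⟨⟨ε, hε, h⟩, h'⟩ := h2
      exact ⟨⟨ε, hε, fun x hx => by rw [hP x hx, h x hx]⟩, h'⟩

end LoopLang

/-! ## Searching for a large cut -/

namespace Pieces

open Finset

/-- The position of `x` among the marked vertices. -/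
def rank (mark : ℕ → ℕ) (x : ℕ) : ℕ := #{y ∈ range x | mark y ≠ 0}

variable {mark : ℕ → ℕ}

theorem rank_succ (x : ℕ) : rank mark (x + 1) = rank mark x + if mark x ≠ 0 then 1 else 0 := by
  unfold rank
  rw [range_add_one, filter_insert]
  split_ifs
  · rw [card_insert_of_notMem (by simp)]
  · rfl

theorem rank_lt {x y : ℕ} (hx : mark x ≠ 0) (h : x < y) : rank mark x < rank mark y := by
  have h1 := rank_succ (mark := mark) x
  rw [if_pos hx] at h1
  have h2 : rank mark (x + 1) ≤ rank mark y :=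
    card_le_card (filter_subset_filter _ (range_subset_range.2 h))
  omega

/-- Every colouring of the marked vertices is given by the binary digits of a number. -/
theorem exists_digits (c : ℕ → Bool) (n : ℕ) :
    ∃ q < 2 ^ rank mark n, ∀ x < n, mark x ≠ 0 → (if c x then 1 else 0) = q / 2 ^ rank mark x % 2 := by
  induction n with
  | zero => exact ⟨0, Nat.pow_pos (by omega), by simp⟩
  | succ n ih =>
    obtain ⟨q, hq, h⟩ := ih
    rw [rank_succ]
    by_cases hm : mark n = 0
    · refine ⟨q, by simpa [hm] using hq, fun x hx hmx => h x ?_ hmx⟩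
      rcases Nat.lt_succ_iff_lt_or_eq.1 hx with hx | rfl
      exacts [hx, absurd hm hmx]
    · rw [if_pos hm, pow_succ]
      set b : ℕ := if c n then 1 else 0 with hb
      have hb1 : b ≤ 1 := by rw [hb]; split_ifs <;> omega
      refine ⟨q + 2 ^ rank mark n * b, ?_, fun x hx hmx => ?_⟩
      · have := Nat.mul_le_mul_left (2 ^ rank mark n) hb1
        omega
      · rcases Nat.lt_succ_iff_lt_or_eq.1 hx with hx | rfl
        · obtain ⟨d, hd⟩ := Nat.exists_eq_add_of_lt (rank_lt hmx hx)
          rw [hd, show 2 ^ (rank mark x + d + 1) * b = 2 ^ rank mark x * (2 * (2 ^ d * b)) by ring,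
            Nat.add_mul_div_left _ _ (Nat.pow_pos (by omega)), h x hx hmx]
          omega
        · rw [Nat.add_mul_div_left _ _ (Nat.pow_pos (by omega)), Nat.div_eq_of_lt hq]
          omega

end Pieces

namespace LoopLang

open Finset Pieces

variable {E : Env} {s : St} {o : ℕ → ℕ}

section
open Var Arr

/-- Increment the number whose binary digits are the colours of the marked vertices. -/
def nextC : Cmd :=
  .set cd 1 ;; .loop x (.when (.and (.eq cd 1) (.not (.eq (mark x) 0)))
    (.ite (.eq (col x) 1) (.put col x 0) (.put col x 1 ;; .set cd 0)))

def testB : BExp := .le thr (.inc (.add (.add tot tot) (.add tot tot)))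

/-- Try all colourings of the marked vertices. -/
def searchC : Cmd := .rep true q (.when (.eq fd 0) (bestC ;; .ite testB (.set fd 1) nextC))

def fixC : Cmd := .put mark i 1 ;; .put col i 1 ;; bestC ;; .ite testB .skip (.put col i 0)

/-- Extend the colouring of the marked vertices by one vertex after the other. -/
def completeC : Cmd := .when (.eq fd 1) (.loop i (.when (.eq (mark i) 0) fixC))

def outputC : Cmd := .loop i (.put out (ord i) (col i)) ;; .set fl fd

end

theorem next_spec {q : ℕ} (hcol : ∀ x, s.a .col x ≤ 1)
    (hq : ∀ x < E.n, s.a .mark x ≠ 0 → s.a .col x = q / 2 ^ rank (s.a .mark) x % 2) :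
    (∀ x, (run E nextC s).a .col x ≤ 1) ∧ ∀ x < E.n, s.a .mark x ≠ 0 →
      (run E nextC s).a .col x = (q + 1) / 2 ^ rank (s.a .mark) x % 2 := by
  set r := rank (s.a .mark) with hr
  have key := loop_inv (E := E) (s := run E (.set .cd 1) s) (x := .x)
    (c := .when (.and (.eq (.var .cd) 1) (.not (.eq (.get .mark (.var .x)) 0)))
      (.ite (.eq (.get .col (.var .x)) 1) (.put .col (.var .x) 0)
        (.put .col (.var .x) 1 ;; .set .cd 0)))
    (fun j s' => (q + 1) / 2 ^ r j = q / 2 ^ r j + s'.v .cd ∧ s'.v .cd ≤ 1 ∧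
      (∀ x, s'.a .col x ≤ 1) ∧ (∀ x < j, s.a .mark x ≠ 0 → s'.a .col x = (q + 1) / 2 ^ r x % 2) ∧
      ∀ x, j ≤ x → s'.a .col x = s.a .col x) ?_ ?_
  · exact ⟨key.2.2.1, key.2.2.2.1⟩
  · have : r 0 = 0 := by simp [hr, rank]
    simp [this, hcol]
  · intro j hj s₁ hf ⟨h1, h2, h3, h4, h5⟩
    have hm₁ : s₁.a .mark = s.a .mark := hf.a .mark rfl
    have hrs : r (j + 1) = r j + if s.a .mark j ≠ 0 then 1 else 0 := rank_succ j
    have hcj := hq j hj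
    have h5j := h5 j le_rfl
    have h3j := h3 j
    by_cases hmj : s.a .mark j = 0
    · rw [run_when, if_neg (by simp [hm₁, hmj])]
      rw [if_neg (by simpa using hmj), add_zero] at hrs
      rw [hrs]
      refine ⟨by simpa using h1, by simpa using h2, h3, fun x hx hmx => ?_, fun x hx => h5 x (by omega)⟩
      rcases Nat.lt_succ_iff_lt_or_eq.1 hx with hx | rfl
      exacts [h4 x hx hmx, absurd hmj hmx]
    · have hcj := hcj hmj
      rw [if_pos hmj] at hrs
      have hdiv : ∀ m, m / 2 ^ r (j + 1) = m / 2 ^ r j / 2 := fun m => by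
        rw [hrs, pow_succ, Nat.div_div_eq_div_mul]
      simp only [hdiv]
      rw [h5j, hcj] at h3j
      have hlow : ∀ x, x ≠ j → x < j + 1 → s.a .mark x ≠ 0 → s₁.a .col x = (q + 1) / 2 ^ r x % 2 :=
        fun x hxj hx hmx => h4 x (by omega) hmx
      by_cases hcd : s₁.v .cd = 1
      · rw [run_when, if_pos (by simp [hm₁, hmj, hcd]), run_ite]
        simp only [evalB_eq, eval_get, eval_var, eval_one, St.setV_a, St.setV_v, if_true, h5j, hcj]
        split_ifs with hc
        · simp only [run_put, St.setA_v, St.setA_a, St.setV_v, St.setV_a, reduceCtorEq, if_false,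
            eval_var, if_true, eval_zero, true_and]
          refine ⟨by omega, h2, fun x => ?_, fun x hx hmx => ?_, fun x hx => ?_⟩
          · split_ifs
            exacts [by omega, h3 x]
          · split_ifs with hxj
            · rw [hxj, h1, hcd]; omega
            · exact hlow x hxj hx hmx
          · rw [if_neg (by omega)]
            exact h5 x (by omega)
        · simp only [run_seq, run_set, run_put, St.setA_v, St.setA_a, St.setV_v, St.setV_a, reduceCtorEq,
            if_false, eval_var, if_true, eval_zero, true_and, eval_one]
          refine ⟨by omega, by omega, fun x => ?_, fun x hx hmx => ?_, fun x hx => ?_⟩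
          · split_ifs
            exacts [le_rfl, h3 x]
          · split_ifs with hxj
            · rw [hxj, h1, hcd]; omega
            · exact hlow x hxj hx hmx
          · rw [if_neg (by omega)]
            exact h5 x (by omega)
      · rw [run_when, if_neg (by simp [hcd])]
        simp only [St.setV_v, reduceCtorEq, if_false, St.setV_a]
        refine ⟨by omega, h2, h3, fun x hx hmx => ?_, fun x hx => h5 x (by omega)⟩
        by_cases hxj : x = j
        · rw [hxj, h5j, hcj, h1, show s₁.v .cd = 0 by omega, add_zero]
        · exact hlow x hxj hx hmx

/-- A state in which the best extension of a partial colouring can be computed. -/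
structure St.Board (E : Env) (o : ℕ → ℕ) (s : St) : Prop where
  ord : s.a .ord = o
  forest : Forest E.n (E.rel o) (s.a .pc) (s.a .mark) (s.a .att)
  col : ∀ x, s.a .col x ≤ 1
  thr : s.v .thr = E.goal o

/-- Some colouring with a large cut extends the colours of the marked vertices. -/
def St.Good (E : Env) (o : ℕ → ℕ) (s : St) : Prop :=
  ∃ χ, Extends E.n (s.a .mark) (s.a .col) χ ∧ E.Big o χ

theorem test_spec (hsym : ∀ x y, E.rel o x y = E.rel o y x) (hirr : ∀ x, E.rel o x x = false)
    (hn : 0 < E.n) (hs : s.Board E o) :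
    evalB E testB (run E bestC s) = true ↔ s.Good E o := by
  have hb := best_spec (E := E) (s := s) (by rwa [hs.ord]) (by rwa [hs.ord]) hn
    (by rw [hs.ord]; exact hs.forest) hs.col
  rw [hs.ord] at hb
  have f := run_fr (E := E) bestC s
  set s' := run E bestC s
  clear_value s'
  have hthr : s'.v .thr = E.goal o := by rw [f.v .thr rfl, hs.thr]
  have hle : 2 * s'.v .tot ≤ E.n * E.n := by
    obtain ⟨χ, -, hχ⟩ := (hb _).2 le_rfl
    exact hχ.trans ((cutIn_le _ _).trans (by simp))
  have key : ∀ c, E.goal o ≤ 2 * c + 1 ↔ E.goal o / 2 ≤ c := fun c => by omega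
  simp only [testB, evalB_le, eval_var, eval_inc, eval_add, hthr, St.Good, Env.Big, key]
  rw [hb, ← key]
  have hcap : s'.v .tot + s'.v .tot ≤ E.cap := by unfold Env.cap; omega
  have hcap' : s'.v .tot + s'.v .tot + (s'.v .tot + s'.v .tot) ≤ E.cap := by unfold Env.cap; omega
  rw [min_eq_left hcap, min_eq_left hcap']
  omega

theorem St.Board.congr {s' : St} (hs : s.Board E o) (ho : s'.a .ord = s.a .ord)
    (hp : s'.a .pc = s.a .pc) (hm : ∀ x, s'.a .mark x = 0 → s.a .mark x = 0)
    (ha : s'.a .att = s.a .att) (hc : ∀ x, s'.a .col x ≤ 1) (ht : s'.v .thr = s.v .thr) :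
    s'.Board E o :=
  ⟨ho.trans hs.ord, by rw [hp, ha]; exact hs.forest.mono hm, hc, ht.trans hs.thr⟩

theorem search_spec (hsym : ∀ x y, E.rel o x y = E.rel o y x) (hirr : ∀ x, E.rel o x x = false)
    (hn : 0 < E.n) (hs : s.Board E o)
    (h0 : s.v .fd = 1 ∧ s.Good E o ∨ s.v .fd = 0 ∧ (∀ x < E.n, s.a .col x = 0) ∧
      #{x ∈ range E.n | s.a .mark x ≠ 0} ≤ 12 * E.k) :
    let s' := run E searchC s
    s'.Board E o ∧ (s'.v .fd = 1 ∧ s'.Good E o ∨ s'.v .fd = 0 ∧ ∀ χ, ¬ E.Big o χ) := by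
  intro s'
  have key := rep_inv (E := E) (s := s) (q := true) (x := .q)
    (c := .when (.eq (.var .fd) 0) (bestC ;; .ite testB (.set .fd 1) nextC))
    (fun j s' => s'.Board E o ∧ (s'.v .fd = 1 ∧ s'.Good E o ∨ s'.v .fd = 0 ∧
      #{x ∈ range E.n | s.a .mark x ≠ 0} ≤ 12 * E.k ∧
      (∀ x < E.n, s.a .mark x ≠ 0 → s'.a .col x = j / 2 ^ rank (s.a .mark) x % 2) ∧
      ∀ q < j, ∀ χ : ℕ → Bool, (∀ x < E.n, s.a .mark x ≠ 0 →
        (if χ x then 1 else 0) = q / 2 ^ rank (s.a .mark) x % 2) → ¬ E.Big o χ)) ?_ ?_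
  · refine ⟨key.1, key.2.imp_right ?_⟩
    rintro ⟨h1, hk, -, h3⟩
    refine ⟨h1, fun χ => ?_⟩
    obtain ⟨q, hq, h⟩ := exists_digits (mark := s.a .mark) χ E.n
    refine h3 q (hq.trans_le ?_) χ h
    rw [Env.bound, if_pos rfl, Env.P, show (4096 : ℕ) = 2 ^ 12 by norm_num, ← pow_mul]
    exact Nat.pow_le_pow_right (by omega) hk
  · refine ⟨hs, h0.imp_right ?_⟩
    rintro ⟨h1, h2, h3⟩
    exact ⟨h1, h3, fun x hx _ => by rw [h2 x hx]; simp, by simp⟩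
  · intro j hj s₁ hf ⟨hB, h⟩
    have hm₁ : s₁.a .mark = s.a .mark := hf.a .mark rfl
    rw [run_when]
    rcases h with ⟨h1, h2⟩ | ⟨h1, hk, h2, h3⟩
    · rw [if_neg (by simp [h1])]
      exact ⟨hB.congr rfl rfl (fun _ => id) rfl hB.col (by simp), .inl ⟨by simpa using h1, h2⟩⟩
    · rw [if_pos (by simp [h1]), run_seq, run_ite]
      have hB' : (s₁.setV .q j).Board E o := hB.congr rfl rfl (fun _ => id) rfl hB.col (by simp)
      have ht := test_spec hsym hirr hn hB'
      have f := run_fr (E := E) bestC (s₁.setV .q j)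
      set s₂ := run E bestC (s₁.setV .q j)
      clear_value s₂
      have a₂ : s₂.a .ord = s₁.a .ord ∧ s₂.a .pc = s₁.a .pc ∧ s₂.a .mark = s₁.a .mark ∧
          s₂.a .att = s₁.a .att ∧ s₂.a .col = s₁.a .col :=
        ⟨f.a _ rfl, f.a _ rfl, f.a _ rfl, f.a _ rfl, f.a _ rfl⟩
      obtain ⟨a1, a2, a3, a4, a5⟩ := a₂
      have thr₂ : s₂.v .thr = s₁.v .thr := by rw [f.v .thr rfl]; simp
      have fd₂ : s₂.v .fd = 0 := by rw [f.v .fd rfl]; simpa using h1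
      have hB₂ : s₂.Board E o := hB.congr a1 a2 (fun x => by rw [a3]; exact id) a4
        (by rw [a5]; exact hB.col) thr₂
      split_ifs with hc
      · rw [ht] at hc
        refine ⟨hB₂.congr rfl rfl (fun _ => id) rfl hB₂.col (by simp), .inl ⟨by simp, ?_⟩⟩
        obtain ⟨χ, hχ, hb⟩ := hc
        refine ⟨χ, ?_, hb⟩
        simpa [a3, a5] using hχ
      · rw [ht] at hc
        have hn := next_spec (E := E) (s := s₂) (q := j) hB₂.col (by rw [a3, a5, hm₁]; exact h2)
        have fn := run_fr (E := E) nextC s₂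
        set s₃ := run E nextC s₂
        clear_value s₃
        refine ⟨hB₂.congr (fn.a _ rfl) (fn.a _ rfl) (fun x => by rw [fn.a .mark rfl]; exact id)
          (fn.a _ rfl) hn.1 (fn.v _ rfl), .inr ⟨by rw [fn.v .fd rfl, fd₂], hk, ?_, fun q hq χ hχ hb => ?_⟩⟩
        · have := hn.2
          rwa [a3, hm₁] at this
        · rcases Nat.lt_succ_iff_lt_or_eq.1 hq with hq | rfl
          · exact h3 q hq χ hχ hb
          · refine hc ⟨χ, fun x hx hmx => ?_, hb⟩
            simp only [St.setV_a] at hmx ⊢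
            rw [hm₁] at hmx
            rw [h2 x hx hmx, ← hχ x hx hmx]
            simp

theorem complete_spec (hsym : ∀ x y, E.rel o x y = E.rel o y x) (hirr : ∀ x, E.rel o x x = false)
    (hn : 0 < E.n) (hs : s.Board E o) (hfd : s.v .fd = 1) (hg : s.Good E o) :
    ∃ χ, E.Big o χ ∧ ∀ x < E.n, (run E completeC s).a .col x = if χ x then 1 else 0 := by
  rw [completeC, run_when, if_pos (by simp [hfd])]
  have key := loop_inv (E := E) (s := s) (x := .i)
    (c := .when (.eq (.get .mark (.var .i)) 0) fixC)
    (fun j s' => s'.Board E o ∧ s'.Good E o ∧ ∀ x < j, s'.a .mark x ≠ 0) ⟨hs, hg, by simp⟩ ?_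
  · obtain ⟨hB, ⟨χ, hχ, hb⟩, hm⟩ := key
    refine ⟨χ, hb, fun x hx => ?_⟩
    have h1 := hχ x hx (hm x hx)
    have h2 := hB.col x
    split_ifs with hc
    · exact h1.1 hc
    · have : ¬ _ = 1 := fun h => hc (h1.2 h)
      omega
  · intro j hj s₁ hf ⟨hB, hG, hm⟩
    rw [run_when]
    by_cases hmj : s₁.a .mark j = 0
    · rw [if_pos (by simp [hmj]), fixC, run_seq, run_seq, run_seq, run_ite]
      set s₂ := run E (.put .col (.var .i) 1) (run E (.put .mark (.var .i) 1) (s₁.setV .i j)) with hs₂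
      have hi₂ : s₂.v .i = j := by simp [hs₂]
      have hm₂ : ∀ x, s₂.a .mark x = if x = j then 1 else s₁.a .mark x := fun x => by simp [hs₂]
      have hc₂ : ∀ x, s₂.a .col x = if x = j then 1 else s₁.a .col x := fun x => by simp [hs₂]
      have hB₂ : s₂.Board E o := by
        refine hB.congr ?_ ?_ (fun x hx => ?_) ?_ (fun x => ?_) (by simp [hs₂])
        · funext x; simp [hs₂]
        · funext x; simp [hs₂]
        · rw [hm₂] at hx
          split_ifs at hx
          exact hx
        · funext x; simp [hs₂]
        · rw [hc₂]
          split_ifs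
          exacts [le_rfl, hB.col x]
      have ht := test_spec hsym hirr hn hB₂
      have f := run_fr (E := E) bestC s₂
      clear_value s₂
      set s₃ := run E bestC s₂
      clear_value s₃
      have hB₃ : s₃.Board E o := hB₂.congr (f.a _ rfl) (f.a _ rfl) (fun x => by rw [f.a .mark rfl]; exact id)
        (f.a _ rfl) (by rw [f.a .col rfl]; exact hB₂.col) (f.v _ rfl)
      have hm₃ : s₃.a .mark = s₂.a .mark := f.a _ rfl
      have hc₃ : s₃.a .col = s₂.a .col := f.a _ rfl
      have hi₃ : s₃.v .i = j := by rw [f.v .i rfl, hi₂]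
      have hmj' : ∀ x < j + 1, s₃.a .mark x ≠ 0 := fun x hx => by
        rw [hm₃, hm₂]
        split_ifs
        · omega
        · exact hm x (by omega)
      split_ifs with hc
      · refine ⟨hB₃, ?_, hmj'⟩
        obtain ⟨χ, hχ, hb⟩ := ht.1 hc
        exact ⟨χ, by rw [run_skip, hm₃, hc₃]; exact hχ, hb⟩
      · have hcol : ∀ x, (run E (.put .col (.var .i) 0) s₃).a .col x = if x = j then 0 else s₃.a .col x :=
          fun x => by simp [hi₃]
        have hmk : (run E (.put .col (.var .i) 0) s₃).a .mark = s₃.a .mark := by funext x; simp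
        refine ⟨hB₃.congr (by funext x; simp) (by funext x; simp) (fun x => by rw [hmk]; exact id)
          (by funext x; simp) (fun x => ?_) rfl, ?_, by rw [hmk]; exact hmj'⟩
        · rw [hcol]
          split_ifs
          exacts [by omega, hB₃.col x]
        · obtain ⟨χ, hχ, hb⟩ := hG
          have hχj : χ j = false := by
            by_contra h
            refine hc (ht.2 ⟨χ, fun x hx hmx => ?_, hb⟩)
            rw [hm₂] at hmx
            rw [hc₂]
            split_ifs at hmx ⊢ with hxj
            · simpa [hxj] using h
            · exact hχ x hx hmx
          refine ⟨χ, fun x hx hmx => ?_, hb⟩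
          rw [hmk, hm₃, hm₂] at hmx
          rw [hcol, hc₃, hc₂]
          split_ifs at hmx ⊢ with hxj
          · simp [hxj, hχj]
          · exact hχ x hx hmx
    · rw [if_neg (by simp [hmj])]
      refine ⟨hB.congr rfl rfl (fun _ => id) rfl hB.col (by simp), hG, fun x hx => ?_⟩
      rcases Nat.lt_succ_iff_lt_or_eq.1 hx with hx | rfl
      exacts [hm x hx, hmj]

theorem output_spec (ho : IsOrder E (s.a .ord)) : (run E outputC s).v .fl = s.v .fd ∧
    ∀ x < E.n, (run E outputC s).a .out (s.a .ord x) = s.a .col x := by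
  rw [outputC, run_seq]
  constructor
  · have f := run_fr (E := E) (.loop .i (.put .out (.get .ord (.var .i)) (.get .col (.var .i)))) s
    simp [f.v .fd rfl]
  · refine loop_inv (E := E) (s := s) (x := .i) (c := .put .out (.get .ord (.var .i)) (.get .col (.var .i)))
      (fun j s' => ∀ x < j, s'.a .out (s.a .ord x) = s.a .col x) (by simp) fun j hj s₁ hf h x hx => ?_
    have a1 : s₁.a .ord = s.a .ord := hf.a _ rfl
    have a2 : s₁.a .col = s.a .col := hf.a _ rfl
    simp only [run_put, eval_get, eval_var, St.setV_v, St.setV_a, if_true, St.setA_a, true_and, a1, a2]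
    by_cases hxj : x = j
    · simp [hxj]
    · rw [if_neg fun h => hxj (ho.inj x (by omega) j hj h)]
      exact h x (by omega)

/-- The whole algorithm. -/
def mainC : Cmd :=
  order ;; lowest ;; decompose ;; majorityC ;; searchC ;; completeC ;; outputC

end LoopLang

/-! ## The algorithm -/

namespace LoopLang

open Finset Pieces

variable {E : Env} {s : St} {o : ℕ → ℕ}

theorem St.Decomposed.forest (hs : s.Decomposed E o) :
    Forest E.n (E.rel o) (s.a .pc) (s.a .mark) (s.a .att) := by
  have htop : s.data.top ≤ E.n := hs.removed.top_le.trans ((card_filter_le _ _).trans (by simp))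
  refine ⟨fun x hx => ⟨Nat.one_le_iff_ne_zero.2 (hs.pos x hx), (hs.removed.pc_le x hx).trans htop⟩,
    fun x hx y hy h1 h2 h3 h4 => hs.removed.same x hx y hy (hs.pos x hx) h1 h2 h3 h4,
    fun x hx y hy h1 h2 => ?_, hs.first⟩
  refine (hs.removed.att x hx y hy (hs.pos x hx) h1 h2).trans (and_congr_right fun _ => ?_)
  exact or_iff_right (hs.pos y hy)

theorem main_spec (hn : 0 < E.n) (hsym : ∀ x y, E.A x y = E.A y x) (hirr : ∀ x, E.A x x = false)
    (hc : ∀ S : Finset ℕ, S ⊆ range E.n → S.Nonempty → S ≠ range E.n →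
      ∃ x ∈ range E.n, x ∉ S ∧ ∃ y ∈ S, E.A x y = true) :
    ∃ o, IsOrder E o ∧ let s' := run E mainC St.zero
      (s'.v .fl = 1 ∧ ∃ χ, E.Big o χ ∧ ∀ x < E.n, s'.a .out (o x) = if χ x then 1 else 0) ∨
      (s'.v .fl = 0 ∧ ∀ χ, ¬ E.Big o χ) := by
  have ho := order_spec (E := E) (s := St.zero) hc fun _ => rfl
  have f₁ := run_fr (E := E) order St.zero
  rw [mainC, run_seq, run_seq, run_seq, run_seq, run_seq, run_seq]
  set s₁ := run E order St.zero
  clear_value s₁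
  set o := s₁.a .ord with hoo
  refine ⟨o, ho, ?_⟩
  have hl := lowest_spec (E := E) (s := s₁)
  have f₂ := run_fr (E := E) lowest s₁
  set s₂ := run E lowest s₁
  clear_value s₂
  have hE : Ctx E o (s₂.a .mn) := ⟨fun x => hirr _, fun x y => hsym _ _, hl, ho.prev⟩
  have hz : ∀ b, b ≠ .ord → b ≠ .vis → b ≠ .mn → s₂.a b = fun _ => 0 := fun b h1 h2 h3 => by
    rw [f₂.a b (by simp [lowest, Cmd.loop, Cmd.when, Cmd.wa, h3]),
      f₁.a b (by simp [order, orderStep, find2C, newNbr, Cmd.loop, Cmd.when, Cmd.wa, h1, h2])]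
    rfl
  have hd := decompose_spec (E := E) (s := s₂) hE hn (f₂.a _ rfl) rfl (hz _ (by decide) (by decide) (by decide))
    (hz _ (by decide) (by decide) (by decide)) (hz _ (by decide) (by decide) (by decide))
    (by rw [f₂.v _ rfl, f₁.v _ rfl]; rfl)
  have f₃ := run_fr (E := E) decompose s₂
  set s₃ := run E decompose s₂
  clear_value s₃
  have hm := majority_spec (E := E) (s := s₃) hd hE.sym fun x => by
    rw [f₃.a .col rfl, hz _ (by decide) (by decide) (by decide)]
  have f₄ := run_fr (E := E) majorityC s₃
  set s₄ := run E majorityC s₃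
  clear_value s₄
  obtain ⟨hthr, hcol, hfd⟩ := hm
  have hB₄ : s₄.Board E o := ⟨(f₄.a _ rfl).trans hd.ord, by
    rw [f₄.a .pc rfl, f₄.a .mark rfl, f₄.a .att rfl]; exact hd.forest, hcol, hthr⟩
  have hs := search_spec (E := E) (s := s₄) hE.sym hE.irr hn hB₄ (by
    refine hfd.imp (fun h => ⟨h.1, _, fun x hx _ => ?_, h.2⟩) fun h => ⟨h.1, h.2.1, ?_⟩
    · simp
    · rw [f₄.a .mark rfl]; exact h.2.2)
  set s₅ := run E searchC s₄
  clear_value s₅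
  obtain ⟨hB, hcase⟩ := hs
  have f₆ := run_fr (E := E) completeC s₅
  have hcomp := complete_spec (E := E) (s := s₅) hE.sym hE.irr hn hB
  set s₆ := run E completeC s₅
  clear_value s₆
  have ord₆ : s₆.a .ord = o := (f₆.a _ rfl).trans hB.ord
  have hout := output_spec (E := E) (s := s₆) (by rw [ord₆]; exact ho)
  rw [f₆.v .fd rfl, ord₆] at hout
  rcases hcase with ⟨h1, h2⟩ | ⟨h1, h2⟩
  · left
    obtain ⟨χ, hb, hχ⟩ := hcomp h1 h2
    exact ⟨hout.1.trans h1, χ, hb, fun x hx => (hout.2 x hx).trans (hχ x hx)⟩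
  · exact .inr ⟨hout.1.trans h1, h2⟩

/-! ### The running time -/

theorem cost_when_le (b : BExp) (c : Cmd) (s : St) :
    cost E (.when b c) s ≤ bw b + 4 + cost E c s := by
  have : cost E .skip s = 0 := rfl
  rw [Cmd.when, cost]
  split_ifs <;> omega

theorem cost_search (hn : 1 ≤ E.n) (s : St) :
    cost E searchC s ≤ (searchC.wt + extend.wt) * (E.P * E.n ^ 2) := by
  have hP : 0 < E.P := Nat.pow_pos (by omega)
  have h := cost_rep_le (E := E) (s := s) (q := true) (x := .q)
    (c := .when (.eq (.var .fd) 0) (bestC ;; .ite testB (.set .fd 1) nextC))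
    (fun _ => bw (.eq (.var .fd) 0) + 4 + ((bestC.wt + extend.wt) * E.n ^ 2
      + (Cmd.ite testB (.set .fd 1) nextC).wt * E.n)) fun j hj s' _ => by
    refine (cost_when_le _ _ _).trans (Nat.add_le_add_left ?_ _)
    rw [cost]
    have := cost_le hn (.ite testB (.set .fd 1) nextC) (d := 1) (by decide) (by decide)
      (run E bestC (s'.setV .q j))
    rw [pow_one] at this
    exact Nat.add_le_add (cost_best hn _) this
  rw [sum_const, card_range, smul_eq_mul, show E.bound true = E.P from rfl] at h
  have hw : searchC.wt = bw (.eq (.var .fd) 0) + 4 + (bestC.wt + (Cmd.ite testB (.set .fd 1) nextC).wt)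
      + 0 + 7 := rfl
  refine h.trans ?_
  rw [hw]
  have h1 : E.n ≤ E.n ^ 2 := Nat.le_self_pow (by decide) _
  have h2 : 1 ≤ E.n ^ 2 := Nat.pow_pos hn
  generalize bw (.eq (.var .fd) 0) + 4 = b
  generalize (Cmd.ite testB (.set .fd 1) nextC).wt = c
  generalize bestC.wt = d
  generalize extend.wt = e
  generalize E.n ^ 2 = m at *
  have h3 : b + ((d + e) * m + c * E.n) + 5 ≤ b * m + ((d + e) * m + c * m) + 5 * m := by nlinarith
  have h4 := Nat.mul_le_mul_left E.P h3
  have h5 : 1 ≤ E.P * m := Nat.mul_pos hP h2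
  nlinarith

theorem cost_complete (hn : 1 ≤ E.n) (s : St) :
    cost E completeC s ≤ (completeC.wt + extend.wt) * E.n ^ 3 := by
  have h := cost_rep_le (E := E) (s := s) (q := false) (x := .i)
    (c := .when (.eq (.get .mark (.var .i)) 0) fixC)
    (fun _ => bw (.eq (.get .mark (.var .i)) 0) + 4 + (fixC.wt + extend.wt) * E.n ^ 2)
    fun j hj s' _ => by
    refine (cost_when_le _ _ _).trans (Nat.add_le_add_left ?_ _)
    have e1 : ∀ s, cost E fixC s ≤ (Cmd.put .mark (.var .i) 1).wt + ((Cmd.put .col (.var .i) 1).wt +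
        ((bestC.wt + extend.wt) * E.n ^ 2 + (Cmd.ite testB .skip (.put .col (.var .i) 0)).wt)) :=
      fun s => by
        rw [fixC, cost, cost, cost]
        have := cost_le hn (.ite testB .skip (.put .col (.var .i) 0)) (d := 0) (by decide) (by decide)
        simp only [pow_zero, mul_one] at this
        exact Nat.add_le_add le_rfl (Nat.add_le_add le_rfl (Nat.add_le_add (cost_best hn _) (this _)))
    refine (e1 _).trans ?_
    have e2 : fixC.wt = (Cmd.put .mark (.var .i) 1).wt + ((Cmd.put .col (.var .i) 1).wt +
        (bestC.wt + (Cmd.ite testB .skip (.put .col (.var .i) 0)).wt)) := rfl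
    rw [e2]
    have h2 : 1 ≤ E.n ^ 2 := Nat.pow_pos hn
    nlinarith
  rw [sum_const, card_range, smul_eq_mul, show E.bound false = E.n from rfl] at h
  refine (cost_when_le _ _ _).trans ?_
  have hw : completeC.wt = bw (.eq (.var .fd) 1) + 4 +
      (bw (.eq (.get .mark (.var .i)) 0) + 4 + fixC.wt + 0 + 7) + 0 := rfl
  rw [hw]
  refine (Nat.add_le_add_left h _).trans ?_
  have h1 : E.n ≤ E.n ^ 3 := Nat.le_self_pow (by decide) _
  have h2 : 1 ≤ E.n ^ 3 := Nat.pow_pos hn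
  have h3 : E.n * E.n ^ 2 = E.n ^ 3 := by ring
  generalize bw (.eq (.var .fd) 1) + 4 = b
  generalize bw (.eq (.get .mark (.var .i)) 0) + 4 = c
  generalize fixC.wt = d
  generalize extend.wt = e
  have h4 : b + (2 + E.n * (c + (d + e) * E.n ^ 2 + 5))
      = b + 2 + (d + e) * (E.n * E.n ^ 2) + (c + 5) * E.n := by ring
  rw [h4, h3]
  nlinarith

theorem cost_main : ∃ K, ∀ E : Env, 1 ≤ E.n → ∀ s, cost E mainC s ≤ K * (E.P * E.n ^ 3) := by
  refine ⟨order.wt + lowest.wt + decompose.wt + majorityC.wt + (searchC.wt + extend.wt) +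
    (completeC.wt + extend.wt) + outputC.wt, fun E hn s => ?_⟩
  have hP : 1 ≤ E.P := Nat.pow_pos (by omega)
  have h1 : E.n ^ 3 ≤ E.P * E.n ^ 3 := Nat.le_mul_of_pos_left _ hP
  have h2 : E.P * E.n ^ 2 ≤ E.P * E.n ^ 3 :=
    Nat.mul_le_mul_left _ (Nat.pow_le_pow_right hn (by decide))
  have key : ∀ (c : Cmd) (s : St), c.poly = true → c.deg ≤ 3 →
      cost E c s ≤ c.wt * (E.P * E.n ^ 3) := fun c s hc hd =>
    (cost_le hn c hc hd s).trans (Nat.mul_le_mul_left _ h1)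
  simp only [mainC, cost, add_mul _ _ (E.P * E.n ^ 3)]
  have a1 := key order s (by decide) (by decide)
  have a2 := key lowest (run E order s) (by decide) (by decide)
  have a3 := key decompose (run E lowest (run E order s)) (by decide) (by decide)
  set s₃ := run E decompose (run E lowest (run E order s))
  have a4 := key majorityC s₃ (by decide) (by decide)
  have a5 := (cost_search hn (run E majorityC s₃)).trans (Nat.mul_le_mul_left _ h2)
  set s₅ := run E searchC (run E majorityC s₃)
  have a6 := (cost_complete hn s₅).trans (Nat.mul_le_mul_left _ h1)
  have a7 := key outputC (run E completeC s₅) (by decide) (by decide)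
  rw [add_mul] at a5 a6
  omega

end LoopLang

/-! ## Translation to graphs -/

namespace MaxCut

open Finset LoopLang Pieces

variable {n : ℕ} (G : SimpleGraph (Fin n)) [DecidableRel G.Adj]

/-- The environment of the algorithm on input `G` and `k`. -/
def env (k : ℕ) : Env where
  n := n
  k := k
  A u v := if h : u < n ∧ v < n then decide (G.Adj ⟨u, h.1⟩ ⟨v, h.2⟩) else false

variable {G} {k : ℕ} {o : ℕ → ℕ}

theorem env_A (u v : Fin n) : (env G k).A u v = decide (G.Adj u v) := by
  simp [env]

theorem env_symm (x y : ℕ) : (env G k).A x y = (env G k).A y x := by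
  simp only [env]
  by_cases h : x < n ∧ y < n
  · rw [dif_pos h, dif_pos h.symm]
    exact decide_eq_decide.2 (G.adj_comm _ _)
  · rw [dif_neg h, dif_neg fun h' => h h'.symm]

theorem env_irrefl (x : ℕ) : (env G k).A x x = false := by
  simp [env]

theorem env_connected (hG : G.Connected) (S : Finset ℕ) (hS : S ⊆ range n) (h0 : S.Nonempty)
    (h1 : S ≠ range n) : ∃ x ∈ range n, x ∉ S ∧ ∃ y ∈ S, (env G k).A x y = true := by
  obtain ⟨y, hy⟩ := h0
  obtain ⟨x, hx, hxS⟩ : ∃ x ∈ range n, x ∉ S := by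
    by_contra! h
    exact h1 (hS.antisymm h)
  have hyn := mem_range.1 (hS hy)
  rw [mem_range] at hx
  obtain ⟨p⟩ := hG.preconnected ⟨y, hyn⟩ ⟨x, hx⟩
  obtain ⟨d, -, hd1, hd2⟩ := p.exists_boundary_dart {v | (v : ℕ) ∈ S} hy hxS
  refine ⟨d.snd, mem_range.2 d.snd.2, hd2, d.fst, hd1, ?_⟩
  rw [env_A]
  simpa using d.adj.symm

/-- An ordering of the vertices as a permutation. -/
theorem exists_perm (ho : IsOrder (env G k) o) :
    ∃ f : Fin n ≃ Fin n, ∀ i : Fin n, ((f i : Fin n) : ℕ) = o i := by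
  refine ⟨Equiv.ofBijective (fun i => ⟨o i, ho.lt i i.2⟩) (Finite.injective_iff_bijective.1 ?_),
    fun i => rfl⟩
  intro i j h
  exact Fin.ext (ho.inj i i.2 j j.2 (congrArg Fin.val h))

theorem rel_eq {f : Fin n ≃ Fin n} (hf : ∀ i : Fin n, ((f i : Fin n) : ℕ) = o i) (i j : Fin n) :
    (env G k).rel o i j = decide (G.Adj (f i) (f j)) := by
  have h1 := (f i).2
  have h2 := (f j).2
  rw [hf] at h1 h2
  rw [Env.rel, show (env G k).n = n from rfl, min_eq_left (by omega), min_eq_left (by omega), ← hf,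
    ← hf, env_A]

theorem sum_cut (S : Finset (Fin n)) :
    ∑ u, ∑ v, (if G.Adj u v ∧ ¬ (u ∈ S ↔ v ∈ S) then 1 else 0) = 2 * cutSize G S := by
  have h1 : cutSize G S = ∑ u, ∑ v, if G.Adj u v ∧ u ∈ S ∧ v ∉ S then 1 else 0 := by
    rw [cutSize, ← sum_product' univ univ (fun u v => if G.Adj u v ∧ u ∈ S ∧ v ∉ S then 1 else 0),
      ← card_filter]
    congr 1
    ext ⟨u, v⟩
    simp only [SimpleGraph.mem_interedges_iff, mem_compl, mem_filter, mem_product, mem_univ, true_and]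
    tauto
  have h2 : cutSize G S = ∑ u, ∑ v, if G.Adj u v ∧ v ∈ S ∧ u ∉ S then 1 else 0 := by
    rw [h1, sum_comm]
    exact sum_congr rfl fun u _ => sum_congr rfl fun v _ =>
      if_congr (and_congr_left fun _ => G.adj_comm _ _) rfl rfl
  rw [two_mul]
  nth_rewrite 1 [h1]
  rw [h2, ← sum_add_distrib]
  refine sum_congr rfl fun u _ => ?_
  rw [← sum_add_distrib]
  refine sum_congr rfl fun v _ => ?_
  by_cases h3 : u ∈ S <;> by_cases h4 : v ∈ S <;> simp [h3, h4]

theorem cutIn_eq {f : Fin n ≃ Fin n} (hf : ∀ i : Fin n, ((f i : Fin n) : ℕ) = o i) {χ : ℕ → Bool}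
    {S : Finset (Fin n)} (hS : ∀ i : Fin n, χ i = true ↔ f i ∈ S) :
    cutIn ((env G k).rel o) χ (range n) = 2 * cutSize G S := by
  rw [← sum_cut, cutIn, sum_range]
  refine Eq.trans (sum_congr rfl fun i _ => ?_) (Equiv.sum_comp f _)
  rw [sum_range]
  refine Eq.trans ?_ (Equiv.sum_comp f _)
  refine sum_congr rfl fun j _ => ?_
  rw [rel_eq hf]
  refine if_congr (and_congr (by simp) (not_congr ?_)) rfl rfl
  rw [Bool.eq_iff_iff, hS, hS]

theorem goal_eq {f : Fin n ≃ Fin n} (hf : ∀ i : Fin n, ((f i : Fin n) : ℕ) = o i) :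
    (env G k).goal o = 2 * #G.edgeFinset + n + 4 * k := by
  rw [← SimpleGraph.sum_degrees_eq_twice_card_edges, Env.goal, show (env G k).n = n from rfl,
    show (env G k).k = k from rfl, sum_range]
  congr 2
  refine Eq.trans (sum_congr rfl fun i _ => ?_) (Equiv.sum_comp f _)
  rw [card_filter, sum_range, ← SimpleGraph.card_neighborFinset_eq_degree,
    SimpleGraph.neighborFinset_eq_filter, card_filter]
  refine Eq.trans ?_ (Equiv.sum_comp f _)
  refine sum_congr rfl fun j _ => ?_
  rw [rel_eq hf]
  simp

theorem big_iff {f : Fin n ≃ Fin n} (hf : ∀ i : Fin n, ((f i : Fin n) : ℕ) = o i) {χ : ℕ → Bool}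
    {S : Finset (Fin n)} (hS : ∀ i : Fin n, χ i = true ↔ f i ∈ S) :
    (env G k).Big o χ ↔ IsLargeCut G k S := by
  rw [Env.Big, show (env G k).n = n from rfl, goal_eq hf, cutIn_eq hf hS, IsLargeCut]
  have : (2 * #G.edgeFinset + n + 4 * k ≤ 2 * (2 * cutSize G S) + 1) ↔
      (2 * (#G.edgeFinset : ℚ) + n + 4 * k ≤ 2 * (2 * cutSize G S) + 1) := by
    exact_mod_cast Iff.rfl
  rw [this]
  constructor <;> intro h <;> linarith

theorem input_mem (i : ℕ) (hi : i < n) (j : ℕ) (hj : j < n) :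
    (input G k).mem (i * n + j) = if (env G k).A i j then 1 else 0 := by
  refine if_congr ?_ rfl rfl
  rw [show (env G k).A i j = _ from env_A ⟨i, hi⟩ ⟨j, hj⟩, decide_eq_true_iff]
  constructor
  · rintro ⟨u, v, h, huv⟩
    have h1 : i = u := by
      have := congrArg (· / n) h
      simpa [Nat.add_comm (_ * n), Nat.add_mul_div_right _ _ (Nat.zero_lt_of_lt hi),
        Nat.div_eq_of_lt hj, Nat.div_eq_of_lt v.2] using this
    have h2 : j = v := by rw [← h1] at h; omega
    rwa [show (⟨i, hi⟩ : Fin n) = u from Fin.ext h1, show (⟨j, hj⟩ : Fin n) = v from Fin.ext h2]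
  · exact fun h => ⟨⟨i, hi⟩, ⟨j, hj⟩, rfl, h⟩

theorem input_mem_eq_zero (i : ℕ) (hi : n * n ≤ i) : (input G k).mem i = 0 := by
  refine if_neg ?_
  rintro ⟨u, v, rfl, -⟩
  have h1 := u.2
  have h2 := v.2
  have : (u + 1) * n ≤ n * n := Nat.mul_le_mul_right _ h1
  rw [Nat.succ_mul] at this
  omega

end MaxCut

theorem exponent_bounds (K n k : ℕ) (hn : 1 ≤ n) (c : ℕ) (hc : c ≤ K * (4096 ^ k * n ^ 3)) :
    ∃ W, 64 * (4 * (n * n + n + k + 1) + 4096 ^ k + c + 1) ≤ 2 ^ W ∧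
      (c + 40 * (n + k + 1)) * (2 * W + 1) ≤
        (K + 120) * (128 * (K + 18) + 31) * 2 ^ (13 * k) * n ^ 4 := by
  set Q := 4096 ^ k * n ^ 3 with hQ
  have hP : 4096 ^ k = 2 ^ (12 * k) := by rw [pow_mul]; norm_num
  have hP1 : 1 ≤ 4096 ^ k := Nat.pow_pos (by omega)
  have hn3 : 1 ≤ n ^ 3 := Nat.pow_pos hn
  have hk : k ≤ 4096 ^ k := (Nat.lt_two_pow_self).le.trans (Nat.pow_le_pow_left (by norm_num) k)
  have q1 : n ^ 3 ≤ Q := Nat.le_mul_of_pos_left _ hP1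
  have q2 : 4096 ^ k ≤ Q := Nat.le_mul_of_pos_right _ hn3
  have n1 : n ≤ n ^ 3 := Nat.le_self_pow (by decide) _
  have n2 : n * n ≤ n ^ 3 := by
    rw [← pow_two]; exact Nat.pow_le_pow_right hn (by decide)
  refine ⟨64 * (K + 18) + 12 * k + 3 * n, ?_, ?_⟩
  · rw [pow_add, pow_add, ← hP]
    have h1 : n ^ 3 ≤ 2 ^ (3 * n) := by
      rw [mul_comm, pow_mul]
      exact Nat.pow_le_pow_left Nat.lt_two_pow_self.le 3
    have h2 : 64 * (K + 18) ≤ 2 ^ (64 * (K + 18)) := Nat.lt_two_pow_self.le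
    have h3 : Q ≤ 4096 ^ k * 2 ^ (3 * n) := Nat.mul_le_mul_left _ h1
    rw [mul_assoc]
    refine le_trans ?_ (Nat.mul_le_mul h2 h3)
    rw [mul_assoc, add_mul]
    omega
  · have h1 : c + 40 * (n + k + 1) ≤ (K + 120) * Q := by
      rw [add_mul]
      omega
    have hk2 : k + 1 ≤ 2 ^ k := Nat.lt_two_pow_self
    have h2 : 2 * (64 * (K + 18) + 12 * k + 3 * n) + 1 ≤ (128 * (K + 18) + 31) * 2 ^ k * n := by
      have e1 : 2 ^ k ≤ 2 ^ k * n := Nat.le_mul_of_pos_right _ hn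
      have e2 : n ≤ 2 ^ k * n := Nat.le_mul_of_pos_left _ (by omega)
      rw [mul_assoc, add_mul]
      generalize 2 ^ k * n = m at *
      have : 128 * (K + 18) ≤ 128 * (K + 18) * m := Nat.le_mul_of_pos_right _ (by omega)
      omega
    refine (Nat.mul_le_mul h1 h2).trans (le_of_eq ?_)
    rw [hQ, hP, show 13 * k = 12 * k + k by ring, pow_add]
    ring

theorem theorem1 :
    ∃ (p : RAM.Program) (C : ℕ),
      ∀ (n : ℕ) (G : SimpleGraph (Fin n)) [DecidableRel G.Adj], G.Connected → ∀ k : ℕ,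
        ∃ (t : ℕ) (τ : RAM.Config),
          RAM.HaltsIn p (MaxCut.input G k) t τ ∧
          t ≤ C * 2 ^ (C * k) * n ^ 4 ∧
          ((∃ S : Finset (Fin n), MaxCut.Outputs τ S ∧ MaxCut.IsLargeCut G k S) ∨
            (MaxCut.Rejects τ ∧ ∀ S : Finset (Fin n), ¬ MaxCut.IsLargeCut G k S)) := by
  obtain ⟨K, hK⟩ := LoopLang.cost_main
  refine ⟨LoopLang.compile LoopLang.mainC, (K + 120) * (128 * (K + 18) + 31), ?_⟩
  intro n G _ hG k
  have hn : 0 < n := Fin.pos_iff_nonempty.2 hG.nonempty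
  obtain ⟨W, hW, hWt⟩ := exponent_bounds K n k hn _ (hK (MaxCut.env G k) hn LoopLang.St.zero)
  obtain ⟨t, τ, hτ, ht, hfl, hout⟩ := LoopLang.compile_spec LoopLang.mainC (E := MaxCut.env G k) hn
    (W := W) (σ := MaxCut.input G k) rfl rfl rfl
    (fun r hr => by simp [MaxCut.input, show r ≠ 0 by omega, show r ≠ 1 by omega])
    (MaxCut.input_mem (G := G) (k := k)) (MaxCut.input_mem_eq_zero (G := G) (k := k)) hW
  obtain ⟨o, ho, h⟩ := LoopLang.main_spec (E := MaxCut.env G k) hn (MaxCut.env_symm (G := G) (k := k))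
    (MaxCut.env_irrefl (G := G) (k := k))
    (MaxCut.env_connected (G := G) (k := k) hG)
  obtain ⟨f, hf⟩ := MaxCut.exists_perm ho
  refine ⟨t, τ, hτ, ht.trans (hWt.trans ?_), ?_⟩
  · refine Nat.mul_le_mul_right _ (Nat.mul_le_mul_left _ (Nat.pow_le_pow_right (by omega)
      (Nat.mul_le_mul_right _ ?_)))
    nlinarith
  · refine h.imp ?_ ?_
    · rintro ⟨h1, χ, hχ, h2⟩
      have hS : ∀ i : Fin n, χ i = true ↔
          f i ∈ Finset.univ.filter (fun v : Fin n => χ (f.symm v) = true) := fun i => by simp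
      refine ⟨_, ⟨hfl.trans h1, fun v => ?_⟩, (MaxCut.big_iff hf hS).1 hχ⟩
      rw [hout v v.2]
      have := h2 (f.symm v) (f.symm v).2
      rw [← hf, Equiv.apply_symm_apply] at this
      rw [this]
      simp
    · rintro ⟨h1, h2⟩
      refine ⟨hfl.trans h1, fun S hS => ?_⟩
      refine h2 (fun i => if h : i < n then decide (f ⟨i, h⟩ ∈ S) else false)
        ((MaxCut.big_iff hf fun i => ?_).2 hS)
      simp
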